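/- Let $k$ be a field of characteristic $0$, let $\mathrm{GL}=\bigcup_{n\ge 1}\mathrm{GL}_n(k)$ (as a discrete group) and let $\mathbf{V}=\bigcup_{n\ge 1}k^n$ be its standard representation. A $k$-linear representation of $\mathrm{GL}$ is called polynomial if it is a subquotient of a (possibly infinite) direct sum of tensor powers of $\mathbf{V}$. For a partition $\lambda$ of size $|\lambda|$ put $k^{\oplus\lambda}=\mathbf{S}_\lambda(\mathbf{V})$, where $\mathbf{S}_\lambda$ is the Schur functor. Let $\sigma=[\sigma_1,\dots,\sigma_r]$ be a finite tuple of non-empty partitions, and let $K=\operatorname{Frac}(\operatorname{Sym}(k^{\oplus\sigma_1}\oplus\cdots\oplus k^{\oplus\sigma_r}))$, with the induced action of $\mathrm{GL}$. A $K$-module is a $K$-vector space $M$ with a semi-linear action of $\mathrm{GL}$ such that every element of $M$ has the form $ax$, where $a\in K$ and $x\in M$ generates a polynomial $k$-linear subrepresentation of $M$. Morphisms of $K$-modules are the $K$-linear $\mathrm{GL}$-equivariant maps; subobjects, simple, injective and indecomposable objects, socles, (finite) length and injective dimension are taken in the category of $K$-modules, and a $K$-module is finitely generated if it is spanned over $K$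 by the $\mathrm{GL}$-orbits of finitely many elements. For a partition $\lambda$ let $K^{\oplus\lambda}=K\otimes_k k^{\oplus\lambda}$, and let $L_\lambda\subseteq K^{\oplus\lambda}$ be the intersection of the kernels of all maps of $K$-modules $K^{\oplus\lambda}\to K^{\oplus\mu}$ with $|\mu|<|\lambda|$. Then: (a) Every finitely generated $K$-module has finite length. (b) A $K$-module is an indecomposable injective if and only if it is isomorphic to $K^{\oplus\lambda}$ for some partition $\lambda$. (c) Every finite length $K$-module has finite injective dimension. (d) For every partition $\lambda$, the $K$-module $L_\lambda$ is simple and is the socle of $K^{\oplus\lambda}$. Every simple $K$-module is isomorphic to $L_\lambda$ for a unique partition $\lambda$. (e) For every partition $\lambda$, the module $K^{\oplus\lambda}$ has finite length, the simple module $L_\lambda$ occurs in it with multiplicity one, and each of the remaining simple constituents is isomorphic to some $L_\mu$ with $|\mu|<|\lambda|$. -/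

import Mathlib

open scoped TensorProduct DirectSum

universe u

noncomputable section

namespace GLStruct

/-! ### The infinite general linear group and its standard representation -/

/-- The standard representation `𝐕 = ⋃ₙ kⁿ`, with basis `e₀, e₁, …`. -/
abbrev Std (k : Type u) [Field k] : Type u := ℕ →₀ k

/-- The subspace `kⁿ` of `𝐕`, spanned by the first `n` basis vectors. -/
def stdSub (k : Type u) [Field k] (n : ℕ) : Submodule k (Std k) :=
  Submodule.span k {v | ∃ i < n, v = Finsupp.single i 1}

/-- `g` lies in the image of `GL_n(k)`: it maps `kⁿ` onto itself and fixes all the further basis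
vectors. -/
def IsBlock (k : Type u) [Field k] (n : ℕ) (g : Std k ≃ₗ[k] Std k) : Prop :=
  (stdSub k n).map (g : Std k →ₗ[k] Std k) = stdSub k n ∧
    ∀ i, n ≤ i → g (Finsupp.single i 1) = Finsupp.single i 1

theorem stdSub_eq_sup (k : Type u) [Field k] {n m : ℕ} (h : n ≤ m) :
    stdSub k m = stdSub k n ⊔
      Submodule.span k {v | ∃ i, n ≤ i ∧ i < m ∧ v = Finsupp.single i (1 : k)} := by
  rw [stdSub, stdSub, ← Submodule.span_union]
  congr 1
  ext v
  constructor
  · rintro ⟨i, hi, rfl⟩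
    rcases lt_or_ge i n with h1 | h1
    · exact Or.inl ⟨i, h1, rfl⟩
    · exact Or.inr ⟨i, h1, hi, rfl⟩
  · rintro (⟨i, hi, rfl⟩ | ⟨i, _, hi, rfl⟩)
    · exact ⟨i, by omega, rfl⟩
    · exact ⟨i, hi, rfl⟩

theorem IsBlock.mono {k : Type u} [Field k] {n m : ℕ} {g : Std k ≃ₗ[k] Std k}
    (hg : IsBlock k n g) (h : n ≤ m) : IsBlock k m g := by
  refine ⟨?_, fun i hi => hg.2 i (h.trans hi)⟩
  rw [stdSub_eq_sup k h, Submodule.map_sup, hg.1, Submodule.map_span]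
  congr 2
  ext v
  constructor
  · rintro ⟨w, ⟨i, h1, h2, rfl⟩, rfl⟩
    exact ⟨i, h1, h2, hg.2 i h1⟩
  · rintro ⟨i, h1, h2, rfl⟩
    exact ⟨_, ⟨i, h1, h2, rfl⟩, hg.2 i h1⟩

/-- The group `GL = ⋃ₙ GL_n(k)`, as a group of automorphisms of `𝐕`. -/
def GLinf (k : Type u) [Field k] : Subgroup (Std k ≃ₗ[k] Std k) where
  carrier := {g | ∃ n, IsBlock k n g}
  one_mem' := ⟨0, Submodule.map_id _, fun _ _ => rfl⟩
  mul_mem' := by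
    rintro g h ⟨n, hg⟩ ⟨m, hh⟩
    replace hg := hg.mono (le_max_left n m)
    replace hh := hh.mono (le_max_right n m)
    refine ⟨max n m, ?_, fun i hi => ?_⟩
    · have : ((g * h : Std k ≃ₗ[k] Std k) : Std k →ₗ[k] Std k) =
          (g : Std k →ₗ[k] Std k) ∘ₗ (h : Std k →ₗ[k] Std k) := rfl
      rw [this, Submodule.map_comp, hh.1, hg.1]
    · rw [LinearEquiv.mul_apply, hh.2 i hi, hg.2 i hi]
  inv_mem' := by
    rintro g ⟨n, hg⟩
    refine ⟨n, ?_, fun i hi => ?_⟩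
    · have h2 : ((g⁻¹ : Std k ≃ₗ[k] Std k) : Std k →ₗ[k] Std k) ∘ₗ (g : Std k →ₗ[k] Std k) =
          LinearMap.id := LinearMap.ext fun x => g.symm_apply_apply x
      conv_lhs => rw [← hg.1]
      rw [← Submodule.map_comp, h2, Submodule.map_id]
    · conv_lhs => rw [← hg.2 i hi]
      exact g.symm_apply_apply _

/-- The action of `GL` on `𝐕`. -/
def stdRep (k : Type u) [Field k] : Representation k (GLinf k) (Std k) where
  toFun g := (g.1 : Std k →ₗ[k] Std k)
  map_one' := rfl
  map_mul' _ _ := rfl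

/-- The action of `GL` on the tensor power of `𝐕` whose factors are indexed by `ι`. -/
def tensorRep (k : Type u) [Field k] (ι : Type) :
    Representation k (GLinf k) (⨂[k] _ : ι, Std k) where
  toFun g := PiTensorProduct.map fun _ => stdRep k g
  map_one' := by simp only [map_one]; exact PiTensorProduct.map_one
  map_mul' g h := by simp only [map_mul]; exact PiTensorProduct.map_mul _ _

/-! ### Polynomial representations -/

/-- A representation of `GL` is polynomial if it is a subquotient (a quotient of a
subrepresentation) of a possibly infinite direct sum of tensor powers of `𝐕`. -/
def IsPolynomial {k : Type u} [Field k] {W : Type u} [AddCommGroup W] [Module k W]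
    (ρ : Representation k (GLinf k) W) : Prop :=
  ∃ (ι : Type u) (d : ι → ℕ)
    (N : Subrepresentation (Representation.directSum fun i => tensorRep k (Fin (d i))))
    (f : Representation.IntertwiningMap N.toRepresentation ρ), Function.Surjective f

/-- The subrepresentation generated by a vector. -/
def orbitSpan {k : Type u} [Field k] {W : Type u} [AddCommGroup W] [Module k W]
    (ρ : Representation k (GLinf k) W) (x : W) : Subrepresentation ρ where
  toSubmodule := Submodule.span k (Set.range fun g => ρ g x)
  apply_mem_toSubmodule g v hv := by
    induction hv using Submodule.span_induction with
    | mem v hv =>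
      obtain ⟨h, rfl⟩ := hv
      refine Submodule.subset_span ⟨g * h, ?_⟩
      simp
    | zero => simp
    | add v w _ _ hv hw => rw [map_add]; exact Submodule.add_mem _ hv hw
    | smul a v _ hv => rw [map_smul]; exact Submodule.smul_mem _ a hv

/-- `x` belongs to the maximal polynomial subrepresentation `W^pol`: the subrepresentation that it
generates is polynomial. -/
def IsPolynomialElement {k : Type u} [Field k] {W : Type u} [AddCommGroup W] [Module k W]
    (ρ : Representation k (GLinf k) W) (x : W) : Prop :=
  IsPolynomial (orbitSpan ρ x).toRepresentation

/-! ### Schur functors applied to the standard representation -/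

/-- The permutation of the tensor factors of `𝐕^{⊗|μ|}`, the factors being indexed by the cells of
`μ`. -/
def permTensor (k : Type u) [Field k] (μ : YoungDiagram) (p : Equiv.Perm μ.cells) :
    (⨂[k] _ : μ.cells, Std k) →ₗ[k] (⨂[k] _ : μ.cells, Std k) :=
  (PiTensorProduct.reindex k (fun _ : μ.cells => Std k) p).toLinearMap

/-- The permutations of the cells of `μ` that preserve each row. -/
def rowPerms (μ : YoungDiagram) : Finset (Equiv.Perm μ.cells) :=
  Finset.univ.filter fun p => ∀ c, (p c).1.1 = c.1.1

/-- The permutations of the cells of `μ` that preserve each column. -/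
def colPerms (μ : YoungDiagram) : Finset (Equiv.Perm μ.cells) :=
  Finset.univ.filter fun p => ∀ c, (p c).1.2 = c.1.2

/-- The Young symmetrizer of `μ`, acting on `𝐕^{⊗|μ|}`. -/
def youngSymmetrizer (k : Type u) [Field k] (μ : YoungDiagram) :
    (⨂[k] _ : μ.cells, Std k) →ₗ[k] (⨂[k] _ : μ.cells, Std k) :=
  ∑ p ∈ rowPerms μ, ∑ q ∈ colPerms μ,
    ((Equiv.Perm.sign q : ℤ) : k) • permTensor k μ (p * q)

theorem permTensor_comm (k : Type u) [Field k] (μ : YoungDiagram) (p : Equiv.Perm μ.cells)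
    (g : GLinf k) (x : ⨂[k] _ : μ.cells, Std k) :
    tensorRep k μ.cells g (permTensor k μ p x) = permTensor k μ p (tensorRep k μ.cells g x) :=
  PiTensorProduct.map_reindex (fun _ : μ.cells => stdRep k g) p x

theorem youngSymmetrizer_comm (k : Type u) [Field k] (μ : YoungDiagram)
    (g : GLinf k) (x : ⨂[k] _ : μ.cells, Std k) :
    tensorRep k μ.cells g (youngSymmetrizer k μ x) =
      youngSymmetrizer k μ (tensorRep k μ.cells g x) := by
  simp only [youngSymmetrizer, LinearMap.sum_apply, LinearMap.smul_apply, map_sum, map_smul,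
    permTensor_comm]

/-- `𝐒_μ(𝐕)`, as a subrepresentation of `𝐕^{⊗|μ|}`: the image of the Young symmetrizer. -/
def schurSub (k : Type u) [Field k] (μ : YoungDiagram) :
    Subrepresentation (tensorRep k μ.cells) where
  toSubmodule := LinearMap.range (youngSymmetrizer k μ)
  apply_mem_toSubmodule g v hv := by
    obtain ⟨w, rfl⟩ := hv
    exact ⟨_, (youngSymmetrizer_comm k μ g w).symm⟩

/-- The underlying space of `k^{⊕μ} = 𝐒_μ(𝐕)`. -/
abbrev Schur (k : Type u) [Field k] (μ : YoungDiagram) : Type u := (schurSub k μ).toSubmodule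

instance instAddCommGroupSchur (k : Type u) [Field k] (μ : YoungDiagram) :
    AddCommGroup (Schur k μ) :=
  Module.addCommMonoidToAddCommGroup k

/-- The polynomial representation `k^{⊕μ} = 𝐒_μ(𝐕)`. -/
def schurRep (k : Type u) [Field k] (μ : YoungDiagram) :
    Representation k (GLinf k) (Schur k μ) :=
  (schurSub k μ).toRepresentation

/-- The underlying space of `k^{⊕σ} = ⨁ i, k^{⊕σ i}` for a tuple of partitions `σ`. -/
abbrev SchurSum (k : Type u) [Field k] {r : ℕ} (σ : Fin r → YoungDiagram) : Type u :=
  ⨁ i, Schur k (σ i)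

/-- The polynomial representation `k^{⊕σ}` for a tuple of partitions `σ`. -/
def schurSumRep (k : Type u) [Field k] {r : ℕ} (σ : Fin r → YoungDiagram) :
    Representation k (GLinf k) (SchurSum k σ) :=
  Representation.directSum fun i => schurRep k (σ i)

/-! ### Rational `GL`-fields -/

/-- The action of `GL` on `Sym(W)` by algebra automorphisms induced by a representation `W`. -/
def symAct {k : Type u} [Field k] {W : Type u} [AddCommGroup W] [Module k W]
    (ρ : Representation k (GLinf k) W) :
    GLinf k →* (SymmetricAlgebra k W ≃ₐ[k] SymmetricAlgebra k W) where
  toFun g := AlgEquiv.ofAlgHom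
    (SymmetricAlgebra.lift (SymmetricAlgebra.ι k W ∘ₗ ρ g))
    (SymmetricAlgebra.lift (SymmetricAlgebra.ι k W ∘ₗ ρ g⁻¹))
    (by ext x; simp) (by ext x; simp)
  map_one' := by
    apply AlgEquiv.coe_toAlgHom_injective
    ext x
    simp
  map_mul' g h := by
    apply AlgEquiv.coe_toAlgHom_injective
    ext x
    simp

/-- The field `Frac(Sym(k^{⊕σ}))`. -/
abbrev RatField (k : Type u) [Field k] {r : ℕ} (σ : Fin r → YoungDiagram) : Type u :=
  FractionRing (SymmetricAlgebra k (SchurSum k σ))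

/-- The action of `GL` on `Frac(Sym(k^{⊕σ}))`. -/
def ratAct (k : Type u) [Field k] {r : ℕ} (σ : Fin r → YoungDiagram) :
    GLinf k →* (RatField k σ ≃ₐ[k] RatField k σ) :=
  (IsFractionRing.fieldEquivOfAlgEquivHom k (RatField k σ)).comp (symAct (schurSumRep k σ))

/-! ### Semi-linear representations -/

/-- A semi-linear representation of `GL` over a field `K/k` on which `GL` acts by
`k`-automorphisms. -/
structure SemilinRep {k : Type u} [Field k] {K : Type u} [Field K] [Algebra k K]
    (act : GLinf k →* (K ≃ₐ[k] K)) where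
  carrier : Type u
  [addCommGroup : AddCommGroup carrier]
  [moduleK : Module K carrier]
  [modulek : Module k carrier]
  [tower : IsScalarTower k K carrier]
  ρ : Representation k (GLinf k) carrier
  semilinear : ∀ (g : GLinf k) (a : K) (x : carrier), ρ g (a • x) = act g a • ρ g x

attribute [instance] SemilinRep.addCommGroup SemilinRep.moduleK SemilinRep.modulek
  SemilinRep.tower

namespace SemilinRep

variable {k : Type u} [Field k] {K : Type u} [Field K] [Algebra k K]
  {act : GLinf k →* (K ≃ₐ[k] K)}

/-- `M` is a `K`-module in the sense of `GL`-fields: every element has the form `a x` with `a ∈ K`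
and `x ∈ M^pol`. -/
def IsKModule (M : SemilinRep act) : Prop :=
  ∀ m : M.carrier, ∃ (a : K) (x : M.carrier), IsPolynomialElement M.ρ x ∧ m = a • x

/-- Compatibility of a `K`-linear map with the actions of `GL`. -/
def IsEquivariant {M N : SemilinRep act} (f : M.carrier →ₗ[K] N.carrier) : Prop :=
  ∀ (g : GLinf k) (x : M.carrier), f (M.ρ g x) = N.ρ g (f x)

/-- `M` and `N` are isomorphic. -/
def Iso (M N : SemilinRep act) : Prop :=
  ∃ e : M.carrier ≃ₗ[K] N.carrier, IsEquivariant (M := M) (N := N) e.toLinearMap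

/-- A `K`-subspace is a subobject if it is stable under `GL`. -/
def IsStable (M : SemilinRep act) (N : Submodule K M.carrier) : Prop :=
  ∀ (g : GLinf k) (x : M.carrier), x ∈ N → M.ρ g x ∈ N

/-- A subobject, as a semi-linear representation. -/
def sub (M : SemilinRep act) (N : Submodule K M.carrier) (hN : M.IsStable N) :
    SemilinRep act where
  carrier := N
  ρ :=
    { toFun := fun g =>
        { toFun := fun x => ⟨M.ρ g x, hN g x x.2⟩
          map_add' := fun x y => Subtype.ext (map_add (M.ρ g) (x : M.carrier) y)
          map_smul' := fun a x => Subtype.ext (map_smul (M.ρ g) a (x : M.carrier)) }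
      map_one' := by ext x; simp
      map_mul' := fun g h => by ext x; simp }
  semilinear g a x := Subtype.ext (M.semilinear g a x)

/-- The quotient by a subobject, as a semi-linear representation. -/
def quot (M : SemilinRep act) (N : Submodule K M.carrier) (hN : M.IsStable N) :
    SemilinRep act where
  carrier := M.carrier ⧸ N
  ρ :=
    { toFun := fun g =>
        (N.restrictScalars k).mapQ (N.restrictScalars k) (M.ρ g) (fun x hx => hN g x hx)
      map_one' := by
        refine LinearMap.ext fun x => ?_
        obtain ⟨x, rfl⟩ := Submodule.Quotient.mk_surjective _ x
        exact congrArg N.mkQ (by simp : M.ρ 1 x = x)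
      map_mul' := fun g h => by
        refine LinearMap.ext fun x => ?_
        obtain ⟨x, rfl⟩ := Submodule.Quotient.mk_surjective _ x
        exact congrArg N.mkQ (by simp : M.ρ (g * h) x = M.ρ g (M.ρ h x)) }
  semilinear g a x := by
    obtain ⟨x, rfl⟩ := Submodule.Quotient.mk_surjective _ x
    exact congrArg N.mkQ (M.semilinear g a x)

theorem isStable_range {M N : SemilinRep act} {f : M.carrier →ₗ[K] N.carrier}
    (hf : IsEquivariant f) : N.IsStable (LinearMap.range f) := by
  rintro g _ ⟨x, rfl⟩
  exact ⟨M.ρ g x, hf g x⟩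

theorem isStable_submoduleOf (M : SemilinRep act) {N P : Submodule K M.carrier}
    (hN : M.IsStable N) (hP : M.IsStable P) : (M.sub P hP).IsStable (N.submoduleOf P) :=
  fun g x hx => hN g x.1 hx

/-- The subquotient `P / N` of `M`, for subobjects `N ⊆ P` of `M`. -/
def subquot (M : SemilinRep act) (N P : Submodule K M.carrier)
    (hN : M.IsStable N) (hP : M.IsStable P) : SemilinRep act :=
  (M.sub P hP).quot (N.submoduleOf P) (M.isStable_submoduleOf hN hP)

/-- `M` is generated by finitely many elements, under the operations of `K` and `GL`. -/
def IsFinGen (M : SemilinRep act) : Prop :=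
  ∃ S : Finset M.carrier,
    Submodule.span K {y | ∃ (g : GLinf k) (x : M.carrier), x ∈ S ∧ y = M.ρ g x} = ⊤

/-- Simple objects of the category of `K`-modules. -/
def IsSimple (M : SemilinRep act) : Prop :=
  M.IsKModule ∧ Nontrivial M.carrier ∧
    ∀ N : Submodule K M.carrier, M.IsStable N → N = ⊥ ∨ N = ⊤

/-- The socle: the sum of all simple subobjects. -/
def socle (M : SemilinRep act) : Submodule K M.carrier :=
  sSup {N | ∃ hN : M.IsStable N, (M.sub N hN).IsSimple}

/-- A composition series `0 = N₀ ⊆ N₁ ⊆ ⋯ ⊆ N_ℓ = M`, with simple quotients `Nᵢ₊₁ / Nᵢ`. -/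
structure CompSeries (M : SemilinRep act) where
  length : ℕ
  term : Fin (length + 1) → Submodule K M.carrier
  stable : ∀ i, M.IsStable (term i)
  le_succ : ∀ i : Fin length, term i.castSucc ≤ term i.succ
  first_eq : term 0 = ⊥
  last_eq : term (Fin.last length) = ⊤
  simple : ∀ i : Fin length,
    (M.subquot (term i.castSucc) (term i.succ) (stable _) (stable _)).IsSimple

/-- The `i`th composition factor `Nᵢ₊₁ / Nᵢ`. -/
def CompSeries.factor {M : SemilinRep act} (s : M.CompSeries) (i : Fin s.length) :
    SemilinRep act :=
  M.subquot (s.term i.castSucc) (s.term i.succ) (s.stable _) (s.stable _)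

/-- `M` has finite length: it admits a composition series. -/
def IsFiniteLength (M : SemilinRep act) : Prop := Nonempty M.CompSeries

/-- `M` is non-zero and is not the direct sum of two non-zero subobjects. -/
def IsIndecomposable (M : SemilinRep act) : Prop :=
  Nontrivial M.carrier ∧
    ∀ N P : Submodule K M.carrier, M.IsStable N → M.IsStable P → IsCompl N P → N = ⊥ ∨ P = ⊥

/-- Injective objects of the category of `K`-modules. -/
def IsInjective (I : SemilinRep act) : Prop :=
  I.IsKModule ∧
    ∀ (X Y : SemilinRep act), X.IsKModule → Y.IsKModule →
      ∀ (i : X.carrier →ₗ[K] Y.carrier) (f : X.carrier →ₗ[K] I.carrier),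
        IsEquivariant i → IsEquivariant f → Function.Injective i →
          ∃ h : Y.carrier →ₗ[K] I.carrier, IsEquivariant h ∧ h ∘ₗ i = f

/-- `M` has injective dimension at most `n`: there is an exact sequence
`0 → M → I₀ → ⋯ → Iₙ → 0` with injective `Iⱼ`. -/
def InjDimLE : ℕ → SemilinRep act → Prop
  | 0, M => M.IsInjective
  | n + 1, M => ∃ (I : SemilinRep act) (f : M.carrier →ₗ[K] I.carrier) (hf : IsEquivariant f),
      I.IsInjective ∧ Function.Injective f ∧
        InjDimLE n (I.quot (LinearMap.range f) (isStable_range hf))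

/-- The `K`-module `K^{⊕μ} = K ⊗ 𝐒_μ(𝐕)`, with the diagonal action of `GL`. -/
def free (act : GLinf k →* (K ≃ₐ[k] K)) (μ : YoungDiagram) : SemilinRep act where
  carrier := K ⊗[k] Schur k μ
  ρ :=
    { toFun := fun g => TensorProduct.map (act g).toLinearMap (schurRep k μ g)
      map_one' := by ext; simp
      map_mul' := fun g h => by ext; simp }
  semilinear g a x := by
    induction x using TensorProduct.induction_on with
    | zero => simp
    | tmul b v => simp [TensorProduct.smul_tmul']
    | add x y hx hy => simp only [smul_add, map_add, hx, hy]

/-- The intersection of the kernels of all maps `K^{⊕μ} → K^{⊕ν}` with `|ν| < |μ|`, as a subspace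
of `K^{⊕μ}`. -/
def simpleSub (act : GLinf k →* (K ≃ₐ[k] K)) (μ : YoungDiagram) :
    Submodule K (free act μ).carrier :=
  sInf {N | ∃ (ν : YoungDiagram) (f : (free act μ).carrier →ₗ[K] (free act ν).carrier),
    ν.card < μ.card ∧ IsEquivariant f ∧ N = LinearMap.ker f}

theorem isStable_simpleSub (act : GLinf k →* (K ≃ₐ[k] K)) (μ : YoungDiagram) :
    (free act μ).IsStable (simpleSub act μ) := by
  intro g x hx
  rw [simpleSub, Submodule.mem_sInf] at hx ⊢
  rintro N ⟨ν, f, hν, hf, rfl⟩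
  have h0 : f x = 0 := hx _ ⟨ν, f, hν, hf, rfl⟩
  rw [LinearMap.mem_ker, hf, h0, map_zero]

/-- The `K`-module `L_μ`. -/
def simpleObj (act : GLinf k →* (K ≃ₐ[k] K)) (μ : YoungDiagram) : SemilinRep act :=
  (free act μ).sub (simpleSub act μ) (isStable_simpleSub act μ)

end SemilinRep

end GLStruct

end

set_option linter.unusedSectionVars false
set_option linter.unusedVariables false

noncomputable section

namespace GLStruct

/-! ### Young symmetrizers in the group algebra -/

section Young

variable (k : Type*) [Field k] {X : Type*} [Fintype X] [DecidableEq X]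

/-! Three facts control the category. (1) Rigidity: an equivariant map K^{⊕μ} → K^{⊕ν} is zero, or
|ν| < |μ|, or μ = ν and it is an invertible scalar (`free_hom_cases`). (2) Embedding: a finitely
generated K-module embeds in a finite direct sum of modules K^{⊕μ} (`LowGen.exists_separating`,
applied to quotients in `exists_separating`). (3) L_μ ≠ 0 (`IsSymFrac.simpleSub_ne_bot`).

The theorem follows formally. If N ≠ 0 is a subobject of K^{⊕μ}, embed the quotient by N: no
component is invertible, since all of them kill N, so by (1) every component kills L_μ, and
therefore L_μ ⊆ N. Thus L_μ is simple and is the socle. If K^{⊕μ} lies in a finitely generated M,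
some component of an embedding of M is non-zero on L_μ, hence invertible on K^{⊕μ}, and K^{⊕μ}
splits off; Zorn's lemma and a pushout give injectivity. Induction on the degree gives finite
length, and minimal embeddings give finite injective dimension.

For (1) and (2) the tool is the path p_t : e_i ↦ e_{q+i} + t e_i, e_{q+i} ↦ e_i (i < q), which is
polynomial in t and invertible even at t = 0. On tensors of degree d in the first q vectors it is
t^d up to terms that involve the second block, while p_0 moves a coefficient from K into the second
block. Comparing degrees in t gives (1), together with the irreducibility of Schur functors. For
(2), a relation between generators degenerates at t = 0 to one whose coefficients are invariant
under a shifted copy of GL; irreducibility then makes a top-degree generator redundant after a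
shift, at the cost of generators of lower degree (`rspan_le_of_relation`). A double induction embeds
the module in K ⊗ P with P polynomial, equivariantly for a shifted copy of GL (`LowGen.embeds`). The
same path produces invariant denominators (`exists_invariant_denom`), and a coaction Sym W → Sym W ⊗
Sym W that splits off the shifted variables converts the result into an embedding equivariant for
all of GL (`LowGen.exists_embedding`).

For (3), a counting argument produces a non-zero vector of K^{⊕μ} killed by all maps of lower
degree. Under a family of unipotent elements with many parameters the image of a vector is fixed in
two ways: by a polynomial of high multidegree, and by one of lower degree modulo an ideal with few
generators (`IsSymFrac.exists_killed`). -/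

omit [Fintype X] [DecidableEq X] in
theorem perm_apply_inv_self (p : Equiv.Perm X) (x : X) : p (p⁻¹ x) = x := p.apply_symm_apply x

omit [Fintype X] in
theorem apply_swap_eq {r : X → ℕ} {x y : X} (h : r x = r y) (z : X) :
    r (Equiv.swap x y z) = r z := by
  by_cases h1 : z = x
  · subst h1; simp [h]
  · by_cases h2 : z = y
    · subst h2; simp [h]
    · rw [Equiv.swap_apply_of_ne_of_ne h1 h2]

/-- The sum of the permutations of `X` that preserve the function `r`. -/
def rowSum (r : X → ℕ) : MonoidAlgebra k (Equiv.Perm X) :=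
  ∑ p : Equiv.Perm X with ∀ x, r (p x) = r x, MonoidAlgebra.of k _ p

/-- The signed sum of the permutations of `X` that preserve the function `c`. -/
def colSum (c : X → ℕ) : MonoidAlgebra k (Equiv.Perm X) :=
  ∑ q : Equiv.Perm X with ∀ x, c (q x) = c x,
    ((Equiv.Perm.sign q : ℤ) : k) • MonoidAlgebra.of k _ q

variable {k}

theorem rowSum_mul_of {r : X → ℕ} {p : Equiv.Perm X} (hp : ∀ x, r (p x) = r x) :
    rowSum k r * MonoidAlgebra.of k _ p = rowSum k r := by
  rw [rowSum, Finset.sum_mul]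
  refine Finset.sum_bij' (fun g _ => g * p) (fun g _ => g * p⁻¹) ?_ ?_ ?_ ?_ ?_
  · intro g hg
    simp only [Finset.mem_filter, Finset.mem_univ, true_and] at hg ⊢
    intro x; rw [Equiv.Perm.mul_apply, hg, hp]
  · intro g hg
    simp only [Finset.mem_filter, Finset.mem_univ, true_and] at hg ⊢
    intro x
    rw [Equiv.Perm.mul_apply, hg, ← hp (p⁻¹ x), perm_apply_inv_self]
  · intros; simp
  · intros; simp
  · intros; rw [map_mul]

theorem of_mul_rowSum {r : X → ℕ} {p : Equiv.Perm X} (hp : ∀ x, r (p x) = r x) :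
    MonoidAlgebra.of k _ p * rowSum k r = rowSum k r := by
  have hp' : ∀ x, r (p⁻¹ x) = r x := fun x => by rw [← hp (p⁻¹ x), perm_apply_inv_self]
  rw [rowSum, Finset.mul_sum]
  refine Finset.sum_bij' (fun g _ => p * g) (fun g _ => p⁻¹ * g) ?_ ?_ ?_ ?_ ?_
  · intro g hg
    simp only [Finset.mem_filter, Finset.mem_univ, true_and] at hg ⊢
    intro x; rw [Equiv.Perm.mul_apply, hp, hg]
  · intro g hg
    simp only [Finset.mem_filter, Finset.mem_univ, true_and] at hg ⊢
    intro x
    rw [Equiv.Perm.mul_apply, hp', hg]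
  · intros; simp
  · intros; simp
  · intros; rw [map_mul]

theorem of_mul_colSum {c : X → ℕ} {q : Equiv.Perm X} (hq : ∀ x, c (q x) = c x) :
    MonoidAlgebra.of k _ q * colSum k c = ((Equiv.Perm.sign q : ℤ) : k) • colSum k c := by
  have hq' : ∀ x, c (q⁻¹ x) = c x := fun x => by rw [← hq (q⁻¹ x), perm_apply_inv_self]
  rw [colSum, Finset.mul_sum, Finset.smul_sum]
  refine Finset.sum_bij' (fun g _ => q * g) (fun g _ => q⁻¹ * g) ?_ ?_ ?_ ?_ ?_
  · intro g hg
    simp only [Finset.mem_filter, Finset.mem_univ, true_and] at hg ⊢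
    intro x; rw [Equiv.Perm.mul_apply, hq, hg]
  · intro g hg
    simp only [Finset.mem_filter, Finset.mem_univ, true_and] at hg ⊢
    intro x
    rw [Equiv.Perm.mul_apply, hq', hg]
  · intros; simp
  · intros; simp
  · intro g _
    rw [mul_smul_comm, ← map_mul, Equiv.Perm.sign_mul, Units.val_mul, Int.cast_mul, smul_smul,
      ← mul_assoc, ← Int.cast_mul, ← Units.val_mul, Int.units_mul_self, Units.val_one,
      Int.cast_one, one_mul]

theorem colSum_mul_of {c : X → ℕ} {q : Equiv.Perm X} (hq : ∀ x, c (q x) = c x) :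
    colSum k c * MonoidAlgebra.of k _ q = ((Equiv.Perm.sign q : ℤ) : k) • colSum k c := by
  have hq' : ∀ x, c (q⁻¹ x) = c x := fun x => by rw [← hq (q⁻¹ x), perm_apply_inv_self]
  rw [colSum, Finset.sum_mul, Finset.smul_sum]
  refine Finset.sum_bij' (fun g _ => g * q) (fun g _ => g * q⁻¹) ?_ ?_ ?_ ?_ ?_
  · intro g hg
    simp only [Finset.mem_filter, Finset.mem_univ, true_and] at hg ⊢
    intro x; rw [Equiv.Perm.mul_apply, hg, hq]
  · intro g hg
    simp only [Finset.mem_filter, Finset.mem_univ, true_and] at hg ⊢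
    intro x
    rw [Equiv.Perm.mul_apply, hg, hq']
  · intros; simp
  · intros; simp
  · intro g _
    rw [smul_mul_assoc, ← map_mul, Equiv.Perm.sign_mul, Units.val_mul, Int.cast_mul, smul_smul,
      mul_comm, mul_assoc, ← Int.cast_mul, ← Units.val_mul, Int.units_mul_self, Units.val_one,
      Int.cast_one, mul_one]

theorem of_mul_rowSum_conj (g : Equiv.Perm X) (r : X → ℕ) :
    MonoidAlgebra.of k _ g * rowSum k r =
      rowSum k (r ∘ ⇑(g⁻¹)) * MonoidAlgebra.of k _ g := by
  rw [rowSum, rowSum, Finset.sum_mul, Finset.mul_sum]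
  refine Finset.sum_bij' (fun p _ => g * p * g⁻¹) (fun p _ => g⁻¹ * p * g) ?_ ?_ ?_ ?_ ?_
  · intro p hp
    simp only [Finset.mem_filter, Finset.mem_univ, true_and] at hp ⊢
    intro x; simp [hp]
  · intro p hp
    simp only [Finset.mem_filter, Finset.mem_univ, true_and] at hp ⊢
    intro x
    have := hp (g x)
    simpa using this
  · intros; group
  · intros; group
  · intros; rw [← map_mul, ← map_mul]; congr 1; group

theorem of_mul_colSum_conj (g : Equiv.Perm X) (c : X → ℕ) :
    MonoidAlgebra.of k _ g * colSum k c =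
      colSum k (c ∘ ⇑(g⁻¹)) * MonoidAlgebra.of k _ g := by
  rw [colSum, colSum, Finset.sum_mul, Finset.mul_sum]
  refine Finset.sum_bij' (fun p _ => g * p * g⁻¹) (fun p _ => g⁻¹ * p * g) ?_ ?_ ?_ ?_ ?_
  · intro p hp
    simp only [Finset.mem_filter, Finset.mem_univ, true_and] at hp ⊢
    intro x; simp [hp]
  · intro p hp
    simp only [Finset.mem_filter, Finset.mem_univ, true_and] at hp ⊢
    intro x
    have := hp (g x)
    simpa using this
  · intros; group
  · intros; group
  · intro p _
    rw [mul_smul_comm, smul_mul_assoc, ← map_mul, ← map_mul]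
    congr 1
    · rcases Int.units_eq_one_or (Equiv.Perm.sign g) with h | h <;>
        simp [Equiv.Perm.sign_mul, h]
    · congr 1; group

theorem eq_zero_of_eq_neg [CharZero k] {M : Type*} [AddCommGroup M] [Module k M] {z : M}
    (h : z = -z) : z = 0 := by
  have h2 : (2 : k) • z = 0 := by
    rw [two_smul]; nth_rewrite 1 [h]; exact neg_add_cancel z
  exact (smul_eq_zero.1 h2).resolve_left two_ne_zero

/-- The transposition of x and y fixes the row sum and negates the column sum, so the product equals
its own negative. -/
theorem rowSum_mul_colSum_eq_zero [CharZero k] {r c : X → ℕ} {x y : X} (hxy : x ≠ y)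
    (hr : r x = r y) (hc : c x = c y) : rowSum k r * colSum k c = 0 := by
  have hr' := apply_swap_eq hr
  have hc' := apply_swap_eq hc
  apply eq_zero_of_eq_neg (k := k)
  conv_lhs => rw [← rowSum_mul_of hr', mul_assoc, of_mul_colSum hc', Equiv.Perm.sign_swap hxy]
  simp

theorem colSum_mul_rowSum_eq_zero [CharZero k] {r c : X → ℕ} {x y : X} (hxy : x ≠ y)
    (hr : r x = r y) (hc : c x = c y) : colSum k c * rowSum k r = 0 := by
  have hr' := apply_swap_eq hr
  have hc' := apply_swap_eq hc
  apply eq_zero_of_eq_neg (k := k)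
  conv_lhs => rw [← of_mul_rowSum hr', ← mul_assoc, colSum_mul_of hc', Equiv.Perm.sign_swap hxy]
  simp

/-! ### Tableaux -/

/-- The row index of an entry of a tableau. -/
def rowOf {μ : YoungDiagram} (e : X ≃ μ.cells) (x : X) : ℕ := (e x).1.1

/-- The column index of an entry of a tableau. -/
def colOf {μ : YoungDiagram} (e : X ≃ μ.cells) (x : X) : ℕ := (e x).1.2

omit [Fintype X] [DecidableEq X] in
theorem rowOf_colOf_inj {μ : YoungDiagram} (e : X ≃ μ.cells) {x y : X}
    (h1 : rowOf e x = rowOf e y) (h2 : colOf e x = colOf e y) : x = y :=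
  e.injective (Subtype.ext (Prod.ext h1 h2))

omit [DecidableEq X] in
-- On a column `r` takes distinct values, so at most min(t, column length) entries have `r` below t.
-- The tableau attains this bound, because the rows met by a column are 0, 1, 2, ….
theorem card_fiber_le {ν : YoungDiagram} (e : X ≃ ν.cells) (r : X → ℕ)
    (hinj : ∀ x y, r x = r y → colOf e x = colOf e y → x = y) (t j : ℕ) :
    (Finset.univ.filter fun x => r x < t ∧ colOf e x = j).card ≤
      (Finset.univ.filter fun x => rowOf e x < t ∧ colOf e x = j).card := by
  rcases le_or_gt t (ν.colLen j) with h | h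
  · calc (Finset.univ.filter fun x => r x < t ∧ colOf e x = j).card
        ≤ (Finset.range t).card := by
          refine Finset.card_le_card_of_injOn r (fun x hx => ?_) (fun x hx y hy hxy => ?_)
          · simp only [Finset.coe_filter, Finset.mem_univ, true_and, Set.mem_ofPred_eq] at hx
            simpa using hx.1
          · simp only [Finset.coe_filter, Finset.mem_univ, true_and, Set.mem_ofPred_eq] at hx hy
            exact hinj x y hxy (hx.2.trans hy.2.symm)
      _ ≤ _ := by
          have hmem : ∀ i ∈ Finset.range t, (i, j) ∈ ν.cells := fun i hi =>
            (YoungDiagram.mem_cells _).2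
              (YoungDiagram.mem_iff_lt_colLen.2 ((Finset.mem_range.1 hi).trans_le h))
          refine Finset.card_le_card_of_surjOn (rowOf e) fun i hi => ?_
          refine ⟨e.symm ⟨(i, j), hmem i hi⟩, ?_, by simp [rowOf]⟩
          simp only [Finset.coe_filter, Finset.mem_univ, true_and, Set.mem_ofPred_eq]
          simpa [rowOf, colOf] using hi
  · refine Finset.card_le_card fun x hx => ?_
    simp only [Finset.mem_filter, Finset.mem_univ, true_and] at hx ⊢
    refine ⟨lt_trans ?_ h, hx.2⟩
    have := (YoungDiagram.mem_cells _).1 (e x).2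
    rw [← hx.2]
    exact YoungDiagram.mem_iff_lt_colLen.1 this

omit [DecidableEq X] in
theorem card_lt_eq_sum (c : X → ℕ) (r : X → ℕ) (t : ℕ) :
    (Finset.univ.filter fun x => r x < t).card =
      ∑ j ∈ Finset.univ.image c, (Finset.univ.filter fun x => r x < t ∧ c x = j).card := by
  rw [Finset.card_eq_sum_card_fiberwise (f := c) (t := Finset.univ.image c)
    (fun x _ => by simp)]
  refine Finset.sum_congr rfl fun j _ => ?_
  rw [Finset.filter_filter]

omit [DecidableEq X] in
-- This is the dominance inequality, summed over the columns.
theorem card_row_lt_le {ν : YoungDiagram} (e : X ≃ ν.cells) (r : X → ℕ)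
    (hinj : ∀ x y, r x = r y → colOf e x = colOf e y → x = y) (t : ℕ) :
    (Finset.univ.filter fun x => r x < t).card ≤
      (Finset.univ.filter fun x => rowOf e x < t).card := by
  rw [card_lt_eq_sum (colOf e), card_lt_eq_sum (colOf e)]
  exact Finset.sum_le_sum fun j _ => card_fiber_le e r hinj t j

omit [DecidableEq X] in
theorem card_rowOf_lt {μ : YoungDiagram} (e : X ≃ μ.cells) (t : ℕ) :
    (Finset.univ.filter fun x => rowOf e x < t).card = (μ.cells.filter fun c => c.1 < t).card := by
  refine Finset.card_bij (fun x _ => (e x).1) ?_ ?_ ?_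
  · intro x hx; simp only [Finset.mem_filter, Finset.mem_univ, true_and] at hx; simpa [rowOf] using hx
  · intro x _ y _ h; exact e.injective (Subtype.ext h)
  · intro c hc
    rw [Finset.mem_filter] at hc
    refine ⟨e.symm ⟨c, hc.1⟩, ?_, by simp⟩
    simp only [Finset.mem_filter, Finset.mem_univ, true_and]
    simpa [rowOf] using hc.2

omit [DecidableEq X] in
theorem diagram_eq_of_card_row_lt {μ ν : YoungDiagram} (e : X ≃ μ.cells) (e' : X ≃ ν.cells)
    (h : ∀ t, (Finset.univ.filter fun x => rowOf e x < t).card =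
      (Finset.univ.filter fun x => rowOf e' x < t).card) : μ = ν := by
  have key : ∀ (μ : YoungDiagram) (t : ℕ), (μ.cells.filter fun c => c.1 < t + 1).card =
      (μ.cells.filter fun c => c.1 < t).card + μ.rowLen t := by
    intro μ t
    rw [YoungDiagram.rowLen_eq_card, YoungDiagram.row, ← Finset.card_union_of_disjoint]
    · congr 1
      ext c
      simp only [Finset.mem_filter, Finset.mem_union]
      have : c.1 < t + 1 ↔ c.1 < t ∨ c.1 = t := by omega
      rw [this]; tauto
    · rw [Finset.disjoint_filter]; intro c _ h1 h2; omega
  have h2 : ∀ t, μ.rowLen t = ν.rowLen t := fun t => by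
    have a1 := h t
    have a2 := h (t + 1)
    rw [card_rowOf_lt, card_rowOf_lt] at a1 a2
    rw [key, key] at a2
    omega
  ext ⟨i, j⟩
  rw [YoungDiagram.mem_cells, YoungDiagram.mem_cells, YoungDiagram.mem_iff_lt_rowLen,
    YoungDiagram.mem_iff_lt_rowLen, h2]

variable (k) in
/-- The Young symmetrizer of a tableau. -/
def youngElt {μ : YoungDiagram} (e : X ≃ μ.cells) : MonoidAlgebra k (Equiv.Perm X) :=
  rowSum k (rowOf e) * colSum k (colOf e)

theorem sandwich_eq_zero {a b : MonoidAlgebra k (Equiv.Perm X)}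
    (h : ∀ g, a * MonoidAlgebra.of k _ g * b = 0) (z : MonoidAlgebra k (Equiv.Perm X)) :
    a * z * b = 0 := by
  induction z using MonoidAlgebra.induction_on with
  | of g => exact h g
  | add x y hx hy => rw [mul_add, add_mul, hx, hy, add_zero]
  | smul c x hx => rw [mul_smul_comm, smul_mul_assoc, hx, smul_zero]

/-- If the product is non-zero, then so are some row sum of `e` times a translated column sum of
`e'`, and the column sum of `e` times the row sum of `e'`. Each of them yields a dominance
inequality, and the two are opposite. -/
theorem youngElt_mul_youngElt_of_ne [CharZero k] {μ ν : YoungDiagram} (hne : μ ≠ ν)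
    (e : X ≃ μ.cells) (e' : X ≃ ν.cells) : youngElt k e * youngElt k e' = 0 := by
  by_contra hcon
  apply hne
  refine diagram_eq_of_card_row_lt e e' fun t => le_antisymm ?_ ?_
  · have : ∃ g : Equiv.Perm X,
        rowSum k (rowOf e) * MonoidAlgebra.of k _ g * colSum k (colOf e') ≠ 0 := by
      by_contra! hall
      apply hcon
      rw [youngElt, youngElt, mul_assoc, ← mul_assoc (colSum k _), ← mul_assoc]
      exact sandwich_eq_zero hall _
    obtain ⟨g, hg⟩ := this
    rw [mul_assoc, of_mul_colSum_conj, ← mul_assoc] at hg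
    have h2 := card_row_lt_le (ν := ν) ((g⁻¹ : Equiv.Perm X).trans e') (rowOf e)
      (fun x y h1 h2 => by
        by_contra hxy
        exact hg (by rw [rowSum_mul_colSum_eq_zero (c := colOf e' ∘ ⇑g⁻¹) hxy h1 h2, zero_mul])) t
    rwa [card_rowOf_lt ((g⁻¹ : Equiv.Perm X).trans e'), ← card_rowOf_lt e'] at h2
  · have h0 : colSum k (colOf e) * rowSum k (rowOf e') ≠ 0 := by
      intro h
      apply hcon
      rw [youngElt, youngElt, mul_assoc, ← mul_assoc (colSum k _), h]; simp
    exact card_row_lt_le e (rowOf e') (fun x y h1 h2 => by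
        by_contra hxy
        exact h0 (colSum_mul_rowSum_eq_zero hxy h1 h2)) t

/-- Von Neumann's lemma: either two entries share a row of `e` and a column of its translate by g,
and the product vanishes, or g is a row permutation times a column permutation. -/
theorem rowSum_mul_of_mul_colSum [CharZero k] {μ : YoungDiagram} (e : X ≃ μ.cells)
    (g : Equiv.Perm X) : ∃ a : k,
    rowSum k (rowOf e) * MonoidAlgebra.of k _ g * colSum k (colOf e) = a • youngElt k e := by
  by_cases hz : rowSum k (rowOf e) * MonoidAlgebra.of k _ g * colSum k (colOf e) = 0
  · exact ⟨0, by rw [hz, zero_smul]⟩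
  let e' : X ≃ μ.cells := (g⁻¹ : Equiv.Perm X).trans e
  have hinj : ∀ x y, rowOf e x = rowOf e y → colOf e' x = colOf e' y → x = y := by
    intro x y h1 h2
    by_contra hxy
    apply hz
    rw [mul_assoc, of_mul_colSum_conj, ← mul_assoc]
    rw [rowSum_mul_colSum_eq_zero (c := colOf e ∘ ⇑g⁻¹) hxy h1 h2, zero_mul]
  have htot : ∀ t, (Finset.univ.filter fun x => rowOf e x < t).card =
      (Finset.univ.filter fun x => rowOf e' x < t).card := fun t => by
    rw [card_rowOf_lt, card_rowOf_lt]
  -- The column-wise inequalities add up to an equality, so each of them is an equality. With t the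
  -- length of column j this says that every entry of that column has `e`-row below t.
  have hmem : ∀ x, (rowOf e x, colOf e' x) ∈ μ.cells := by
    intro x
    rw [YoungDiagram.mem_cells, YoungDiagram.mem_iff_lt_colLen]
    set j := colOf e' x
    set t := μ.colLen j with ht
    have h1 := htot t
    rw [card_lt_eq_sum (colOf e'), card_lt_eq_sum (colOf e'),
      Finset.sum_eq_sum_iff_of_le (fun j _ => card_fiber_le e' (rowOf e) hinj t j)] at h1
    have h2 := h1 j (by simp [j])
    have h3 : (Finset.univ.filter fun x => rowOf e' x < t ∧ colOf e' x = j) =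
        Finset.univ.filter fun x => colOf e' x = j := by
      ext y
      simp only [Finset.mem_filter, Finset.mem_univ, true_and, and_iff_right_iff_imp]
      intro hy
      have := (YoungDiagram.mem_cells _).1 (e' y).2
      rw [ht, ← hy]
      exact YoungDiagram.mem_iff_lt_colLen.1 this
    rw [h3] at h2
    have h4 := Finset.eq_of_subset_of_card_le
      (s := Finset.univ.filter fun x => rowOf e x < t ∧ colOf e' x = j)
      (t := Finset.univ.filter fun x => colOf e' x = j)
      (fun y hy => by
        simp only [Finset.mem_filter, Finset.mem_univ, true_and] at hy ⊢; exact hy.2) h2.ge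
    have h5 : x ∈ Finset.univ.filter fun x => colOf e' x = j := by simp [j]
    rw [← h4, Finset.mem_filter] at h5
    exact h5.2.1
  -- Each x is sent to the entry of `e'` in the cell given by the `e`-row and the `e'`-column of x.
  -- This permutation h preserves `e'`-columns, and (g⁻¹h)⁻¹ preserves `e`-rows, which factors g.
  let h0 : X → X := fun x => e'.symm ⟨(rowOf e x, colOf e' x), hmem x⟩
  have hh0 : Function.Injective h0 := by
    intro x y hxy
    have := congrArg Subtype.val (e'.symm.injective hxy)
    rw [Prod.mk.injEq] at this
    exact hinj x y this.1 this.2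
  let h : Equiv.Perm X := Equiv.ofBijective h0 (Finite.injective_iff_bijective.1 hh0)
  have hr : ∀ x, rowOf e (g⁻¹ (h x)) = rowOf e x := fun x => by
    change rowOf e' (h0 x) = _
    simp [h0, rowOf]
  have hc : ∀ x, colOf e' (h x) = colOf e' x := fun x => by
    change colOf e' (h0 x) = _
    simp [h0, colOf]
  have hp : ∀ x, rowOf e ((g⁻¹ * h)⁻¹ x) = rowOf e x := fun x => by
    have := hr ((g⁻¹ * h)⁻¹ x)
    rw [← this, ← Equiv.Perm.mul_apply, perm_apply_inv_self]
  have hq : ∀ x, colOf e ((g⁻¹ * h * g) x) = colOf e x := fun x => by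
    have := hc (g x)
    simpa [colOf, e'] using this
  refine ⟨((Equiv.Perm.sign (g⁻¹ * h * g) : ℤ) : k), ?_⟩
  have hg : g = (g⁻¹ * h)⁻¹ * (g⁻¹ * h * g) := by group
  conv_lhs => rw [hg, map_mul, ← mul_assoc, rowSum_mul_of hp, mul_assoc, of_mul_colSum hq]
  rw [youngElt, mul_smul_comm]

theorem rowSum_mul_mul_colSum [CharZero k] {μ : YoungDiagram} (e : X ≃ μ.cells)
    (z : MonoidAlgebra k (Equiv.Perm X)) : ∃ a : k,
    rowSum k (rowOf e) * z * colSum k (colOf e) = a • youngElt k e := by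
  induction z using MonoidAlgebra.induction_on with
  | of g => exact rowSum_mul_of_mul_colSum e g
  | add x y hx hy =>
    obtain ⟨a, ha⟩ := hx
    obtain ⟨b, hb⟩ := hy
    exact ⟨a + b, by rw [mul_add, add_mul, ha, hb, add_smul]⟩
  | smul c x hx =>
    obtain ⟨a, ha⟩ := hx
    exact ⟨c * a, by rw [mul_smul_comm, smul_mul_assoc, ha, smul_smul]⟩

theorem youngElt_mul_mul_youngElt [CharZero k] {μ : YoungDiagram} (e : X ≃ μ.cells)
    (z : MonoidAlgebra k (Equiv.Perm X)) :
    ∃ a : k, youngElt k e * z * youngElt k e = a • youngElt k e := by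
  obtain ⟨a, ha⟩ := rowSum_mul_mul_colSum e (colSum k (colOf e) * z * rowSum k (rowOf e))
  refine ⟨a, ?_⟩
  rw [← ha, youngElt]
  simp only [mul_assoc]

/-- Left multiplication by x on the group algebra has trace |G| times the coefficient of x at 1, and
nilpotent operators have trace zero. -/
theorem coeff_one_eq_zero_of_isNilpotent [CharZero k] {G : Type*} [Group G] [Fintype G]
    {x : MonoidAlgebra k G} (hx : IsNilpotent x) : x.coeff 1 = 0 := by
  classical
  let b : Module.Basis G k (MonoidAlgebra k G) :=
    Module.Basis.ofRepr
      { toFun := fun x => x.coeff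
        invFun := fun f => MonoidAlgebra.ofCoeff f
        map_add' := fun _ _ => rfl
        map_smul' := fun _ _ => rfl
        left_inv := fun _ => rfl
        right_inv := fun _ => rfl }
  have hb : ∀ g, b g = MonoidAlgebra.single g 1 := fun g => rfl
  have h1 : IsNilpotent (LinearMap.mulLeft k x) := by
    obtain ⟨n, hn⟩ := hx
    exact ⟨n, by rw [LinearMap.pow_mulLeft, hn, LinearMap.mulLeft_zero_eq_zero]⟩
  have h2 := (LinearMap.isNilpotent_trace_of_isNilpotent h1).eq_zero
  rw [LinearMap.trace_eq_matrix_trace k b, Matrix.trace] at h2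
  have h3 : ∀ g, Matrix.diag (LinearMap.toMatrix b b (LinearMap.mulLeft k x)) g = x.coeff 1 := by
    intro g
    rw [Matrix.diag_apply, LinearMap.toMatrix_apply, LinearMap.mulLeft_apply, hb]
    change (x * MonoidAlgebra.single g 1).coeff g = _
    rw [MonoidAlgebra.coeff_mul_single_apply, mul_inv_cancel, mul_one]
  simp only [h3, Finset.sum_const, nsmul_eq_mul] at h2
  exact (mul_eq_zero.1 h2).resolve_left (Nat.cast_ne_zero.2 (Finset.card_ne_zero.2 ⟨1, by simp⟩))

/-- A row permutation times a column permutation is the identity only if both are. -/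
theorem coeff_one_youngElt {μ : YoungDiagram} (e : X ≃ μ.cells) :
    (youngElt k e).coeff 1 = 1 := by
  rw [youngElt, rowSum, Finset.sum_mul, colSum]
  simp only [Finset.mul_sum, mul_smul_comm, ← map_mul]
  simp only [MonoidAlgebra.coeff_sum, MonoidAlgebra.of_apply, Finsupp.finsetSum_apply]
  have h1 : ∀ p : Equiv.Perm X, (∀ x, rowOf e (p x) = rowOf e x) →
      ∀ q : Equiv.Perm X, (∀ x, colOf e (q x) = colOf e x) → p * q = 1 → q = 1 := by
    intro p hp q hq hpq
    ext x
    have h2 : p (q x) = x := by rw [← Equiv.Perm.mul_apply, hpq]; rfl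
    rw [rowOf_colOf_inj e (x := q x) (y := x) (by rw [← hp (q x), h2]) (hq x)]; rfl
  rw [Finset.sum_eq_single 1, Finset.sum_eq_single 1]
  · simp
  · intro q hq hq1
    simp only [Finset.mem_filter, Finset.mem_univ, true_and] at hq
    simp [hq1]
  · intro h; exact absurd (by simp) h
  · intro p hp hp1
    refine Finset.sum_eq_zero fun q hq => ?_
    simp only [Finset.mem_filter, Finset.mem_univ, true_and] at hp hq
    have : p * q ≠ 1 := fun h => by
      have := h1 p hp q hq h
      subst this
      exact hp1 (by simpa using h)
    simp [this]
  · intro h; exact absurd (by simp) h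

/-- The factor is non-zero because a nilpotent element has coefficient 0 at the identity, while here
this coefficient is 1. -/
theorem youngElt_sq [CharZero k] {μ : YoungDiagram} (e : X ≃ μ.cells) :
    ∃ a : k, a ≠ 0 ∧ youngElt k e * youngElt k e = a • youngElt k e := by
  obtain ⟨a, ha⟩ := youngElt_mul_mul_youngElt (k := k) e 1
  rw [mul_one] at ha
  refine ⟨a, fun h0 => ?_, ha⟩
  rw [h0, zero_smul] at ha
  have := coeff_one_eq_zero_of_isNilpotent (x := youngElt k e) ⟨2, by rw [pow_two, ha]⟩
  rw [coeff_one_youngElt] at this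
  exact one_ne_zero this

end Young

/-! ### Completeness of the Young symmetrizers. -/

section YoungComplete

theorem card_cellsOfRowLens (w : List ℕ) : (YoungDiagram.cellsOfRowLens w).card = w.sum := by
  induction w with
  | nil => rfl
  | cons a w ih =>
    rw [YoungDiagram.cellsOfRowLens, Finset.card_union_of_disjoint, Finset.card_map, ih]
    · simp
    · rw [Finset.disjoint_left]
      rintro ⟨i, j⟩ h1 h2
      simp only [Finset.mem_product, Finset.mem_singleton] at h1
      rw [Finset.mem_map] at h2
      obtain ⟨⟨i', j'⟩, _, h3⟩ := h2
      have := congrArg Prod.fst h3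
      simp only [Function.Embedding.prodMap] at this
      exact Nat.succ_ne_zero i' (this.trans h1.1)

/-- The Young diagram of a partition. -/
def partitionDiagram {n : ℕ} (p : n.Partition) : YoungDiagram :=
  YoungDiagram.ofRowLens (p.parts.sort (· ≥ ·)) (p.parts.pairwise_sort (· ≥ ·)).sortedGE

theorem card_partitionDiagram {n : ℕ} (p : n.Partition) : (partitionDiagram p).card = n := by
  change (YoungDiagram.cellsOfRowLens _).card = n
  rw [card_cellsOfRowLens, ← Multiset.sum_coe, Multiset.sort_eq, p.parts_sum]

theorem partitionDiagram_injective {n : ℕ} :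
    Function.Injective (partitionDiagram : n.Partition → YoungDiagram) := by
  intro p q h
  have hp : ∀ p : n.Partition, (partitionDiagram p).rowLens = p.parts.sort (· ≥ ·) := fun p =>
    YoungDiagram.rowLens_ofRowLens_eq_self fun x hx => p.parts_pos ((Multiset.mem_sort _).1 hx)
  have h2 := hp p
  rw [h, hp q] at h2
  have h3 := congrArg (fun l : List ℕ => (l : Multiset ℕ)) h2
  simp only [Multiset.sort_eq] at h3
  exact Nat.Partition.ext h3.symm

variable {k : Type*} [Field k] {X : Type*} [Fintype X] [DecidableEq X]

variable (k) in
/-- The sum of the conjugates of a Young symmetrizer. -/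
def centralElt {μ : YoungDiagram} (e : X ≃ μ.cells) : MonoidAlgebra k (Equiv.Perm X) :=
  ∑ g : Equiv.Perm X, MonoidAlgebra.of k _ g * youngElt k e * MonoidAlgebra.of k _ g⁻¹

theorem of_mul_centralElt {μ : YoungDiagram} (e : X ≃ μ.cells) (h : Equiv.Perm X) :
    MonoidAlgebra.of k _ h * centralElt k e = centralElt k e * MonoidAlgebra.of k _ h := by
  rw [centralElt, Finset.mul_sum, Finset.sum_mul]
  refine Finset.sum_bij' (fun g _ => h * g) (fun g _ => h⁻¹ * g) (by simp) (by simp) (by simp)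
    (by simp) fun g _ => ?_
  rw [mul_inv_rev, map_mul, map_mul]
  simp only [mul_assoc]
  rw [← map_mul, inv_mul_cancel, map_one, mul_one]

theorem coeff_conj_centralElt {μ : YoungDiagram} (e : X ≃ μ.cells) (g h : Equiv.Perm X) :
    (centralElt k e).coeff (g * h * g⁻¹) = (centralElt k e).coeff h := by
  have h1 := congrArg (fun x => x.coeff (g * h)) (of_mul_centralElt (k := k) e g)
  simp only [MonoidAlgebra.of_apply] at h1
  rw [MonoidAlgebra.coeff_single_mul_apply, MonoidAlgebra.coeff_mul_single_apply] at h1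
  simpa using h1.symm

theorem coeff_one_centralElt {μ : YoungDiagram} (e : X ≃ μ.cells) :
    (centralElt k e).coeff 1 = (Fintype.card (Equiv.Perm X) : k) := by
  rw [centralElt]
  simp only [MonoidAlgebra.coeff_sum, MonoidAlgebra.of_apply, Finsupp.finsetSum_apply]
  have : ∀ g : Equiv.Perm X, (MonoidAlgebra.single g (1 : k) * youngElt k e *
      MonoidAlgebra.single g⁻¹ 1).coeff 1 = 1 := fun g => by
    rw [MonoidAlgebra.coeff_mul_single_apply, MonoidAlgebra.coeff_single_mul_apply]
    simp [coeff_one_youngElt]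
  simp [this]

/-- A conjugate of a Young symmetrizer is the symmetrizer of a relabelled tableau of the same shape,
so orthogonality for different shapes kills every cross term. -/
theorem centralElt_mul_centralElt_of_ne [CharZero k] {μ ν : YoungDiagram} (hne : μ ≠ ν)
    (e : X ≃ μ.cells) (e' : X ≃ ν.cells) : centralElt k e * centralElt k e' = 0 := by
  have h1 : centralElt k e * youngElt k e' = 0 := by
    rw [centralElt, Finset.sum_mul]
    refine Finset.sum_eq_zero fun g _ => ?_
    rw [mul_assoc, youngElt, youngElt, ← mul_assoc (MonoidAlgebra.of k _ g⁻¹), of_mul_rowSum_conj,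
      mul_assoc (rowSum k (rowOf e' ∘ _)), of_mul_colSum_conj, ← mul_assoc (rowSum k (rowOf e' ∘ _)),
      mul_assoc (MonoidAlgebra.of k _ g), ← mul_assoc (rowSum k (rowOf e) * _)]
    have := youngElt_mul_youngElt_of_ne (k := k) hne e (((g⁻¹)⁻¹ : Equiv.Perm X).trans e')
    change _ * (rowSum k (rowOf e' ∘ _) * colSum k (colOf e' ∘ _)) = 0 at this
    rw [youngElt] at this
    rw [this]; simp
  conv_lhs => rw [centralElt.eq_1 k e', Finset.mul_sum]
  refine Finset.sum_eq_zero fun g _ => ?_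
  rw [← mul_assoc, ← mul_assoc, ← of_mul_centralElt, mul_assoc (MonoidAlgebra.of k _ g), h1]
  simp

theorem centralElt_sq_ne_zero [CharZero k] {μ : YoungDiagram} (e : X ≃ μ.cells) :
    centralElt k e * centralElt k e ≠ 0 := by
  intro h
  have := coeff_one_eq_zero_of_isNilpotent (x := centralElt k e) ⟨2, by rw [pow_two, h]⟩
  rw [coeff_one_centralElt] at this
  exact Fintype.card_ne_zero (Nat.cast_eq_zero.1 this)

variable (k X) in
/-- The space of class functions on the symmetric group. -/
def classFun : Submodule k (MonoidAlgebra k (Equiv.Perm X)) where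
  carrier := {x | ∀ g h, x.coeff (g * h * g⁻¹) = x.coeff h}
  add_mem' hx hy g h := by
    rw [MonoidAlgebra.coeff_add, Finsupp.add_apply, Finsupp.add_apply, hx, hy]
  zero_mem' _ _ := rfl
  smul_mem' c x hx g h := by
    rw [MonoidAlgebra.coeff_smul, Finsupp.smul_apply, Finsupp.smul_apply, hx]

variable (k X) in
/-- The values of a class function at the partitions. -/
def classFunValues : classFun k X →ₗ[k] ((Fintype.card X).Partition → k) := by
  classical
  exact LinearMap.pi fun p => if h : ∃ s : Equiv.Perm X, s.partition = p then
    { toFun := fun x => x.1.coeff h.choose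
      map_add' := fun _ _ => rfl
      map_smul' := fun _ _ => rfl } else 0

/-- Permutations of equal cycle type are conjugate. This bounds the dimension of the class functions
by the number of partitions. -/
theorem classFunValues_injective : Function.Injective (classFunValues k X) := by
  rw [← LinearMap.ker_eq_bot, LinearMap.ker_eq_bot']
  intro x hx
  apply Subtype.ext
  apply MonoidAlgebra.coeff_injective
  ext s
  have h : ∃ s' : Equiv.Perm X, s'.partition = s.partition := ⟨s, rfl⟩
  have h1 := congrFun hx s.partition
  simp only [classFunValues, LinearMap.pi_apply, dif_pos h] at h1
  obtain ⟨g, hg⟩ := isConj_iff.1 (Equiv.Perm.partition_eq_of_isConj.2 h.choose_spec)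
  rw [← hg, x.2]
  exact h1

/-- The elements `centralElt`, one for each partition, are mutually orthogonal with non-zero
squares, hence linearly independent. There are as many of them as the dimension of the class
functions allows, so they span these, and 1 is a class function. -/
theorem one_mem_span_youngElt [CharZero k] :
    (1 : MonoidAlgebra k (Equiv.Perm X)) ∈ Submodule.span k
      {w | ∃ (μ : YoungDiagram) (e : X ≃ μ.cells) (x y : MonoidAlgebra k (Equiv.Perm X)),
        w = x * youngElt k e * y} := by
  have he : ∀ p : (Fintype.card X).Partition, Nonempty (X ≃ (partitionDiagram p).cells) := fun p =>
    ⟨Fintype.equivOfCardEq (by rw [Fintype.card_coe]; exact (card_partitionDiagram p).symm)⟩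
  let e := fun p => (he p).some
  let v : (Fintype.card X).Partition → classFun k X := fun p =>
    ⟨centralElt k (e p), coeff_conj_centralElt (e p)⟩
  have : FiniteDimensional k (classFun k X) :=
    Module.Finite.of_injective _ (classFunValues_injective (k := k) (X := X))
  have hli : LinearIndependent k v := by
    rw [linearIndependent_iff']
    intro s a ha p hp
    have h1 : ∑ q ∈ s, a q • centralElt k (e q) = 0 := by
      simpa [v] using congrArg Subtype.val ha
    have h2 := congrArg (· * centralElt k (e p)) h1
    simp only [Finset.sum_mul, zero_mul, smul_mul_assoc] at h2
    rw [Finset.sum_eq_single p] at h2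
    · exact (smul_eq_zero.1 h2).resolve_right (centralElt_sq_ne_zero _)
    · intro q _ hq
      rw [centralElt_mul_centralElt_of_ne (fun h => hq (partitionDiagram_injective h)), smul_zero]
    · exact fun h => absurd hp h
  have hcard : Fintype.card (Fintype.card X).Partition = Module.finrank k (classFun k X) := by
    apply le_antisymm hli.fintype_card_le_finrank
    have := LinearMap.finrank_le_finrank_of_injective
      (classFunValues_injective (k := k) (X := X))
    rwa [Module.finrank_fintype_fun_eq_card] at this
  have hspan := hli.span_eq_top_of_card_eq_finrank' hcard
  have h1 : (1 : MonoidAlgebra k (Equiv.Perm X)) ∈ classFun k X := by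
    intro g h
    rw [MonoidAlgebra.one_def, MonoidAlgebra.coeff_single, Finsupp.single_apply,
      Finsupp.single_apply]
    congr 1
    exact propext ⟨fun h1 => by simpa using conj_eq_one_iff.1 h1.symm |>.symm, fun h1 => by simp [← h1]⟩
  have h2 : (⟨1, h1⟩ : classFun k X) ∈ Submodule.span k (Set.range v) := hspan ▸ Submodule.mem_top
  have h3 := Submodule.mem_map_of_mem (f := (classFun k X).subtype) h2
  rw [Submodule.map_span] at h3
  refine (Submodule.span_le.2 ?_) h3
  rintro _ ⟨_, ⟨p, rfl⟩, rfl⟩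
  change centralElt k (e p) ∈ _
  exact Submodule.sum_mem _ fun g _ => Submodule.subset_span ⟨_, e p, _, _, rfl⟩

end YoungComplete

/-! ### Elements of `GL` -/

section Elements

variable {k : Type u} [Field k]

variable (k) in
/-- The standard basis vector `eᵢ`. -/
abbrev bv (i : ℕ) : Std k := Finsupp.single i 1

/-- The linear endomorphism of `𝐕` with given values on the basis. -/
def lc (v : ℕ → Std k) : Std k →ₗ[k] Std k := Finsupp.linearCombination k v

@[simp] theorem lc_bv (v : ℕ → Std k) (i : ℕ) : lc v (bv k i) = v i := by
  simp [lc, bv]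

theorem std_ext {W : Type*} [AddCommMonoid W] [Module k W] {f g : Std k →ₗ[k] W}
    (h : ∀ i, f (bv k i) = g (bv k i)) : f = g := by
  refine Finsupp.lhom_ext' fun i => LinearMap.ext_ring ?_
  exact h i

theorem mem_stdSub {n : ℕ} {v : Std k} : v ∈ stdSub k n ↔ ∀ i, n ≤ i → v i = 0 := by
  constructor
  · intro hv
    induction hv using Submodule.span_induction with
    | mem v hv =>
      obtain ⟨j, hj, rfl⟩ := hv
      intro i hi
      rw [Finsupp.single_apply, if_neg (by omega)]
    | zero => intro i _; rfl
    | add v w _ _ hv hw => intro i hi; rw [Finsupp.add_apply, hv i hi, hw i hi, add_zero]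
    | smul a v _ hv => intro i hi; rw [Finsupp.smul_apply, hv i hi, smul_zero]
  · intro h
    rw [← Finsupp.sum_single v, Finsupp.sum]
    refine Submodule.sum_mem _ fun i hi => ?_
    have : i < n := by
      by_contra hcon
      exact (Finsupp.mem_support_iff.1 hi) (h i (by omega))
    rw [← mul_one (v i), ← smul_eq_mul, ← Finsupp.smul_single]
    exact Submodule.smul_mem _ _ (Submodule.subset_span ⟨i, this, rfl⟩)

theorem bv_mem_stdSub {n i : ℕ} (h : i < n) : bv k i ∈ stdSub k n :=
  Submodule.subset_span ⟨i, h, rfl⟩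

theorem exists_mem_stdSub (v : Std k) : ∃ n, ∀ m, n ≤ m → v ∈ stdSub k m := by
  refine ⟨v.support.sup id + 1, fun m hm => mem_stdSub.2 fun i hi => ?_⟩
  by_contra h
  have := Finset.le_sup (f := id) (Finsupp.mem_support_iff.2 h)
  simp only [id] at this
  omega

theorem map_stdSub_le {n : ℕ} {f : Std k →ₗ[k] Std k} (hf : ∀ i < n, f (bv k i) ∈ stdSub k n) :
    (stdSub k n).map f ≤ stdSub k n := by
  rw [stdSub, Submodule.map_span_le]
  rintro _ ⟨i, hi, rfl⟩
  exact hf i hi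

/-- An element of `GL` from a pair of inverse maps. -/
def mkGL (f g : Std k →ₗ[k] Std k) (hfg : ∀ i, f (g (bv k i)) = bv k i)
    (hgf : ∀ i, g (f (bv k i)) = bv k i)
    (hn : ∃ n, (∀ i < n, f (bv k i) ∈ stdSub k n) ∧ (∀ i < n, g (bv k i) ∈ stdSub k n) ∧
      ∀ i, n ≤ i → f (bv k i) = bv k i) : GLinf k :=
  ⟨LinearEquiv.ofLinearMap f g (std_ext hfg) (std_ext hgf), by
    obtain ⟨n, h1, h2, h3⟩ := hn
    refine ⟨n, le_antisymm (map_stdSub_le h1) ?_, h3⟩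
    intro v hv
    refine ⟨g v, map_stdSub_le h2 ⟨v, hv, rfl⟩, ?_⟩
    exact LinearMap.congr_fun (std_ext (g := LinearMap.id) hfg : f ∘ₗ g = LinearMap.id) v⟩

@[simp] theorem mkGL_apply (f g : Std k →ₗ[k] Std k) (hfg hgf hn) (v : Std k) :
    (mkGL f g hfg hgf hn).1 v = f v := rfl

/-- Permutation matrices. -/
def permGL (s : Equiv.Perm ℕ) (hs : ∃ n, ∀ i, n ≤ i → s i = i) : GLinf k :=
  mkGL (lc fun i => bv k (s i)) (lc fun i => bv k (s.symm i)) (by simp) (by simp) (by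
    obtain ⟨n, hn⟩ := hs
    have h1 : ∀ i < n, s i < n := fun i hi => by
      by_contra h
      have := hn (s i) (by omega)
      exact absurd (s.injective this) (by omega)
    have h2 : ∀ i < n, s.symm i < n := fun i hi => by
      by_contra h
      have := hn (s.symm i) (by omega)
      rw [Equiv.apply_symm_apply] at this
      omega
    exact ⟨n, fun i hi => by rw [lc_bv]; exact bv_mem_stdSub (h1 i hi),
      fun i hi => by rw [lc_bv]; exact bv_mem_stdSub (h2 i hi),
      fun i hi => by rw [lc_bv, hn i hi]⟩)

@[simp] theorem permGL_bv (s : Equiv.Perm ℕ) (hs) (i : ℕ) :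
    (permGL (k := k) s hs).1 (bv k i) = bv k (s i) := by
  rw [permGL, mkGL_apply, lc_bv]

theorem exists_gl_shift (n p : ℕ) : ∃ g : GLinf k, ∀ i < p, g.1 (bv k i) = bv k (n + i) := by
  let s : Equiv.Perm ℕ :=
    { toFun := fun i => if i < p then n + i else if i < n + p then i - p else i
      invFun := fun i => if i < n then i + p else if i < n + p then i - n else i
      left_inv := fun i => by dsimp only; split_ifs <;> omega
      right_inv := fun i => by dsimp only; split_ifs <;> omega }
  refine ⟨permGL s ⟨n + p, fun i hi => ?_⟩, fun i hi => ?_⟩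
  · change (if i < p then n + i else if i < n + p then i - p else i) = i
    split_ifs <;> omega
  · rw [permGL_bv]
    congr 1
    change (if i < p then n + i else if i < n + p then i - p else i) = n + i
    rw [if_pos hi]

/-- Used to move vectors from the first block of length q to the third without touching coefficients
that live in the second. -/
theorem exists_gl_swap (q : ℕ) : ∃ g : GLinf k, (∀ i < q, g.1 (bv k i) = bv k (2 * q + i)) ∧
    ∀ i, q ≤ i → i < 2 * q → g.1 (bv k i) = bv k i := by
  let s : Equiv.Perm ℕ :=
    { toFun := fun i => if i < q then 2 * q + i else if i < 2 * q then i else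
        if i < 3 * q then i - 2 * q else i
      invFun := fun i => if i < q then 2 * q + i else if i < 2 * q then i else
        if i < 3 * q then i - 2 * q else i
      left_inv := fun i => by dsimp only; split_ifs <;> omega
      right_inv := fun i => by dsimp only; split_ifs <;> omega }
  refine ⟨permGL s ⟨3 * q, fun i hi => ?_⟩, fun i hi => ?_, fun i h1 h2 => ?_⟩
  · change (if i < q then 2 * q + i else if i < 2 * q then i else
        if i < 3 * q then i - 2 * q else i) = i
    split_ifs <;> omega
  · rw [permGL_bv]
    congr 1
    change (if i < q then 2 * q + i else if i < 2 * q then i else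
        if i < 3 * q then i - 2 * q else i) = 2 * q + i
    rw [if_pos hi]
  · rw [permGL_bv]
    congr 1
    change (if i < q then 2 * q + i else if i < 2 * q then i else
        if i < 3 * q then i - 2 * q else i) = i
    split_ifs <;> omega

/-- Diagonal matrices with two different entries. -/
theorem exists_gl_diag (S : Finset ℕ) {a : k} (ha : a ≠ 0) :
    ∃ g : GLinf k, ∀ i, g.1 (bv k i) = if i ∈ S then a • bv k i else bv k i := by
  let f : k → Std k →ₗ[k] Std k := fun a => lc fun i => if i ∈ S then a • bv k i else bv k i
  have hf : ∀ a i, f a (bv k i) = if i ∈ S then a • bv k i else bv k i := fun a i => by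
    simp only [f, lc_bv]
  refine ⟨mkGL (f a) (f a⁻¹) (fun i => ?_) (fun i => ?_) ⟨S.sup id + 1, fun i hi => ?_,
    fun i hi => ?_, fun i hi => ?_⟩, fun i => by rw [mkGL_apply, hf]⟩
  · rw [hf]
    by_cases h : i ∈ S
    · rw [if_pos h, map_smul, hf, if_pos h, smul_smul, inv_mul_cancel₀ ha, one_smul]
    · rw [if_neg h, hf, if_neg h]
  · rw [hf]
    by_cases h : i ∈ S
    · rw [if_pos h, map_smul, hf, if_pos h, smul_smul, mul_inv_cancel₀ ha, one_smul]
    · rw [if_neg h, hf, if_neg h]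
  · rw [hf]; split_ifs
    · exact Submodule.smul_mem _ _ (bv_mem_stdSub hi)
    · exact bv_mem_stdSub hi
  · rw [hf]; split_ifs
    · exact Submodule.smul_mem _ _ (bv_mem_stdSub hi)
    · exact bv_mem_stdSub hi
  · rw [hf, if_neg]
    intro h
    have := Finset.le_sup (f := id) h
    simp only [id] at this
    omega

/-- Elementary unipotent matrices: `c j ↦ c j + w j`. -/
theorem exists_gl_unip {κ : Type*} [Finite κ] (c : κ → ℕ) (hc : Function.Injective c)
    (w : κ → Std k) (hw : ∀ j l, w j (c l) = 0) :
    ∃ g : GLinf k, (∀ j, g.1 (bv k (c j)) = bv k (c j) + w j) ∧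
      ∀ i, (∀ j, c j ≠ i) → g.1 (bv k i) = bv k i := by
  classical
  cases nonempty_fintype κ
  let η : Std k →ₗ[k] Std k := lc fun i => if h : ∃ j, c j = i then w h.choose else 0
  have hη1 : ∀ j, η (bv k (c j)) = w j := fun j => by
    have h : ∃ j', c j' = c j := ⟨j, rfl⟩
    simp only [η, lc_bv, dif_pos h]
    rw [hc h.choose_spec]
  have hη2 : ∀ i, (∀ j, c j ≠ i) → η (bv k i) = 0 := fun i hi => by
    simp only [η, lc_bv]
    rw [dif_neg (by push Not; exact hi)]
  have hη3 : ∀ v : Std k, (∀ l, v (c l) = 0) → η v = 0 := fun v hv => by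
    rw [← Finsupp.sum_single v, Finsupp.sum, map_sum]
    refine Finset.sum_eq_zero fun i hi => ?_
    rw [← mul_one (v i), ← smul_eq_mul, ← Finsupp.smul_single, map_smul, hη2, smul_zero]
    rintro j rfl
    exact (Finsupp.mem_support_iff.1 hi) (hv j)
  have hηη : ∀ i, η (η (bv k i)) = 0 := fun i => by
    by_cases h : ∃ j, c j = i
    · obtain ⟨j, rfl⟩ := h
      rw [hη1, hη3 _ (hw j)]
    · push Not at h
      rw [hη2 i h, map_zero]
  choose N hN using fun j => exists_mem_stdSub (w j)
  have hmem : ∀ i, η (bv k i) ∈ stdSub k (Finset.univ.sup (fun j => c j + 1 + N j)) := fun i => by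
    by_cases h : ∃ j, c j = i
    · obtain ⟨j, rfl⟩ := h
      rw [hη1]
      refine hN j _ ?_
      have := Finset.le_sup (f := fun j => c j + 1 + N j) (Finset.mem_univ j)
      omega
    · push Not at h
      rw [hη2 i h]; exact Submodule.zero_mem _
  refine ⟨mkGL (LinearMap.id + η) (LinearMap.id - η) (fun i => ?_) (fun i => ?_)
    ⟨Finset.univ.sup (fun j => c j + 1 + N j), fun i hi => ?_,
    fun i hi => ?_, fun i hi => ?_⟩, fun j => ?_, fun i hi => ?_⟩
  · simp [hηη]
  · simp [hηη]
  · exact Submodule.add_mem _ (bv_mem_stdSub hi) (hmem i)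
  · exact Submodule.sub_mem _ (bv_mem_stdSub hi) (hmem i)
  · rw [LinearMap.add_apply, LinearMap.id_apply, hη2, add_zero]
    rintro j rfl
    have := Finset.le_sup (f := fun j => c j + 1 + N j) (Finset.mem_univ j)
    omega
  · rw [mkGL_apply, LinearMap.add_apply, LinearMap.id_apply, hη1]
  · rw [mkGL_apply, LinearMap.add_apply, LinearMap.id_apply, hη2 i hi, add_zero]

variable (k) in
/-- The projection of `𝐕` onto `k^q`. -/
def trunc (q : ℕ) : Std k →ₗ[k] Std k := lc fun i => if i < q then bv k i else 0

variable (k) in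
/-- The interchange of the first two blocks of length `q`. -/
def blockSwap (q : ℕ) : Std k →ₗ[k] Std k :=
  lc fun i => if i < q then bv k (q + i) else if i < 2 * q then bv k (i - q) else bv k i

variable (k) in
/-- Minus the projection of `𝐕` onto the second block of length `q`. -/
def negBlock (q : ℕ) : Std k →ₗ[k] Std k :=
  lc fun i => if i < q then 0 else if i < 2 * q then -bv k i else 0

theorem blockSwap_block {q : ℕ} (i : ℕ) :
    (i < q ∧ blockSwap k q (bv k i) = bv k (q + i) ∧ trunc k q (bv k i) = bv k i ∧
      negBlock k q (bv k i) = 0) ∨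
    (∃ j < q, i = q + j ∧ blockSwap k q (bv k i) = bv k j ∧ trunc k q (bv k i) = 0 ∧
      negBlock k q (bv k i) = -bv k i) ∨
    (2 * q ≤ i ∧ blockSwap k q (bv k i) = bv k i ∧ trunc k q (bv k i) = 0 ∧
      negBlock k q (bv k i) = 0) := by
  simp only [blockSwap, trunc, negBlock, lc_bv]
  rcases lt_or_ge i q with h | h
  · left; simp only [h, if_true, true_and]
  · right
    rw [if_neg h.not_gt, if_neg h.not_gt, if_neg h.not_gt]
    rcases lt_or_ge i (2 * q) with h2 | h2
    · left
      simp only [h2, if_true]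
      exact ⟨i - q, by omega, by omega, rfl, trivial, trivial⟩
    · right
      simp only [h2.not_gt, if_false, h2, true_and]

theorem blockSwap_eq {q i : ℕ} (h : i < q) : blockSwap k q (bv k i) = bv k (q + i) ∧
    trunc k q (bv k i) = bv k i ∧ negBlock k q (bv k i) = 0 ∧
    blockSwap k q (bv k (q + i)) = bv k i ∧ trunc k q (bv k (q + i)) = 0 ∧
      negBlock k q (bv k (q + i)) = -bv k (q + i) := by
  simp only [blockSwap, trunc, negBlock, lc_bv]
  simp [h, show q + i < 2 * q by omega]

/-- The path `eᵢ ↦ t eᵢ + e_{q+i}`, `e_{q+i} ↦ eᵢ`, for `i < q`. -/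
def pathGL (q : ℕ) (t : k) : GLinf k :=
  -- Both the map and its inverse are affine in t, so the path stays in `GLinf` at t = 0, where it
  -- interchanges the two blocks.
  mkGL (blockSwap k q + t • trunc k q) (blockSwap k q + t • negBlock k q)
    (fun i => by
      simp only [LinearMap.add_apply, LinearMap.smul_apply]
      rcases blockSwap_block (k := k) (q := q) i with ⟨h, h1, h2, h3⟩ | ⟨j, hj, rfl, h1, h2, h3⟩ |
        ⟨h, h1, h2, h3⟩
      · obtain ⟨e1, e2, e3, e4, e5, e6⟩ := blockSwap_eq (k := k) h
        rw [e1, e3, smul_zero, add_zero, e4, e5, smul_zero, add_zero]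
      · obtain ⟨e1, e2, e3, e4, e5, e6⟩ := blockSwap_eq (k := k) hj
        rw [e4, e6]
        simp only [map_add, map_smul, map_neg, e1, e2, e4, e5, smul_neg, neg_zero, smul_zero,
          add_zero]
        abel
      · rw [h1, h3, smul_zero, add_zero, h1, h2, smul_zero, add_zero])
    (fun i => by
      simp only [LinearMap.add_apply, LinearMap.smul_apply]
      rcases blockSwap_block (k := k) (q := q) i with ⟨h, h1, h2, h3⟩ | ⟨j, hj, rfl, h1, h2, h3⟩ |
        ⟨h, h1, h2, h3⟩
      · obtain ⟨e1, e2, e3, e4, e5, e6⟩ := blockSwap_eq (k := k) h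
        rw [e1, e2]
        simp only [map_add, map_smul, e1, e3, e4, e6, smul_neg, smul_zero, add_zero]
        abel
      · obtain ⟨e1, e2, e3, e4, e5, e6⟩ := blockSwap_eq (k := k) hj
        rw [e4, e5, smul_zero, add_zero, e1, e3, smul_zero, add_zero]
      · rw [h1, h2, smul_zero, add_zero, h1, h3, smul_zero, add_zero])
    ⟨2 * q, fun i hi => by
      rw [LinearMap.add_apply, LinearMap.smul_apply]
      rcases blockSwap_block (k := k) (q := q) i with ⟨h, h1, h2, h3⟩ | ⟨j, hj, rfl, h1, h2, h3⟩ |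
        ⟨h, h1, h2, h3⟩
      · rw [h1, h2]
        exact Submodule.add_mem _ (bv_mem_stdSub (by omega))
          (Submodule.smul_mem _ _ (bv_mem_stdSub hi))
      · rw [h1, h2, smul_zero, add_zero]
        exact bv_mem_stdSub (by omega)
      · omega,
    fun i hi => by
      rw [LinearMap.add_apply, LinearMap.smul_apply]
      rcases blockSwap_block (k := k) (q := q) i with ⟨h, h1, h2, h3⟩ | ⟨j, hj, rfl, h1, h2, h3⟩ |
        ⟨h, h1, h2, h3⟩
      · rw [h1, h3, smul_zero, add_zero]
        exact bv_mem_stdSub (by omega)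
      · rw [h1, h3]
        exact Submodule.add_mem _ (bv_mem_stdSub (by omega))
          (Submodule.smul_mem _ _ (Submodule.neg_mem _ (bv_mem_stdSub hi)))
      · omega,
    fun i hi => by
      rw [LinearMap.add_apply, LinearMap.smul_apply]
      rcases blockSwap_block (k := k) (q := q) i with ⟨h, h1, h2, h3⟩ | ⟨j, hj, rfl, h1, h2, h3⟩ |
        ⟨h, h1, h2, h3⟩
      · omega
      · omega
      · rw [h1, h2, smul_zero, add_zero]⟩

theorem pathGL_apply (q : ℕ) (t : k) (v : Std k) :
    (pathGL q t).1 v = blockSwap k q v + t • trunc k q v := rfl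

theorem pathGL_inv_apply (q : ℕ) (t : k) (v : Std k) :
    ((pathGL q t)⁻¹).1 v = blockSwap k q v + t • negBlock k q v := rfl

theorem pathGL_bv {q i : ℕ} (h : i < q) (t : k) :
    (pathGL q t).1 (bv k i) = bv k (q + i) + t • bv k i := by
  rw [pathGL_apply, (blockSwap_eq h).1, (blockSwap_eq h).2.1]

/-! ### Shifts -/

variable (k) in
/-- The shift `eᵢ ↦ e_{n+i}`. -/
def tau (n : ℕ) : Std k →ₗ[k] Std k := lc fun i => bv k (n + i)

variable (k) in
/-- The left inverse of the shift that kills `k^n`. -/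
def untau (n : ℕ) : Std k →ₗ[k] Std k := lc fun i => if i < n then 0 else bv k (i - n)

theorem tau_bv (n i : ℕ) : tau k n (bv k i) = bv k (n + i) := by rw [tau, lc_bv]

theorem untau_tau (n : ℕ) (v : Std k) : untau k n (tau k n v) = v := by
  refine LinearMap.congr_fun (f := untau k n ∘ₗ tau k n) (g := LinearMap.id) (std_ext fun i => ?_) v
  simp [untau, tau]

theorem trunc_tau (n : ℕ) (v : Std k) : trunc k n (tau k n v) = 0 := by
  refine LinearMap.congr_fun (f := trunc k n ∘ₗ tau k n) (g := 0) (std_ext fun i => ?_) v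
  simp [trunc, tau]

theorem untau_trunc (n : ℕ) (v : Std k) : untau k n (trunc k n v) = 0 := by
  refine LinearMap.congr_fun (f := untau k n ∘ₗ trunc k n) (g := 0) (std_ext fun i => ?_) v
  by_cases h : i < n <;> simp [untau, trunc, h]

theorem trunc_trunc (n : ℕ) (v : Std k) : trunc k n (trunc k n v) = trunc k n v := by
  refine LinearMap.congr_fun (f := trunc k n ∘ₗ trunc k n) (g := trunc k n)
    (std_ext fun i => ?_) v
  by_cases h : i < n <;> simp [trunc, h]

theorem trunc_add_tau_untau (n : ℕ) (v : Std k) : trunc k n v + tau k n (untau k n v) = v := by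
  refine LinearMap.congr_fun (f := trunc k n + tau k n ∘ₗ untau k n) (g := LinearMap.id)
    (std_ext fun i => ?_) v
  by_cases h : i < n <;> simp [untau, trunc, tau, h, show n ≤ i ↔ ¬ i < n by omega]

theorem trunc_mem_stdSub (n : ℕ) (v : Std k) : trunc k n v ∈ stdSub k n := by
  rw [mem_stdSub]
  intro i hi
  refine LinearMap.congr_fun (f := Finsupp.lapply i ∘ₗ trunc k n) (g := 0) (std_ext fun j => ?_) v
  by_cases h : j < n
  · simp [trunc, h, show j ≠ i by omega]
  · simp [trunc, h]

theorem tau_mem_stdSub {n m : ℕ} {v : Std k} (hv : v ∈ stdSub k m) :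
    tau k n v ∈ stdSub k (n + m) := by
  induction hv using Submodule.span_induction with
  | mem v hv =>
    obtain ⟨i, hi, rfl⟩ := hv
    rw [tau_bv]; exact bv_mem_stdSub (by omega)
  | zero => rw [map_zero]; exact Submodule.zero_mem _
  | add v w _ _ hv hw => rw [map_add]; exact Submodule.add_mem _ hv hw
  | smul a v _ hv => rw [map_smul]; exact Submodule.smul_mem _ _ hv

theorem gl_exists_level (g : GLinf k) : ∃ n, ∀ m, n ≤ m →
    (∀ i < m, g.1 (bv k i) ∈ stdSub k m) ∧ ∀ i, m ≤ i → g.1 (bv k i) = bv k i := by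
  obtain ⟨n, hn⟩ := g.2
  refine ⟨n, fun m hm => ?_⟩
  have := hn.mono hm
  refine ⟨fun i hi => ?_, this.2⟩
  rw [← this.1]
  exact ⟨_, bv_mem_stdSub hi, rfl⟩

/-- The endomorphism of `GL` that shifts a matrix by `n`. -/
def shiftHom (n : ℕ) : GLinf k →* GLinf k where
  toFun g := mkGL (trunc k n + tau k n ∘ₗ (g.1 : Std k →ₗ[k] Std k) ∘ₗ untau k n)
    (trunc k n + tau k n ∘ₗ ((g⁻¹).1 : Std k →ₗ[k] Std k) ∘ₗ untau k n)
    (fun i => by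
      simp [untau_tau, trunc_tau, untau_trunc, trunc_trunc, -Subgroup.coe_inv, trunc_add_tau_untau])
    (fun i => by
      simp [untau_tau, trunc_tau, untau_trunc, trunc_trunc, -Subgroup.coe_inv, trunc_add_tau_untau])
    (by
      obtain ⟨m1, h1⟩ := gl_exists_level g
      obtain ⟨m2, h2⟩ := gl_exists_level g⁻¹
      have aux : ∀ g : GLinf k, ∀ m, (∀ i < m, g.1 (bv k i) ∈ stdSub k m) → ∀ i < n + m,
          (trunc k n + tau k n ∘ₗ (g.1 : Std k →ₗ[k] Std k) ∘ₗ untau k n) (bv k i) ∈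
            stdSub k (n + m) := by
        intro g m hg i hi
        have h0 : trunc k n (bv k i) ∈ stdSub k (n + m) :=
          mem_stdSub.2 fun j hj => mem_stdSub.1 (trunc_mem_stdSub n _) j (by omega)
        refine Submodule.add_mem _ h0 (tau_mem_stdSub ?_)
        simp only [LinearMap.comp_apply, untau, lc_bv]
        split_ifs with h
        · rw [map_zero]; exact Submodule.zero_mem _
        · exact hg _ (by omega)
      refine ⟨n + max m1 m2, aux g _ (h1 _ (le_max_left _ _)).1, aux g⁻¹ _
        (h2 _ (le_max_right _ _)).1, fun i hi => ?_⟩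
      have hi' : ¬ i < n := by omega
      have h3 := (h1 (max m1 m2) (le_max_left _ _)).2 (i - n) (by omega)
      simp only [LinearMap.add_apply, LinearMap.comp_apply, untau, trunc, lc_bv, if_neg hi', zero_add,
        LinearEquiv.coe_coe, h3, tau]
      congr 1; omega)
  map_one' := by
    apply Subtype.ext
    apply LinearEquiv.toLinearMap_injective
    refine LinearMap.ext fun v => ?_
    change trunc k n v + tau k n (untau k n v) = v
    exact trunc_add_tau_untau n v
  map_mul' g h := by
    apply Subtype.ext
    apply LinearEquiv.toLinearMap_injective
    refine LinearMap.ext fun v => ?_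
    change trunc k n v + tau k n (g.1 (h.1 (untau k n v))) =
      trunc k n (trunc k n v + tau k n (h.1 (untau k n v))) +
        tau k n (g.1 (untau k n (trunc k n v + tau k n (h.1 (untau k n v)))))
    simp only [map_add, untau_tau, trunc_tau, untau_trunc, trunc_trunc, add_zero, zero_add]

theorem shiftHom_apply (n : ℕ) (g : GLinf k) (v : Std k) :
    (shiftHom n g).1 v = trunc k n v + tau k n (g.1 (untau k n v)) := rfl

theorem shiftHom_tau (n : ℕ) (g : GLinf k) (v : Std k) :
    (shiftHom n g).1 (tau k n v) = tau k n (g.1 v) := by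
  rw [shiftHom_apply, trunc_tau, untau_tau, zero_add]

theorem untau_shiftHom (n : ℕ) (g : GLinf k) (v : Std k) :
    untau k n ((shiftHom n g).1 v) = g.1 (untau k n v) := by
  rw [shiftHom_apply, map_add, untau_trunc, untau_tau, zero_add]

theorem shiftHom_bv {n i : ℕ} (h : i < n) (g : GLinf k) :
    (shiftHom n g).1 (bv k i) = bv k i := by
  simp [shiftHom_apply, trunc, untau, h]

theorem gl_ext {g h : GLinf k} (H : ∀ i, g.1 (bv k i) = h.1 (bv k i)) : g = h := by
  apply Subtype.ext
  apply LinearEquiv.toLinearMap_injective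
  exact std_ext H

theorem shiftHom_shiftHom (n m : ℕ) (g : GLinf k) :
    shiftHom n (shiftHom m g) = shiftHom (n + m) g := by
  refine gl_ext fun i => ?_
  rcases lt_or_ge i n with h | h
  · rw [shiftHom_bv h, shiftHom_bv (by omega)]
  · obtain ⟨j, rfl⟩ := Nat.exists_eq_add_of_le h
    rw [← tau_bv, shiftHom_tau]
    rcases lt_or_ge j m with h2 | h2
    · rw [shiftHom_bv h2, tau_bv, shiftHom_bv (by omega)]
    · obtain ⟨l, rfl⟩ := Nat.exists_eq_add_of_le h2
      rw [← tau_bv m, shiftHom_tau]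
      have h3 : ∀ v : Std k, tau k n (tau k m v) = tau k (n + m) v := fun v => by
        refine LinearMap.congr_fun (f := tau k n ∘ₗ tau k m) (g := tau k (n + m))
          (std_ext fun i => ?_) v
        simp [tau, add_assoc]
      rw [h3, h3, shiftHom_tau]

theorem tau_tau (n m : ℕ) (v : Std k) : tau k n (tau k m v) = tau k (n + m) v := by
  refine LinearMap.congr_fun (f := tau k n ∘ₗ tau k m) (g := tau k (n + m)) (std_ext fun i => ?_) v
  simp [tau, add_assoc]

end Elements

/-! ### Tensor powers -/

section Tensors

variable {k : Type u} [Field k]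

variable (k) in
/-- The tensor power of `𝐕` whose factors are indexed by `κ`. -/
abbrev Ten (κ : Type) : Type u := ⨂[k] _ : κ, Std k

instance instAddCommGroupTen (k : Type u) [Field k] (κ : Type) : AddCommGroup (Ten k κ) :=
  Module.addCommMonoidToAddCommGroup k

variable (κ : Type) in
/-- The tensor power of an endomorphism of `𝐕`. -/
def tmap (f : Std k →ₗ[k] Std k) : Ten k κ →ₗ[k] Ten k κ := PiTensorProduct.map fun _ => f

variable {κ : Type}

@[simp] theorem tmap_tprod (f : Std k →ₗ[k] Std k) (v : κ → Std k) :
    tmap κ f (PiTensorProduct.tprod k v) = PiTensorProduct.tprod k fun s => f (v s) :=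
  PiTensorProduct.map_tprod _ _

@[simp] theorem tensorRep_tprod (g : GLinf k) (v : κ → Std k) :
    tensorRep k κ g (PiTensorProduct.tprod k v) = PiTensorProduct.tprod k fun s => g.1 (v s) :=
  PiTensorProduct.map_tprod _ _

theorem tensorRep_eq_tmap (g : GLinf k) (x : Ten k κ) :
    tensorRep k κ g x = tmap κ (g.1 : Std k →ₗ[k] Std k) x := rfl

theorem tmap_tmap (f g : Std k →ₗ[k] Std k) (x : Ten k κ) :
    tmap κ f (tmap κ g x) = tmap κ (f ∘ₗ g) x := by
  rw [tmap, tmap, tmap, PiTensorProduct.map_comp]; rfl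

theorem tmap_id (x : Ten k κ) : tmap κ LinearMap.id x = x := by
  rw [tmap, PiTensorProduct.map_id]; rfl

variable (k) in
/-- The basis tensors. -/
def bten (I : κ → ℕ) : Ten k κ := PiTensorProduct.tprod k fun s => bv k (I s)

variable (k κ) in
/-- The standard basis of a tensor power of `𝐕`. -/
def tenBasis [Finite κ] : Module.Basis (κ → ℕ) k (Ten k κ) :=
  Basis.piTensorProduct fun _ => Finsupp.basisSingleOne

theorem tenBasis_apply [Finite κ] (I : κ → ℕ) : tenBasis k κ I = bten k I := by
  rw [tenBasis, Basis.piTensorProduct_apply]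
  simp [bten]

theorem tenBasis_repr_tprod [Fintype κ] (v : κ → Std k) (I : κ → ℕ) :
    (tenBasis k κ).repr (PiTensorProduct.tprod k v) I = ∏ s, v s (I s) := by
  rw [tenBasis, Basis.piTensorProduct_repr_tprod_apply]
  rfl

open Classical in
theorem tenBasis_repr_bten [Finite κ] (I J : κ → ℕ) :
    (tenBasis k κ).repr (bten k I) J = if I = J then 1 else 0 := by
  rw [← tenBasis_apply, Module.Basis.repr_self, Finsupp.single_apply]

/-- Along `pathGL` the factors have this shape, and the top power of t comes only from the full set
S, that is, from the original tensor. -/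
theorem tprod_add_smul [Fintype κ] [DecidableEq κ] (a b : κ → Std k) (t : k) :
    PiTensorProduct.tprod k (fun s => a s + t • b s) =
      ∑ S : Finset κ, t ^ S.card • PiTensorProduct.tprod k (S.piecewise b a) := by
  have h := MultilinearMap.map_add_univ (PiTensorProduct.tprod k) (fun s => t • b s) a
  rw [show (fun s => a s + t • b s) = (fun s => t • b s) + a from
    funext fun s => add_comm _ _, h]
  refine Finset.sum_congr rfl fun S _ => ?_
  have h2 := MultilinearMap.map_piecewise_smul (PiTensorProduct.tprod k) (fun _ : κ => t)
    (S.piecewise b a) S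
  rw [Finset.prod_const] at h2
  rw [← h2]
  congr 1
  ext s : 1
  by_cases hs : s ∈ S <;> simp [hs]

/-! A stable subspace that contains a basis tensor with distinct entries is everything. -/

theorem bten_mem_of_disjoint [Finite κ] {S : Submodule k (Ten k κ)}
    (hS : ∀ g x, x ∈ S → tensorRep k κ g x ∈ S) {c I : κ → ℕ} (hc : Function.Injective c)
    (hcI : ∀ s t, I s ≠ c t) (hmem : bten k c ∈ S) : bten k I ∈ S := by
  classical
  cases nonempty_fintype κ
  -- A is the set of positions already replaced, and ε says which of the other factors carry a
  -- perturbation. The difference between ε a = true and ε a = false replaces the factor at a.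
  have key : ∀ A : Finset κ, ∀ ε : κ → Bool, PiTensorProduct.tprod k (fun s =>
      if s ∈ A then bv k (I s) else bv k (c s) + if ε s then bv k (I s) else 0) ∈ S := by
    intro A
    induction A using Finset.induction_on with
    | empty =>
      intro ε
      obtain ⟨g, hg, -⟩ := exists_gl_unip (k := k) c hc (fun s => if ε s then bv k (I s) else 0)
        (fun j l => by
          split_ifs
          · rw [Finsupp.single_apply, if_neg (hcI j l)]
          · rfl)
      have := hS g _ hmem
      rw [bten, tensorRep_tprod] at this
      simpa [hg] using this
    | insert a A ha ih =>
      intro ε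
      have h1 := ih (Function.update ε a true)
      have h2 := ih (Function.update ε a false)
      let v : κ → Std k := fun s => if s ∈ A then bv k (I s) else
        bv k (c s) + if ε s then bv k (I s) else 0
      have e1 : (fun s => if s ∈ A then bv k (I s) else
          bv k (c s) + if Function.update ε a true s then bv k (I s) else 0) =
          Function.update v a (bv k (c a) + bv k (I a)) := by
        ext s : 1
        by_cases h : s = a
        · subst h; simp [ha]
        · simp [h, v]
      have e2 : (fun s => if s ∈ A then bv k (I s) else
          bv k (c s) + if Function.update ε a false s then bv k (I s) else 0) =
          Function.update v a (bv k (c a)) := by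
        ext s : 1
        by_cases h : s = a
        · subst h; simp [ha]
        · simp [h, v]
      have e3 : (fun s => if s ∈ insert a A then bv k (I s) else
          bv k (c s) + if ε s then bv k (I s) else 0) = Function.update v a (bv k (I a)) := by
        ext s : 1
        by_cases h : s = a
        · subst h; simp
        · simp [h, v]
      rw [e1, MultilinearMap.map_update_add] at h1
      rw [e2] at h2
      rw [e3]
      have := Submodule.sub_mem _ h1 h2
      rwa [add_sub_cancel_left] at this
  simpa [bten] using key Finset.univ (fun _ => false)

theorem eq_top_of_bten_mem [Finite κ] {S : Submodule k (Ten k κ)}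
    (hS : ∀ g x, x ∈ S → tensorRep k κ g x ∈ S) {c : κ → ℕ} (hc : Function.Injective c)
    (hmem : bten k c ∈ S) : S = ⊤ := by
  classical
  cases nonempty_fintype κ
  rw [eq_top_iff, ← (tenBasis k κ).span_eq, Submodule.span_le]
  rintro _ ⟨I, rfl⟩
  rw [tenBasis_apply]
  -- As I and c may share values, the passage goes through a family c' disjoint from both.
  let N := Finset.univ.sup (fun s => c s + I s) + 1
  have hN : ∀ s, c s + I s < N := fun s =>
    Nat.lt_succ_of_le (Finset.le_sup (f := fun s => c s + I s) (Finset.mem_univ s))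
  let c' : κ → ℕ := fun s => N + (Fintype.equivFin κ s : ℕ)
  have hc' : Function.Injective c' := fun s t h => by
    have h2 : (Fintype.equivFin κ s : ℕ) = Fintype.equivFin κ t := Nat.add_left_cancel h
    exact (Fintype.equivFin κ).injective (Fin.ext h2)
  have h1 : bten k c' ∈ S := bten_mem_of_disjoint hS hc
    (fun s t => by have := hN t; dsimp only [c']; omega) hmem
  exact bten_mem_of_disjoint hS hc' (fun s t => by have := hN s; dsimp only [c']; omega) h1

theorem exists_injective_lt (κ : Type) [Finite κ] :
    ∃ c : κ → ℕ, Function.Injective c ∧ ∀ s, c s < Nat.card κ :=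
  ⟨fun s => (Finite.equivFin κ s : ℕ),
    fun _ _ h => (Finite.equivFin κ).injective (Fin.ext h), fun s => (Finite.equivFin κ s).2⟩

end Tensors

/-! ### Representations -/

section Reps

variable {k : Type u} [Field k]
variable {W : Type*} [AddCommGroup W] [Module k W] {W' : Type*} [AddCommGroup W'] [Module k W']
variable {W'' : Type*} [AddCommGroup W''] [Module k W'']

/-- Compatibility of a linear map with two representations. -/
def Equi (ρ : Representation k (GLinf k) W) (σ : Representation k (GLinf k) W')
    (f : W →ₗ[k] W') : Prop :=
  ∀ g x, f (ρ g x) = σ g (f x)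

/-- The vector `x` is fixed by all the elements that fix the first `p` basis vectors. -/
def FixedAt (ρ : Representation k (GLinf k) W) (p : ℕ) (x : W) : Prop :=
  ∀ g : GLinf k, (∀ i < p, g.1 (bv k i) = bv k i) → ρ g x = x

theorem FixedAt.mono {ρ : Representation k (GLinf k) W} {p q : ℕ} {x : W} (h : FixedAt ρ p x)
    (hpq : p ≤ q) : FixedAt ρ q x :=
  fun g hg => h g fun i hi => hg i (hi.trans_le hpq)

theorem FixedAt.congr {ρ : Representation k (GLinf k) W} {p : ℕ} {x : W} (h : FixedAt ρ p x)
    {g g' : GLinf k} (hg : ∀ i < p, g.1 (bv k i) = g'.1 (bv k i)) : ρ g x = ρ g' x := by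
  have h1 : ρ (g'⁻¹ * g) x = x := h _ fun i hi => by
    change (g'⁻¹).1 (g.1 (bv k i)) = _
    rw [hg i hi]
    exact g'.1.symm_apply_apply _
  have h2 : ρ g' (ρ (g'⁻¹ * g) x) = ρ g x := by
    rw [← Module.End.mul_apply, ← map_mul, mul_inv_cancel_left]
  rw [← h2, h1]

theorem FixedAt.map {ρ : Representation k (GLinf k) W} {σ : Representation k (GLinf k) W'}
    {f : W →ₗ[k] W'} (hf : Equi ρ σ f) {p : ℕ} {x : W} (h : FixedAt ρ p x) :
    FixedAt σ p (f x) := fun g hg => by rw [← hf, h g hg]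

variable (ρ : Representation k (GLinf k) W)

/-- The subspace of smooth vectors. -/
def smoothPart : Submodule k W where
  carrier := {x | ∃ p, FixedAt ρ p x}
  zero_mem' := ⟨0, fun g _ => map_zero _⟩
  add_mem' := by
    rintro x y ⟨p, hp⟩ ⟨q, hq⟩
    refine ⟨max p q, fun g hg => ?_⟩
    rw [map_add, hp.mono (le_max_left p q) g hg, hq.mono (le_max_right p q) g hg]
  smul_mem' := by
    rintro a x ⟨p, hp⟩
    exact ⟨p, fun g hg => by rw [map_smul, hp g hg]⟩

/-- The span of the images of the maps from tensor powers of `𝐕` into the subspace `N`. -/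
def polyIn (N : Submodule k W) : Submodule k W :=
  Submodule.span k {x | ∃ (κ : Type) (_ : Fintype κ) (f : Ten k κ →ₗ[k] W),
    Equi (tensorRep k κ) ρ f ∧ (∀ y, f y ∈ N) ∧ ∃ y, f y = x}

/-- The maximal polynomial subrepresentation. -/
abbrev polyPart : Submodule k W := polyIn ρ ⊤

variable {ρ}

theorem mem_polyIn {N : Submodule k W} {κ : Type} [Finite κ] {f : Ten k κ →ₗ[k] W}
    (hf : Equi (tensorRep k κ) ρ f) (hN : ∀ y, f y ∈ N) (y : Ten k κ) : f y ∈ polyIn ρ N := by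
  cases nonempty_fintype κ
  exact Submodule.subset_span ⟨κ, inferInstance, f, hf, hN, y, rfl⟩

theorem mem_polyPart {κ : Type} [Finite κ] {f : Ten k κ →ₗ[k] W}
    (hf : Equi (tensorRep k κ) ρ f) (y : Ten k κ) : f y ∈ polyPart ρ :=
  mem_polyIn hf (fun _ => Submodule.mem_top) y

theorem map_polyIn_le {σ : Representation k (GLinf k) W'} {h : W →ₗ[k] W'} (hh : Equi ρ σ h)
    {N : Submodule k W} {N' : Submodule k W'} (hN : ∀ x ∈ N, h x ∈ N') {x : W}
    (hx : x ∈ polyIn ρ N) : h x ∈ polyIn σ N' := by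
  have : polyIn ρ N ≤ (polyIn σ N').comap h := Submodule.span_le.2 (by
    rintro _ ⟨κ, i, f, hf, hfN, y, rfl⟩
    exact mem_polyIn (N := N') (f := h ∘ₗ f) (fun g x => by
      rw [LinearMap.comp_apply, LinearMap.comp_apply, hf, hh]) (fun y => hN _ (hfN y)) y)
  exact this hx

theorem map_mem_polyPart {σ : Representation k (GLinf k) W'} {h : W →ₗ[k] W'} (hh : Equi ρ σ h)
    {x : W} (hx : x ∈ polyPart ρ) : h x ∈ polyPart σ :=
  map_polyIn_le hh (fun _ _ => Submodule.mem_top) hx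

theorem polyIn_stable {N : Submodule k W} (g : GLinf k) {x : W} (hx : x ∈ polyIn ρ N) :
    ρ g x ∈ polyIn ρ N := by
  have : polyIn ρ N ≤ (polyIn ρ N).comap (ρ g) := Submodule.span_le.2 (by
    rintro _ ⟨κ, i, f, hf, hfN, y, rfl⟩
    change ρ g (f y) ∈ polyIn ρ N
    rw [← hf]
    exact mem_polyIn hf hfN _)
  exact this hx

theorem tensor_fixedAt {κ : Type} [Finite κ] (x : Ten k κ) : ∃ p, FixedAt (tensorRep k κ) p x := by
  have : (⊤ : Submodule k (Ten k κ)) ≤ smoothPart (tensorRep k κ) := by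
    rw [← (tenBasis k κ).span_eq, Submodule.span_le]
    rintro _ ⟨I, rfl⟩
    cases nonempty_fintype κ
    refine ⟨Finset.univ.sup I + 1, fun g hg => ?_⟩
    rw [tenBasis_apply, bten, tensorRep_tprod]
    congr 1
    ext s : 1
    exact hg _ (Nat.lt_succ_of_le (Finset.le_sup (Finset.mem_univ s)))
  exact this (Submodule.mem_top (x := x))

theorem polyPart_le_smoothPart : polyPart ρ ≤ smoothPart ρ := Submodule.span_le.2 (by
  rintro _ ⟨κ, i, f, hf, -, y, rfl⟩
  obtain ⟨p, hp⟩ := tensor_fixedAt y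
  exact ⟨p, hp.map hf⟩)

/-! ### Polynomial families of vectors -/

/-- The family `φ t` of vectors is polynomial in `t`. -/
def PolyFam (φ : k → W) : Prop := ∃ m : ℕ →₀ W, ∀ t, φ t = m.sum fun s w => t ^ s • w

theorem PolyFam.add {φ ψ : k → W} (h1 : PolyFam φ) (h2 : PolyFam ψ) :
    PolyFam fun t => φ t + ψ t := by
  obtain ⟨m, hm⟩ := h1
  obtain ⟨n, hn⟩ := h2
  refine ⟨m + n, fun t => ?_⟩
  dsimp only
  rw [hm, hn, Finsupp.sum_add_index' (by simp) (by simp)]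

theorem PolyFam.zero : PolyFam fun _ : k => (0 : W) := ⟨0, fun t => by simp⟩

theorem PolyFam.sum {ι : Type*} {s : Finset ι} {φ : ι → k → W} (h : ∀ i ∈ s, PolyFam (φ i)) :
    PolyFam fun t => ∑ i ∈ s, φ i t := by
  classical
  induction s using Finset.induction_on with
  | empty => simpa using PolyFam.zero
  | insert a s ha ih =>
    simp only [Finset.sum_insert ha]
    exact (h a (Finset.mem_insert_self a s)).add
      (ih fun i hi => h i (Finset.mem_insert_of_mem hi))

theorem PolyFam.map {φ : k → W} (h : PolyFam φ) (f : W →ₗ[k] W') : PolyFam fun t => f (φ t) := by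
  obtain ⟨m, hm⟩ := h
  refine ⟨m.mapRange f (map_zero f), fun t => ?_⟩
  dsimp only
  rw [hm, Finsupp.sum_mapRange_index (by simp), Finsupp.sum, Finsupp.sum, map_sum]
  simp

theorem PolyFam.pow_smul {φ : k → W} (h : PolyFam φ) (n : ℕ) : PolyFam fun t => t ^ n • φ t := by
  obtain ⟨m, hm⟩ := h
  refine ⟨m.mapDomain (n + ·), fun t => ?_⟩
  dsimp only
  rw [hm, Finsupp.sum_mapDomain_index (by simp) (by simp [smul_add]), Finsupp.sum, Finsupp.sum,
    Finset.smul_sum]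
  simp [pow_add, mul_smul]

theorem PolyFam.monomial (n : ℕ) (x : W) : PolyFam fun t : k => t ^ n • x :=
  ⟨Finsupp.single n x, fun t => by simp⟩

/-- Any functional on the quotient by S turns the family into a polynomial with infinitely many
zeros. Leaving out t = 0 is what later permits a specialization to t = 0 after a division by powers
of t. -/
theorem coeff_mem_of_forall_mem [CharZero k] {m : ℕ →₀ W} {S : Submodule k W}
    (h : ∀ t : k, t ≠ 0 → (m.sum fun s w => t ^ s • w) ∈ S) (s : ℕ) : m s ∈ S := by
  rw [← Submodule.Quotient.mk_eq_zero, ← Submodule.mkQ_apply,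
    ← Module.forall_dual_apply_eq_zero_iff k]
  intro l
  let p : Polynomial k := m.sum fun s w => Polynomial.C (l (S.mkQ w)) * Polynomial.X ^ s
  have hp : p = 0 := by
    refine Polynomial.eq_zero_of_infinite_isRoot p (Set.Infinite.mono (s := {t | t ≠ 0}) ?_ ?_)
    · intro t ht
      have h1 := h t ht
      rw [← Submodule.Quotient.mk_eq_zero, ← Submodule.mkQ_apply, Finsupp.sum, map_sum] at h1
      have h2 := congrArg l h1
      rw [map_sum, map_zero] at h2
      change p.eval t = 0
      simp only [p, Finsupp.sum, Polynomial.eval_finsetSum, Polynomial.eval_mul, Polynomial.eval_C,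
        Polynomial.eval_pow, Polynomial.eval_X]
      rw [← h2]
      refine Finset.sum_congr rfl fun i _ => ?_
      rw [map_smul, map_smul, smul_eq_mul, mul_comm]
    · exact (Set.finite_singleton (0 : k)).infinite_compl
  have h3 := congrArg (fun q => Polynomial.coeff q s) hp
  simp only [p, Finsupp.sum, Polynomial.finsetSum_coeff, Polynomial.coeff_C_mul_X_pow,
    Polynomial.coeff_zero] at h3
  by_cases hs : s ∈ m.support
  · rw [Finset.sum_eq_single s] at h3
    · simpa using h3
    · intro b _ hb; rw [if_neg hb.symm]
    · exact fun h => absurd hs h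
  · rw [Finsupp.notMem_support_iff.1 hs, map_zero, map_zero]

theorem polyFam_tmap {κ : Type} [Finite κ] (A B : Std k →ₗ[k] Std k) (x : Ten k κ) :
    PolyFam fun t : k => tmap κ (A + t • B) x := by
  classical
  cases nonempty_fintype κ
  have hx : x ∈ Submodule.span k (Set.range (PiTensorProduct.tprod k (s := fun _ : κ => Std k))) := by
    rw [PiTensorProduct.span_tprod_eq_top]; exact Submodule.mem_top
  induction hx using Submodule.span_induction with
  | mem x hx =>
    obtain ⟨v, rfl⟩ := hx
    simp only [tmap_tprod, LinearMap.add_apply, LinearMap.smul_apply, tprod_add_smul]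
    exact PolyFam.sum fun S _ => PolyFam.monomial _ _
  | zero => simpa using PolyFam.zero
  | add x y _ _ hx hy => simpa using hx.add hy
  | smul a x _ hx =>
    simp only [map_smul]
    exact hx.map (a • LinearMap.id)

/-- Polynomial vectors are combinations of images of tensors, and the tensor powers of A + tB are
polynomial in t. -/
theorem polyFam_of_mem_polyPart {g : k → GLinf k} {A B : Std k →ₗ[k] Std k}
    (hg : ∀ t, ((g t).1 : Std k →ₗ[k] Std k) = A + t • B) {x : W} (hx : x ∈ polyPart ρ) :
    PolyFam fun t => ρ (g t) x := by
  induction hx using Submodule.span_induction with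
  | mem x hx =>
    obtain ⟨κ, _, f, hf, -, y, rfl⟩ := hx
    have h : ∀ t, ρ (g t) (f y) = f (tmap κ (A + t • B) y) := fun t => by
      rw [← hf, tensorRep_eq_tmap, hg]
    simp only [h]
    exact (polyFam_tmap A B y).map f
  | zero => simpa using PolyFam.zero
  | add x y _ _ hx hy => simpa using hx.add hy
  | smul a x _ hx =>
    simp only [map_smul]
    exact hx.map (a • LinearMap.id)

theorem polyFam_pathGL (q : ℕ) {x : W} (hx : x ∈ polyPart ρ) :
    PolyFam fun t => ρ (pathGL q t) x :=
  polyFam_of_mem_polyPart (A := blockSwap k q) (B := trunc k q) (fun _ => rfl) hx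

theorem polyFam_pathGL_inv (q : ℕ) {x : W} (hx : x ∈ polyPart ρ) :
    PolyFam fun t => ρ (pathGL q t)⁻¹ x :=
  polyFam_of_mem_polyPart (A := blockSwap k q) (B := negBlock k q) (fun _ => rfl) hx

end Reps

/-! ### The group algebra acting on tensor powers -/

section Perm

variable {k : Type u} [Field k] {κ : Type}

variable (k) in
/-- Reindexing of the factors of a tensor power. -/
def rx {κ' : Type} (e : κ ≃ κ') : Ten k κ →ₗ[k] Ten k κ' :=
  (PiTensorProduct.reindex k (fun _ => Std k) e).toLinearMap

theorem rx_tprod {κ' : Type} (e : κ ≃ κ') (v : κ → Std k) :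
    rx k e (PiTensorProduct.tprod k v) = PiTensorProduct.tprod k fun s => v (e.symm s) :=
  PiTensorProduct.reindex_tprod (R := k) (s := fun _ => Std k) e _

theorem rx_bten {κ' : Type} (e : κ ≃ κ') (I : κ → ℕ) :
    rx k e (bten k I) = bten k (I ∘ e.symm) := rx_tprod _ _

theorem rx_equi {κ' : Type} (e : κ ≃ κ') : Equi (tensorRep k κ) (tensorRep k κ') (rx k e) :=
  fun g x => (PiTensorProduct.map_reindex (fun _ : κ => stdRep k g) e x).symm

theorem ten_ext {W : Type*} [AddCommMonoid W] [Module k W] {f g : Ten k κ →ₗ[k] W}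
    (h : ∀ v, f (PiTensorProduct.tprod k v) = g (PiTensorProduct.tprod k v)) : f = g :=
  PiTensorProduct.ext (MultilinearMap.ext h)

theorem rx_comp {κ' κ'' : Type} (e : κ ≃ κ') (e' : κ' ≃ κ'') :
    rx k e' ∘ₗ rx k e = rx k (e.trans e') :=
  ten_ext fun v => by
    rw [LinearMap.comp_apply, rx_tprod, rx_tprod, rx_tprod]; rfl

theorem rx_refl : rx k (Equiv.refl κ) = LinearMap.id :=
  ten_ext fun v => by rw [rx_tprod]; rfl

theorem rx_rx_symm {κ' : Type} (e : κ ≃ κ') (x : Ten k κ') : rx k e (rx k e.symm x) = x := by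
  rw [← LinearMap.comp_apply, rx_comp, Equiv.symm_trans_self, rx_refl]; rfl

variable (k κ) in
/-- The action of the group algebra of the permutations of `κ` on the tensor power. -/
def permEnd : MonoidAlgebra k (Equiv.Perm κ) →ₐ[k] Module.End k (Ten k κ) :=
  MonoidAlgebra.lift k (Module.End k (Ten k κ)) (Equiv.Perm κ)
    { toFun := fun p => rx k p
      map_one' := rx_refl
      map_mul' := fun p q => (rx_comp q p).symm }

theorem permEnd_of (p : Equiv.Perm κ) : permEnd k κ (MonoidAlgebra.of k _ p) = rx k p := by
  rw [permEnd, MonoidAlgebra.lift_of]; rfl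

theorem permEnd_equi (z : MonoidAlgebra k (Equiv.Perm κ)) :
    Equi (tensorRep k κ) (tensorRep k κ) (permEnd k κ z) := by
  intro g x
  induction z using MonoidAlgebra.induction_on with
  | of p => rw [permEnd_of]; exact rx_equi p g x
  | add y z hy hz => simp only [map_add, LinearMap.add_apply, hy, hz]
  | smul r z hz => simp only [map_smul, LinearMap.smul_apply, hz]

theorem youngSymmetrizer_eq (μ : YoungDiagram) :
    youngSymmetrizer k μ = permEnd k μ.cells (youngElt k (Equiv.refl μ.cells)) := by
  classical
  rw [youngElt, rowSum, colSum, map_mul, map_sum, map_sum, Finset.sum_mul_sum, youngSymmetrizer]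
  refine Finset.sum_congr (by ext; simp [rowPerms, rowOf]) fun p _ =>
    Finset.sum_congr (by ext; simp [colPerms, colOf]) fun q _ => ?_
  rw [map_smul, permEnd_of, permEnd_of, mul_smul_comm]
  congr 1
  exact (rx_comp q p).symm

theorem permEnd_mul_apply (y z : MonoidAlgebra k (Equiv.Perm κ)) (x : Ten k κ) :
    permEnd k κ (y * z) x = permEnd k κ y (permEnd k κ z x) := by rw [map_mul]; rfl

/-! ### Multilinearization -/

/-- These elements serve to polarize: the new vectors e_{c t} mark the positions at which the index
J t occurs. -/
theorem exists_gl_spread [Finite κ] {c : κ → ℕ} (J : κ → ℕ) {p : ℕ} (hcp : ∀ t, p ≤ c t)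
    (S : Finset κ) : ∃ g : GLinf k, ∀ i < p,
      g.1 (bv k i) = bv k i + ∑ t ∈ S, if J t = i then bv k (c t) else 0 := by
  obtain ⟨g, hg, -⟩ := exists_gl_unip (k := k) (fun i : Fin p => (i : ℕ)) Fin.val_injective
    (fun i => ∑ t ∈ S, if J t = i then bv k (c t) else 0) (fun j l => by
      rw [Finsupp.finsetSum_apply]
      refine Finset.sum_eq_zero fun t _ => ?_
      split_ifs
      · have := hcp t
        rw [Finsupp.single_apply, if_neg (by omega)]
      · rfl)
  exact ⟨g, fun i hi => hg ⟨i, hi⟩⟩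

theorem spread_coord_image {c : κ → ℕ} (hc : Function.Injective c) (J : κ → ℕ) {p : ℕ}
    (hcp : ∀ t, p ≤ c t) (S : Finset κ) [DecidableEq κ] {i : ℕ} (hi : i < p) (t : κ) :
    (bv k i + ∑ t ∈ S, if J t = i then bv k (c t) else 0 : Std k) (c t) =
      if t ∈ S ∧ J t = i then 1 else 0 := by
  have := hcp t
  rw [Finsupp.add_apply, Finsupp.single_apply, if_neg (by omega), zero_add,
    Finsupp.finsetSum_apply]
  by_cases ht : t ∈ S
  · rw [Finset.sum_eq_single_of_mem t ht]
    · by_cases hJ : J t = i <;> simp [ht, hJ]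
    · intro s _ hs
      split_ifs
      · rw [Finsupp.single_apply, if_neg fun h => hs (hc h)]
      · rfl
  · rw [Finset.sum_eq_zero]
    · simp [ht]
    · intro s hs
      split_ifs
      · rw [Finsupp.single_apply, if_neg fun h => ht (by rwa [← hc h])]
      · rfl

/-- Polarization: the alternating sum over S of the elements of `exists_gl_spread` keeps exactly the
terms in which every new vector e_{c t} occurs. The result is a combination of permutations of the
tensor e_c, and its coefficient at c is that of x at J. -/
theorem exists_permEnd_bten_mem [Fintype κ] [DecidableEq κ] {N : Submodule k (Ten k κ)}
    (hN : ∀ g x, x ∈ N → tensorRep k κ g x ∈ N) {x : Ten k κ} (hx : x ∈ N) (hx0 : x ≠ 0) :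
    ∃ (c : κ → ℕ) (z : MonoidAlgebra k (Equiv.Perm κ)), Function.Injective c ∧
      permEnd k κ z (bten k c) ∈ N ∧ permEnd k κ z (bten k c) ≠ 0 := by
  classical
  obtain ⟨J, hJ⟩ : ∃ J, (tenBasis k κ).repr x J ≠ 0 := by
    by_contra! h
    exact hx0 ((tenBasis k κ).repr.map_eq_zero_iff.1 (Finsupp.ext h))
  let p := ((tenBasis k κ).repr x).support.sup (fun I => Finset.univ.sup I) + 1
  have hp : ∀ I ∈ ((tenBasis k κ).repr x).support, ∀ s, I s < p := fun I hI s =>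
    Nat.lt_succ_of_le ((Finset.le_sup (f := I) (Finset.mem_univ s)).trans
      (Finset.le_sup (f := fun I : κ → ℕ => Finset.univ.sup I) hI))
  let c : κ → ℕ := fun s => p + (Fintype.equivFin κ s : ℕ)
  have hcp : ∀ s, p ≤ c s := fun s => Nat.le_add_right _ _
  have hc : Function.Injective c := fun s t h =>
    (Fintype.equivFin κ).injective (Fin.ext (Nat.add_left_cancel h))
  choose g hg using exists_gl_spread (k := k) J hcp
  let Ω : Ten k κ →ₗ[k] Ten k κ := ∑ S : Finset κ, (-1 : k) ^ Sᶜ.card • tensorRep k κ (g S)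
  have hΩN : Ω x ∈ N := by
    simp only [Ω, LinearMap.sum_apply, LinearMap.smul_apply]
    exact N.sum_mem fun S _ => N.smul_mem _ (hN _ _ hx)
  have coordb : ∀ I : κ → ℕ, (∀ s, I s < p) → ∀ S K,
      (tenBasis k κ).repr (tensorRep k κ (g S) (bten k I)) K =
      ∏ s, (bv k (I s) + ∑ t ∈ S, if J t = I s then bv k (c t) else 0 : Std k) (K s) := by
    intro I hI S K
    rw [bten, tensorRep_tprod, tenBasis_repr_tprod]
    exact Finset.prod_congr rfl fun s _ => by rw [hg S _ (hI s)]
  have coordΩ : ∀ y K, (tenBasis k κ).repr (Ω y) K = ∑ S : Finset κ, (-1 : k) ^ Sᶜ.card *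
      (tenBasis k κ).repr (tensorRep k κ (g S) y) K := by
    intro y K
    simp only [Ω, LinearMap.sum_apply, LinearMap.smul_apply, map_sum, map_smul,
      Finsupp.finsetSum_apply, Finsupp.smul_apply, smul_eq_mul]
  have expand : ∀ K, (tenBasis k κ).repr (Ω x) K = ∑ I ∈ ((tenBasis k κ).repr x).support,
      (tenBasis k κ).repr x I * (tenBasis k κ).repr (Ω (bten k I)) K := by
    intro K
    conv_lhs => rw [← (tenBasis k κ).linearCombination_repr x, Finsupp.linearCombination_apply,
      Finsupp.sum]
    simp only [map_sum, map_smul, Finsupp.finsetSum_apply, Finsupp.smul_apply, smul_eq_mul,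
      tenBasis_apply]
  have h1 : (tenBasis k κ).repr (Ω x) c = (tenBasis k κ).repr x J := by
    rw [expand, Finset.sum_eq_single J]
    · rw [coordΩ, Finset.sum_eq_single Finset.univ]
      · rw [coordb J (hp J (Finsupp.mem_support_iff.2 hJ)), Finset.prod_eq_one]
        · simp
        · intro s _
          rw [spread_coord_image hc J hcp _ (hp J (Finsupp.mem_support_iff.2 hJ) s)]
          simp
      · intro S _ hS
        obtain ⟨s, hs⟩ : ∃ s, s ∉ S := by
          by_contra! h; exact hS (Finset.eq_univ_of_forall h)
        rw [coordb J (hp J (Finsupp.mem_support_iff.2 hJ)), Finset.prod_eq_zero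
          (Finset.mem_univ s), mul_zero]
        rw [spread_coord_image hc J hcp _ (hp J (Finsupp.mem_support_iff.2 hJ) s)]
        simp [hs]
      · simp
    · intro I hI hIJ
      obtain ⟨s, hs⟩ : ∃ s, I s ≠ J s := by
        by_contra! h; exact hIJ (funext h)
      rw [coordΩ, Finset.sum_eq_zero, mul_zero]
      intro S _
      rw [coordb I (hp I hI), Finset.prod_eq_zero (Finset.mem_univ s), mul_zero]
      rw [spread_coord_image hc J hcp _ (hp I hI s)]
      simp [hs.symm]
    · intro h
      exact absurd (Finsupp.mem_support_iff.2 hJ) h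
  have h2 : ∀ K, (tenBasis k κ).repr (Ω x) K ≠ 0 → ∃ π : Equiv.Perm κ, K = c ∘ π := by
    intro K hK
    -- If K misses c t₀, then adjoining t₀ to S does not change the coordinate at K but flips the
    -- sign, so the terms cancel in pairs.
    have hT : ∀ t, ∃ s, c t = K s := by
      by_contra! hcon
      obtain ⟨t₀, ht₀⟩ := hcon
      apply hK
      rw [expand]
      refine Finset.sum_eq_zero fun I hI => ?_
      rw [coordΩ]
      have hinv : ∀ S : Finset κ, (tenBasis k κ).repr (tensorRep k κ (g (insert t₀ S)) (bten k I)) K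
          = (tenBasis k κ).repr (tensorRep k κ (g S) (bten k I)) K := by
        intro S
        rw [coordb I (hp I hI), coordb I (hp I hI)]
        refine Finset.prod_congr rfl fun s _ => ?_
        by_cases hts : t₀ ∈ S
        · rw [Finset.insert_eq_of_mem hts]
        · rw [Finset.sum_insert hts, Finsupp.add_apply, Finsupp.add_apply, Finsupp.add_apply]
          have : (if J t₀ = I s then bv k (c t₀) else 0 : Std k) (K s) = 0 := by
            split_ifs
            · rw [Finsupp.single_apply, if_neg (ht₀ s)]
            · rfl
          rw [this, zero_add]
      have hz : ∑ S : Finset κ, (-1 : k) ^ Sᶜ.card *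
          (tenBasis k κ).repr (tensorRep k κ (g S) (bten k I)) K = 0 := by
        rw [← Finset.powerset_univ, ← Finset.insert_erase (Finset.mem_univ t₀),
          Finset.sum_powerset_insert (Finset.notMem_erase _ _), ← Finset.sum_add_distrib]
        refine Finset.sum_eq_zero fun S hS => ?_
        have hts : t₀ ∉ S := fun h =>
          Finset.notMem_erase t₀ _ (Finset.mem_powerset.1 hS h)
        rw [hinv, ← add_mul]
        have : Sᶜ.card = (insert t₀ S)ᶜ.card + 1 := by
          rw [Finset.compl_insert, Finset.card_erase_add_one (Finset.mem_compl.2 hts)]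
        rw [this, pow_succ]
        ring
      rw [hz, mul_zero]
    choose σ hσ using hT
    have hσi : Function.Injective σ := fun a b h => hc (by rw [hσ a, hσ b, h])
    let π : Equiv.Perm κ := Equiv.ofBijective σ (Finite.injective_iff_bijective.1 hσi)
    refine ⟨π.symm, funext fun s => ?_⟩
    have := hσ (π.symm s)
    rw [show σ (π.symm s) = s from π.apply_symm_apply s] at this
    exact this.symm
  have hΩ : Ω x ∈ LinearMap.range ((permEnd k κ).toLinearMap.flip (bten k c)) := by
    rw [← (tenBasis k κ).linearCombination_repr (Ω x), Finsupp.linearCombination_apply,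
      Finsupp.sum]
    refine Submodule.sum_mem _ fun K hK => Submodule.smul_mem _ _ ?_
    obtain ⟨π, rfl⟩ := h2 K (Finsupp.mem_support_iff.1 hK)
    refine ⟨MonoidAlgebra.of k _ π⁻¹, ?_⟩
    rw [LinearMap.flip_apply, AlgHom.toLinearMap_apply, permEnd_of, rx_bten, tenBasis_apply]
    rfl
  obtain ⟨z, hz⟩ := hΩ
  rw [LinearMap.flip_apply, AlgHom.toLinearMap_apply] at hz
  refine ⟨c, z, hc, hz ▸ hΩN, fun h0 => hJ ?_⟩
  rw [← h1, ← hz, h0, map_zero]; rfl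

end Perm

/-! ### Irreducibility of Schur functors and complete reducibility. -/

section SchurSimple

variable {k : Type u} [Field k] [CharZero k]

omit [CharZero k] in
theorem exists_gl_perm {κ : Type} [Finite κ] {c : κ → ℕ} (hc : Function.Injective c)
    (π : Equiv.Perm κ) : ∃ g : GLinf k, tensorRep k κ g (bten k c) = bten k (c ∘ π) := by
  classical
  cases nonempty_fintype κ
  let f : κ ↪ ℕ := ⟨c, hc⟩
  refine ⟨permGL (π.viaFintypeEmbedding f) ⟨Finset.univ.sup c + 1, fun i hi => ?_⟩, ?_⟩
  · refine Equiv.Perm.viaFintypeEmbedding_apply_notMem_range _ _ ?_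
    rintro ⟨s, rfl⟩
    have : c s ≤ Finset.univ.sup c := Finset.le_sup (Finset.mem_univ s)
    have h2 : f s = c s := rfl
    omega
  · rw [bten, tensorRep_tprod]
    congr 1
    ext s : 1
    rw [permGL_bv]
    congr 1
    exact Equiv.Perm.viaFintypeEmbedding_apply_image π f s

omit [CharZero k] in
-- As the entries of c are distinct, a permutation of the factors of `bten k c` is also the effect
-- of a permutation matrix, which commutes with the group algebra and preserves N.
theorem permEnd_mul_bten_mem {κ : Type} [Finite κ] {N : Submodule k (Ten k κ)}
    (hN : ∀ g x, x ∈ N → tensorRep k κ g x ∈ N) {c : κ → ℕ} (hc : Function.Injective c)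
    {z : MonoidAlgebra k (Equiv.Perm κ)} (hz : permEnd k κ z (bten k c) ∈ N)
    (w : MonoidAlgebra k (Equiv.Perm κ)) : permEnd k κ (z * w) (bten k c) ∈ N := by
  induction w using MonoidAlgebra.induction_on with
  | of p =>
    obtain ⟨g, hg⟩ := exists_gl_perm (k := k) hc p⁻¹
    rw [permEnd_mul_apply, permEnd_of, rx_bten, show (p.symm : κ → κ) = (p⁻¹ : Equiv.Perm κ) from rfl, ← hg, permEnd_equi]
    exact hN _ _ hz
  | add x y hx hy => rw [mul_add, map_add]; exact N.add_mem hx hy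
  | smul r x hx => rw [mul_smul_comm, map_smul]; exact N.smul_mem _ hx

/-- For every p the element p⁻¹z has square zero, so its coefficient at 1, which is the coefficient
of z at p, vanishes. -/
theorem eq_zero_of_sandwich {X : Type*} [Fintype X] [DecidableEq X]
    {z : MonoidAlgebra k (Equiv.Perm X)} (h : ∀ w, z * w * z = 0) : z = 0 := by
  ext p
  have h1 : (MonoidAlgebra.of k _ p⁻¹ * z).coeff 1 = 0 := by
    refine coeff_one_eq_zero_of_isNilpotent ⟨2, ?_⟩
    rw [pow_two, mul_assoc, ← mul_assoc z, h, mul_zero]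
  rw [MonoidAlgebra.of_apply, MonoidAlgebra.coeff_single_mul_apply] at h1
  simpa using h1

/-- A stable non-zero subspace of `𝐒_μ(𝐕)` is everything. -/
theorem range_youngSymmetrizer_le {μ : YoungDiagram} {N : Submodule k (Ten k μ.cells)}
    (hN : ∀ g x, x ∈ N → tensorRep k μ.cells g x ∈ N)
    (hle : N ≤ LinearMap.range (youngSymmetrizer k μ)) (hne : N ≠ ⊥) :
    LinearMap.range (youngSymmetrizer k μ) ≤ N := by
  obtain ⟨x, hx, hx0⟩ := N.ne_bot_iff.1 hne
  -- Polarization puts a non-zero z·e_c in N. As N lies in the image of the symmetrizer y, also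
  -- yz·e_c is in N, and yzwy is a non-zero multiple of y for some w. Hence y·e_c is in N, and e_c
  -- generates the tensor power.
  obtain ⟨c, z, hc, hz, hz0⟩ := exists_permEnd_bten_mem hN hx hx0
  rw [youngSymmetrizer_eq] at hle ⊢
  set y := youngElt k (Equiv.refl μ.cells) with hy
  obtain ⟨a, ha, hyy⟩ := youngElt_sq (k := k) (Equiv.refl μ.cells)
  rw [← hy] at hyy
  obtain ⟨v, hv⟩ := hle hz
  have hyz : permEnd k _ (y * z) (bten k c) = a • permEnd k _ z (bten k c) := by
    rw [permEnd_mul_apply, ← hv, ← permEnd_mul_apply, hyy, map_smul]; rfl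
  have hyz0 : y * z ≠ 0 := fun h => by
    rw [h, map_zero] at hyz
    exact smul_ne_zero ha hz0 hyz.symm
  have hyzN : permEnd k _ (y * z) (bten k c) ∈ N := hyz ▸ N.smul_mem _ hz
  obtain ⟨w, hw⟩ : ∃ w, y * z * w * y ≠ 0 := by
    by_contra! hcon
    refine hyz0 (eq_zero_of_sandwich fun w => ?_)
    rw [← mul_assoc, hcon w, zero_mul]
  obtain ⟨b, hb⟩ := youngElt_mul_mul_youngElt (k := k) (Equiv.refl μ.cells) (z * w)
  rw [← hy, ← mul_assoc] at hb
  have hb0 : b ≠ 0 := fun h => hw (by rw [hb, h, zero_smul])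
  have hycN : permEnd k _ y (bten k c) ∈ N := by
    have h1 := permEnd_mul_bten_mem hN hc hyzN (w * y)
    rw [← mul_assoc, hb, map_smul] at h1
    exact (N.smul_mem_iff hb0).1 h1
  have htop : N.comap (permEnd k _ y) = ⊤ := eq_top_of_bten_mem (fun g x hx => by
    change permEnd k _ y _ ∈ N
    rw [permEnd_equi]; exact hN _ _ hx) hc hycN
  rintro _ ⟨x, rfl⟩
  have : x ∈ N.comap (permEnd k _ y) := htop ▸ Submodule.mem_top
  exact this

variable {W : Type*} [AddCommGroup W] [Module k W] {ρ : Representation k (GLinf k) W}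

theorem eq_bot_or_eq_top_of_schur_stable {μ : YoungDiagram} {N : Submodule k (Schur k μ)}
    (hN : ∀ g x, x ∈ N → schurRep k μ g x ∈ N) : N = ⊥ ∨ N = ⊤ := by
  by_cases h : N = ⊥
  · exact Or.inl h
  right
  have h1 : LinearMap.range (youngSymmetrizer k μ) ≤ N.map (schurSub k μ).toSubmodule.subtype := by
    refine range_youngSymmetrizer_le ?_ ?_ ?_
    · rintro g _ ⟨x, hx, rfl⟩
      exact ⟨_, hN g x hx, rfl⟩
    · rintro _ ⟨x, -, rfl⟩
      exact x.2
    · intro h0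
      refine h ((Submodule.eq_bot_iff _).2 fun x hx => Subtype.ext ?_)
      exact (Submodule.eq_bot_iff _).1 h0 _ ⟨x, hx, rfl⟩
  rw [eq_top_iff]
  rintro ⟨x, hx⟩ -
  obtain ⟨y, hy, hyx⟩ := h1 hx
  have : y = ⟨x, hx⟩ := Subtype.ext hyx
  exact this ▸ hy

variable (k) in
/-- The projection of the tensor power onto `𝐒_μ(𝐕)`. -/
def toSchur (μ : YoungDiagram) : Ten k μ.cells →ₗ[k] Schur k μ :=
  (youngSymmetrizer k μ).rangeRestrict

variable (k) in
/-- The inclusion of `𝐒_μ(𝐕)` into the tensor power. -/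
def ofSchur (μ : YoungDiagram) : Schur k μ →ₗ[k] Ten k μ.cells :=
  (schurSub k μ).toSubmodule.subtype

omit [CharZero k] in
theorem toSchur_equi (μ : YoungDiagram) :
    Equi (tensorRep k μ.cells) (schurRep k μ) (toSchur k μ) := fun g x =>
  Subtype.ext (youngSymmetrizer_comm k μ g x).symm

omit [CharZero k] in
theorem ofSchur_equi (μ : YoungDiagram) :
    Equi (schurRep k μ) (tensorRep k μ.cells) (ofSchur k μ) := fun _ _ => rfl

omit [CharZero k] in
theorem toSchur_surjective (μ : YoungDiagram) : Function.Surjective (toSchur k μ) :=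
  LinearMap.surjective_rangeRestrict _

omit [CharZero k] in
theorem Equi.comp {W' W'' : Type*} [AddCommGroup W'] [Module k W'] [AddCommGroup W'']
    [Module k W''] {ρ' : Representation k (GLinf k) W'} {ρ'' : Representation k (GLinf k) W''}
    {f : W' →ₗ[k] W''} {g : W →ₗ[k] W'} (hf : Equi ρ' ρ'' f) (hg : Equi ρ ρ' g) :
    Equi ρ ρ'' (f ∘ₗ g) := fun a x => by
  rw [LinearMap.comp_apply, hg, hf]; rfl

omit [CharZero k] in
theorem Equi.comp_toSchur {μ : YoungDiagram} {f : Schur k μ →ₗ[k] W}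
    (hf : Equi (schurRep k μ) ρ f) : Equi (tensorRep k μ.cells) ρ (f ∘ₗ toSchur k μ) :=
  hf.comp (toSchur_equi μ)

omit [CharZero k] in
theorem schur_mem_polyPart {μ : YoungDiagram} {f : Schur k μ →ₗ[k] W}
    (hf : Equi (schurRep k μ) ρ f) (y : Schur k μ) : f y ∈ polyPart ρ := by
  obtain ⟨x, rfl⟩ := toSchur_surjective μ y
  exact mem_polyPart hf.comp_toSchur x

omit [CharZero k] in
theorem permEnd_youngElt {κ : Type} [Fintype κ] [DecidableEq κ] {μ : YoungDiagram}
    (e : κ ≃ μ.cells) :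
    permEnd k κ (youngElt k e) = rx k e.symm ∘ₗ youngSymmetrizer k μ ∘ₗ rx k e := by
  classical
  have hx : ∀ p : Equiv.Perm κ, rx k p =
      rx k e.symm ∘ₗ permTensor k μ (e.permCongr p) ∘ₗ rx k e := fun p => by
    change _ = rx k e.symm ∘ₗ rx k (e.permCongr p) ∘ₗ rx k e
    rw [rx_comp, rx_comp]
    congr 1
    ext s
    simp
  have hm : ∀ p q : Equiv.Perm κ, e.permCongr (p * q) = e.permCongr p * e.permCongr q :=
    fun p q => Equiv.ext fun s => by simp [Equiv.permCongr_apply]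
  rw [youngElt, rowSum, colSum, map_mul, map_sum, map_sum, Finset.sum_mul_sum, youngSymmetrizer]
  refine LinearMap.ext fun x => ?_
  simp only [LinearMap.comp_apply, LinearMap.sum_apply, map_sum]
  refine Finset.sum_equiv e.permCongr (fun p => ?_) fun p _ =>
    Finset.sum_equiv e.permCongr (fun p => ?_) fun q _ => ?_
  · refine (Finset.mem_filter_univ p).trans (Iff.trans ?_ (Finset.mem_filter_univ _).symm)
    exact ⟨fun h s => by simpa [rowOf, colOf] using h (e.symm s),
      fun h s => by simpa [rowOf, colOf] using h (e s)⟩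
  · refine (Finset.mem_filter_univ p).trans (Iff.trans ?_ (Finset.mem_filter_univ _).symm)
    exact ⟨fun h s => by simpa [rowOf, colOf] using h (e.symm s),
      fun h s => by simpa [rowOf, colOf] using h (e s)⟩
  · rw [map_smul, permEnd_of, permEnd_of, mul_smul_comm, Equiv.Perm.sign_permCongr,
      LinearMap.smul_apply, LinearMap.smul_apply, map_smul, ← hm]
    congr 1
    exact (LinearMap.congr_fun (rx_comp q p) x).trans (LinearMap.congr_fun (hx (p * q)) x)

/-- Every tensor power is spanned by the images of Schur functors of the same degree. -/
theorem mem_span_schur {κ : Type} [Fintype κ] (x : Ten k κ) :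
    x ∈ Submodule.span k {x | ∃ (μ : YoungDiagram) (f : Schur k μ →ₗ[k] Ten k κ),
      μ.card = Fintype.card κ ∧ Equi (schurRep k μ) (tensorRep k κ) f ∧ ∃ y, f y = x} := by
  classical
  have h := one_mem_span_youngElt (k := k) (X := κ)
  suffices H : ∀ z ∈ Submodule.span k
      {w | ∃ (μ : YoungDiagram) (e : κ ≃ μ.cells) (x y : MonoidAlgebra k (Equiv.Perm κ)),
        w = x * youngElt k e * y}, permEnd k κ z x ∈
      Submodule.span k {x | ∃ (μ : YoungDiagram) (f : Schur k μ →ₗ[k] Ten k κ),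
      μ.card = Fintype.card κ ∧ Equi (schurRep k μ) (tensorRep k κ) f ∧ ∃ y, f y = x} by
    simpa using H 1 h
  intro z hz
  induction hz using Submodule.span_induction with
  | mem z hz =>
    obtain ⟨μ, e, a, b, rfl⟩ := hz
    refine Submodule.subset_span ⟨μ, permEnd k κ a ∘ₗ rx k e.symm ∘ₗ ofSchur k μ, ?_, ?_,
      toSchur k μ (rx k e (permEnd k κ b x)), ?_⟩
    · rw [Fintype.card_congr e, Fintype.card_coe]
    · exact (permEnd_equi a).comp ((rx_equi e.symm).comp (ofSchur_equi μ))
    · rw [mul_assoc, permEnd_mul_apply, permEnd_mul_apply, permEnd_youngElt]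
      rfl
  | zero => simp
  | add y z _ _ hy hz => rw [map_add]; exact Submodule.add_mem _ hy hz
  | smul r z _ hz => rw [map_smul]; exact Submodule.smul_mem _ _ hz

theorem mem_span_schur_of_equi {κ : Type} [Fintype κ] {f : Ten k κ →ₗ[k] W}
    (hf : Equi (tensorRep k κ) ρ f) (x : Ten k κ) :
    f x ∈ Submodule.span k {x | ∃ (μ : YoungDiagram) (f : Schur k μ →ₗ[k] W),
      μ.card = Fintype.card κ ∧ Equi (schurRep k μ) ρ f ∧ ∃ y, f y = x} := by
  have h := Submodule.mem_map_of_mem (f := f) (mem_span_schur x)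
  rw [Submodule.map_span] at h
  refine Submodule.span_mono ?_ h
  rintro _ ⟨_, ⟨μ, g, hc, hg, y, rfl⟩, rfl⟩
  exact ⟨μ, f ∘ₗ g, hc, hf.comp hg, y, rfl⟩

/-! ### Semisimplicity of polynomial representations -/

theorem polyPart_le_span_schur : polyPart ρ ≤
    Submodule.span k {x | ∃ (μ : YoungDiagram) (f : Schur k μ →ₗ[k] W),
      Equi (schurRep k μ) ρ f ∧ ∃ y, f y = x} := Submodule.span_le.2 (by
  rintro _ ⟨κ, _, f, hf, -, y, rfl⟩
  refine Submodule.span_mono ?_ (mem_span_schur_of_equi hf y)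
  rintro _ ⟨μ, g, -, hg⟩
  exact ⟨μ, g, hg⟩)

/-- A non-zero equivariant image of a Schur functor is simple, because the preimage of a
subrepresentation is zero or everything, and such images span the polynomial part. -/
theorem isSemisimpleModule_asModule (h : polyPart ρ = ⊤) :
    IsSemisimpleModule (MonoidAlgebra k (GLinf k)) ρ.asModule := by
  have hatom : ∀ (μ : YoungDiagram) (f : Schur k μ →ₗ[k] W) (hf : Equi (schurRep k μ) ρ f),
      f ≠ 0 → ∃ m : Submodule (MonoidAlgebra k (GLinf k)) ρ.asModule,
        IsSimpleModule (MonoidAlgebra k (GLinf k)) m ∧ ∀ y : Schur k μ, (f y : W) ∈ m := by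
    intro μ f hf h0
    let m : Submodule (MonoidAlgebra k (GLinf k)) ρ.asModule := Subrepresentation.asSubmodule
      ⟨LinearMap.range f, by rintro g _ ⟨y, rfl⟩; exact ⟨schurRep k μ g y, hf g y⟩⟩
    refine ⟨m, isSimpleModule_iff_isAtom.2 ⟨fun hm => h0 (LinearMap.ext fun y => ?_),
      fun b hb => ?_⟩, fun y => ⟨y, rfl⟩⟩
    · have : (f y : W) ∈ m := ⟨y, rfl⟩
      rw [hm] at this
      exact this
    · let B := Subrepresentation.ofSubmodule' b
      rcases eq_bot_or_eq_top_of_schur_stable (N := B.toSubmodule.comap f) (fun g x hx => by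
        rw [Submodule.mem_comap, hf]; exact B.apply_mem_toSubmodule g hx) with h1 | h1
      · refine (Submodule.eq_bot_iff _).2 fun x hx => ?_
        obtain ⟨y, rfl⟩ := hb.le hx
        have : y ∈ B.toSubmodule.comap f := hx
        rw [h1, Submodule.mem_bot] at this
        rw [this, map_zero]
        rfl
      · refine absurd ?_ hb.not_ge
        rintro _ ⟨y, rfl⟩
        have : y ∈ B.toSubmodule.comap f := h1 ▸ Submodule.mem_top
        exact this
  refine IsSemisimpleModule.of_sSup_simples_eq_top ?_
  rw [eq_top_iff]
  rintro x -
  let S := sSup {m : Submodule (MonoidAlgebra k (GLinf k)) ρ.asModule |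
    IsSimpleModule (MonoidAlgebra k (GLinf k)) m}
  have hle : polyPart ρ ≤ (Subrepresentation.ofSubmodule' S).toSubmodule := by
    refine polyPart_le_span_schur.trans (Submodule.span_le.2 ?_)
    rintro _ ⟨μ, f, hf, y, rfl⟩
    by_cases h0 : f = 0
    · rw [h0]; exact Submodule.zero_mem _
    · obtain ⟨m, hm, hfm⟩ := hatom μ f hf h0
      exact (le_sSup hm : m ≤ S) (hfm y)
  have key : ∀ x : W, x ∈ (Subrepresentation.ofSubmodule' S).toSubmodule :=
    fun x => hle (h ▸ Submodule.mem_top)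
  exact key x

theorem exists_stable_compl (h : polyPart ρ = ⊤) {N : Submodule k W}
    (hN : ∀ g x, x ∈ N → ρ g x ∈ N) :
    ∃ N' : Submodule k W, (∀ g x, x ∈ N' → ρ g x ∈ N') ∧ IsCompl N N' := by
  have := isSemisimpleModule_asModule h
  have h2 : Representation.IsSemisimpleRepresentation ρ := by
    rw [Representation.isSemisimpleRepresentation_iff_isSemisimpleModule_asModule]; exact this
  obtain ⟨N', hN'⟩ := exists_isCompl (⟨N, fun g x hx => hN g x hx⟩ : Subrepresentation ρ)
  refine ⟨N'.toSubmodule, fun g x hx => N'.apply_mem_toSubmodule g hx, ?_⟩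
  rw [isCompl_iff, disjoint_iff, codisjoint_iff] at hN' ⊢
  exact ⟨congrArg Subrepresentation.toSubmodule hN'.1, congrArg Subrepresentation.toSubmodule hN'.2⟩

end SchurSimple

/-! ### Closure properties of polynomial representations and restriction along shifts. -/

section PolyReps

variable {k : Type u} [Field k]
variable {W : Type*} [AddCommGroup W] [Module k W] {ρ : Representation k (GLinf k) W}
variable {W' : Type*} [AddCommGroup W'] [Module k W'] {ρ' : Representation k (GLinf k) W'}

/-! ### Subrepresentations and quotients of polynomial representations -/

theorem polyPart_eq_top_of_surjective {f : W →ₗ[k] W'} (hf : Equi ρ ρ' f)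
    (hs : Function.Surjective f) (h : polyPart ρ = ⊤) : polyPart ρ' = ⊤ := by
  rw [eq_top_iff]
  rintro y -
  obtain ⟨x, rfl⟩ := hs y
  exact map_mem_polyPart hf (h ▸ Submodule.mem_top)

theorem Equi.codRestrict {N : Subrepresentation ρ'} {f : W →ₗ[k] W'} (hf : Equi ρ ρ' f)
    (h : ∀ x, f x ∈ N.toSubmodule) :
    Equi ρ N.toRepresentation (f.codRestrict N.toSubmodule h) :=
  fun g x => Subtype.ext (hf g x)

theorem Equi.subtype (N : Subrepresentation ρ) :
    Equi N.toRepresentation ρ N.toSubmodule.subtype := fun _ _ => rfl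

variable (ρ) in
/-- The maximal polynomial subrepresentation, as a subrepresentation. -/
def polySub : Subrepresentation ρ where
  toSubmodule := polyPart ρ
  apply_mem_toSubmodule g _ hv := polyIn_stable g hv

theorem polyPart_polySub : polyPart (polySub ρ).toRepresentation = ⊤ := by
  rw [eq_top_iff]
  rintro ⟨x, hx⟩ -
  change x ∈ Submodule.span k _ at hx
  suffices H : ∀ x ∈ polyPart ρ, ∃ y ∈ polyPart (polySub ρ).toRepresentation, (y : W) = x by
    obtain ⟨y, hy, rfl⟩ := H x hx
    exact hy
  intro x hx
  induction hx using Submodule.span_induction with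
  | mem x hx =>
    obtain ⟨κ, _, f, hf, -, y, rfl⟩ := hx
    exact ⟨⟨f y, mem_polyPart hf y⟩,
      mem_polyPart (Equi.codRestrict (N := polySub ρ) hf fun y => mem_polyPart hf y) y, rfl⟩
  | zero => exact ⟨0, Submodule.zero_mem _, rfl⟩
  | add x y _ _ hx hy =>
    obtain ⟨x', hx', rfl⟩ := hx
    obtain ⟨y', hy', rfl⟩ := hy
    exact ⟨x' + y', Submodule.add_mem _ hx' hy', rfl⟩
  | smul a x _ hx =>
    obtain ⟨x', hx', rfl⟩ := hx
    exact ⟨a • x', Submodule.smul_mem _ a hx', rfl⟩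

theorem exists_equi_proj [CharZero k] (h : polyPart ρ = ⊤) {N : Submodule k W}
    (hN : ∀ g x, x ∈ N → ρ g x ∈ N) :
    ∃ p : W →ₗ[k] W, Equi ρ ρ p ∧ (∀ x, p x ∈ N) ∧ ∀ x ∈ N, p x = x := by
  obtain ⟨N', hN', hc⟩ := exists_stable_compl h hN
  have hl : ∀ x ∈ N, N.projection N' hc x = x := fun x hx => by
    rw [Submodule.projection_apply, Submodule.projectionOnto_apply_of_mem_left hc hx]
  have hr : ∀ x ∈ N', N.projection N' hc x = 0 := fun x hx => by
    rw [Submodule.projection_apply, Submodule.projectionOnto_apply_of_mem_right hc hx]; rfl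
  refine ⟨N.projection N' hc, fun g x => ?_, fun x => Subtype.coe_prop _, hl⟩
  have hx : x ∈ N ⊔ N' := hc.sup_eq_top ▸ Submodule.mem_top
  obtain ⟨a, ha, b, hb, rfl⟩ := Submodule.mem_sup.1 hx
  rw [map_add, map_add, map_add, map_add, hl a ha, hr b hb, hl _ (hN g a ha), hr _ (hN' g b hb),
    map_zero]

/-- By complete reducibility a subrepresentation of the polynomial part is also a quotient of it,
and quotients of polynomial representations are visibly polynomial. -/
theorem polyPart_subrepresentation [CharZero k] (N : Subrepresentation ρ)
    (hN : N.toSubmodule ≤ polyPart ρ) : polyPart N.toRepresentation = ⊤ := by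
  obtain ⟨p, hp, hpN, hpid⟩ := exists_equi_proj (polyPart_polySub (ρ := ρ))
    (N := N.toSubmodule.comap (polySub ρ).toSubmodule.subtype)
    (fun g x hx => N.apply_mem_toSubmodule g hx)
  refine polyPart_eq_top_of_surjective (ρ := (polySub ρ).toRepresentation)
    (f := ((polySub ρ).toSubmodule.subtype ∘ₗ p).codRestrict N.toSubmodule hpN)
    (Equi.codRestrict ((Equi.subtype (polySub ρ)).comp hp) hpN) ?_ polyPart_polySub
  rintro ⟨x, hx⟩
  have h1 := congrArg Subtype.val (hpid ⟨x, hN hx⟩ hx)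
  exact ⟨⟨x, hN hx⟩, Subtype.ext h1⟩

theorem exists_schur_of_ne_bot [CharZero k] {N : Submodule k W} (hN : ∀ g x, x ∈ N → ρ g x ∈ N)
    (hle : N ≤ polyPart ρ) (h0 : N ≠ ⊥) : ∃ (μ : YoungDiagram) (f : Schur k μ →ₗ[k] W),
      Equi (schurRep k μ) ρ f ∧ f ≠ 0 ∧ ∀ y, f y ∈ N := by
  let S : Subrepresentation ρ := ⟨N, fun g x hx => hN g x hx⟩
  have h1 := polyPart_le_span_schur (ρ := S.toRepresentation)
  rw [polyPart_subrepresentation S hle, top_le_iff] at h1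
  by_contra! hcon
  refine h0 ((Submodule.eq_bot_iff _).2 fun x hx => ?_)
  have hx1 : (⟨x, hx⟩ : S.toSubmodule) ∈ (⊤ : Submodule k S.toSubmodule) := Submodule.mem_top
  rw [← h1] at hx1
  suffices H : (⟨x, hx⟩ : S.toSubmodule) ∈ (⊥ : Submodule k S.toSubmodule) from
    congrArg Subtype.val ((Submodule.mem_bot k).1 H)
  refine Submodule.span_le.2 ?_ hx1
  rintro _ ⟨μ, f, hf, y, rfl⟩
  by_contra hy
  obtain ⟨z, hz⟩ := hcon μ (S.toSubmodule.subtype ∘ₗ f) ((Equi.subtype S).comp hf) (fun h => hy (by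
    have := LinearMap.congr_fun h y
    exact Subtype.ext this))
  exact hz (f z).2

/-! ### Comparison with the definition by subquotients -/

section Product

variable {ι : Type*} {V : ι → Type*} [∀ i, AddCommGroup (V i)] [∀ i, Module k (V i)]

/-- The product of representations. -/
def piRep (τ : ∀ i, Representation k (GLinf k) (V i)) :
    Representation k (GLinf k) (∀ i, V i) where
  toFun g := LinearMap.pi fun i => τ i g ∘ₗ LinearMap.proj i
  map_one' := by ext; simp
  map_mul' g h := by ext; simp

theorem equi_single [DecidableEq ι] (τ : ∀ i, Representation k (GLinf k) (V i)) (i : ι) :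
    Equi (τ i) (piRep τ) (LinearMap.single k V i) := fun g x => by
  ext j
  by_cases h : j = i
  · subst h; simp [piRep]
  · simp [piRep, h]

theorem equi_proj (τ : ∀ i, Representation k (GLinf k) (V i)) (i : ι) :
    Equi (piRep τ) (τ i) (LinearMap.proj i) := fun _ _ => rfl

theorem polyPart_piRep [Fintype ι] {τ : ∀ i, Representation k (GLinf k) (V i)}
    (h : ∀ i, polyPart (τ i) = ⊤) : polyPart (piRep τ) = ⊤ := by
  classical
  rw [eq_top_iff]
  rintro x -
  rw [← Finset.univ_sum_single x]
  exact Submodule.sum_mem _ fun i _ =>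
    map_mem_polyPart (equi_single τ i) (h i ▸ Submodule.mem_top)

theorem polyPart_directSum [DecidableEq ι] {τ : ∀ i, Representation k (GLinf k) (V i)}
    (h : ∀ i, polyPart (τ i) = ⊤) : polyPart (Representation.directSum τ) = ⊤ := by
  rw [eq_top_iff]
  rintro x -
  have he : ∀ i, Equi (τ i) (Representation.directSum τ) (DirectSum.lof k ι V i) := fun i g x => by
    rw [Representation.directSum_apply, DirectSum.lmap_lof]
  induction x using DirectSum.induction_on with
  | zero => exact Submodule.zero_mem _
  | of i x => exact map_mem_polyPart (he i) (h i ▸ Submodule.mem_top)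
  | add x y hx hy => exact Submodule.add_mem _ hx hy

end Product

theorem polyPart_tensorRep (κ : Type) [Finite κ] : polyPart (tensorRep k κ) = ⊤ :=
  eq_top_iff.2 fun x _ => mem_polyPart (f := LinearMap.id) (fun _ _ => rfl) x

theorem polyPart_schurRep (μ : YoungDiagram) : polyPart (schurRep k μ) = ⊤ :=
  eq_top_iff.2 fun x _ => schur_mem_polyPart (f := LinearMap.id) (fun _ _ => rfl) x

theorem isPolynomial_iff [CharZero k] {W : Type u} [AddCommGroup W] [Module k W]
    {ρ : Representation k (GLinf k) W} : IsPolynomial ρ ↔ polyPart ρ = ⊤ := by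
  classical
  constructor
  · rintro ⟨ι, d, N, f, hf⟩
    have h1 := polyPart_directSum (τ := fun i => tensorRep k (Fin (d i)))
      fun i => polyPart_tensorRep _
    exact polyPart_eq_top_of_surjective (f := f.toLinearMap)
      (fun g x => LinearMap.congr_fun (f.isIntertwining' g) x) hf
      (polyPart_subrepresentation N (h1 ▸ le_top))
  · intro h
    -- One summand is taken for every equivariant map from a standard tensor power, so that the sum
    -- maps onto the whole polynomial part.
    let ι : Type u := Σ d : ℕ, {f : Ten k (Fin d) →ₗ[k] W // Equi (tensorRep k (Fin d)) ρ f}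
    let F : (⨁ i : ι, Ten k (Fin i.1)) →ₗ[k] W := DirectSum.toModule k ι W fun i => i.2.1
    have hF : Equi (Representation.directSum fun i : ι => tensorRep k (Fin i.1)) ρ F := by
      intro g x
      induction x using DirectSum.induction_on with
      | zero => simp
      | of i x =>
        rw [Representation.directSum_apply, ← DirectSum.lof_eq_of k, DirectSum.lmap_lof,
          DirectSum.toModule_lof, DirectSum.toModule_lof]
        exact i.2.2 g x
      | add x y hx hy => simp only [map_add, hx, hy]
    refine ⟨ι, fun i => i.1, ⊤,
      (F ∘ₗ (⊤ : Subrepresentation _).toSubmodule.subtype).intertwiningMap_of_isIntertwiningMap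
        _ _ fun g x => hF g x, ?_⟩
    intro x
    have hx : x ∈ LinearMap.range F := by
      have : polyPart ρ ≤ LinearMap.range F := Submodule.span_le.2 (by
        rintro _ ⟨κ, _, f, hf, -, y, rfl⟩
        let e := Fintype.equivFin κ
        let i : ι := ⟨Fintype.card κ, f ∘ₗ rx k e.symm, hf.comp (rx_equi e.symm)⟩
        refine ⟨DirectSum.lof k ι _ i (rx k e y), ?_⟩
        rw [DirectSum.toModule_lof]
        exact congrArg f (rx_rx_symm e.symm y))
      exact this (h ▸ Submodule.mem_top)
    obtain ⟨y, rfl⟩ := hx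
    exact ⟨⟨y, trivial⟩, rfl⟩

theorem isPolynomialElement_iff [CharZero k] {W : Type u} [AddCommGroup W] [Module k W]
    {ρ : Representation k (GLinf k) W} {x : W} : IsPolynomialElement ρ x ↔ x ∈ polyPart ρ := by
  rw [IsPolynomialElement, isPolynomial_iff]
  constructor
  · intro h
    have hx : x ∈ (orbitSpan ρ x).toSubmodule := Submodule.subset_span ⟨1, by simp⟩
    exact map_mem_polyPart (x := (⟨x, hx⟩ : (orbitSpan ρ x).toSubmodule))
      (Equi.subtype (orbitSpan ρ x)) (h ▸ Submodule.mem_top)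
  · intro hx
    refine polyPart_subrepresentation _ (Submodule.span_le.2 ?_)
    rintro _ ⟨g, rfl⟩
    exact polyIn_stable g hx

/-! ### Tensor products -/

theorem tmul_mem_polyPart {x : W} {y : W'} (hx : x ∈ polyPart ρ) (hy : y ∈ polyPart ρ') :
    x ⊗ₜ[k] y ∈ polyPart (ρ.tprod ρ') := by
  induction hx using Submodule.span_induction with
  | mem x hx =>
    induction hy using Submodule.span_induction with
    | mem y hy =>
      obtain ⟨κ, _, f, hf, -, x, rfl⟩ := hx
      obtain ⟨κ', _, f', hf', -, y, rfl⟩ := hy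
      let F : Ten k (κ ⊕ κ') →ₗ[k] W ⊗[k] W' :=
        TensorProduct.map f f' ∘ₗ (PiTensorProduct.tmulEquiv k (Std k)).symm.toLinearMap
      have hF : Equi (tensorRep k (κ ⊕ κ')) (ρ.tprod ρ') F := fun g x => by
        refine LinearMap.congr_fun (f := F ∘ₗ tensorRep k (κ ⊕ κ') g)
          (g := ρ.tprod ρ' g ∘ₗ F) (ten_ext fun v => ?_) x
        simp only [F, LinearMap.comp_apply, tensorRep_tprod, LinearEquiv.coe_coe,
          PiTensorProduct.tmulEquiv_symm_apply, TensorProduct.map_tmul,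
          Representation.tprod_apply, ← hf g, ← hf' g]
      have := mem_polyPart hF (PiTensorProduct.tmulEquiv k (Std k) (x ⊗ₜ[k] y))
      simpa [F] using this
    | zero => rw [TensorProduct.tmul_zero]; exact Submodule.zero_mem _
    | add y z _ _ hy hz => rw [TensorProduct.tmul_add]; exact Submodule.add_mem _ hy hz
    | smul a y _ hy => rw [TensorProduct.tmul_smul]; exact Submodule.smul_mem _ a hy
  | zero => rw [TensorProduct.zero_tmul]; exact Submodule.zero_mem _
  | add y z _ _ hy hz => rw [TensorProduct.add_tmul]; exact Submodule.add_mem _ hy hz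
  | smul a y _ hy => rw [← TensorProduct.smul_tmul']; exact Submodule.smul_mem _ a hy

theorem polyPart_tprod (h : polyPart ρ = ⊤) (h' : polyPart ρ' = ⊤) :
    polyPart (ρ.tprod ρ') = ⊤ := by
  rw [eq_top_iff]
  rintro x -
  induction x using TensorProduct.induction_on with
  | zero => exact Submodule.zero_mem _
  | tmul x y => exact tmul_mem_polyPart (h ▸ Submodule.mem_top) (h' ▸ Submodule.mem_top)
  | add x y hx hy => exact Submodule.add_mem _ hx hy

/-! ### Restriction along the shift homomorphisms -/

variable (ρ) in
/-- Restriction of a representation along the shift by `n`. -/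
def shiftRep (n : ℕ) : Representation k (GLinf k) W := ρ.comp (shiftHom n)

theorem shiftRep_apply (n : ℕ) (g : GLinf k) (x : W) : shiftRep ρ n g x = ρ (shiftHom n g) x := rfl

theorem Equi.shift {f : W →ₗ[k] W'} (hf : Equi ρ ρ' f) (n : ℕ) :
    Equi (shiftRep ρ n) (shiftRep ρ' n) f := fun g x => hf _ x

theorem tmap_tau_equi (κ : Type) (n : ℕ) :
    Equi (tensorRep k κ) (shiftRep (tensorRep k κ) n) (tmap κ (tau k n)) := fun _ x => by
  rw [shiftRep_apply, tensorRep_eq_tmap, tensorRep_eq_tmap, tmap_tmap, tmap_tmap]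
  congr 1
  exact congrArg _ (LinearMap.ext fun v => (shiftHom_tau n _ v).symm)

section Insertion

variable {κ : Type}

variable (k) in
/-- Insertion of the basis vectors with small indices into a shifted tensor. -/
def insMap (n : ℕ) (I : κ → ℕ) : Ten k {s // n ≤ I s} →ₗ[k] Ten k κ :=
  PiTensorProduct.lift (((PiTensorProduct.tprod k (s := fun _ : κ => Std k)).domDomRestrict
    (fun s => n ≤ I s) (fun s => bv k (I s))).compLinearMap fun _ => tau k n)

theorem insMap_tprod (n : ℕ) (I : κ → ℕ) (v : {s // n ≤ I s} → Std k) :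
    insMap k n I (PiTensorProduct.tprod k v) = PiTensorProduct.tprod k fun s =>
      if h : n ≤ I s then tau k n (v ⟨s, h⟩) else bv k (I s) := by
  rw [insMap, PiTensorProduct.lift.tprod]; rfl

theorem insMap_equi (n : ℕ) (I : κ → ℕ) :
    Equi (tensorRep k _) (shiftRep (tensorRep k κ) n) (insMap k n I) := fun g x => by
  refine LinearMap.congr_fun (f := insMap k n I ∘ₗ tensorRep k _ g)
    (g := shiftRep (tensorRep k κ) n g ∘ₗ insMap k n I) (ten_ext fun v => ?_) x
  rw [LinearMap.comp_apply, LinearMap.comp_apply, tensorRep_tprod, insMap_tprod, insMap_tprod,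
    shiftRep_apply, tensorRep_tprod]
  congr 1
  ext s : 1
  split_ifs with h
  · rw [shiftHom_tau]
  · rw [shiftHom_bv (not_le.1 h)]

theorem insMap_bten {n : ℕ} {I J : κ → ℕ} (h : ∀ s, J s = min (I s) n) :
    insMap k n J (bten k fun s => I s - n) = bten k I := by
  rw [bten, insMap_tprod, bten]
  congr 1
  ext s : 1
  have := h s
  split_ifs with hs
  · rw [tau_bv]
    congr 1
    dsimp only
    omega
  · congr 1
    omega

end Insertion

/-- For the shifted group the vectors of k^n are fixed. A tensor power therefore breaks up according
to the factors that lie in k^n, and each piece is a tensor power in the remaining factors, inserted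
by `insMap`. -/
theorem bten_mem_polyPart_shiftRep {κ : Type} [Finite κ] (n : ℕ) (I : κ → ℕ) :
    bten k I ∈ polyPart (shiftRep (tensorRep k κ) n) := by
  rw [← insMap_bten (n := n) (J := fun s => min (I s) n) fun s => rfl]
  exact mem_polyPart (insMap_equi n _) _

theorem polyPart_le_shiftRep (n : ℕ) : polyPart ρ ≤ polyPart (shiftRep ρ n) :=
  Submodule.span_le.2 (by
    rintro _ ⟨κ, _, f, hf, -, y, rfl⟩
    refine map_mem_polyPart (hf.shift n) ?_
    rw [← (tenBasis k κ).linearCombination_repr y, Finsupp.linearCombination_apply, Finsupp.sum]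
    refine Submodule.sum_mem _ fun I _ => Submodule.smul_mem _ _ ?_
    rw [tenBasis_apply]
    exact bten_mem_polyPart_shiftRep n I)

theorem polyPart_shiftRep (n : ℕ) (h : polyPart ρ = ⊤) : polyPart (shiftRep ρ n) = ⊤ :=
  top_le_iff.1 (h ▸ polyPart_le_shiftRep n)

/-! ### Finitely many maps to Schur functors that separate the elements -/

theorem exists_finite_schur_cover {p : YoungDiagram → Prop} {x : W}
    (hx : x ∈ Submodule.span k {x | ∃ (μ : YoungDiagram) (f : Schur k μ →ₗ[k] W),
      p μ ∧ Equi (schurRep k μ) ρ f ∧ ∃ y, f y = x}) :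
    ∃ (ι : Type) (_ : Fintype ι) (μ : ι → YoungDiagram) (f : ∀ j, Schur k (μ j) →ₗ[k] W),
      (∀ j, p (μ j)) ∧ (∀ j, Equi (schurRep k (μ j)) ρ (f j)) ∧
        ∃ y : ∀ j, Schur k (μ j), x = ∑ j, f j (y j) := by
  induction hx using Submodule.span_induction with
  | mem x hx =>
    obtain ⟨μ, f, hp, hf, y, rfl⟩ := hx
    exact ⟨Unit, inferInstance, fun _ => μ, fun _ => f, fun _ => hp, fun _ => hf, fun _ => y, by simp⟩
  | zero => exact ⟨Empty, inferInstance, Empty.elim, fun j => j.elim, fun j => j.elim, fun j => j.elim,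
      fun j => j.elim, by simp⟩
  | add x y _ _ hx hy =>
    obtain ⟨ι, _, μ, f, hp, hf, a, rfl⟩ := hx
    obtain ⟨ι', _, μ', f', hp', hf', a', rfl⟩ := hy
    refine ⟨ι ⊕ ι', inferInstance, Sum.elim μ μ', fun j => match j with
      | .inl j => f j
      | .inr j => f' j, ?_, ?_, fun j => match j with
      | .inl j => a j
      | .inr j => a' j, ?_⟩
    · rintro (j | j)
      · exact hp j
      · exact hp' j
    · rintro (j | j)
      · exact hf j
      · exact hf' j
    · rw [Fintype.sum_sum_type]
      rfl
  | smul r x _ hx =>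
    obtain ⟨ι, _, μ, f, hp, hf, a, rfl⟩ := hx
    exact ⟨ι, inferInstance, μ, f, hp, hf, fun j => r • a j, by simp [Finset.smul_sum]⟩

theorem exists_finite_schur_cover_finset [CharZero k] (h : polyPart ρ = ⊤) (F : Finset W) :
    ∃ (ι : Type) (_ : Fintype ι) (μ : ι → YoungDiagram) (f : ∀ j, Schur k (μ j) →ₗ[k] W),
      (∀ j, Equi (schurRep k (μ j)) ρ (f j)) ∧ ∀ x ∈ F, ∃ y : ∀ j, Schur k (μ j),
        x = ∑ j, f j (y j) := by
  classical
  induction F using Finset.induction_on with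
  | empty => exact ⟨Empty, inferInstance, Empty.elim, fun j => j.elim, fun j => j.elim, by simp⟩
  | insert x F _ ih =>
    obtain ⟨ι, _, μ, f, hf, hF⟩ := ih
    obtain ⟨ι', _, μ', f', -, hf', a, ha⟩ :=
      exists_finite_schur_cover (x := x) (ρ := ρ) (p := fun _ => True) (by
        refine Submodule.span_mono ?_ (polyPart_le_span_schur (h ▸ Submodule.mem_top (x := x)))
        rintro _ ⟨μ, f, hf⟩
        exact ⟨μ, f, trivial, hf⟩)
    refine ⟨ι ⊕ ι', inferInstance, Sum.elim μ μ', fun j => match j with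
      | .inl j => f j
      | .inr j => f' j, ?_, fun z hz => ?_⟩
    · rintro (j | j)
      · exact hf j
      · exact hf' j
    · rcases Finset.mem_insert.1 hz with rfl | hz
      · refine ⟨fun j => match j with
          | .inl j => 0
          | .inr j => a j, ?_⟩
        have h0 : ∑ j, f j 0 = 0 := Finset.sum_eq_zero fun j _ => map_zero (f j)
        rw [Fintype.sum_sum_type]
        change _ = ∑ j, f j 0 + ∑ j, f' j (a j)
        rw [h0, zero_add, ha]
      · obtain ⟨b, rfl⟩ := hF z hz
        refine ⟨fun j => match j with
          | .inl j => b j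
          | .inr j => 0, ?_⟩
        have h0 : ∑ j, f' j 0 = 0 := Finset.sum_eq_zero fun j _ => map_zero (f' j)
        rw [Fintype.sum_sum_type]
        change _ = ∑ j, f j (b j) + ∑ j, f' j 0
        rw [h0, add_zero]

/-- N is the image of a finite sum of Schur functors that covers F. The maps are an equivariant
projection onto N followed by the inverse of that sum on a complement of its kernel. -/
theorem exists_schur_separating [CharZero k] (h : polyPart ρ = ⊤) (F : Finset W) :
    ∃ (ι : Type) (_ : Fintype ι) (μ : ι → YoungDiagram) (p : ∀ j, W →ₗ[k] Schur k (μ j))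
      (N : Submodule k W), (∀ j, Equi ρ (schurRep k (μ j)) (p j)) ∧
      (∀ g x, x ∈ N → ρ g x ∈ N) ∧ (∀ x ∈ F, x ∈ N) ∧ ∀ x ∈ N, (∀ j, p j x = 0) → x = 0 := by
  classical
  obtain ⟨ι, _, μ, f, hf, hF⟩ := exists_finite_schur_cover_finset h F
  let T : (∀ j, Schur k (μ j)) →ₗ[k] W := ∑ j, f j ∘ₗ LinearMap.proj j
  have hT : ∀ y, T y = ∑ j, f j (y j) := fun y => by simp [T]
  have hTe : Equi (piRep fun j => schurRep k (μ j)) ρ T := fun g y => by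
    rw [hT, hT, map_sum]
    exact Finset.sum_congr rfl fun j _ => hf j g _
  obtain ⟨C, hC, hcompl⟩ := exists_stable_compl
    (polyPart_piRep fun j => polyPart_schurRep (k := k) (μ j)) (N := LinearMap.ker T)
    (fun g x hx => by rw [LinearMap.mem_ker, hTe, LinearMap.mem_ker.1 hx, map_zero])
  obtain ⟨q, hq, hqN, hqid⟩ := exists_equi_proj h (N := LinearMap.range T)
    (fun g x hx => by obtain ⟨y, rfl⟩ := hx; exact ⟨_, hTe g y⟩)
  have hinj : Function.Injective (T.domRestrict C) := by
    rw [← LinearMap.ker_eq_bot, Submodule.eq_bot_iff]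
    rintro ⟨x, hx⟩ h0
    exact Subtype.ext (Submodule.disjoint_def.1 hcompl.disjoint x h0 hx)
  have hsurj : ∀ x, ∃ y : C, T y = q x := fun x => by
    obtain ⟨y, hy⟩ := hqN x
    have hy1 : y ∈ LinearMap.ker T ⊔ C := hcompl.sup_eq_top ▸ Submodule.mem_top
    obtain ⟨a, ha, b, hb, rfl⟩ := Submodule.mem_sup.1 hy1
    refine ⟨⟨b, hb⟩, ?_⟩
    rw [← hy, map_add, LinearMap.mem_ker.1 ha, zero_add]
  choose s hs using hsurj
  let S : W →ₗ[k] ∀ j, Schur k (μ j) :=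
    { toFun := fun x => s x
      map_add' := fun x y => congrArg Subtype.val (hinj (a₁ := s (x + y)) (a₂ := s x + s y) (by
        rw [map_add]
        change T (s (x + y)) = T (s x) + T (s y)
        rw [hs, hs, hs, map_add]))
      map_smul' := fun a x => congrArg Subtype.val (hinj (a₁ := s (a • x)) (a₂ := a • s x) (by
        rw [map_smul]
        change T (s (a • x)) = a • T (s x)
        rw [hs, hs, map_smul])) }
  have hS : Equi ρ (piRep fun j => schurRep k (μ j)) S := fun g x =>
    congrArg Subtype.val (hinj (a₁ := s (ρ g x)) (a₂ := ⟨_, hC g _ (s x).2⟩) (by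
      change T (s (ρ g x)) = T (piRep (fun j => schurRep k (μ j)) g (s x))
      rw [hs, hTe, hs, hq]))
  refine ⟨ι, inferInstance, μ, fun j => LinearMap.proj j ∘ₗ S, LinearMap.range T, fun j => (equi_proj _ j).comp hS,
    fun g x hx => by obtain ⟨y, rfl⟩ := hx; exact ⟨_, hTe g y⟩, fun x hx => ?_, fun x hx h0 => ?_⟩
  · obtain ⟨y, rfl⟩ := hF x hx
    exact ⟨y, hT y⟩
  · have : S x = 0 := funext h0
    have h1 := hs x
    rw [hqid x hx, show ((s x : C) : ∀ j, Schur k (μ j)) = S x from rfl, this, map_zero] at h1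
    exact h1.symm

end PolyReps

/-! ### Equivariant maps from tensor powers to K ⊗ tensor powers. -/

section BaseChange

variable {k : Type u} [Field k] {K : Type*} [Field K] [Algebra k K]

/-- The action on the field `K`, as a linear representation. -/
def actRep (act : GLinf k →* (K ≃ₐ[k] K)) : Representation k (GLinf k) K where
  toFun g := (act g).toLinearMap
  map_one' := by ext; simp
  map_mul' g h := by ext; simp

@[simp] theorem actRep_apply (act : GLinf k →* (K ≃ₐ[k] K)) (g : GLinf k) (a : K) :
    actRep act g a = act g a := rfl

variable {W : Type*} [AddCommGroup W] [Module k W] {W' : Type*} [AddCommGroup W'] [Module k W']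

/-- The semi-linear representation on `K ⊗ W`. -/
def baseRep (act : GLinf k →* (K ≃ₐ[k] K)) (ρ : Representation k (GLinf k) W) :
    Representation k (GLinf k) (K ⊗[k] W) := (actRep act).tprod ρ

variable {act : GLinf k →* (K ≃ₐ[k] K)} {ρ : Representation k (GLinf k) W}
  {ρ' : Representation k (GLinf k) W'}

@[simp] theorem baseRep_tmul (g : GLinf k) (a : K) (x : W) :
    baseRep act ρ g (a ⊗ₜ x) = act g a ⊗ₜ ρ g x := rfl

theorem baseRep_smul (g : GLinf k) (a : K) (z : K ⊗[k] W) :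
    baseRep act ρ g (a • z) = act g a • baseRep act ρ g z := by
  induction z using TensorProduct.induction_on with
  | zero => simp
  | tmul b x => simp [TensorProduct.smul_tmul']
  | add x y hx hy => simp only [smul_add, map_add, hx, hy]

theorem Equi.lTensor {f : W →ₗ[k] W'} (hf : Equi ρ ρ' f) :
    Equi (baseRep act ρ) (baseRep act ρ') (f.lTensor K) := fun g z => by
  induction z using TensorProduct.induction_on with
  | zero => simp
  | tmul b x => simp [hf g x]
  | add x y hx hy => simp only [map_add, hx, hy]

/-- A vector that is fixed up to conjugation by the path elements is invariant. -/
theorem FixedAt.invariant_of_path {p q₀ : ℕ} {x : W} (hp : FixedAt ρ p x)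
    (h : ∀ q, q₀ ≤ q → ρ (pathGL q 1) x = ρ (pathGL q 0) x) (g : GLinf k) : ρ g x = x := by
  obtain ⟨n, hn⟩ := gl_exists_level g
  let q := max q₀ (max p n)
  have hpq : p ≤ q := (le_max_left _ _).trans (le_max_right _ _)
  let s : GLinf k := pathGL q 0
  have hs : ∀ i < q, s⁻¹.1 (bv k i) = bv k (q + i) := fun i hi => by
    rw [pathGL_inv_apply, zero_smul, add_zero, (blockSwap_eq hi).1]
  have hs' : ∀ i < q, s.1 (bv k (q + i)) = bv k i := fun i hi => by
    rw [pathGL_apply, zero_smul, add_zero, (blockSwap_eq hi).2.2.2.1]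
  have hs2 : ∀ i < q, s⁻¹.1 (bv k (q + i)) = bv k i := fun i hi => by
    rw [pathGL_inv_apply, zero_smul, add_zero, (blockSwap_eq hi).2.2.2.1]
  have cancel : ∀ y z, ρ s y = ρ s z → y = z := fun y z hyz => by
    have := congrArg (ρ s⁻¹) hyz
    rwa [Representation.inv_self_apply, Representation.inv_self_apply] at this
  have h1 : ρ (pathGL q 1) x = ρ s x := h q (le_max_left _ _)
  have h2 : ρ (s⁻¹ * pathGL q 1) x = x := by
    rw [map_mul, Module.End.mul_apply, h1, Representation.inv_self_apply]
  -- Since s⁻¹ interchanges e_i and e_{q+i}, the two elements agree on the first q vectors. Hence s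
  -- fixes x, and conjugation by s moves g off the first q vectors, where it cannot affect x.
  have h3 : ρ (s⁻¹ * pathGL q 1) x = ρ (pathGL q 1) x := hp.congr fun i hi => by
    have hi' := hi.trans_le hpq
    change s⁻¹.1 ((pathGL q 1).1 (bv k i)) = _
    rw [pathGL_bv hi', one_smul, map_add, hs i hi', hs2 i hi', add_comm]
  have h4 : ρ s x = x := by rw [← h1, ← h3, h2]
  have h5 : ρ (s * g * s⁻¹) x = x := hp _ fun i hi => by
    have hi' := hi.trans_le hpq
    change s.1 (g.1 (s⁻¹.1 (bv k i))) = _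
    rw [hs i hi', (hn q ((le_max_right _ _).trans (le_max_right _ _))).2 _ (Nat.le_add_right _ _),
      hs' i hi']
  have h6 : ρ s⁻¹ x = x := cancel _ _ (by rw [Representation.self_inv_apply, h4])
  refine cancel _ _ ?_
  rw [map_mul, map_mul, Module.End.mul_apply, Module.End.mul_apply, h6] at h5
  rw [h5, h4]

variable (K) in
/-- The standard basis of `K ⊗ T(κ)`. -/
def tenBasisK (κ : Type) [Finite κ] : Module.Basis (κ → ℕ) K (K ⊗[k] Ten k κ) :=
  (tenBasis k κ).baseChange K

theorem tenBasisK_apply {κ : Type} [Finite κ] (I : κ → ℕ) :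
    tenBasisK K κ I = (1 : K) ⊗ₜ[k] bten k I := by
  rw [tenBasisK, Module.Basis.baseChange_apply, tenBasis_apply]

theorem tenBasisK_repr_tmul {κ : Type} [Fintype κ] (a : K) (v : κ → Std k) (J : κ → ℕ) :
    (tenBasisK K κ).repr (a ⊗ₜ[k] PiTensorProduct.tprod k v) J = (∏ s, v s (J s)) • a := by
  rw [tenBasisK, Module.Basis.baseChange_repr_tmul, tenBasis_repr_tprod]

theorem eq_sum_tmul_bten {κ : Type} [Finite κ] (z : K ⊗[k] Ten k κ) :
    z = ∑ I ∈ ((tenBasisK K κ).repr z).support, (tenBasisK K κ).repr z I ⊗ₜ[k] bten k I := by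
  conv_lhs => rw [← (tenBasisK K κ).linearCombination_repr z, Finsupp.linearCombination_apply,
    Finsupp.sum]
  refine Finset.sum_congr rfl fun I _ => ?_
  rw [tenBasisK_apply, TensorProduct.smul_tmul', smul_eq_mul, mul_one]

theorem tenBasisK_repr_baseRep {κ : Type} [Fintype κ] (g : GLinf k) (z : K ⊗[k] Ten k κ)
    (J : κ → ℕ) : (tenBasisK K κ).repr (baseRep act (tensorRep k κ) g z) J =
      ∑ I ∈ ((tenBasisK K κ).repr z).support,
        (∏ s, g.1 (bv k (I s)) (J s)) • act g ((tenBasisK K κ).repr z I) := by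
  conv_lhs => rw [eq_sum_tmul_bten z]
  rw [map_sum, map_sum, Finsupp.finsetSum_apply]
  refine Finset.sum_congr rfl fun I _ => ?_
  rw [baseRep_tmul, bten, tensorRep_tprod, tenBasisK_repr_tmul]

/-- As e_i goes to e_{q+i} + t e_i, only the basis tensor at J contributes to these two coordinates,
with factor 1 in the second block and t in each slot of the first. -/
theorem baseRep_pathGL_repr {κ : Type} [Fintype κ] {q : ℕ} (t : k) (z : K ⊗[k] Ten k κ)
    (hq : ∀ I ∈ ((tenBasisK K κ).repr z).support, ∀ s, I s < q) {J : κ → ℕ} (hJ : ∀ s, J s < q) :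
    (tenBasisK K κ).repr (baseRep act (tensorRep k κ) (pathGL q t) z) (fun s => q + J s) =
        act (pathGL q t) ((tenBasisK K κ).repr z J) ∧
      (tenBasisK K κ).repr (baseRep act (tensorRep k κ) (pathGL q t) z) J =
        t ^ Fintype.card κ • act (pathGL q t) ((tenBasisK K κ).repr z J) := by
  classical
  rw [tenBasisK_repr_baseRep, tenBasisK_repr_baseRep]
  have h1 : ∀ I ∈ ((tenBasisK K κ).repr z).support, ∀ s,
      (pathGL q t).1 (bv k (I s)) (q + J s) = if I s = J s then 1 else 0 := by
    intro I hI s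
    have h := hq I hI s
    have h' := hJ s
    rw [pathGL_bv h]
    simp only [Finsupp.add_apply, Finsupp.smul_apply, Finsupp.single_apply, smul_eq_mul]
    rw [if_neg (by omega : ¬ I s = q + J s)]
    simp
  have h2 : ∀ I ∈ ((tenBasisK K κ).repr z).support, ∀ s,
      (pathGL q t).1 (bv k (I s)) (J s) = if I s = J s then t else 0 := by
    intro I hI s
    have h := hq I hI s
    have h' := hJ s
    rw [pathGL_bv h]
    simp only [Finsupp.add_apply, Finsupp.smul_apply, Finsupp.single_apply, smul_eq_mul]
    rw [if_neg (by omega : ¬ q + I s = J s)]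
    simp
  constructor
  · rw [Finset.sum_eq_single J]
    · by_cases hJs : J ∈ ((tenBasisK K κ).repr z).support
      · rw [Finset.prod_eq_one fun s _ => by rw [h1 J hJs, if_pos rfl], one_smul]
      · rw [Finsupp.notMem_support_iff.1 hJs, map_zero, smul_zero]
    · intro I hI hIJ
      obtain ⟨s, hs⟩ := Function.ne_iff.1 hIJ
      rw [Finset.prod_eq_zero (Finset.mem_univ s) (by rw [h1 I hI, if_neg hs]), zero_smul]
    · intro hJs
      rw [Finsupp.notMem_support_iff.1 hJs, map_zero, smul_zero]
  · rw [Finset.sum_eq_single J]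
    · by_cases hJs : J ∈ ((tenBasisK K κ).repr z).support
      · rw [Finset.prod_congr rfl fun s _ => by rw [h2 J hJs, if_pos rfl], Finset.prod_const,
          Finset.card_univ]
      · simp only [Finsupp.notMem_support_iff.1 hJs, map_zero, smul_zero]
    · intro I hI hIJ
      obtain ⟨s, hs⟩ := Function.ne_iff.1 hIJ
      rw [Finset.prod_eq_zero (Finset.mem_univ s) (by rw [h2 I hI, if_neg hs]), zero_smul]
    · intro hJs
      simp only [Finsupp.notMem_support_iff.1 hJs, map_zero, smul_zero]

/-- A bound for the entries of a finite family of multi-indices. -/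
theorem exists_entry_bound {κ : Type} [Fintype κ] (F : Finset (κ → ℕ)) :
    ∃ q, ∀ I ∈ F, ∀ s, I s < q := by
  classical
  refine ⟨F.sup (fun I => Finset.univ.sup I) + 1, fun I hI s => ?_⟩
  exact Nat.lt_succ_of_le ((Finset.le_sup (f := I) (Finset.mem_univ s)).trans
      (Finset.le_sup (f := fun I : κ → ℕ => Finset.univ.sup I) hI))

variable [CharZero k]

omit [CharZero k] in
-- Equivariance allows the path to be applied on the source, to a tensor with |κ| factors each
-- affine in t.
theorem polynomial_of_equi {κ ι : Type} [Fintype κ] [Fintype ι]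
    {f : Ten k κ →ₗ[k] K ⊗[k] Ten k ι} (hf : Equi (tensorRep k κ) (baseRep act (tensorRep k ι)) f)
    (c : κ → ℕ) {q : ℕ} (hq : ∀ s, c s < q) (J : ι → ℕ) :
    ∃ P : Polynomial K, P.natDegree ≤ Fintype.card κ ∧ ∀ t : k, P.eval (algebraMap k K t) =
      (tenBasisK K ι).repr (baseRep act (tensorRep k ι) (pathGL q t) (f (bten k c))) J := by
  classical
  let w : Finset κ → K := fun S => (tenBasisK K ι).repr (f (PiTensorProduct.tprod k
    (S.piecewise (fun s => bv k (c s)) (fun s => bv k (q + c s))))) J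
  refine ⟨∑ S : Finset κ, Polynomial.C (w S) * Polynomial.X ^ S.card, ?_, fun t => ?_⟩
  · refine Polynomial.natDegree_sum_le_of_forall_le _ _ fun S _ => ?_
    exact (Polynomial.natDegree_C_mul_X_pow_le _ _).trans (Finset.card_le_univ S)
  · have h1 : tensorRep k κ (pathGL q t) (bten k c) = PiTensorProduct.tprod k fun s =>
        bv k (q + c s) + t • bv k (c s) := by
      rw [bten, tensorRep_tprod]
      congr 1
      ext s : 1
      rw [pathGL_bv (hq s)]
    rw [← hf, h1, tprod_add_smul, map_sum, map_sum, Finsupp.finsetSum_apply,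
      Polynomial.eval_finsetSum]
    refine Finset.sum_congr rfl fun S _ => ?_
    rw [map_smul, ← algebraMap_smul K, map_smul, Finsupp.smul_apply, smul_eq_mul, map_pow]
    rw [Polynomial.eval_mul, Polynomial.eval_C, Polynomial.eval_pow, Polynomial.eval_X, mul_comm]

theorem infinite_range_algebraMap : (Set.range (algebraMap k K)).Infinite :=
  Set.infinite_range_of_injective (algebraMap k K).injective

/-- Two coordinates of f(p_t e_c) are compared: the one at q + I is the coefficient moved by p_t,
and the one at I is the same times t^|ι|. The latter has degree at most |κ| in t and the former is a
non-zero polynomial; if the degrees agree, the moved coefficient is constant along the path. -/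
theorem equi_leading {κ ι : Type} [Fintype κ] [Fintype ι]
    {f : Ten k κ →ₗ[k] K ⊗[k] Ten k ι} (hf : Equi (tensorRep k κ) (baseRep act (tensorRep k ι)) f)
    {c : κ → ℕ} {I : ι → ℕ} (hI : (tenBasisK K ι).repr (f (bten k c)) I ≠ 0) :
    Fintype.card ι ≤ Fintype.card κ ∧ (Fintype.card ι = Fintype.card κ → ∃ q₀, ∀ q, q₀ ≤ q →
      actRep act (pathGL q 1) ((tenBasisK K ι).repr (f (bten k c)) I) =
        actRep act (pathGL q 0) ((tenBasisK K ι).repr (f (bten k c)) I)) := by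
  obtain ⟨q₁, hq₁⟩ := exists_entry_bound ((tenBasisK K ι).repr (f (bten k c))).support
  obtain ⟨q₂, hq₂⟩ := exists_entry_bound {c}
  have hIs : I ∈ ((tenBasisK K ι).repr (f (bten k c))).support := Finsupp.mem_support_iff.2 hI
  have key : ∀ q, max q₁ q₂ ≤ q → ∃ P Q : Polynomial K, P.natDegree ≤ Fintype.card κ ∧
      (∀ t : k, Q.eval (algebraMap k K t) =
        act (pathGL q t) ((tenBasisK K ι).repr (f (bten k c)) I)) ∧ Q ≠ 0 ∧
      Polynomial.X ^ Fintype.card ι * Q = P := by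
    intro q hq
    have hc : ∀ s, c s < q := fun s =>
      (hq₂ c (Finset.mem_singleton_self c) s).trans_le ((le_max_right _ _).trans hq)
    have hz : ∀ I ∈ ((tenBasisK K ι).repr (f (bten k c))).support, ∀ s, I s < q :=
      fun I hI s => (hq₁ I hI s).trans_le ((le_max_left _ _).trans hq)
    obtain ⟨P, hP, hPt⟩ := polynomial_of_equi hf c hc I
    obtain ⟨Q, -, hQt⟩ := polynomial_of_equi hf c hc (fun s => q + I s)
    have hQ : ∀ t : k, Q.eval (algebraMap k K t) =
        act (pathGL q t) ((tenBasisK K ι).repr (f (bten k c)) I) := fun t => by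
      rw [hQt, (baseRep_pathGL_repr t _ hz (hz I hIs)).1]
    refine ⟨P, Q, hP, hQ, fun h0 => hI ?_, ?_⟩
    · have := hQ 0
      rw [h0, Polynomial.eval_zero] at this
      exact (map_eq_zero_iff _ (act (pathGL q 0)).injective).1 this.symm
    · refine Polynomial.eq_of_infinite_eval_eq _ _
        (Set.Infinite.mono ?_ (infinite_range_algebraMap (k := k)))
      rintro _ ⟨t, rfl⟩
      rw [Set.mem_ofPred_eq, hPt, (baseRep_pathGL_repr t _ hz (hz I hIs)).2, ← hQ,
        Polynomial.eval_mul, Polynomial.eval_pow, Polynomial.eval_X, Algebra.smul_def, map_pow]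
  constructor
  · obtain ⟨P, Q, hP, -, hQ0, hPQ⟩ := key _ le_rfl
    rw [← hPQ, Polynomial.natDegree_X_pow_mul _ hQ0] at hP
    omega
  · intro hcard
    refine ⟨max q₁ q₂, fun q hq => ?_⟩
    obtain ⟨P, Q, hP, hQ, hQ0, hPQ⟩ := key q hq
    rw [← hPQ, Polynomial.natDegree_X_pow_mul _ hQ0] at hP
    have h0 : Q.natDegree = 0 := by omega
    rw [actRep_apply, actRep_apply, ← hQ, ← hQ, Polynomial.eq_C_of_natDegree_eq_zero h0,
      Polynomial.eval_C, Polynomial.eval_C]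

omit [CharZero k] in
theorem exists_repr_ne_zero {κ : Type} [Finite κ] {z : K ⊗[k] Ten k κ} (hz : z ≠ 0) :
    ∃ I, (tenBasisK K κ).repr z I ≠ 0 := by
  by_contra! h
  exact hz ((tenBasisK K κ).repr.map_eq_zero_iff.1 (Finsupp.ext h))

omit [CharZero k] in
theorem equi_eq_of_bten {κ : Type} [Finite κ] {f f' : Ten k κ →ₗ[k] W}
    (hf : Equi (tensorRep k κ) ρ f) (hf' : Equi (tensorRep k κ) ρ f') {c : κ → ℕ}
    (hc : Function.Injective c) (h : f (bten k c) = f' (bten k c)) : f = f' := by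
  have : LinearMap.eqLocus f f' = ⊤ := eq_top_of_bten_mem (fun g x hx => by
    rw [LinearMap.mem_eqLocus] at hx ⊢
    rw [hf, hf', hx]) hc h
  exact LinearMap.ext fun x => (this ▸ Submodule.mem_top : x ∈ LinearMap.eqLocus f f')

theorem card_le_of_equi {κ ι : Type} [Fintype κ] [Fintype ι]
    {f : Ten k κ →ₗ[k] K ⊗[k] Ten k ι} (hf : Equi (tensorRep k κ) (baseRep act (tensorRep k ι)) f)
    (h0 : f ≠ 0) : Fintype.card ι ≤ Fintype.card κ := by
  obtain ⟨c, hc, -⟩ := exists_injective_lt κ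
  have hfc : f (bten k c) ≠ 0 := fun h =>
    h0 (equi_eq_of_bten hf (f' := 0) (fun _ _ => by simp) hc h)
  obtain ⟨I, hI⟩ := exists_repr_ne_zero hfc
  exact (equi_leading hf hI).1

/-- Equivariant maps between tensor powers of the same degree are combinations of permutations. -/
theorem equi_eq_sum_rx {κ ι : Type} [Fintype κ] [Fintype ι] [DecidableEq κ] [DecidableEq ι]
    (hsm : ∀ a : K, ∃ p, FixedAt (actRep act) p a)
    {f : Ten k κ →ₗ[k] K ⊗[k] Ten k ι} (hf : Equi (tensorRep k κ) (baseRep act (tensorRep k ι)) f)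
    (hcard : Fintype.card ι = Fintype.card κ) :
    ∃ a : (κ ≃ ι) → K, (∀ π g, act g (a π) = a π) ∧
      ∀ x, f x = ∑ π, a π ⊗ₜ[k] rx k π x := by
  obtain ⟨c, hc, -⟩ := exists_injective_lt κ
  set z := f (bten k c) with hz
  -- In equal degree every coefficient is constant along the path, hence invariant under the whole
  -- group.
  have hinv : ∀ I g, act g ((tenBasisK K ι).repr z I) = (tenBasisK K ι).repr z I := by
    intro I g
    by_cases hI : (tenBasisK K ι).repr z I = 0
    · rw [hI, map_zero]
    obtain ⟨p, hp⟩ := hsm ((tenBasisK K ι).repr z I)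
    obtain ⟨q₀, hq₀⟩ := (equi_leading hf hI).2 hcard
    exact hp.invariant_of_path hq₀ g
  -- A weight argument: doubling e_{c s} doubles f(e_c). As the coefficients are invariant, a
  -- coordinate whose index misses c s would be both doubled and unchanged.
  have hsupp : ∀ I, (tenBasisK K ι).repr z I ≠ 0 → ∃ π : κ ≃ ι, I = c ∘ π.symm := by
    intro I hI
    have hex : ∀ s, ∃ r, I r = c s := by
      intro s
      obtain ⟨g, hg⟩ := exists_gl_diag (k := k) {c s} (two_ne_zero (α := k))
      have h1 : tensorRep k κ g (bten k c) = (2 : k) • bten k c := by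
        have h := (PiTensorProduct.tprod k (s := fun _ : κ => Std k)).map_smul_univ
          (fun r => if r = s then (2 : k) else 1) (fun r => bv k (c r))
        rw [Finset.prod_ite_eq' Finset.univ s, if_pos (Finset.mem_univ s)] at h
        rw [bten, tensorRep_tprod, ← h]
        congr 1
        ext r : 1
        rw [hg]
        by_cases hr : r = s
        · subst hr; simp
        · simp [hr, hc.eq_iff]
      by_contra! hcon
      have hgd : ∀ i j, g.1 (bv k i) j = 0 ∨ i = j := fun i j => by
        by_cases hij : i = j
        · exact Or.inr hij
        · left
          rw [hg]
          split_ifs <;> simp [hij]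
      have h2 := tenBasisK_repr_baseRep (act := act) g z I
      rw [hz, ← hf, h1, map_smul, ← algebraMap_smul K, map_smul, Finsupp.smul_apply, ← hz,
        Finset.sum_eq_single I] at h2
      · rw [Finset.prod_eq_one (fun r _ => by
          rw [hg, if_neg (by simpa using hcon r), Finsupp.single_eq_same]), one_smul, hinv,
          smul_eq_mul, map_ofNat, two_mul, add_eq_left] at h2
        exact hI h2
      · intro I' _ hI'
        obtain ⟨r, hr⟩ := Function.ne_iff.1 hI'
        rw [Finset.prod_eq_zero (Finset.mem_univ r) ((hgd _ _).resolve_right hr), zero_smul]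
      · intro h
        exact absurd (Finsupp.mem_support_iff.2 hI) h
    choose σ hσ using hex
    have hσi : Function.Injective σ := fun a b h => hc (by rw [← hσ a, ← hσ b, h])
    let π : κ ≃ ι := Equiv.ofBijective σ
      ((Fintype.bijective_iff_injective_and_card σ).2 ⟨hσi, hcard.symm⟩)
    refine ⟨π, funext fun r => ?_⟩
    have := hσ (π.symm r)
    rw [show σ (π.symm r) = r from π.apply_symm_apply r] at this
    exact this
  refine ⟨fun π => (tenBasisK K ι).repr z (c ∘ π.symm), fun π g => hinv _ g, ?_⟩
  let f' : Ten k κ →ₗ[k] K ⊗[k] Ten k ι := ∑ π : κ ≃ ι,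
    (TensorProduct.mk k K (Ten k ι) ((tenBasisK K ι).repr z (c ∘ π.symm))) ∘ₗ rx k π
  have hf'x : ∀ x, f' x = ∑ π : κ ≃ ι, (tenBasisK K ι).repr z (c ∘ π.symm) ⊗ₜ[k] rx k π x :=
    fun x => by simp [f']
  have hf' : Equi (tensorRep k κ) (baseRep act (tensorRep k ι)) f' := fun g x => by
    rw [hf'x, hf'x, map_sum]
    refine Finset.sum_congr rfl fun π _ => ?_
    rw [baseRep_tmul, hinv, rx_equi]
  have : f = f' := by
    refine equi_eq_of_bten hf hf' hc ?_
    rw [← hz, hf'x]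
    conv_lhs => rw [eq_sum_tmul_bten z]
    symm
    refine Finset.sum_bij_ne_zero (fun π _ _ => c ∘ π.symm) ?_ ?_ ?_ ?_
    · intro π _ h
      rw [Finsupp.mem_support_iff]
      intro h0
      rw [h0, TensorProduct.zero_tmul] at h
      exact h rfl
    · intro π _ _ π' _ _ h
      have : π.symm = π'.symm := Equiv.ext fun s => hc (congrFun h s)
      exact Equiv.symm_bijective.injective this
    · intro I hI _
      obtain ⟨π, rfl⟩ := hsupp I (Finsupp.mem_support_iff.1 hI)
      refine ⟨π, Finset.mem_univ _, fun h => ?_, rfl⟩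
      rename_i h'
      rw [rx_bten] at h
      exact h' h
    · intro π _ _
      rw [rx_bten]
  intro x
  rw [this, hf'x]

end BaseChange

/-! ### Maps between Schur functors over K. -/

section SchurBase

variable {k : Type u} [Field k] [CharZero k] {K : Type*} [Field K] [Algebra k K]
  {act : GLinf k →* (K ≃ₐ[k] K)}

/-- Doubling all the basis vectors involved multiplies the source by 2^|κ| and the target coordinate
by 2^|ι|, while the coefficients do not move. -/
theorem card_eq_of_equi_trivial (hact : ∀ g a, act g a = a) {κ ι : Type} [Fintype κ] [Fintype ι]
    {f : Ten k κ →ₗ[k] K ⊗[k] Ten k ι} (hf : Equi (tensorRep k κ) (baseRep act (tensorRep k ι)) f)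
    (h0 : f ≠ 0) : Fintype.card ι = Fintype.card κ := by
  obtain ⟨c, hc, -⟩ := exists_injective_lt κ
  have hfc : f (bten k c) ≠ 0 := fun h =>
    h0 (equi_eq_of_bten hf (f' := 0) (fun _ _ => by simp) hc h)
  obtain ⟨I, hI⟩ := exists_repr_ne_zero hfc
  obtain ⟨q₁, hq₁⟩ := exists_entry_bound ((tenBasisK K ι).repr (f (bten k c))).support
  obtain ⟨q₂, hq₂⟩ := exists_entry_bound {c}
  obtain ⟨g, hg⟩ := exists_gl_diag (k := k) (Finset.range (max q₁ q₂)) (two_ne_zero (α := k))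
  have h1 : tensorRep k κ g (bten k c) = (2 : k) ^ Fintype.card κ • bten k c := by
    have h := (PiTensorProduct.tprod k (s := fun _ : κ => Std k)).map_smul_univ
      (fun _ => (2 : k)) (fun r => bv k (c r))
    rw [Finset.prod_const, Finset.card_univ] at h
    rw [bten, tensorRep_tprod, ← h]
    congr 1
    ext r : 1
    rw [hg, if_pos (Finset.mem_range.2 ((hq₂ c (Finset.mem_singleton_self c) r).trans_le
      (le_max_right _ _)))]
  have hIs : I ∈ ((tenBasisK K ι).repr (f (bten k c))).support := Finsupp.mem_support_iff.2 hI
  have hgd : ∀ i j, g.1 (bv k i) j = 0 ∨ i = j := fun i j => by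
    by_cases hij : i = j
    · exact Or.inr hij
    · left
      rw [hg]
      split_ifs <;> simp [hij]
  have h2 := tenBasisK_repr_baseRep (act := act) g (f (bten k c)) I
  rw [← hf, h1, map_smul, ← algebraMap_smul K, map_smul, Finsupp.smul_apply,
    Finset.sum_eq_single I] at h2
  · have h3 : ∀ r, g.1 (bv k (I r)) (I r) = 2 := fun r => by
      rw [hg, if_pos (Finset.mem_range.2 ((hq₁ I hIs r).trans_le (le_max_left _ _)))]
      simp
    simp only [h3, Finset.prod_const, Finset.card_univ] at h2
    rw [hact, ← algebraMap_smul K ((2 : k) ^ Fintype.card ι), smul_eq_mul, smul_eq_mul] at h2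
    have h4 := (algebraMap k K).injective (mul_right_cancel₀ hI h2)
    have h5 : (2 : ℕ) ^ Fintype.card κ = 2 ^ Fintype.card ι := by exact_mod_cast h4
    exact (Nat.pow_right_injective le_rfl h5).symm
  · intro I' _ hI'
    obtain ⟨r, hr⟩ := Function.ne_iff.1 hI'
    rw [Finset.prod_eq_zero (Finset.mem_univ r) ((hgd _ _).resolve_right hr), zero_smul]
  · intro h
    exact absurd hIs h

variable {μ ν : YoungDiagram} {f : Schur k μ →ₗ[k] K ⊗[k] Schur k ν}

variable (f) in
/-- The map of tensor powers induced by a map of Schur functors. -/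
def tenOfSchur : Ten k μ.cells →ₗ[k] K ⊗[k] Ten k ν.cells :=
  (ofSchur k ν).lTensor K ∘ₗ f ∘ₗ toSchur k μ

omit [CharZero k] in
theorem lTensor_ofSchur_injective : Function.Injective ((ofSchur k ν).lTensor K) :=
  Module.Flat.lTensor_preserves_injective_linearMap _ Subtype.val_injective

omit [CharZero k] in
theorem tenOfSchur_equi (hf : Equi (schurRep k μ) (baseRep act (schurRep k ν)) f) :
    Equi (tensorRep k μ.cells) (baseRep act (tensorRep k ν.cells)) (tenOfSchur f) :=
  (Equi.lTensor (ofSchur_equi ν)).comp (hf.comp (toSchur_equi μ))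

omit [CharZero k] in
theorem tenOfSchur_ne_zero (h0 : f ≠ 0) : tenOfSchur f ≠ 0 := fun h => h0 (by
  refine LinearMap.ext fun v => ?_
  obtain ⟨x, rfl⟩ := toSchur_surjective μ v
  refine lTensor_ofSchur_injective ?_
  rw [LinearMap.zero_apply, map_zero]
  exact LinearMap.congr_fun h x)

omit [CharZero k] in
theorem card_cells (μ : YoungDiagram) : Fintype.card μ.cells = μ.card := Fintype.card_coe _

theorem schur_card_le (hf : Equi (schurRep k μ) (baseRep act (schurRep k ν)) f) (h0 : f ≠ 0) :
    ν.card ≤ μ.card := by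
  rw [← card_cells, ← card_cells]
  exact card_le_of_equi (tenOfSchur_equi hf) (tenOfSchur_ne_zero h0)

theorem schur_card_eq_of_trivial (hact : ∀ g a, act g a = a)
    (hf : Equi (schurRep k μ) (baseRep act (schurRep k ν)) f) (h0 : f ≠ 0) :
    ν.card = μ.card := by
  rw [← card_cells, ← card_cells]
  exact card_eq_of_equi_trivial hact (tenOfSchur_equi hf) (tenOfSchur_ne_zero h0)

/-- Both Young symmetrizers square to non-zero multiples of themselves, so up to a non-zero scalar f
can be sandwiched between them. A product of symmetrizers then appears in every term, ready for
orthogonality when μ ≠ ν and for von Neumann's lemma when μ = ν. -/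
theorem tenOfSchur_formula (hsm : ∀ a : K, ∃ p, FixedAt (actRep act) p a)
    (hf : Equi (schurRep k μ) (baseRep act (schurRep k ν)) f) (hcard : ν.card = μ.card) :
    ∃ (a : (μ.cells ≃ ν.cells) → K) (r : k), r ≠ 0 ∧ (∀ π g, act g (a π) = a π) ∧
      ∀ x, r • tenOfSchur f x = ∑ π, a π ⊗ₜ[k] rx k π (permEnd k _
        (youngElt k π * youngElt k (Equiv.refl μ.cells)) x) := by
  classical
  obtain ⟨a, ha, hfa⟩ := equi_eq_sum_rx hsm (tenOfSchur_equi hf)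
    (by rw [card_cells, card_cells, hcard])
  obtain ⟨r, hr, hyr⟩ := youngElt_sq (k := k) (Equiv.refl μ.cells)
  obtain ⟨s, hs, hys⟩ := youngElt_sq (k := k) (Equiv.refl ν.cells)
  refine ⟨a, s * r, mul_ne_zero hs hr, ha, fun x => ?_⟩
  have h1 : tenOfSchur f (youngSymmetrizer k μ x) = r • tenOfSchur f x := by
    have : toSchur k μ (youngSymmetrizer k μ x) = r • toSchur k μ x := Subtype.ext (by
      change youngSymmetrizer k μ (youngSymmetrizer k μ x) = r • youngSymmetrizer k μ x
      rw [youngSymmetrizer_eq, ← permEnd_mul_apply, hyr, map_smul]; rfl)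
    rw [tenOfSchur, LinearMap.comp_apply, LinearMap.comp_apply, this, map_smul, map_smul]
    rfl
  have h2 : ∀ z : K ⊗[k] Schur k ν, (youngSymmetrizer k ν).lTensor K ((ofSchur k ν).lTensor K z) =
      s • (ofSchur k ν).lTensor K z := fun z => by
    induction z using TensorProduct.induction_on with
    | zero => simp
    | tmul b v =>
      obtain ⟨x, rfl⟩ := toSchur_surjective ν v
      rw [LinearMap.lTensor_tmul, LinearMap.lTensor_tmul, ← TensorProduct.tmul_smul]
      congr 1
      change youngSymmetrizer k ν (youngSymmetrizer k ν x) = s • youngSymmetrizer k ν x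
      rw [youngSymmetrizer_eq, ← permEnd_mul_apply, hys, map_smul]; rfl
    | add x y hx hy => rw [map_add, map_add, hx, hy, smul_add]
  have h3 := h2 (f (toSchur k μ (youngSymmetrizer k μ x)))
  change (youngSymmetrizer k ν).lTensor K (tenOfSchur f (youngSymmetrizer k μ x)) =
    s • tenOfSchur f (youngSymmetrizer k μ x) at h3
  rw [h1, smul_smul] at h3
  rw [← h3, ← h1, hfa, map_sum]
  refine Finset.sum_congr rfl fun π _ => ?_
  rw [LinearMap.lTensor_tmul, permEnd_mul_apply, permEnd_youngElt π, ← youngSymmetrizer_eq]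
  congr 1
  exact (rx_rx_symm π _).symm

/-- Maps between distinct Schur functors of the same degree vanish. -/
theorem schur_eq_zero_of_ne (hsm : ∀ a : K, ∃ p, FixedAt (actRep act) p a)
    (hf : Equi (schurRep k μ) (baseRep act (schurRep k ν)) f) (hcard : ν.card = μ.card)
    (hne : μ ≠ ν) : f = 0 := by
  classical
  obtain ⟨a, r, hr, -, h⟩ := tenOfSchur_formula hsm hf hcard
  by_contra h0
  refine tenOfSchur_ne_zero h0 (LinearMap.ext fun x => ?_)
  have := h x
  simp only [youngElt_mul_youngElt_of_ne hne.symm, map_zero, LinearMap.zero_apply,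
    TensorProduct.tmul_zero, Finset.sum_const_zero] at this
  exact (smul_eq_zero.1 this).resolve_left hr

/-- The endomorphisms of a Schur functor over `K` are invariant scalars. -/
theorem schur_eq_tmul (hsm : ∀ a : K, ∃ p, FixedAt (actRep act) p a)
    {f : Schur k μ →ₗ[k] K ⊗[k] Schur k μ}
    (hf : Equi (schurRep k μ) (baseRep act (schurRep k μ)) f) :
    ∃ b : K, (∀ g, act g b = b) ∧ ∀ v, f v = b ⊗ₜ v := by
  classical
  obtain ⟨a, r, hr, ha, h⟩ := tenOfSchur_formula hsm hf rfl
  have hy : ∀ π : μ.cells ≃ μ.cells, ∃ s : k, ∀ x,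
      rx k π (permEnd k _ (youngElt k π * youngElt k (Equiv.refl μ.cells)) x) =
        s • youngSymmetrizer k μ x := by
    intro π
    obtain ⟨s, hs⟩ := youngElt_mul_mul_youngElt (k := k) (Equiv.refl μ.cells)
      (MonoidAlgebra.of k _ π)
    refine ⟨s, fun x => ?_⟩
    rw [permEnd_mul_apply, permEnd_youngElt π]
    rw [LinearMap.comp_apply, rx_rx_symm, youngSymmetrizer_eq, LinearMap.comp_apply,
      ← permEnd_of, ← permEnd_mul_apply, ← permEnd_mul_apply, hs, map_smul]
    rfl
  choose s hs using hy
  refine ⟨∑ π, (r⁻¹ * s π) • a π, fun g => ?_, fun v => ?_⟩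
  · rw [map_sum]
    exact Finset.sum_congr rfl fun π _ => by rw [map_smul, ha]
  · obtain ⟨x, rfl⟩ := toSchur_surjective μ v
    refine lTensor_ofSchur_injective ?_
    have h1 := h x
    simp only [hs] at h1
    have h2 := congrArg (r⁻¹ • ·) h1
    simp only [inv_smul_smul₀ hr, Finset.smul_sum] at h2
    refine h2.trans ?_
    rw [TensorProduct.sum_tmul, map_sum]
    refine Finset.sum_congr rfl fun π _ => ?_
    rw [LinearMap.lTensor_tmul, TensorProduct.tmul_smul, smul_smul, TensorProduct.smul_tmul']
    rfl

end SchurBase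

/-! ### Subspaces generated in bounded degree, and their behaviour under shifts. -/

section Generators

variable {k : Type u} [Field k] {K : Type u} [Field K] [Algebra k K]
  {M : Type u} [AddCommGroup M] [Module K M] [Module k M] [IsScalarTower k K M]

/-- Semi-linearity of a representation on a `K`-vector space. -/
def Semi (act : GLinf k →* (K ≃ₐ[k] K)) (ρ : Representation k (GLinf k) M) : Prop :=
  ∀ g (a : K) x, ρ g (a • x) = act g a • ρ g x

theorem Semi.shift {act : GLinf k →* (K ≃ₐ[k] K)} {ρ : Representation k (GLinf k) M}
    (h : Semi act ρ) (n : ℕ) : Semi (act.comp (shiftHom n)) (shiftRep ρ n) := fun g a x => h _ a x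

theorem Semi.map_span {act : GLinf k →* (K ≃ₐ[k] K)} {ρ : Representation k (GLinf k) M}
    (h : Semi act ρ) {S : Set M} {N : Submodule K M} {g : GLinf k} (hS : ∀ x ∈ S, ρ g x ∈ N)
    {x : M} (hx : x ∈ Submodule.span K S) : ρ g x ∈ N := by
  induction hx using Submodule.span_induction with
  | mem x hx => exact hS x hx
  | zero => rw [map_zero]; exact N.zero_mem
  | add x y _ _ hx hy => rw [map_add]; exact N.add_mem hx hy
  | smul a x _ hx => rw [h]; exact N.smul_mem _ hx

theorem Semi.map_sup {act : GLinf k →* (K ≃ₐ[k] K)} {ρ : Representation k (GLinf k) M}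
    {N N' P : Submodule K M} {g : GLinf k} (hN : ∀ x ∈ N, ρ g x ∈ P) (hN' : ∀ x ∈ N', ρ g x ∈ P)
    {x : M} (hx : x ∈ N ⊔ N') : ρ g x ∈ P := by
  obtain ⟨a, ha, b, hb, rfl⟩ := Submodule.mem_sup.1 hx
  rw [map_add]
  exact P.add_mem (hN a ha) (hN' b hb)

variable (K) in
/-- The `K`-span of the image of a `k`-linear map. -/
def rspan {V : Type*} [AddCommGroup V] [Module k V] (f : V →ₗ[k] M) : Submodule K M :=
  Submodule.span K (Set.range f)

theorem mem_rspan {V : Type*} [AddCommGroup V] [Module k V] (f : V →ₗ[k] M) (x : V) :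
    f x ∈ rspan K f := Submodule.subset_span ⟨x, rfl⟩

theorem rspan_le {V : Type*} [AddCommGroup V] [Module k V] {f : V →ₗ[k] M} {N : Submodule K M}
    (h : ∀ x, f x ∈ N) : rspan K f ≤ N := Submodule.span_le.2 (by
  rintro _ ⟨x, rfl⟩; exact h x)

variable {V : Type*} [AddCommGroup V] [Module k V] {τ : Representation k (GLinf k) V}

theorem rspan_stable {act : GLinf k →* (K ≃ₐ[k] K)} {ρ : Representation k (GLinf k) M}
    (h : Semi act ρ) {f : V →ₗ[k] M} (hf : Equi τ ρ f) {g : GLinf k} {x : M}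
    (hx : x ∈ rspan K f) : ρ g x ∈ rspan K f :=
  h.map_span (by rintro _ ⟨y, rfl⟩; rw [← hf]; exact mem_rspan f _) hx

variable (K) in
/-- Subspaces generated by finitely many maps from tensor powers of degree less than `d`. -/
inductive LowGen (ρ : Representation k (GLinf k) M) (d : ℕ) : Submodule K M → Prop
  | bot : LowGen ρ d ⊥
  | sup {N : Submodule K M} (hN : LowGen ρ d N) {κ : Type} [Fintype κ] (f : Ten k κ →ₗ[k] M)
      (hcard : Fintype.card κ < d) (hf : Equi (tensorRep k κ) ρ f) : LowGen ρ d (N ⊔ rspan K f)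

/-- Subspaces generated by `m` maps from Schur functors of degree `d`, and finitely many maps from
tensor powers of smaller degree. -/
inductive TopGen (ρ : Representation k (GLinf k) M) (d : ℕ) : ℕ → Submodule K M → Prop
  | low {N : Submodule K M} (hN : LowGen K ρ d N) : TopGen ρ d 0 N
  | sup {m : ℕ} {N : Submodule K M} (hN : TopGen ρ d m N) {μ : YoungDiagram}
      (f : Schur k μ →ₗ[k] M) (hcard : μ.card = d) (hf : Equi (schurRep k μ) ρ f) :
      TopGen ρ d (m + 1) (N ⊔ rspan K f)

variable {ρ : Representation k (GLinf k) M} {d : ℕ}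

theorem LowGen.sup_low {N N' : Submodule K M} (hN : LowGen K ρ d N) (hN' : LowGen K ρ d N') :
    LowGen K ρ d (N ⊔ N') := by
  induction hN' with
  | bot => rwa [sup_bot_eq]
  | sup hN' f hcard hf ih => rw [← sup_assoc]; exact LowGen.sup ih f hcard hf

theorem LowGen.rspan {κ : Type} [Fintype κ] {f : Ten k κ →ₗ[k] M} (hcard : Fintype.card κ < d)
    (hf : Equi (tensorRep k κ) ρ f) : LowGen K ρ d (GLStruct.rspan K f) := by
  simpa using LowGen.sup LowGen.bot f hcard hf

theorem LowGen.finset_sup {ι : Type*} (s : Finset ι) {N : ι → Submodule K M}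
    (h : ∀ i ∈ s, LowGen K ρ d (N i)) : LowGen K ρ d (s.sup N) := by
  classical
  induction s using Finset.induction_on with
  | empty => exact LowGen.bot
  | insert i s _ ih =>
    rw [Finset.sup_insert]
    exact (h i (Finset.mem_insert_self i s)).sup_low
      (ih fun j hj => h j (Finset.mem_insert_of_mem hj))

theorem LowGen.stable {act : GLinf k →* (K ≃ₐ[k] K)} (hρ : Semi act ρ) {N : Submodule K M}
    (hN : LowGen K ρ d N) (g : GLinf k) : ∀ x ∈ N, ρ g x ∈ N := by
  induction hN with
  | bot => intro x hx; rw [(Submodule.mem_bot K).1 hx, map_zero]; exact Submodule.zero_mem _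
  | sup hN f hcard hf ih =>
    exact fun x hx => Semi.map_sup (act := act) (fun x hx => Submodule.mem_sup_left (ih x hx))
      (fun x hx => Submodule.mem_sup_right (rspan_stable hρ hf hx)) hx

theorem TopGen.stable {act : GLinf k →* (K ≃ₐ[k] K)} (hρ : Semi act ρ) {m : ℕ}
    {N : Submodule K M} (hN : TopGen ρ d m N) (g : GLinf k) : ∀ x ∈ N, ρ g x ∈ N := by
  induction hN with
  | low hN => exact hN.stable hρ g
  | sup hN f hcard hf ih =>
    exact fun x hx => Semi.map_sup (act := act) (fun x hx => Submodule.mem_sup_left (ih x hx))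
      (fun x hx => Submodule.mem_sup_right (rspan_stable hρ hf hx)) hx

theorem TopGen.sup_low {m : ℕ} {N N' : Submodule K M} (hN : TopGen ρ d m N)
    (hN' : LowGen K ρ d N') : TopGen ρ d m (N ⊔ N') := by
  induction hN with
  | low hN => exact TopGen.low (hN.sup_low hN')
  | sup hN f hcard hf ih => rw [sup_right_comm]; exact TopGen.sup ih f hcard hf

/-- Restriction along a shift of a map from a tensor power: the part with at least one small index
has smaller degree. -/
theorem exists_lowGen_shift {κ : Type} [Fintype κ] {f : Ten k κ →ₗ[k] M}
    (hf : Equi (tensorRep k κ) ρ f) (n : ℕ) :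
    ∃ N : Submodule K M, LowGen K (shiftRep ρ n) (Fintype.card κ) N ∧ N ≤ rspan K f ∧
      ∀ I : κ → ℕ, (∃ s, I s < n) → f (bten k I) ∈ N := by
  classical
  let A : Finset (κ → Fin (n + 1)) := Finset.univ.filter fun J => ∃ s, (J s : ℕ) < n
  refine ⟨A.sup fun J => rspan K (f ∘ₗ insMap k n fun s => (J s : ℕ)),
    LowGen.finset_sup _ fun J hJ => ?_, Finset.sup_le fun J _ => rspan_le fun x => mem_rspan f _,
    fun I hI => ?_⟩
  · refine LowGen.rspan ?_ ((hf.shift n).comp (insMap_equi n _))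
    obtain ⟨s, hs⟩ := (Finset.mem_filter.1 hJ).2
    exact Fintype.card_subtype_lt (x := s) (by simpa using hs)
  · let J : κ → Fin (n + 1) := fun s => ⟨min (I s) n, by omega⟩
    have hJ : J ∈ A := Finset.mem_filter.2 ⟨Finset.mem_univ _, hI.imp fun s hs => by
      simpa [J] using hs⟩
    refine Finset.le_sup (f := fun J : κ → Fin (n + 1) =>
      rspan K (f ∘ₗ insMap k n fun s => (J s : ℕ))) hJ ?_
    rw [← insMap_bten (J := fun s => (J s : ℕ)) (I := I) (n := n) fun s => rfl]
    exact mem_rspan (f ∘ₗ insMap k n fun s => (J s : ℕ)) _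

theorem mem_of_forall_bten {κ : Type} [Finite κ] {f : Ten k κ →ₗ[k] M} {N : Submodule K M}
    (h : ∀ I, f (bten k I) ∈ N) (x : Ten k κ) : f x ∈ N := by
  rw [← (tenBasis k κ).linearCombination_repr x, Finsupp.linearCombination_apply, Finsupp.sum,
    map_sum]
  refine N.sum_mem fun I _ => ?_
  rw [map_smul, ← algebraMap_smul K, tenBasis_apply]
  exact N.smul_mem _ (h I)

theorem bten_eq_tmap_tau {κ : Type} {n : ℕ} {I : κ → ℕ} (h : ∀ s, n ≤ I s) :
    bten k I = tmap κ (tau k n) (bten k fun s => I s - n) := by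
  rw [bten, bten, tmap_tprod]
  congr 1
  ext s : 1
  rw [tau_bv]
  congr 1
  have := h s
  omega

theorem LowGen.mono {d' : ℕ} (hd : d ≤ d') {N : Submodule K M} (hN : LowGen K ρ d N) :
    LowGen K ρ d' N := by
  induction hN with
  | bot => exact LowGen.bot
  | sup hN f hcard hf ih => exact LowGen.sup ih f (hcard.trans_le hd) hf

/-- Basis tensors with all indices at least n are shifts of tensors of the same degree. The others
come from tensor powers with fewer factors, so the degree bound persists. -/
theorem LowGen.shift (n : ℕ) {N : Submodule K M} (hN : LowGen K ρ d N) :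
    LowGen K (shiftRep ρ n) d N := by
  induction hN with
  | bot => exact LowGen.bot
  | @sup N hN κ _ f hcard hf ih =>
    obtain ⟨N', hN', hle, hI⟩ := exists_lowGen_shift (K := K) hf n
    have : GLStruct.rspan K f = N' ⊔ GLStruct.rspan K (f ∘ₗ tmap κ (tau k n)) := by
      refine le_antisymm (rspan_le (mem_of_forall_bten fun I => ?_)) (sup_le hle
        (rspan_le fun x => mem_rspan f _))
      by_cases h : ∃ s, I s < n
      · exact Submodule.mem_sup_left (hI I h)
      · push Not at h
        rw [bten_eq_tmap_tau h]
        exact Submodule.mem_sup_right (mem_rspan (f ∘ₗ tmap κ (tau k n)) _)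
    rw [this, ← sup_assoc]
    exact LowGen.sup (ih.sup_low (hN'.mono hcard.le)) _ hcard ((hf.shift n).comp (tmap_tau_equi κ n))

theorem permEnd_tmap {κ : Type} (f : Std k →ₗ[k] Std k) (z : MonoidAlgebra k (Equiv.Perm κ))
    (x : Ten k κ) : permEnd k κ z (tmap κ f x) = tmap κ f (permEnd k κ z x) := by
  induction z using MonoidAlgebra.induction_on with
  | of p =>
    rw [permEnd_of]
    refine LinearMap.congr_fun (f := rx k p ∘ₗ tmap κ f) (g := tmap κ f ∘ₗ rx k p)
      (ten_ext fun v => ?_) x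
    simp only [LinearMap.comp_apply, tmap_tprod, rx_tprod]
  | add y z hy hz => simp only [map_add, LinearMap.add_apply, hy, hz]
  | smul r z hz => simp only [map_smul, LinearMap.smul_apply, hz]

variable (k) in
/-- The action of the shift on a Schur functor. -/
def schurTau (n : ℕ) (μ : YoungDiagram) : Schur k μ →ₗ[k] Schur k μ :=
  (tmap μ.cells (tau k n)).restrict (by
    rintro _ ⟨y, rfl⟩
    exact ⟨tmap _ (tau k n) y, by rw [youngSymmetrizer_eq, permEnd_tmap]⟩)

theorem schurTau_toSchur (n : ℕ) (μ : YoungDiagram) (x : Ten k μ.cells) :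
    schurTau k n μ (toSchur k μ x) = toSchur k μ (tmap _ (tau k n) x) := Subtype.ext (by
  change tmap _ (tau k n) (youngSymmetrizer k μ x) = youngSymmetrizer k μ (tmap _ (tau k n) x)
  rw [youngSymmetrizer_eq, permEnd_tmap])

theorem schurTau_equi (n : ℕ) (μ : YoungDiagram) :
    Equi (schurRep k μ) (shiftRep (schurRep k μ) n) (schurTau k n μ) := fun g x =>
  Subtype.ext (tmap_tau_equi _ n g x.1)

/-- Restriction along a shift of a map from a Schur functor. -/
theorem exists_lowGen_shift_schur {μ : YoungDiagram} {f : Schur k μ →ₗ[k] M}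
    (hf : Equi (schurRep k μ) ρ f) (n : ℕ) :
    ∃ N : Submodule K M, LowGen K (shiftRep ρ n) μ.card N ∧
      rspan K f = N ⊔ rspan K (f ∘ₗ schurTau k n μ) ∧
      ∀ I : μ.cells → ℕ, (∃ s, I s < n) → f (toSchur k μ (bten k I)) ∈ N := by
  obtain ⟨N, hN, hle, hI⟩ := exists_lowGen_shift (K := K) hf.comp_toSchur n
  rw [card_cells] at hN
  refine ⟨N, hN, le_antisymm (rspan_le fun x => ?_) (sup_le (hle.trans
    (rspan_le fun x => mem_rspan f _)) (rspan_le fun x => mem_rspan f _)), hI⟩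
  obtain ⟨x, rfl⟩ := toSchur_surjective μ x
  refine mem_of_forall_bten (f := f ∘ₗ toSchur k μ) (fun I => ?_) x
  by_cases h : ∃ s, I s < n
  · exact Submodule.mem_sup_left (hI I h)
  · push Not at h
    rw [bten_eq_tmap_tau h, LinearMap.comp_apply, ← schurTau_toSchur]
    exact Submodule.mem_sup_right (mem_rspan (f ∘ₗ schurTau k n μ) _)

/-- The number m of top-degree generators does not grow: each remains one generator, and what its
restriction adds has lower degree. The induction on m in `TopGen.embeds` depends on this. -/
theorem TopGen.shift (n : ℕ) {m : ℕ} {N : Submodule K M} (hN : TopGen ρ d m N) :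
    TopGen (shiftRep ρ n) d m N := by
  induction hN with
  | low hN => exact TopGen.low (hN.shift n)
  | @sup m N hN μ f hcard hf ih =>
    obtain ⟨N', hN', he, -⟩ := exists_lowGen_shift_schur (K := K) hf n
    rw [he, ← sup_assoc]
    exact TopGen.sup (ih.sup_low (hcard ▸ hN')) _ hcard ((hf.shift n).comp (schurTau_equi n μ))

/-- One basis tensor with distinct entries generates the tensor power, so it is enough to cover that
tensor. -/
theorem exists_finite_schur_span [CharZero k] (κ : Type) [Fintype κ] :
    ∃ (ι : Type) (_ : Fintype ι) (μ : ι → YoungDiagram) (f : ∀ j, Schur k (μ j) →ₗ[k] Ten k κ),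
      (∀ j, (μ j).card = Fintype.card κ) ∧ (∀ j, Equi (schurRep k (μ j)) (tensorRep k κ) (f j)) ∧
        ∀ x, ∃ y : ∀ j, Schur k (μ j), x = ∑ j, f j (y j) := by
  obtain ⟨c, hc, -⟩ := exists_injective_lt κ
  obtain ⟨ι, _, μ, f, hμ, hf, hy⟩ := exists_finite_schur_cover (mem_span_schur (bten k c))
  refine ⟨ι, inferInstance, μ, f, hμ, hf, fun x => ?_⟩
  let T : (∀ j, Schur k (μ j)) →ₗ[k] Ten k κ := ∑ j, f j ∘ₗ LinearMap.proj j
  have hT : ∀ y, T y = ∑ j, f j (y j) := fun y => by simp [T]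
  have : LinearMap.range T = ⊤ := eq_top_of_bten_mem (by
    rintro g _ ⟨y, rfl⟩
    refine ⟨piRep (fun j => schurRep k (μ j)) g y, ?_⟩
    rw [hT, hT, map_sum]
    exact Finset.sum_congr rfl fun j _ => hf j g _) hc (by
    obtain ⟨y, hy⟩ := hy
    exact ⟨y, (hT y).trans hy.symm⟩)
  obtain ⟨y, hy⟩ := (this ▸ Submodule.mem_top : x ∈ LinearMap.range T)
  exact ⟨y, hy.symm.trans (hT y)⟩

theorem TopGen.finset_sup {m : ℕ} {N : Submodule K M} (hN : TopGen ρ d m N) {ι : Type*}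
    (s : Finset ι) {μ : ι → YoungDiagram} (f : ∀ j, Schur k (μ j) →ₗ[k] M)
    (hcard : ∀ j, (μ j).card = d) (hf : ∀ j, Equi (schurRep k (μ j)) ρ (f j)) :
    ∃ m', TopGen ρ d m' (N ⊔ s.sup fun j => GLStruct.rspan K (f j)) := by
  classical
  induction s using Finset.induction_on with
  | empty => exact ⟨m, by simpa using hN⟩
  | insert i s _ ih =>
    obtain ⟨m', ih⟩ := ih
    refine ⟨m' + 1, ?_⟩
    rw [Finset.sup_insert, sup_comm (rspan K (f i)), ← sup_assoc]
    exact TopGen.sup ih (f i) (hcard i) (hf i)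

/-- Tensor powers of degree exactly d are replaced by Schur functors, whose irreducibility the
degeneration argument needs. This drives the induction on the degree. -/
theorem LowGen.exists_topGen [CharZero k] {N : Submodule K M} (hN : LowGen K ρ (d + 1) N) :
    ∃ m, TopGen ρ d m N := by
  induction hN with
  | bot => exact ⟨0, TopGen.low LowGen.bot⟩
  | @sup N hN κ _ f hcard hf ih =>
    obtain ⟨m, hm⟩ := ih
    rcases (Nat.lt_succ_iff_lt_or_eq.1 hcard) with h | h
    · exact ⟨m, hm.sup_low (LowGen.rspan h hf)⟩
    · obtain ⟨ι, _, μ, φ, hμ, hφ, hx⟩ := exists_finite_schur_span (k := k) κ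
      obtain ⟨m', hm'⟩ := hm.finset_sup Finset.univ (fun j => f ∘ₗ φ j) (fun j => (hμ j).trans h)
        (fun j => hf.comp (hφ j))
      refine ⟨m', ?_⟩
      convert hm' using 2
      refine le_antisymm (rspan_le fun x => ?_)
        (Finset.sup_le fun j _ => rspan_le fun x => mem_rspan f _)
      obtain ⟨y, rfl⟩ := hx x
      rw [map_sum]
      exact Submodule.sum_mem _ fun j hj => (Finset.le_sup (f := fun j => GLStruct.rspan K (f ∘ₗ φ j))
        hj) (mem_rspan (f ∘ₗ φ j) _)

end Generators

/-! ### Fields of fractions of polynomial subalgebras. -/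

section FractionSub

variable {k : Type u} [Field k] {K : Type u} [Field K] [Algebra k K]

/-- `A` is a stable polynomial subalgebra with fraction field `K`. -/
structure FracSub (act : GLinf k →* (K ≃ₐ[k] K)) (A : Subalgebra k K) : Prop where
  stable : ∀ g, ∀ a ∈ A, act g a ∈ A
  poly : ∀ a ∈ A, a ∈ polyPart (actRep act)
  frac : ∀ x : K, ∃ a ∈ A, ∃ b ∈ A, b ≠ 0 ∧ b * x = a

variable {act : GLinf k →* (K ≃ₐ[k] K)} {A : Subalgebra k K}

theorem FracSub.shift (h : FracSub act A) (n : ℕ) : FracSub (act.comp (shiftHom n)) A where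
  stable g a ha := h.stable _ a ha
  poly a ha := polyPart_le_shiftRep (ρ := actRep act) n (h.poly a ha)
  frac := h.frac

theorem FracSub.smooth (h : FracSub act A) (x : K) : ∃ p, FixedAt (actRep act) p x := by
  obtain ⟨a, ha, b, hb, hb0, hx⟩ := h.frac x
  obtain ⟨p, hp⟩ := polyPart_le_smoothPart (h.poly a ha)
  obtain ⟨q, hq⟩ := polyPart_le_smoothPart (h.poly b hb)
  refine ⟨max p q, fun g hg => mul_left_cancel₀ hb0 ?_⟩
  have h1 : act g a = a := hp.mono (le_max_left p q) g hg
  have h2 : act g b = b := hq.mono (le_max_right p q) g hg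
  rw [actRep_apply]
  conv_lhs => rw [← h2]
  rw [← map_mul, hx, h1]

theorem FracSub.exists_common_denom (h : FracSub act A) {ι : Type*} (s : Finset ι) (x : ι → K) :
    ∃ b ∈ A, b ≠ 0 ∧ ∀ i ∈ s, b * x i ∈ A := by
  classical
  induction s using Finset.induction_on with
  | empty => exact ⟨1, A.one_mem, one_ne_zero, by simp⟩
  | insert i s _ ih =>
    obtain ⟨b, hb, hb0, hs⟩ := ih
    obtain ⟨a, ha, c, hc, hc0, hx⟩ := h.frac (x i)
    refine ⟨b * c, A.mul_mem hb hc, mul_ne_zero hb0 hc0, fun j hj => ?_⟩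
    rcases Finset.mem_insert.1 hj with rfl | hj
    · rw [mul_assoc, hx]; exact A.mul_mem hb ha
    · rw [mul_comm b c, mul_assoc]; exact A.mul_mem hc (hs j hj)

end FractionSub

/-! ### Tensors relative to blocks of basis vectors. -/

section Slots

variable {k : Type u} [Field k] {κ : Type}

variable (k κ) in
/-- The tensors whose entries are among the first `q` basis vectors. -/
def levelSub (q : ℕ) : Submodule k (Ten k κ) :=
  Submodule.span k {x | ∃ I : κ → ℕ, (∀ s, I s < q) ∧ x = bten k I}

variable (k κ) in
/-- The span of the tensors with an entry among the basis vectors of the second block. -/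
def slotSub (q : ℕ) : Submodule k (Ten k κ) :=
  Submodule.span k {x | ∃ (v : κ → Std k) (s : κ) (i : ℕ), q ≤ i ∧ i < 2 * q ∧ v s = bv k i ∧
    x = PiTensorProduct.tprod k v}

theorem exists_mem_levelSub [Fintype κ] (x : Ten k κ) :
    ∃ q₀, ∀ q, q₀ ≤ q → x ∈ levelSub k κ q := by
  obtain ⟨q₀, hq₀⟩ := exists_entry_bound ((tenBasis k κ).repr x).support
  refine ⟨q₀, fun q hq => ?_⟩
  rw [← (tenBasis k κ).linearCombination_repr x, Finsupp.linearCombination_apply, Finsupp.sum]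
  refine Submodule.sum_mem _ fun I hI => Submodule.smul_mem _ _ (Submodule.subset_span
    ⟨I, fun s => (hq₀ I hI s).trans_le hq, tenBasis_apply I⟩)

/-- When the factors e_{q+i} + t e_i are multiplied out, the only term free of vectors from the
second block is t^|κ| x. -/
theorem path_sub_mem_slotSub [Fintype κ] {q : ℕ} (t : k) {x : Ten k κ} (hx : x ∈ levelSub k κ q) :
    tensorRep k κ (pathGL q t) x - t ^ Fintype.card κ • x ∈ slotSub k κ q := by
  classical
  induction hx using Submodule.span_induction with
  | mem x hx =>
    obtain ⟨I, hI, rfl⟩ := hx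
    have h1 : tensorRep k κ (pathGL q t) (bten k I) = PiTensorProduct.tprod k fun s =>
        bv k (q + I s) + t • bv k (I s) := by
      rw [bten, tensorRep_tprod]
      congr 1
      ext s : 1
      rw [pathGL_bv (hI s)]
    rw [h1, tprod_add_smul, ← Finset.add_sum_erase _ _ (Finset.mem_univ Finset.univ),
      Finset.piecewise_univ, Finset.card_univ, bten, add_sub_cancel_left]
    refine Submodule.sum_mem _ fun S hS => Submodule.smul_mem _ _ ?_
    obtain ⟨s, hs⟩ : ∃ s, s ∉ S := by
      by_contra! h
      exact (Finset.mem_erase.1 hS).1 (Finset.eq_univ_of_forall h)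
    have := hI s
    refine Submodule.subset_span ⟨_, s, q + I s, by omega, by omega, ?_, rfl⟩
    rw [Finset.piecewise_eq_of_notMem _ _ _ hs]
  | zero => simp
  | add x y _ _ hx hy =>
    rw [map_add, smul_add, add_sub_add_comm]
    exact Submodule.add_mem _ hx hy
  | smul a x _ hx =>
    rw [map_smul, smul_comm, ← smul_sub]
    exact Submodule.smul_mem _ a hx

theorem swap_mem_slotSub {q : ℕ} {h : GLinf k}
    (hh : ∀ i, q ≤ i → i < 2 * q → h.1 (bv k i) = bv k i) {x : Ten k κ}
    (hx : x ∈ slotSub k κ q) : tensorRep k κ h x ∈ slotSub k κ q := by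
  have : slotSub k κ q ≤ (slotSub k κ q).comap (tensorRep k κ h) := Submodule.span_le.2 (by
    rintro _ ⟨v, s, i, h1, h2, hv, rfl⟩
    refine Submodule.subset_span ⟨fun s => h.1 (v s), s, i, h1, h2, ?_, ?_⟩
    · exact (congrArg h.1 hv).trans (hh i h1 h2)
    · rw [tensorRep_tprod])
  exact this hx

theorem slotSub_le [Fintype κ] (q : ℕ) : slotSub k κ q ≤
    Submodule.span k {x | ∃ I : κ → ℕ, (∃ s, I s < 2 * q) ∧ x = bten k I} := by
  refine Submodule.span_le.2 ?_
  rintro _ ⟨v, s, i, -, h2, hv, rfl⟩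
  rw [← (tenBasis k κ).linearCombination_repr (PiTensorProduct.tprod k v),
    Finsupp.linearCombination_apply, Finsupp.sum]
  refine Submodule.sum_mem _ fun I hI => Submodule.smul_mem _ _ (Submodule.subset_span
    ⟨I, ⟨s, ?_⟩, tenBasis_apply I⟩)
  rw [Finsupp.mem_support_iff, tenBasis_repr_tprod] at hI
  have h3 := Finset.prod_ne_zero_iff.1 hI s (Finset.mem_univ s)
  rw [hv, Finsupp.single_apply] at h3
  have : i = I s := by by_contra h; exact h3 (if_neg h)
  omega

theorem swap_levelSub {q : ℕ} {h : GLinf k} (hh : ∀ i < q, h.1 (bv k i) = bv k (2 * q + i))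
    {x : Ten k κ} (hx : x ∈ levelSub k κ q) :
    tensorRep k κ h x = tmap κ (tau k (2 * q)) x := by
  have : levelSub k κ q ≤ LinearMap.eqLocus (tensorRep k κ h) (tmap κ (tau k (2 * q))) :=
    Submodule.span_le.2 (by
      rintro _ ⟨I, hI, rfl⟩
      change tensorRep k κ h _ = tmap κ _ _
      rw [bten, tensorRep_tprod, tmap_tprod]
      congr 1
      ext s : 1
      rw [hh _ (hI s), tau_bv])
  exact this hx

end Slots

/-! ### Embedding a finitely generated module after a shift. -/

section Embedding

variable {k : Type u} [Field k] [CharZero k] {K : Type u} [Field K] [Algebra k K]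
  {M : Type u} [AddCommGroup M] [Module K M] [Module k M] [IsScalarTower k K M]

/-- The value at 0 is the constant coefficient of the family: this is the specialization step of the
degeneration. -/
theorem PolyFam.apply_zero_mem {W : Type*} [AddCommGroup W] [Module k W] {φ : k → W}
    (h : PolyFam φ) {S : Submodule k W} (hS : ∀ t, t ≠ 0 → φ t ∈ S) : φ 0 ∈ S := by
  obtain ⟨m, hm⟩ := h
  have h1 := coeff_mem_of_forall_mem (m := m) (S := S) (fun t ht => hm t ▸ hS t ht) 0
  rw [hm, Finsupp.sum, Finset.sum_eq_single 0]
  · simpa using h1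
  · intro s _ hs; rw [zero_pow hs, zero_smul]
  · intro h; rw [Finsupp.notMem_support_iff.1 h, smul_zero]

/-- Extension of scalars of an equivariant map. -/
theorem liftBaseChange_equi {act : GLinf k →* (K ≃ₐ[k] K)} {ρ : Representation k (GLinf k) M}
    (hρ : Semi act ρ) {V : Type*} [AddCommGroup V] [Module k V] {τ : Representation k (GLinf k) V}
    {f : V →ₗ[k] M} (hf : Equi τ ρ f) (g : GLinf k) (z : K ⊗[k] V) :
    f.liftBaseChange K (baseRep act τ g z) = ρ g (f.liftBaseChange K z) := by
  induction z using TensorProduct.induction_on with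
  | zero => simp
  | tmul a v =>
    rw [baseRep_tmul, LinearMap.liftBaseChange_tmul, LinearMap.liftBaseChange_tmul, hf, hρ]
  | add x y hx hy => simp only [map_add, hx, hy]

theorem exists_of_mem_rspan {V : Type*} [AddCommGroup V] [Module k V] {f : V →ₗ[k] M} {x : M}
    (hx : x ∈ rspan K f) : ∃ z, f.liftBaseChange K z = x := by
  have : rspan K f ≤ LinearMap.range (f.liftBaseChange K) :=
    rspan_le fun v => ⟨1 ⊗ₜ v, by rw [LinearMap.liftBaseChange_tmul, one_smul]⟩
  exact this hx

theorem polyPart_actRep_one (E : Type*) [Field E] [Algebra k E] :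
    polyPart (actRep (1 : GLinf k →* (E ≃ₐ[k] E))) = ⊤ := by
  rw [eq_top_iff]
  rintro a -
  let f : Ten k Empty →ₗ[k] E := LinearMap.toSpanSingleton k E a ∘ₗ
    (PiTensorProduct.isEmptyEquiv Empty).toLinearMap
  have hf : Equi (tensorRep k Empty) (actRep (1 : GLinf k →* (E ≃ₐ[k] E))) f := fun g x => by
    refine LinearMap.congr_fun (f := f ∘ₗ tensorRep k Empty g) (g := f) (ten_ext fun v => ?_) x
    rw [LinearMap.comp_apply, tensorRep_tprod]
    congr 2
    exact Subsingleton.elim _ _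
  have := mem_polyPart hf ((PiTensorProduct.isEmptyEquiv Empty).symm 1)
  simpa [f] using this

/-- The degeneration argument: a relation between a Schur generator of top degree and the
other generators shows that this generator is superfluous after a shift. -/
theorem rspan_le_of_relation {act : GLinf k →* (K ≃ₐ[k] K)} {A : Subalgebra k K}
    (hA : FracSub act A) {ρ : Representation k (GLinf k) M} (hρ : Semi act ρ) {N : Submodule K M}
    (hN : ∀ g, ∀ x ∈ N, ρ g x ∈ N) {μ : YoungDiagram} {f : Schur k μ →ₗ[k] M}
    (hf : Equi (schurRep k μ) ρ f) {y : K ⊗[k] Schur k μ} (hy0 : y ≠ 0)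
    (hy : f.liftBaseChange K y ∈ N) :
    ∃ (n : ℕ) (L : Submodule K M), LowGen K (shiftRep ρ n) μ.card L ∧
      L ≤ rspan K f ∧ rspan K f ≤ N ⊔ L := by
  classical
  let b := Module.Basis.ofVectorSpace k (Schur k μ)
  let B := b.baseChange K
  obtain ⟨c, hcA, hc0, hcs⟩ := hA.exists_common_denom (B.repr y).support fun i => B.repr y i
  -- the coefficients, the vectors, and their lifts to tensors
  let s := (B.repr y).support
  let a : _ → K := fun i => c * B.repr y i
  have ha : ∀ i ∈ s, a i ∈ A := hcs
  have ha0 : ∀ i ∈ s, a i ≠ 0 := fun i hi => mul_ne_zero hc0 (Finsupp.mem_support_iff.1 hi)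
  have hrel : ∑ i ∈ s, a i • f (b i) ∈ N := by
    have h1 : y = ∑ i ∈ s, B.repr y i ⊗ₜ[k] b i := by
      conv_lhs => rw [← B.linearCombination_repr y, Finsupp.linearCombination_apply, Finsupp.sum]
      refine Finset.sum_congr rfl fun i _ => ?_
      rw [Module.Basis.baseChange_apply, TensorProduct.smul_tmul', smul_eq_mul, mul_one]
    have h2 := N.smul_mem c hy
    rw [h1, map_sum, Finset.smul_sum] at h2
    refine (congrArg (· ∈ N) (Finset.sum_congr rfl fun i _ => ?_)).mp h2
    rw [LinearMap.liftBaseChange_tmul, smul_smul]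
  choose x hx using fun i => toSchur_surjective μ (b i)
  choose p hp using fun i => hA.smooth (a i)
  choose q₁ hq₁ using fun i => exists_mem_levelSub (x i)
  -- For this q the coefficients and the tensors of the relation involve only the first q basis
  -- vectors.
  let q := max (s.sup p) (s.sup q₁)
  have hpq : ∀ i ∈ s, FixedAt (actRep act) q (a i) := fun i hi =>
    (hp i).mono ((Finset.le_sup hi).trans (le_max_left _ _))
  have hxq : ∀ i ∈ s, x i ∈ levelSub k μ.cells q := fun i hi =>
    hq₁ i q ((Finset.le_sup hi).trans (le_max_right _ _))
  let F : Ten k μ.cells →ₗ[k] M := f ∘ₗ toSchur k μ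
  have hF : Equi (tensorRep k μ.cells) ρ F := hf.comp_toSchur
  have hFx : ∀ i, F (x i) = f (b i) := fun i => congrArg f (hx i)
  let LB : Submodule K M := Submodule.span K (F '' (slotSub k μ.cells q))
  -- the leading term of the relation along the path
  have h0 : ∑ i ∈ s, act (pathGL q 0) (a i) • f (b i) ∈ N ⊔ LB := by
    have hpf : PolyFam fun t : k => ∑ i ∈ s, act (pathGL q t) (a i) • f (b i) :=
      PolyFam.sum fun i hi => (polyFam_pathGL q (hA.poly _ (ha i hi))).map
        ((LinearMap.toSpanSingleton K M (f (b i))).restrictScalars k)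
    -- For t ≠ 0, apply the path to the relation, drop the terms in the second block and divide by
    -- t^|μ|. What remains is polynomial in t, because the coefficients are polynomial elements, so
    -- t = 0 is allowed as well.
    refine hpf.apply_zero_mem (S := (N ⊔ LB).restrictScalars k) fun t ht => ?_
    rw [Submodule.restrictScalars_mem]
    have h1 : ∑ i ∈ s, act (pathGL q t) (a i) • F (tensorRep k _ (pathGL q t) (x i)) ∈ N := by
      have := hN (pathGL q t) _ hrel
      rw [map_sum] at this
      refine (congrArg (· ∈ N) (Finset.sum_congr rfl fun i _ => ?_)).mp this
      rw [hρ, hF, hFx]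
    have h2 : ∑ i ∈ s, act (pathGL q t) (a i) •
        F (tensorRep k _ (pathGL q t) (x i) - t ^ Fintype.card μ.cells • x i) ∈ LB :=
      Submodule.sum_mem _ fun i hi => Submodule.smul_mem _ _ (Submodule.subset_span
        ⟨_, path_sub_mem_slotSub t (hxq i hi), rfl⟩)
    have h3 : algebraMap k K (t ^ Fintype.card μ.cells) •
        ∑ i ∈ s, act (pathGL q t) (a i) • f (b i) ∈ N ⊔ LB := by
      have := Submodule.sub_mem _ (Submodule.mem_sup_left (T := LB) h1)
        (Submodule.mem_sup_right (S := N) h2)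
      rw [← Finset.sum_sub_distrib] at this
      rw [Finset.smul_sum]
      refine (congrArg (· ∈ N ⊔ LB) (Finset.sum_congr rfl fun i _ => ?_)).mp this
      rw [← smul_sub, ← map_sub, sub_sub_cancel, map_smul, hFx, smul_comm, algebraMap_smul]
    refine (Submodule.smul_mem_iff _ ?_).1 h3
    rw [Ne, map_eq_zero_iff _ (algebraMap k K).injective]
    exact pow_ne_zero _ ht
  -- At t = 0 the coefficients live in the second block. The element h fixes this block and carries
  -- the vectors to the third, so the coefficients become invariants of the group shifted by 2q.
  obtain ⟨h, hh1, hh2⟩ := exists_gl_swap (k := k) q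
  have hLB : ∀ z ∈ LB, ρ h z ∈ LB := fun z hz => hρ.map_span (by
    rintro _ ⟨w, hw, rfl⟩
    rw [← hF]
    exact Submodule.subset_span ⟨_, swap_mem_slotSub hh2 hw, rfl⟩) hz
  obtain ⟨L, hL, hLe, hLI⟩ := exists_lowGen_shift_schur (K := K) hf (2 * q)
  have hLBL : LB ≤ L := Submodule.span_le.2 (by
    rintro _ ⟨w, hw, rfl⟩
    have : slotSub k μ.cells q ≤ (L.restrictScalars k).comap F := (slotSub_le q).trans
      (Submodule.span_le.2 (by rintro _ ⟨I, hI, rfl⟩; exact hLI I hI))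
    exact this hw)
  let f' : Schur k μ →ₗ[k] M := f ∘ₗ schurTau k (2 * q) μ
  have hf' : Equi (schurRep k μ) (shiftRep ρ (2 * q)) f' :=
    (hf.shift _).comp (schurTau_equi _ _)
  let act' := act.comp (shiftHom (2 * q))
  let θ : _ → K := fun i => act (pathGL q 0) (a i)
  have hθ : ∀ i ∈ s, ∀ g : GLinf k, (∀ j, q ≤ j → j < 2 * q → g.1 (bv k j) = bv k j) →
      act g (θ i) = θ i := fun i hi g hg => by
    have : actRep act (g * pathGL q 0) (a i) = actRep act (pathGL q 0) (a i) :=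
      (hpq i hi).congr fun j hj => by
        change g.1 ((pathGL q 0).1 (bv k j)) = _
        rw [pathGL_bv hj, zero_smul, add_zero, hg _ (by omega) (by omega)]
    rw [map_mul (actRep act) g (pathGL q 0)] at this
    exact this
  have h1 : ∑ i ∈ s, θ i • f' (b i) ∈ N ⊔ L := by
    have := Semi.map_sup (act := act) (ρ := ρ) (g := h) (P := N ⊔ L)
      (fun z hz => Submodule.mem_sup_left (hN h z hz))
      (fun z hz => Submodule.mem_sup_right (hLBL (hLB z hz))) h0
    rw [map_sum] at this
    refine (congrArg (· ∈ N ⊔ L) (Finset.sum_congr rfl fun i hi => ?_)).mp this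
    rw [hρ, hθ i hi h hh2]
    congr 1
    rw [← hFx, ← hF, swap_levelSub hh1 (hxq i hi)]
    change f (toSchur k μ _) = f (schurTau k (2 * q) μ (b i))
    rw [← hx i, schurTau_toSchur]
  -- the solutions of the relation with invariant coefficients
  let E := IntermediateField.fixedField act'.range
  have hE : ∀ (g : GLinf k) (e : E), act' g e = e := fun g e => e.2 ⟨act' g, g, rfl⟩
  let G : E ⊗[k] Schur k μ →ₗ[k] M := (f'.liftBaseChange K).restrictScalars k ∘ₗ
    (E.val.toLinearMap.rTensor (Schur k μ))
  have hGt : ∀ (e : E) (v : Schur k μ), G (e ⊗ₜ v) = (e : K) • f' v := fun e v => by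
    change f'.liftBaseChange K ((e : K) ⊗ₜ v) = _
    rw [LinearMap.liftBaseChange_tmul]
  have hG : Equi (baseRep 1 (schurRep k μ)) (shiftRep ρ (2 * q)) G := fun g z => by
    induction z using TensorProduct.induction_on with
    | zero => simp
    | tmul e v =>
      rw [baseRep_tmul, hGt, hGt, (hρ.shift (2 * q)) g, hf']
      exact congrArg (· • _) (hE g e).symm
    | add z w hz hw => simp only [map_add, hz, hw]
  have hNL : ∀ g, ∀ z ∈ N ⊔ L, shiftRep ρ (2 * q) g z ∈ N ⊔ L := fun g z hz =>
    Semi.map_sup (act := act') (fun z hz => Submodule.mem_sup_left (hN _ z hz))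
      (fun z hz => Submodule.mem_sup_right (hL.stable (hρ.shift _) g z hz)) hz
  let R : Submodule k (E ⊗[k] Schur k μ) := ((N ⊔ L).restrictScalars k).comap G
  have hR : ∀ g z, z ∈ R → baseRep (1 : GLinf k →* (E ≃ₐ[k] E)) (schurRep k μ) g z ∈ R :=
    fun g z hz => by
      change G _ ∈ N ⊔ L
      rw [hG]
      exact hNL g _ hz
  have hR0 : R ≠ ⊥ := by
    intro hbot
    let e : _ → E := fun i => if hi : i ∈ s then
      ⟨θ i, by
        rintro ⟨_, g, rfl⟩
        exact hθ i hi _ fun j _ hj => shiftHom_bv hj g⟩ else 0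
    have he : ∀ i ∈ s, (e i : K) = θ i := fun i hi => by simp [e, hi]
    have hu : ∑ i ∈ s, e i ⊗ₜ[k] b i ∈ R := by
      change G _ ∈ N ⊔ L
      rw [map_sum]
      refine (congrArg (· ∈ N ⊔ L) (Finset.sum_congr rfl fun i hi => ?_)).mp h1
      rw [hGt, he i hi]
    rw [hbot, Submodule.mem_bot] at hu
    obtain ⟨i, hi⟩ : s.Nonempty := by
      rw [Finset.nonempty_iff_ne_empty, Ne, Finsupp.support_eq_empty]
      exact fun h => hy0 (B.repr.map_eq_zero_iff.1 h)
    have h2 := congrArg (fun z => (b.baseChange E).repr z i) hu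
    simp only [map_sum, Finsupp.finsetSum_apply, Module.Basis.baseChange_repr_tmul,
      Module.Basis.repr_self, map_zero, Finsupp.zero_apply] at h2
    rw [Finset.sum_eq_single i] at h2
    · rw [Finsupp.single_eq_same, one_smul] at h2
      have h3 := he i hi
      rw [h2] at h3
      exact ha0 i hi ((map_eq_zero_iff _ (act (pathGL q 0)).injective).1 h3.symm)
    · intro j _ hj
      rw [Finsupp.single_eq_of_ne hj.symm, zero_smul]
    · exact fun h => absurd hi h
  -- As the group acts trivially on E, the representation E ⊗ 𝐒_μ is polynomial, so R contains a
  -- non-zero image of a Schur functor. By rigidity this is e ⊗ 𝐒_μ for a single e ≠ 0, and division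
  -- by e puts the image of `f'` into N ⊔ L.
  obtain ⟨ν, φ, hφ, hφ0, hφR⟩ := exists_schur_of_ne_bot hR (by
    rw [show polyPart (baseRep (1 : GLinf k →* (E ≃ₐ[k] E)) (schurRep k μ)) = ⊤ from
      polyPart_tprod (polyPart_actRep_one E) (polyPart_schurRep μ)]
    exact le_top) hR0
  have hsm : ∀ e : E, ∃ p, FixedAt (actRep (1 : GLinf k →* (E ≃ₐ[k] E))) p e :=
    fun e => ⟨0, fun _ _ => rfl⟩
  have hcard := schur_card_eq_of_trivial (fun _ _ => rfl) hφ hφ0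
  have hνμ : ν = μ := by
    by_contra hne
    exact hφ0 (schur_eq_zero_of_ne hsm hφ hcard hne)
  subst hνμ
  obtain ⟨e, -, he⟩ := schur_eq_tmul hsm hφ
  have he0 : (e : K) ≠ 0 := fun h => hφ0 (LinearMap.ext fun v => by
    rw [he, Subtype.ext (a2 := (0 : E)) h, TensorProduct.zero_tmul]; rfl)
  refine ⟨2 * q, L, hL, le_sup_left.trans hLe.ge, hLe.le.trans (sup_le le_sup_right (rspan_le fun v => ?_))⟩
  have h2 : G (φ v) ∈ N ⊔ L := hφR v
  rw [he, hGt] at h2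
  exact (Submodule.smul_mem_iff _ he0).1 h2

/-- The subspace `N` embeds, after a shift, into the extension of scalars of a polynomial
representation. -/
def Embeds (act : GLinf k →* (K ≃ₐ[k] K)) (ρ : Representation k (GLinf k) M)
    (N : Submodule K M) : Prop :=
  ∃ (n : ℕ) (P : Type u) (_ : AddCommGroup P) (_ : Module k P) (τ : Representation k (GLinf k) P)
    (φ : M →ₗ[K] K ⊗[k] P), polyPart τ = ⊤ ∧ (∀ x ∈ N, φ x = 0 → x = 0) ∧
      ∀ g, ∀ x ∈ N, φ (ρ (shiftHom n g) x) = baseRep (act.comp (shiftHom n)) τ g (φ x)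

theorem Embeds.of_shift {act : GLinf k →* (K ≃ₐ[k] K)} {ρ : Representation k (GLinf k) M}
    {N : Submodule K M} {n : ℕ} (h : Embeds (act.comp (shiftHom n)) (shiftRep ρ n) N) :
    Embeds act ρ N := by
  obtain ⟨m, P, _, _, τ, φ, hτ, hφ, he⟩ := h
  refine ⟨n + m, P, inferInstance, inferInstance, τ, φ, hτ, hφ, fun g x hx => ?_⟩
  have h1 := he g x hx
  rw [shiftRep_apply, shiftHom_shiftHom] at h1
  rw [h1]
  congr 1
  have h2 : (act.comp (shiftHom n)).comp (shiftHom m) = act.comp (shiftHom (n + m)) :=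
    MonoidHom.ext fun g => congrArg act (shiftHom_shiftHom n m g)
  rw [h2]

theorem polyPart_prod {W W' : Type*} [AddCommGroup W] [Module k W] [AddCommGroup W'] [Module k W']
    {ρ : Representation k (GLinf k) W} {ρ' : Representation k (GLinf k) W'}
    (h : polyPart ρ = ⊤) (h' : polyPart ρ' = ⊤) : polyPart (ρ.prod ρ') = ⊤ := by
  rw [eq_top_iff]
  rintro ⟨x, y⟩ -
  have h1 : Equi ρ (ρ.prod ρ') (LinearMap.inl k W W') := fun g x => by simp
  have h2 : Equi ρ' (ρ.prod ρ') (LinearMap.inr k W W') := fun g x => by simp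
  have := Submodule.add_mem _ (map_mem_polyPart h1 (h ▸ Submodule.mem_top (x := x)))
    (map_mem_polyPart h2 (h' ▸ Submodule.mem_top (x := y)))
  simpa using this

/-- A free Schur generator can be split off. -/
theorem Embeds.sup {act : GLinf k →* (K ≃ₐ[k] K)} {ρ : Representation k (GLinf k) M}
    (hρ : Semi act ρ) {N : Submodule K M} (hN : ∀ g, ∀ x ∈ N, ρ g x ∈ N) (h : Embeds act ρ N)
    {μ : YoungDiagram} {f : Schur k μ →ₗ[k] M} (hf : Equi (schurRep k μ) ρ f)
    (hfree : ∀ y, f.liftBaseChange K y ∈ N → y = 0) : Embeds act ρ (N ⊔ rspan K f) := by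
  obtain ⟨n, P, _, _, τ, φ, hτ, hφ, he⟩ := h
  let F := f.liftBaseChange K
  -- G is only K-linear, but on the sum of N and the image of F the resulting `ψ` is forced to be
  -- the projection to the free part, and that one is equivariant.
  obtain ⟨G, hG⟩ := (N.mkQ ∘ₗ F).exists_leftInverse_of_injective (by
    rw [LinearMap.ker_eq_bot']
    intro y hy
    exact hfree y ((Submodule.Quotient.mk_eq_zero N).1 hy))
  let ψ : M →ₗ[K] K ⊗[k] Schur k μ := G ∘ₗ N.mkQ
  have hψF : ∀ y, ψ (F y) = y := fun y => LinearMap.congr_fun hG y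
  have hψN : ∀ x ∈ N, ψ x = 0 := fun x hx => by
    change G (N.mkQ x) = 0
    rw [Submodule.mkQ_apply, (Submodule.Quotient.mk_eq_zero N).2 hx, map_zero]
  let i₁ := (LinearMap.inl k (Schur k μ) P).baseChange K
  let i₂ := (LinearMap.inr k (Schur k μ) P).baseChange K
  let p₁ := (LinearMap.fst k (Schur k μ) P).baseChange K
  let p₂ := (LinearMap.snd k (Schur k μ) P).baseChange K
  let τ' := (shiftRep (schurRep k μ) n).prod τ
  let φ' : M →ₗ[K] K ⊗[k] (Schur k μ × P) := i₁ ∘ₗ ψ + i₂ ∘ₗ φ ∘ₗ (LinearMap.id - F ∘ₗ ψ)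
  have hφ' : ∀ x ∈ N, ∀ y, φ' (x + F y) = i₁ y + i₂ (φ x) := fun x hx y => by
    simp only [φ', LinearMap.add_apply, LinearMap.comp_apply, LinearMap.sub_apply,
      LinearMap.id_apply, map_add, hψN x hx, hψF, map_zero, zero_add]
    rw [sub_zero, sub_self, map_zero, map_zero, add_zero, add_comm]
  have hmem : ∀ x ∈ N ⊔ rspan K f, ∃ z ∈ N, ∃ y, x = z + F y := fun x hx => by
    obtain ⟨z, hz, w, hw, rfl⟩ := Submodule.mem_sup.1 hx
    obtain ⟨y, rfl⟩ := exists_of_mem_rspan hw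
    exact ⟨z, hz, y, rfl⟩
  refine ⟨n, Schur k μ × P, inferInstance, inferInstance, τ', φ',
    polyPart_prod (polyPart_shiftRep n (polyPart_schurRep μ)) hτ, fun x hx h0 => ?_,
    fun g x hx => ?_⟩
  · obtain ⟨z, hz, y, rfl⟩ := hmem x hx
    rw [hφ' z hz] at h0
    have h11 : p₁ (i₁ y) = y := by
      rw [← LinearMap.comp_apply, ← LinearMap.baseChange_comp, LinearMap.fst_comp_inl,
        LinearMap.baseChange_id]; rfl
    have h12 : p₁ (i₂ (φ z)) = 0 := by
      rw [← LinearMap.comp_apply, ← LinearMap.baseChange_comp, LinearMap.fst_comp_inr,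
        LinearMap.baseChange_zero]; rfl
    have h21 : p₂ (i₁ y) = 0 := by
      rw [← LinearMap.comp_apply, ← LinearMap.baseChange_comp, LinearMap.snd_comp_inl,
        LinearMap.baseChange_zero]; rfl
    have h22 : p₂ (i₂ (φ z)) = φ z := by
      rw [← LinearMap.comp_apply, ← LinearMap.baseChange_comp, LinearMap.snd_comp_inr,
        LinearMap.baseChange_id]; rfl
    have h1 := congrArg p₁ h0
    have h2 := congrArg p₂ h0
    rw [map_add, h11, h12, add_zero, map_zero] at h1
    rw [map_add, h21, h22, zero_add, map_zero] at h2
    rw [h1, hφ z hz h2, map_zero, zero_add]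
  · obtain ⟨z, hz, y, rfl⟩ := hmem x hx
    have h1 : ρ (shiftHom n g) (z + F y) = ρ (shiftHom n g) z +
        F (baseRep act (schurRep k μ) (shiftHom n g) y) := by
      rw [map_add, liftBaseChange_equi hρ hf]
    rw [h1, hφ' _ (hN _ _ hz), hφ' z hz, he g z hz, map_add]
    have h2 : Equi (shiftRep (schurRep k μ) n) τ' (LinearMap.inl k (Schur k μ) P) :=
      fun g x => by simp [τ']
    have h3 : Equi τ τ' (LinearMap.inr k (Schur k μ) P) := fun g x => by simp [τ']
    congr 1
    · exact h2.lTensor (act := act.comp (shiftHom n)) g y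
    · exact h3.lTensor (act := act.comp (shiftHom n)) g (φ z)

theorem Embeds.bot {act : GLinf k →* (K ≃ₐ[k] K)} {ρ : Representation k (GLinf k) M} :
    Embeds act ρ (⊥ : Submodule K M) := by
  refine ⟨0, Schur k ⊥, inferInstance, inferInstance, schurRep k ⊥, 0, polyPart_schurRep _,
    fun x hx _ => (Submodule.mem_bot K).1 hx, fun g x hx => by simp⟩

/-- The last generator of degree d is either free modulo the others, and splits off, or satisfies a
relation, and after a shift it is absorbed by generators of lower degree. In both cases m drops by
one. -/
theorem TopGen.embeds {A : Subalgebra k K} {d : ℕ}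
    (hd : ∀ (act : GLinf k →* (K ≃ₐ[k] K)) (ρ : Representation k (GLinf k) M) (N : Submodule K M),
      FracSub act A → Semi act ρ → LowGen K ρ d N → Embeds act ρ N) (m : ℕ) :
    ∀ (act : GLinf k →* (K ≃ₐ[k] K)) (ρ : Representation k (GLinf k) M) (N : Submodule K M),
      FracSub act A → Semi act ρ → TopGen ρ d m N → Embeds act ρ N := by
  induction m with
  | zero =>
    intro act ρ N hA hρ hN
    cases hN with
    | low hN => exact hd act ρ N hA hρ hN
  | succ m ih =>
    intro act ρ N hA hρ hN
    cases hN with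
    | @sup _ N hN μ f hcard hf =>
      by_cases hfree : ∀ y, f.liftBaseChange K y ∈ N → y = 0
      · exact (ih act ρ N hA hρ hN).sup hρ (fun g => hN.stable hρ g) hf hfree
      · push Not at hfree
        obtain ⟨y, hy, hy0⟩ := hfree
        obtain ⟨n, L, hL, hLf, hle⟩ := rspan_le_of_relation hA hρ (fun g => hN.stable hρ g) hf hy0 hy
        have he : N ⊔ rspan K f = N ⊔ L :=
          le_antisymm (sup_le le_sup_left hle) (sup_le le_sup_left (hLf.trans le_sup_right))
        rw [he]
        exact Embeds.of_shift (n := n) (ih _ _ _ (hA.shift n) (hρ.shift n)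
          ((hN.shift n).sup_low (hcard ▸ hL)))

theorem LowGen.embeds {A : Subalgebra k K} (d : ℕ) :
    ∀ (act : GLinf k →* (K ≃ₐ[k] K)) (ρ : Representation k (GLinf k) M) (N : Submodule K M),
      FracSub act A → Semi act ρ → LowGen K ρ d N → Embeds act ρ N := by
  induction d with
  | zero =>
    intro act ρ N hA hρ hN
    cases hN with
    | bot => exact Embeds.bot
    | sup hN f hcard hf => exact absurd hcard (Nat.not_lt_zero _)
  | succ d ih =>
    intro act ρ N hA hρ hN
    obtain ⟨m, hm⟩ := hN.exists_topGen
    exact TopGen.embeds ih m act ρ N hA hρ hm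

end Embedding

/-! ### The A-lattice in K ⊗ P. -/

section Lattice

variable {k : Type u} [Field k] {K : Type u} [Field K] [Algebra k K]
  {P : Type u} [AddCommGroup P] [Module k P] {P' : Type u} [AddCommGroup P'] [Module k P']

variable (P) in
/-- The image of `A ⊗ P` in `K ⊗ P`. -/
def latt (A : Subalgebra k K) : Submodule k (K ⊗[k] P) :=
  LinearMap.range (A.val.toLinearMap.rTensor P)

variable {A : Subalgebra k K}

theorem tmul_mem_latt {a : K} (ha : a ∈ A) (p : P) : a ⊗ₜ[k] p ∈ latt P A :=
  ⟨(⟨a, ha⟩ : A) ⊗ₜ p, rfl⟩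

theorem latt_induction {Q : Submodule k (K ⊗[k] P)}
    (h : ∀ a ∈ A, ∀ p : P, a ⊗ₜ[k] p ∈ Q) : latt P A ≤ Q := by
  rintro _ ⟨z, rfl⟩
  induction z using TensorProduct.induction_on with
  | zero => rw [map_zero]; exact Q.zero_mem
  | tmul a p => exact h a a.2 p
  | add x y hx hy => rw [map_add]; exact Q.add_mem hx hy

theorem smul_mem_latt {a : K} (ha : a ∈ A) {z : K ⊗[k] P} (hz : z ∈ latt P A) :
    a • z ∈ latt P A :=
  latt_induction (Q := (latt P A).comap (LinearMap.lsmul K (K ⊗[k] P) a |>.restrictScalars k))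
    (fun c hc p => by
      change a • (c ⊗ₜ[k] p) ∈ latt P A
      rw [TensorProduct.smul_tmul']
      exact tmul_mem_latt (A.mul_mem ha hc) p) hz

theorem lTensor_mem_latt (f : P →ₗ[k] P') {z : K ⊗[k] P} (hz : z ∈ latt P A) :
    f.lTensor K z ∈ latt P' A :=
  latt_induction (Q := (latt P' A).comap (f.lTensor K)) (fun c hc p => tmul_mem_latt hc _) hz

theorem baseRep_mem_latt {act : GLinf k →* (K ≃ₐ[k] K)} (hA : ∀ g, ∀ a ∈ A, act g a ∈ A)
    (τ : Representation k (GLinf k) P) (g : GLinf k) {z : K ⊗[k] P} (hz : z ∈ latt P A) :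
    baseRep act τ g z ∈ latt P A :=
  latt_induction (Q := (latt P A).comap (baseRep act τ g))
    (fun c hc p => tmul_mem_latt (hA g c hc) _) hz

theorem eq_sum_repr {ι : Type*} (b : Module.Basis ι k P) (z : K ⊗[k] P) :
    z = ∑ i ∈ ((b.baseChange K).repr z).support, (b.baseChange K).repr z i ⊗ₜ[k] b i := by
  conv_lhs => rw [← (b.baseChange K).linearCombination_repr z, Finsupp.linearCombination_apply,
    Finsupp.sum]
  refine Finset.sum_congr rfl fun i _ => ?_
  rw [Module.Basis.baseChange_apply, TensorProduct.smul_tmul', smul_eq_mul, mul_one]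

/-- Solving for the coefficients of C recursively requires one more division by the constant term of
H at every step. -/
theorem coeff_pow_mul_mem {H C : Polynomial K} (hH : ∀ n, H.coeff n ∈ A)
    (hHC : ∀ n, (H * C).coeff n ∈ A) (n : ℕ) : H.coeff 0 ^ (n + 1) * C.coeff n ∈ A := by
  induction n using Nat.strong_induction_on with
  | _ n ih =>
    have h1 := hHC n
    rw [Polynomial.coeff_mul, Finset.Nat.sum_antidiagonal_eq_sum_range_succ
      (fun i j => H.coeff i * C.coeff j), Finset.sum_range_succ'] at h1
    simp only [Nat.sub_zero] at h1
    have h2 := A.mul_mem (A.pow_mem (hH 0) n) h1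
    rw [mul_add, Finset.mul_sum] at h2
    have h3 : ∑ i ∈ Finset.range n, H.coeff 0 ^ n * (H.coeff (i + 1) * C.coeff (n - (i + 1))) ∈ A :=
      A.sum_mem fun i hi => by
        have hi' := Finset.mem_range.1 hi
        have h4 := A.mul_mem (A.mul_mem (hH (i + 1)) (A.pow_mem (hH 0) i))
          (ih (n - (i + 1)) (by omega))
        convert h4 using 1
        have : n = i + (n - (i + 1) + 1) := by omega
        conv_lhs => rw [this, pow_add]
        rw [← this]
        ring
    have h5 := A.sub_mem h2 h3
    rw [add_sub_cancel_left, ← mul_assoc, ← pow_succ] at h5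
    exact h5

end Lattice

/-! ### Denominators invariant under a shifted group. -/

section Denominators

variable {k : Type u} [Field k] [CharZero k] {K : Type u} [Field K] [Algebra k K]

/-- The polynomial with given coefficients. -/
def famPoly (m : ℕ →₀ K) : Polynomial K := m.sum fun s w => Polynomial.monomial s w

theorem famPoly_eval (m : ℕ →₀ K) (t : k) :
    (famPoly m).eval (algebraMap k K t) = m.sum fun s w => t ^ s • w := by
  rw [famPoly, Finsupp.sum, Finsupp.sum, Polynomial.eval_finsetSum]
  refine Finset.sum_congr rfl fun s _ => ?_
  rw [Polynomial.eval_monomial, Algebra.smul_def, map_pow, mul_comm]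

theorem famPoly_coeff (m : ℕ →₀ K) (s : ℕ) : (famPoly m).coeff s = m s := by
  rw [famPoly, Finsupp.sum, Polynomial.finsetSum_coeff]
  simp only [Polynomial.coeff_monomial]
  rw [Finset.sum_ite_eq']
  split_ifs with h
  · rfl
  · exact (Finsupp.notMem_support_iff.1 h).symm

theorem PolyFam.exists_polynomial {φ : k → K} (h : PolyFam φ) :
    ∃ p : Polynomial K, ∀ t : k, p.eval (algebraMap k K t) = φ t := by
  obtain ⟨m, hm⟩ := h
  exact ⟨famPoly m, fun t => by rw [famPoly_eval, hm]⟩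

theorem PolyFam.exists_polynomial_mem {φ : k → K} (h : PolyFam φ) {A : Subalgebra k K}
    (hA : ∀ t, φ t ∈ A) :
    ∃ p : Polynomial K, (∀ t : k, p.eval (algebraMap k K t) = φ t) ∧ ∀ n, p.coeff n ∈ A := by
  obtain ⟨m, hm⟩ := h
  refine ⟨famPoly m, fun t => by rw [famPoly_eval, hm], fun n => ?_⟩
  rw [famPoly_coeff]
  exact coeff_mem_of_forall_mem (S := Subalgebra.toSubmodule A) (fun t _ => hm t ▸ hA t) n

/-- The denominators of an element that moves polynomially along the path. -/
theorem exists_pow_mul_mem {act : GLinf k →* (K ≃ₐ[k] K)} {A : Subalgebra k K}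
    (hA : FracSub act A) {q : ℕ} {a h : K} (hh : h ∈ A) (hah : h * a ∈ A)
    (ha : PolyFam fun t => act (pathGL q t) a) :
    ∃ N, ∀ n, N ≤ n → ∀ t, act (pathGL q 0) h ^ n * act (pathGL q t) a ∈ A := by
  obtain ⟨H, hH, hHA⟩ := (polyFam_pathGL q (hA.poly h hh)).exists_polynomial_mem
    fun t => hA.stable _ h hh
  obtain ⟨Q, hQ, hQA⟩ := (polyFam_pathGL q (hA.poly _ hah)).exists_polynomial_mem
    fun t => hA.stable _ _ hah
  obtain ⟨C, hC⟩ := ha.exists_polynomial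
  have hHC : H * C = Q := by
    refine Polynomial.eq_of_infinite_eval_eq _ _
      (Set.Infinite.mono ?_ (infinite_range_algebraMap (k := k)))
    rintro _ ⟨t, rfl⟩
    rw [Set.mem_ofPred_eq, Polynomial.eval_mul, hH, hC, hQ]
    exact (map_mul (act (pathGL q t)) h a).symm
  have h0 : H.coeff 0 = act (pathGL q 0) h := by
    rw [Polynomial.coeff_zero_eq_eval_zero]
    have := hH 0
    rwa [map_zero] at this
  have hθ : act (pathGL q 0) h ∈ A := hA.stable _ h hh
  refine ⟨C.natDegree + 1, fun n hn t => ?_⟩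
  rw [← hC, Polynomial.eval_eq_sum_range, Finset.mul_sum]
  refine A.sum_mem fun i hi => ?_
  have hi' := Finset.mem_range.1 hi
  have h1 := coeff_pow_mul_mem hHA (fun n => hHC ▸ hQA n) i
  rw [h0] at h1
  have h2 := A.mul_mem (A.mul_mem (A.pow_mem hθ (n - (i + 1))) h1)
    (A.pow_mem (A.algebraMap_mem t) i)
  convert h2 using 1
  rw [← mul_assoc, ← mul_assoc, ← pow_add, Nat.sub_add_cancel (by omega)]

variable {P : Type u} [AddCommGroup P] [Module k P] {τ : Representation k (GLinf k) P}

theorem polyFam_lTensor (hτ : polyPart τ = ⊤) (q : ℕ) (z : K ⊗[k] P) :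
    PolyFam fun t => (τ (pathGL q t)⁻¹).lTensor K z := by
  induction z using TensorProduct.induction_on with
  | zero => simpa using PolyFam.zero
  | tmul a p =>
    exact (polyFam_pathGL_inv q (hτ ▸ Submodule.mem_top (x := p))).map (TensorProduct.mk k K P a)
  | add x y hx hy => simpa using hx.add hy

theorem path_bten {κ : Type} [Fintype κ] {c : κ → ℕ} {q : ℕ} (hc : ∀ s, c s < q) :
    ∃ w : Finset κ → Ten k κ, (∀ t : k, tensorRep k κ (pathGL q t) (bten k c) =
      ∑ S, t ^ S.card • w S) ∧ w Finset.univ = bten k c := by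
  classical
  refine ⟨fun S => PiTensorProduct.tprod k
    (S.piecewise (fun s => bv k (c s)) fun s => bv k (q + c s)), fun t => ?_, ?_⟩
  · rw [← tprod_add_smul, bten, tensorRep_tprod]
    congr 1
    ext s : 1
    rw [pathGL_bv (hc s)]
  · dsimp only
    rw [Finset.piecewise_univ, bten]

/-- The full set is the only one of cardinality |κ|, so its term is the whole coefficient of the top
power of t. -/
theorem coeff_univ_mem {κ : Type} [Fintype κ] {W : Type*} [AddCommGroup W] [Module k W]
    {w : Finset κ → W} {S : Submodule k W} (h : ∀ t : k, ∑ X, t ^ X.card • w X ∈ S) :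
    w Finset.univ ∈ S := by
  classical
  let m : ℕ →₀ W := ∑ X, Finsupp.single X.card (w X)
  have hm : ∀ t : k, (m.sum fun s w => t ^ s • w) = ∑ X, t ^ X.card • w X := fun t => by
    rw [← Finsupp.sum_finsetSum_index (by simp) (by simp [smul_add])]
    exact Finset.sum_congr rfl fun X _ => Finsupp.sum_single_index (by simp)
  have h1 := coeff_mem_of_forall_mem (m := m) (S := S) (fun t _ => hm t ▸ h t) (Fintype.card κ)
  rwa [Finsupp.finsetSum_apply, Finset.sum_eq_single Finset.univ, Finset.card_univ,
    Finsupp.single_eq_same] at h1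
  · intro X _ hX
    rw [Finsupp.single_eq_of_ne]
    intro h
    exact hX (Finset.card_eq_iff_eq_univ X |>.1 h.symm)
  · intro h; exact absurd (Finset.mem_univ _) h

/-- After a shift, a map from a tensor power to `K ⊗ P` has an invariant denominator. -/
theorem exists_invariant_denom {act : GLinf k →* (K ≃ₐ[k] K)} {A : Subalgebra k K}
    (hA : FracSub act A) (hτ : polyPart τ = ⊤) {κ : Type} [Fintype κ]
    {f : Ten k κ →ₗ[k] K ⊗[k] P} (hf : Equi (tensorRep k κ) (baseRep act τ) f) :
    ∃ q₀, ∀ q, q₀ ≤ q → ∃ b ∈ A, b ≠ 0 ∧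
      (∀ g : GLinf k, (∀ j, q ≤ j → j < 2 * q → g.1 (bv k j) = bv k j) → act g b = b) ∧
      ∀ v, b • f (tmap κ (tau k (2 * q)) v) ∈ latt P A := by
  classical
  obtain ⟨c, hc, -⟩ := exists_injective_lt κ
  obtain ⟨q₁, hq₁⟩ := exists_entry_bound {c}
  let β := Module.Basis.ofVectorSpace k P
  let B := β.baseChange K
  let z := f (bten k c)
  let s := (B.repr z).support
  obtain ⟨h, hhA, hh0, hhs⟩ := hA.exists_common_denom s fun i => B.repr z i
  obtain ⟨p, hp⟩ := hA.smooth h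
  refine ⟨max q₁ p, fun q hq => ?_⟩
  have hcq : ∀ r, c r < q := fun r =>
    (hq₁ c (Finset.mem_singleton_self c) r).trans_le ((le_max_left _ _).trans hq)
  obtain ⟨w, hw, hwu⟩ := path_bten (k := k) hcq
  let θ : K := act (pathGL q 0) h
  have hθA : θ ∈ A := hA.stable _ h hhA
  have hθ0 : θ ≠ 0 := fun h0 => hh0 ((map_eq_zero_iff _ (act (pathGL q 0)).injective).1 h0)
  have hθg : ∀ g : GLinf k, (∀ j, q ≤ j → j < 2 * q → g.1 (bv k j) = bv k j) → act g θ = θ :=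
    fun g hg => by
      have : actRep act (g * pathGL q 0) h = actRep act (pathGL q 0) h :=
        (hp.mono ((le_max_right _ _).trans hq)).congr fun j hj => by
          change g.1 ((pathGL q 0).1 (bv k j)) = _
          rw [pathGL_bv hj, zero_smul, add_zero, hg _ (by omega) (by omega)]
      rw [map_mul (actRep act) g (pathGL q 0)] at this
      exact this
  have hz : z = ∑ i ∈ s, B.repr z i ⊗ₜ[k] β i := eq_sum_repr β z
  -- Undoing the path on the factor P alone leaves it acting on the coefficients only. The left side
  -- is polynomial in t, because the inverse path is, so the coefficients of z move polynomially.
  have hpath : ∀ t, (τ (pathGL q t)⁻¹).lTensor K (f (tensorRep k κ (pathGL q t) (bten k c))) =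
      ∑ i ∈ s, act (pathGL q t) (B.repr z i) ⊗ₜ[k] β i := fun t => by
    rw [hf]
    change (τ (pathGL q t)⁻¹).lTensor K (baseRep act τ (pathGL q t) z) = _
    conv_lhs => rw [hz]
    rw [map_sum, map_sum]
    refine Finset.sum_congr rfl fun i _ => ?_
    rw [baseRep_tmul, LinearMap.lTensor_tmul, Representation.inv_self_apply]
  have hpf : ∀ i ∈ s, PolyFam fun t => act (pathGL q t) (B.repr z i) := fun i hi => by
    have h1 : PolyFam fun t => (τ (pathGL q t)⁻¹).lTensor K
        (f (tensorRep k κ (pathGL q t) (bten k c))) := by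
      simp only [hw, map_sum, map_smul]
      exact PolyFam.sum fun S _ => (polyFam_lTensor hτ q (f (w S))).pow_smul S.card
    have h2 := h1.map ((B.coord i).restrictScalars k)
    refine (congrArg PolyFam (funext fun t => ?_)).mp h2
    rw [hpath, map_sum, Finset.sum_eq_single_of_mem i hi]
    · simp [B]
    · intro j _ hj
      simp [B, Finsupp.single_eq_of_ne hj.symm]
  have hex : ∀ i, ∃ N, i ∈ s → ∀ n, N ≤ n → ∀ t, θ ^ n * act (pathGL q t) (B.repr z i) ∈ A :=
    fun i => by
      by_cases hi : i ∈ s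
      · obtain ⟨N, hN⟩ := exists_pow_mul_mem hA hhA (hhs i hi) (hpf i hi)
        exact ⟨N, fun _ => hN⟩
      · exact ⟨0, fun h => absurd h hi⟩
  choose N hN using hex
  let b : K := θ ^ s.sup N
  have hbg : ∀ g : GLinf k, (∀ j, q ≤ j → j < 2 * q → g.1 (bv k j) = bv k j) → act g b = b :=
    fun g hg => by rw [map_pow, hθg g hg]
  have h1 : ∀ t, b • f (tensorRep k κ (pathGL q t) (bten k c)) ∈ latt P A := fun t => by
    have h2 : ∑ i ∈ s, (b * act (pathGL q t) (B.repr z i)) ⊗ₜ[k] β i ∈ latt P A :=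
      Submodule.sum_mem _ fun i hi => tmul_mem_latt (hN i hi _ (Finset.le_sup hi) t) _
    have h3 := lTensor_mem_latt (τ (pathGL q t)) h2
    have h4 : ∑ i ∈ s, (b * act (pathGL q t) (B.repr z i)) ⊗ₜ[k] β i =
        b • (τ (pathGL q t)⁻¹).lTensor K (f (tensorRep k κ (pathGL q t) (bten k c))) := by
      rw [hpath, Finset.smul_sum]
      exact Finset.sum_congr rfl fun i _ => by rw [TensorProduct.smul_tmul', smul_eq_mul]
    have h5 : ∀ x : K ⊗[k] P, (τ (pathGL q t)).lTensor K (b • (τ (pathGL q t)⁻¹).lTensor K x) =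
        b • x := fun x => by
      induction x using TensorProduct.induction_on with
      | zero => simp
      | tmul a x =>
        rw [LinearMap.lTensor_tmul, TensorProduct.smul_tmul', LinearMap.lTensor_tmul,
          Representation.self_inv_apply, TensorProduct.smul_tmul']
      | add x y hx hy => rw [map_add, smul_add, map_add, hx, hy, smul_add]
    rwa [h4, h5] at h3
  -- The coefficient of t^|κ| in f(p_t e_c) is f(e_c) itself, and b does not depend on t.
  have h2 : b • f (bten k c) ∈ latt P A := by
    have := coeff_univ_mem (k := k) (w := fun S => b • f (w S)) (S := latt P A) fun t => by
      have := h1 t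
      rw [hw, map_sum, Finset.smul_sum] at this
      refine (congrArg (· ∈ latt P A) (Finset.sum_congr rfl fun S _ => ?_)).mp this
      rw [map_smul, smul_comm]
    rwa [hwu] at this
  -- The denominator b lives in the second block, so g₀ fixes it while moving the tensor away by 2q.
  obtain ⟨g₀, hg1, hg2⟩ := exists_gl_swap (k := k) q
  have h3 : b • f (tmap κ (tau k (2 * q)) (bten k c)) ∈ latt P A := by
    have := baseRep_mem_latt hA.stable τ g₀ h2
    rw [baseRep_smul, hbg g₀ hg2, ← hf, swap_levelSub hg1] at this
    · exact this
    · exact Submodule.subset_span ⟨c, hcq, rfl⟩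
  refine ⟨b, A.pow_mem hθA _, pow_ne_zero _ hθ0, hbg, fun v => ?_⟩
  let R : Submodule k (Ten k κ) := (latt P A).comap
    ((LinearMap.lsmul K (K ⊗[k] P) b).restrictScalars k ∘ₗ f ∘ₗ tmap κ (tau k (2 * q)))
  have hR : R = ⊤ := eq_top_of_bten_mem (fun g x hx => by
    change b • f (tmap κ (tau k (2 * q)) (tensorRep k κ g x)) ∈ latt P A
    have h4 := baseRep_mem_latt hA.stable τ (shiftHom (2 * q) g) hx
    change baseRep act τ (shiftHom (2 * q) g) (b • f (tmap κ (tau k (2 * q)) x)) ∈ _ at h4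
    rw [baseRep_smul, hbg _ fun j _ hj => shiftHom_bv hj g, ← hf] at h4
    rwa [tmap_tau_equi]) hc h3
  exact (hR ▸ Submodule.mem_top : v ∈ R)

end Denominators

/-! ### The shift operator of a smooth representation. -/

section ShiftOperator

variable {k : Type u} [Field k] {W : Type*} [AddCommGroup W] [Module k W]

theorem gl_apply_of_mem_stdSub {N p : ℕ} {g : GLinf k}
    (hg : ∀ i < p, g.1 (bv k i) = bv k (N + i)) {v : Std k} (hv : v ∈ stdSub k p) :
    g.1 v = tau k N v := by
  induction hv using Submodule.span_induction with
  | mem v hv =>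
    obtain ⟨i, hi, rfl⟩ := hv
    exact (hg i hi).trans (tau_bv N i).symm
  | zero => rw [map_zero, map_zero]
  | add x y _ _ hx hy => rw [map_add, map_add, hx, hy]
  | smul a x _ hx => rw [map_smul, map_smul, hx]

/-- The operator on a smooth representation that acts as the elements of the group that shift
enough basis vectors by `N`. -/
def shiftOp (ρ : Representation k (GLinf k) W) (hsm : ∀ x, ∃ p, FixedAt ρ p x) (N : ℕ) :
    W →ₗ[k] W :=
  -- The value does not depend on the level at which x is fixed. Linearity follows by taking a
  -- common level for several vectors.
  have key : ∀ x p, FixedAt ρ p x → ρ (exists_gl_shift N (hsm x).choose).choose x =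
      ρ (exists_gl_shift N p).choose x := fun x p hp => by
    have h1 := (exists_gl_shift (k := k) N (hsm x).choose).choose_spec
    have h2 := (exists_gl_shift (k := k) N p).choose_spec
    rcases le_total p (hsm x).choose with h | h
    · exact hp.congr fun i hi => (h1 i (hi.trans_le h)).trans (h2 i hi).symm
    · exact (hsm x).choose_spec.congr fun i hi => (h1 i hi).trans (h2 i (hi.trans_le h)).symm
  { toFun := fun x => ρ (exists_gl_shift N (hsm x).choose).choose x
    map_add' := fun x y => by
      obtain ⟨p, hp⟩ := hsm x
      obtain ⟨q, hq⟩ := hsm y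
      have hp' := hp.mono (le_max_left p q)
      have hq' := hq.mono (le_max_right p q)
      rw [key x _ hp', key y _ hq', key (x + y) (max p q) (fun g hg => by
        rw [map_add, hp' g hg, hq' g hg]), map_add]
    map_smul' := fun a x => by
      obtain ⟨p, hp⟩ := hsm x
      rw [key x _ hp, key (a • x) p (fun g hg => by rw [map_smul, hp g hg]), map_smul]
      rfl }

variable {ρ : Representation k (GLinf k) W} {hsm : ∀ x, ∃ p, FixedAt ρ p x} {N : ℕ}

theorem shiftOp_eq {x : W} {p : ℕ} (hp : FixedAt ρ p x) {g : GLinf k}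
    (hg : ∀ i < p, g.1 (bv k i) = bv k (N + i)) : shiftOp ρ hsm N x = ρ g x := by
  have h1 := (exists_gl_shift (k := k) N (hsm x).choose).choose_spec
  change ρ (exists_gl_shift N (hsm x).choose).choose x = _
  rcases le_total p (hsm x).choose with h | h
  · exact hp.congr fun i hi => (h1 i (hi.trans_le h)).trans (hg i hi).symm
  · exact (hsm x).choose_spec.congr fun i hi => (h1 i hi).trans (hg i (hi.trans_le h)).symm

theorem exists_shiftOp_eq (ρ : Representation k (GLinf k) W) (hsm : ∀ x, ∃ p, FixedAt ρ p x)
    (N : ℕ) (x : W) : ∃ p, ∀ g : GLinf k,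
      (∀ i < p, g.1 (bv k i) = bv k (N + i)) → shiftOp ρ hsm N x = ρ g x := by
  obtain ⟨p, hp⟩ := hsm x
  exact ⟨p, fun g hg => shiftOp_eq hp hg⟩

theorem shiftOp_injective : Function.Injective (shiftOp ρ hsm N) := by
  rw [injective_iff_map_eq_zero]
  intro x hx
  obtain ⟨p, hp⟩ := exists_shiftOp_eq ρ hsm N x
  obtain ⟨g, hg⟩ := exists_gl_shift (k := k) N p
  rw [hp g hg] at hx
  rw [← Representation.inv_self_apply ρ g x, hx, map_zero]

/-- If g shifts enough vectors, then g h and `shiftHom N h` g agree on the vectors that matter. Thus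
composition with this operator turns a map equivariant for the shifted group into one that
intertwines the original action on its source. -/
theorem shiftOp_equi : Equi ρ (shiftRep ρ N) (shiftOp ρ hsm N) := fun h x => by
  obtain ⟨p, hp⟩ := hsm x
  obtain ⟨r, hr⟩ := hsm (ρ h x)
  obtain ⟨m, hm⟩ := gl_exists_level h
  let q := max (max p r) m
  obtain ⟨g, hg⟩ := exists_gl_shift (k := k) N q
  have hp' := hp.mono ((le_max_left p r).trans (le_max_left _ m))
  rw [shiftOp_eq (hr.mono ((le_max_right p r).trans (le_max_left _ m))) hg, shiftOp_eq hp' hg,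
    shiftRep_apply, ← Module.End.mul_apply, ← Module.End.mul_apply, ← map_mul, ← map_mul]
  refine hp'.congr fun i hi => ?_
  change g.1 (h.1 (bv k i)) = (shiftHom N h).1 (g.1 (bv k i))
  rw [gl_apply_of_mem_stdSub hg ((hm q (le_max_right _ m)).1 i hi), hg i hi, ← tau_bv,
    shiftHom_tau]

theorem shiftOp_comp {κ : Type} [Fintype κ] {f : Ten k κ →ₗ[k] W}
    (hf : Equi (tensorRep k κ) ρ f) (v : Ten k κ) :
    shiftOp ρ hsm N (f v) = f (tmap κ (tau k N) v) := by
  have : shiftOp ρ hsm N ∘ₗ f = f ∘ₗ tmap κ (tau k N) := (tenBasis k κ).ext fun I => by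
    obtain ⟨p, hp⟩ := exists_shiftOp_eq ρ hsm N (f (tenBasis k κ I))
    obtain ⟨g, hg⟩ := exists_gl_shift (k := k) N (max p (Finset.univ.sup I + 1))
    rw [LinearMap.comp_apply, LinearMap.comp_apply,
      hp g fun i hi => hg i (hi.trans_le (le_max_left _ _)), ← hf, tenBasis_apply, bten,
      tensorRep_tprod, tmap_tprod]
    congr 2
    ext s : 1
    rw [tau_bv]
    exact hg _ (lt_of_lt_of_le (Nat.lt_succ_of_le (Finset.le_sup (Finset.mem_univ s)))
      (le_max_right _ _))
  exact LinearMap.congr_fun this v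

end ShiftOperator

/-! ### Shift operators on semi-linear representations. -/

section Semilinear

variable {k : Type u} [Field k] {K : Type u} [Field K] [Algebra k K]
  {M : Type u} [AddCommGroup M] [Module K M] [Module k M] [IsScalarTower k K M]
  {act : GLinf k →* (K ≃ₐ[k] K)} {ρ : Representation k (GLinf k) M} {N : ℕ}

/-- The price of the shift operator: scalars are shifted as well. The coaction below removes this
twist. -/
theorem shiftOp_smul (hρ : Semi act ρ) {hsm : ∀ x, ∃ p, FixedAt ρ p x}
    {hK : ∀ a, ∃ p, FixedAt (actRep act) p a} (a : K) (x : M) :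
    shiftOp ρ hsm N (a • x) = shiftOp (actRep act) hK N a • shiftOp ρ hsm N x := by
  obtain ⟨p, hp⟩ := exists_shiftOp_eq ρ hsm N x
  obtain ⟨q, hq⟩ := exists_shiftOp_eq (actRep act) hK N a
  obtain ⟨r, hr⟩ := exists_shiftOp_eq ρ hsm N (a • x)
  obtain ⟨g, hg⟩ := exists_gl_shift (k := k) N (max (max p q) r)
  rw [hp g fun i hi => hg i (hi.trans_le ((le_max_left p q).trans (le_max_left _ r))),
    hq g fun i hi => hg i (hi.trans_le ((le_max_right p q).trans (le_max_left _ r))),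
    hr g fun i hi => hg i (hi.trans_le (le_max_right _ r)), hρ, actRep_apply]

theorem shiftOp_mem {A : Subalgebra k K} (hA : FracSub act A) {a : K} (ha : a ∈ A) :
    shiftOp (actRep act) hA.smooth N a ∈ A := by
  obtain ⟨p, hp⟩ := exists_shiftOp_eq (actRep act) hA.smooth N a
  obtain ⟨g, hg⟩ := exists_gl_shift (k := k) N p
  rw [hp g hg]
  exact hA.stable g a ha

/-- The smooth elements of a semi-linear representation form a subspace. -/
def smoothSub (hρ : Semi act ρ) (hK : ∀ a, ∃ p, FixedAt (actRep act) p a) : Submodule K M where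
  __ := smoothPart ρ
  smul_mem' a x := by
    rintro ⟨p, hp⟩
    obtain ⟨q, hq⟩ := hK a
    refine ⟨max p q, fun g hg => ?_⟩
    rw [hρ, hp.mono (le_max_left p q) g hg]
    exact congrArg (· • x) (hq.mono (le_max_right p q) g hg)

theorem LowGen.le_smoothSub (hρ : Semi act ρ) (hK : ∀ a, ∃ p, FixedAt (actRep act) p a) {d : ℕ}
    {N : Submodule K M} (hN : LowGen K ρ d N) : N ≤ smoothSub hρ hK := by
  induction hN with
  | bot => exact bot_le
  | sup hN f hcard hf ih =>
    refine sup_le ih (rspan_le fun v => ?_)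
    obtain ⟨p, hp⟩ := tensor_fixedAt v
    exact ⟨p, hp.map hf⟩

end Semilinear

/-! ### Extension of maps from an A-lattice to its K-span. -/

section Extension

variable {k : Type u} [Field k] {K : Type u} [Field K] [Algebra k K]
  {M : Type u} [AddCommGroup M] [Module K M] [Module k M] [IsScalarTower k K M]
  {Q : Type u} [AddCommGroup Q] [Module K Q] [Module k Q] [IsScalarTower k K Q]
  {act : GLinf k →* (K ≃ₐ[k] K)} {A : Subalgebra k K}

theorem FracSub.exists_smul_mem (hA : FracSub act A) {L : Submodule k M}
    (hL : ∀ a ∈ A, ∀ x ∈ L, a • x ∈ L) (hspan : Submodule.span K (L : Set M) = ⊤) (x : M) :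
    ∃ a ∈ A, a ≠ 0 ∧ a • x ∈ L := by
  have hx : x ∈ Submodule.span K (L : Set M) := hspan ▸ Submodule.mem_top
  induction hx using Submodule.span_induction with
  | mem x hx => exact ⟨1, A.one_mem, one_ne_zero, by rwa [one_smul]⟩
  | zero => exact ⟨1, A.one_mem, one_ne_zero, by rw [smul_zero]; exact L.zero_mem⟩
  | add x y _ _ hx hy =>
    obtain ⟨a, ha, ha0, hax⟩ := hx
    obtain ⟨b, hb, hb0, hby⟩ := hy
    refine ⟨a * b, A.mul_mem ha hb, mul_ne_zero ha0 hb0, ?_⟩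
    rw [smul_add, mul_comm, mul_smul, mul_comm, mul_smul]
    exact L.add_mem (hL b hb _ hax) (hL a ha _ hby)
  | smul c x _ hx =>
    obtain ⟨a, ha, ha0, hax⟩ := hx
    obtain ⟨e, he, b, hb, hb0, h⟩ := hA.frac c
    refine ⟨b * a, A.mul_mem hb ha, mul_ne_zero hb0 ha0, ?_⟩
    rw [smul_smul, mul_right_comm, h, mul_smul]
    exact hL e he _ hax

/-- An `A`-linear map on an `A`-lattice extends to a `K`-linear map. -/
theorem FracSub.exists_extension (hA : FracSub act A) {L : Submodule k M}
    (hspan : Submodule.span K (L : Set M) = ⊤)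
    (ψ : M →ₗ[k] Q) (hψ : ∀ a ∈ A, ∀ x ∈ L, ψ (a • x) = a • ψ x) :
    ∃ Ψ : M →ₗ[K] Q, ∀ x ∈ L, Ψ x = ψ x := by
  let B := Module.Basis.ofSpan hspan.ge
  have hB : ∀ i, B i ∈ L := fun i => Module.Basis.ofSpan_subset hspan.ge ⟨i, rfl⟩
  refine ⟨B.constr ℕ fun i => ψ (B i), fun x hx => ?_⟩
  obtain ⟨a, ha, ha0, has⟩ := hA.exists_common_denom (B.repr x).support (B.repr x)
  have hx' : a • x = ∑ i ∈ (B.repr x).support, (a * B.repr x i) • B i := by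
    conv_lhs => rw [← B.linearCombination_repr x, Finsupp.linearCombination_apply, Finsupp.sum]
    rw [Finset.smul_sum]
    exact Finset.sum_congr rfl fun i _ => by rw [mul_smul]
  have h1 : a • ψ x = a • B.constr ℕ (fun i => ψ (B i)) x := by
    rw [← hψ a ha x hx, ← map_smul, hx', map_sum, map_sum]
    refine Finset.sum_congr rfl fun i hi => ?_
    rw [hψ _ (has i hi) _ (hB i), map_smul, Module.Basis.constr_basis]
  exact (smul_right_injective Q ha0 h1).symm

end Extension

/-! ### Coactions and honest equivariant embeddings. -/

section Coaction

variable {k : Type u} [Field k] {K : Type u} [Field K] [Algebra k K]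
  {act : GLinf k →* (K ≃ₐ[k] K)} {A : Subalgebra k K}

/-- The action on a stable subalgebra. -/
def algRep (h : ∀ g, ∀ a ∈ A, act g a ∈ A) : Representation k (GLinf k) A where
  toFun g :=
    { toFun := fun a => ⟨act g a, h g a a.2⟩
      map_add' := fun a b => Subtype.ext (map_add (act g) (a : K) b)
      map_smul' := fun c a => Subtype.ext (map_smul (act g) c (a : K)) }
  map_one' := by ext; simp
  map_mul' g h := by ext; simp

theorem polyPart_algRep [CharZero k] (hA : FracSub act A) : polyPart (algRep hA.stable) = ⊤ :=
  polyPart_subrepresentation (ρ := actRep act)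
    { toSubmodule := Subalgebra.toSubmodule A
      apply_mem_toSubmodule := hA.stable } hA.poly

/-- A coaction of `A` on itself that makes the shifts by `N` of elements of `A` trivial on the
second factor. -/
def HasCoaction (h : ∀ g, ∀ a ∈ A, act g a ∈ A) (N : ℕ) : Prop :=
  ∃ D : A →ₐ[k] A ⊗[k] A, Function.Injective D ∧
    (∀ g a, D (algRep h (shiftHom N g) a) =
      TensorProduct.map (algRep h g) (algRep h (shiftHom N g)) (D a)) ∧
    ∀ a, ∃ p, ∀ g : GLinf k, (∀ i < p, g.1 (bv k i) = bv k (N + i)) → D (algRep h g a) = a ⊗ₜ 1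

variable {P : Type u} [AddCommGroup P] [Module k P]

variable (A P) in
/-- The canonical map from `(A ⊗ A) ⊗ P` to `K ⊗ (A ⊗ P)`. -/
def reassoc : (A ⊗[k] A) ⊗[k] P →ₗ[k] K ⊗[k] (A ⊗[k] P) :=
  A.val.toLinearMap.rTensor (A ⊗[k] P) ∘ₗ (TensorProduct.assoc k A A P).toLinearMap

theorem reassoc_tmul (a b : A) (p : P) : reassoc A P ((a ⊗ₜ b) ⊗ₜ p) = (a : K) ⊗ₜ (b ⊗ₜ p) := rfl

theorem reassoc_injective : Function.Injective (reassoc A P) :=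
  (Module.Flat.rTensor_preserves_injective_linearMap _ Subtype.val_injective).comp
    (TensorProduct.assoc k A A P).injective

theorem reassoc_mul (a : A) (w : A ⊗[k] A) (p : P) :
    reassoc A P (((a ⊗ₜ 1) * w) ⊗ₜ p) = (a : K) • reassoc A P (w ⊗ₜ p) := by
  induction w using TensorProduct.induction_on with
  | zero => simp
  | tmul b c =>
    rw [Algebra.TensorProduct.tmul_mul_tmul, one_mul, reassoc_tmul, reassoc_tmul,
      TensorProduct.smul_tmul']
    rfl
  | add x y hx hy => rw [mul_add, TensorProduct.add_tmul, map_add, hx, hy, TensorProduct.add_tmul,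
      map_add, smul_add]

theorem reassoc_equi (h : ∀ g, ∀ a ∈ A, act g a ∈ A)
    (g g' : GLinf k) (w : A ⊗[k] A) (f : P →ₗ[k] P) (p : P) :
    reassoc A P (TensorProduct.map (algRep h g) (algRep h g') w ⊗ₜ f p) =
      TensorProduct.map (actRep act g) (TensorProduct.map (algRep h g') f)
        (reassoc A P (w ⊗ₜ p)) := by
  induction w using TensorProduct.induction_on with
  | zero => simp
  | tmul b c => rfl
  | add x y hx hy => rw [map_add, TensorProduct.add_tmul, map_add, hx, hy, TensorProduct.add_tmul,
      map_add, map_add]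

variable {M : Type u} [AddCommGroup M] [Module K M] [Module k M] [IsScalarTower k K M]
  {ρ : Representation k (GLinf k) M}

/-- The denominators of all generators at once. -/
theorem LowGen.exists_denom [CharZero k] (hA : FracSub act A)
    (hsm : ∀ x, ∃ p, FixedAt ρ p x) {d n : ℕ} {τ : Representation k (GLinf k) P}
    {φ : M →ₗ[K] K ⊗[k] P} (hτ : polyPart τ = ⊤)
    (hφ : ∀ g x, φ (ρ (shiftHom n g) x) = baseRep (act.comp (shiftHom n)) τ g (φ x))
    {L : Submodule K M} (hL : LowGen K ρ d L) :
    ∃ q₀, ∀ q, q₀ ≤ q → ∃ b ∈ A, b ≠ 0 ∧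
      (∀ g : GLinf k, (∀ j, q ≤ j → j < 2 * q → g.1 (bv k j) = bv k j) →
        act (shiftHom n g) b = b) ∧
      L ≤ Submodule.span K {x | b • φ (shiftOp ρ hsm (n + 2 * q) x) ∈ latt P A} := by
  induction hL with
  | bot => exact ⟨0, fun q _ => ⟨1, A.one_mem, one_ne_zero, fun g _ => map_one _, bot_le⟩⟩
  | @sup L hL κ _ f hcard hf ih =>
    obtain ⟨q₁, h₁⟩ := ih
    have hf' : Equi (tensorRep k κ) (baseRep (act.comp (shiftHom n)) τ)
        (φ.restrictScalars k ∘ₗ f ∘ₗ tmap κ (tau k n)) := fun g x => by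
      change φ (f (tmap κ (tau k n) (tensorRep k κ g x))) = _
      rw [tmap_tau_equi, shiftRep_apply, hf, hφ]
      rfl
    obtain ⟨q₂, h₂⟩ := exists_invariant_denom (hA.shift n) hτ hf'
    refine ⟨max q₁ q₂, fun q hq => ?_⟩
    obtain ⟨b₁, hb₁, hb₁0, hb₁g, hs₁⟩ := h₁ q ((le_max_left _ _).trans hq)
    obtain ⟨b₂, hb₂, hb₂0, hb₂g, hs₂⟩ := h₂ q ((le_max_right _ _).trans hq)
    refine ⟨b₁ * b₂, A.mul_mem hb₁ hb₂, mul_ne_zero hb₁0 hb₂0, fun g hg => ?_,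
      sup_le (hs₁.trans (Submodule.span_mono fun x hx => ?_)) (rspan_le fun v =>
        Submodule.subset_span ?_)⟩
    · rw [map_mul, hb₁g g hg]
      exact congrArg (b₁ * ·) (hb₂g g hg)
    · rw [Set.mem_ofPred_eq] at hx ⊢
      rw [mul_comm, mul_smul]
      exact smul_mem_latt hb₂ hx
    · have h3 := smul_mem_latt hb₁ (hs₂ v)
      rw [Set.mem_ofPred_eq, shiftOp_comp hf, mul_smul]
      convert h3 using 3
      change φ _ = φ (f (tmap κ (tau k n) (tmap κ (tau k (2 * q)) v)))
      rw [tmap_tmap]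
      congr 3
      exact congrArg _ (LinearMap.ext fun v => (tau_tau n (2 * q) v).symm)

/-- A finitely generated module embeds equivariantly into the extension of scalars of a polynomial
representation. -/
theorem LowGen.exists_embedding [CharZero k] (hA : FracSub act A)
    (hD : ∀ N, HasCoaction hA.stable N) (hρ : Semi act ρ) {d : ℕ}
    (hL : LowGen K ρ d (⊤ : Submodule K M)) :
    ∃ (Q : Type u) (_ : AddCommGroup Q) (_ : Module k Q) (τ : Representation k (GLinf k) Q)
      (Ψ : M →ₗ[K] K ⊗[k] Q), polyPart τ = ⊤ ∧ Function.Injective Ψ ∧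
        Equi ρ (baseRep act τ) (Ψ.restrictScalars k) := by
  obtain ⟨n, P, _, _, τ, φ, hτ, hφi, hφ⟩ := LowGen.embeds d act ρ ⊤ hA hρ hL
  have hsm : ∀ x, ∃ p, FixedAt ρ p x := fun x =>
    hL.le_smoothSub hρ hA.smooth (Submodule.mem_top (x := x))
  obtain ⟨q, hq⟩ := hL.exists_denom hA hsm hτ fun g x => hφ g x Submodule.mem_top
  obtain ⟨b, hb, hb0, hbg, hspan⟩ := hq q le_rfl
  let N := n + 2 * q
  let T := shiftOp ρ hsm N
  let TK := shiftOp (actRep act) hA.smooth N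
  obtain ⟨D, hDi, hDg, hDT⟩ := hD N
  -- This map intertwines the action of g on M with that of the shift of g, as b is invariant under
  -- the shifts by N, but it is only semi-linear with respect to the shift `TK` of scalars.
  let ψ₁ : M →ₗ[k] K ⊗[k] P :=
    (LinearMap.lsmul K (K ⊗[k] P) b).restrictScalars k ∘ₗ φ.restrictScalars k ∘ₗ T
  have hψ₁ : ∀ x, ψ₁ x = b • φ (T x) := fun x => rfl
  have hψ₁a : ∀ a x, ψ₁ (a • x) = TK a • ψ₁ x := fun a x => by
    rw [hψ₁, hψ₁, shiftOp_smul hρ (hK := hA.smooth), map_smul, smul_comm]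
  have hψ₁g : ∀ g x, ψ₁ (ρ g x) =
      baseRep (act.comp (shiftHom N)) (shiftRep τ (2 * q)) g (ψ₁ x) := fun g x => by
    rw [hψ₁, hψ₁, shiftOp_equi, shiftRep_apply, ← shiftHom_shiftHom, hφ _ _ Submodule.mem_top,
      baseRep_smul]
    have h1 : (act.comp (shiftHom N)) g b = b := by
      rw [MonoidHom.comp_apply, ← shiftHom_shiftHom]
      exact hbg _ fun j _ hj => shiftHom_bv hj g
    rw [h1]
    congr 1
    have h2 : actRep (act.comp (shiftHom n)) (shiftHom (2 * q) g) =
        actRep (act.comp (shiftHom N)) g := LinearMap.ext fun a => by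
      change act (shiftHom n (shiftHom (2 * q) g)) a = act (shiftHom N g) a
      rw [shiftHom_shiftHom]
    change TensorProduct.map (actRep (act.comp (shiftHom n)) (shiftHom (2 * q) g)) _ _ = _
    rw [h2]
    rfl
  let ι : A ⊗[k] P →ₗ[k] K ⊗[k] P := A.val.toLinearMap.rTensor P
  have hι : Function.Injective ι :=
    Module.Flat.rTensor_preserves_injective_linearMap _ Subtype.val_injective
  -- An arbitrary k-linear left inverse: it makes `ψ` defined everywhere, but only its values on the
  -- image of A ⊗ P enter the argument.
  obtain ⟨r, hr⟩ := ι.exists_leftInverse_of_injective (LinearMap.ker_eq_bot.2 hι)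
  have hrι : ∀ w, r (ι w) = w := fun w => LinearMap.congr_fun hr w
  let Dh : A ⊗[k] P →ₗ[k] K ⊗[k] (A ⊗[k] P) := reassoc A P ∘ₗ D.toLinearMap.rTensor P
  have hDh : Function.Injective Dh :=
    reassoc_injective.comp (Module.Flat.rTensor_preserves_injective_linearMap D.toLinearMap hDi)
  -- The coaction sends the shift of a to a ⊗ 1, so `ψ` is A-linear on the lattice L. It also turns
  -- the shifted action on A into the original action on the first factor, which makes `ψ`
  -- equivariant into K ⊗ (A ⊗ P).
  let ψ := Dh ∘ₗ r ∘ₗ ψ₁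
  let L : Submodule k M := (latt P A).comap ψ₁
  have hLa : ∀ a ∈ A, ∀ x ∈ L, a • x ∈ L := fun a ha x hx => by
    change ψ₁ (a • x) ∈ latt P A
    rw [hψ₁a]
    exact smul_mem_latt (shiftOp_mem hA ha) hx
  have hLs : Submodule.span K (L : Set M) = ⊤ := top_le_iff.1 hspan
  have hLg : ∀ g, ∀ x ∈ L, ρ g x ∈ L := fun g x hx => by
    change ψ₁ (ρ g x) ∈ latt P A
    rw [hψ₁g]
    exact baseRep_mem_latt (hA.shift N).stable _ g hx
  have hψa : ∀ a ∈ A, ∀ x ∈ L, ψ (a • x) = a • ψ x := fun a ha x hx => by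
    obtain ⟨w, hw⟩ := hx
    change Dh (r (ψ₁ (a • x))) = a • Dh (r (ψ₁ x))
    rw [hψ₁a, ← hw]
    have h1 : ∀ w, TK a • ι w = ι ((⟨TK a, shiftOp_mem hA ha⟩ : A) • w) := fun w => by
      induction w using TensorProduct.induction_on with
      | zero => simp
      | tmul c p => rfl
      | add x y hx hy => rw [map_add, smul_add, hx, hy, smul_add, map_add]
    change Dh (r (TK a • ι w)) = a • Dh (r (ι w))
    rw [h1, hrι, hrι]
    obtain ⟨p, hp⟩ := hDT ⟨a, ha⟩
    obtain ⟨p', hp'⟩ := exists_shiftOp_eq (actRep act) hA.smooth N a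
    obtain ⟨g, hg⟩ := exists_gl_shift (k := k) N (max p p')
    have h2 : (⟨TK a, shiftOp_mem hA ha⟩ : A) = algRep hA.stable g ⟨a, ha⟩ :=
      Subtype.ext (hp' g fun i hi => hg i (hi.trans_le (le_max_right p p')))
    have h3 := hp g fun i hi => hg i (hi.trans_le (le_max_left p p'))
    rw [h2]
    clear hw
    induction w using TensorProduct.induction_on with
    | zero => simp
    | tmul c p =>
      change reassoc A P (D (algRep hA.stable g ⟨a, ha⟩ * c) ⊗ₜ p) = a • reassoc A P (D c ⊗ₜ p)
      rw [map_mul, h3, reassoc_mul]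
    | add x y hx hy => rw [smul_add, map_add, hx, hy, map_add, smul_add]
  obtain ⟨Ψ, hΨ⟩ := hA.exists_extension hLs ψ hψa
  let τ' := (shiftRep (algRep hA.stable) N).tprod (shiftRep τ (2 * q))
  have hψg : ∀ g, ∀ x ∈ L, ψ (ρ g x) = baseRep act τ' g (ψ x) := fun g x hx => by
    obtain ⟨w, hw⟩ := hx
    change Dh (r (ψ₁ (ρ g x))) = baseRep act τ' g (Dh (r (ψ₁ x)))
    rw [hψ₁g, ← hw]
    have h1 : ∀ w, baseRep (act.comp (shiftHom N)) (shiftRep τ (2 * q)) g (ι w) = ι (τ' g w) :=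
      fun w => by
        induction w using TensorProduct.induction_on with
        | zero => simp
        | tmul c p => rfl
        | add x y hx hy => simp only [map_add, hx, hy]
    change Dh (r (baseRep _ _ g (ι w))) = baseRep act τ' g (Dh (r (ι w)))
    rw [h1, hrι, hrι]
    clear hw
    induction w using TensorProduct.induction_on with
    | zero => simp
    | tmul c p =>
      change reassoc A P (D (algRep hA.stable (shiftHom N g) c) ⊗ₜ τ (shiftHom (2 * q) g) p) =
        baseRep act τ' g (reassoc A P (D c ⊗ₜ p))
      rw [hDg, reassoc_equi]
      rfl
    | add x y hx hy => simp only [map_add, hx, hy]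
  refine ⟨A ⊗[k] P, inferInstance, inferInstance, τ', Ψ,
    polyPart_tprod (polyPart_shiftRep N (polyPart_algRep hA)) (polyPart_shiftRep _ hτ), ?_, ?_⟩
  · rw [injective_iff_map_eq_zero]
    intro x hx
    obtain ⟨a, ha, ha0, hax⟩ := hA.exists_smul_mem hLa hLs x
    have h1 : ψ (a • x) = 0 := by rw [← hΨ _ hax, map_smul, hx, smul_zero]
    obtain ⟨w, hw⟩ := hax
    have h2 : Dh (r (ψ₁ (a • x))) = 0 := h1
    rw [← hw] at h2
    change Dh (r (ι w)) = 0 at h2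
    rw [hrι, map_eq_zero_iff _ hDh] at h2
    rw [h2, map_zero, hψ₁] at hw
    have h3 := hφi _ Submodule.mem_top (smul_eq_zero.1 hw.symm |>.resolve_left hb0)
    rw [map_eq_zero_iff _ shiftOp_injective] at h3
    exact (smul_eq_zero.1 h3).resolve_left ha0
  · intro g x
    have hx : x ∈ Submodule.span K (L : Set M) := hLs ▸ Submodule.mem_top
    change Ψ (ρ g x) = baseRep act τ' g (Ψ x)
    induction hx using Submodule.span_induction with
    | mem x hx => rw [hΨ _ (hLg g x hx), hΨ x hx, hψg g x hx]
    | zero => simp only [map_zero]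
    | add x y _ _ hx hy => simp only [map_add, hx, hy]
    | smul a x _ hx => rw [hρ, map_smul, map_smul, baseRep_smul, hx]

end Coaction

/-! ### Finite separating families of maps to K ⊗ Schur functors. -/

section Separation

variable {k : Type u} [Field k] {K : Type u} [Field K] [Algebra k K]
  {P : Type u} [AddCommGroup P] [Module k P]
  {act : GLinf k →* (K ≃ₐ[k] K)} {A : Subalgebra k K}

/-- Maps that are jointly injective remain so after extension of scalars. -/
theorem eq_zero_of_lTensor_eq_zero {N : Submodule k P} {ι : Type*} {V : ι → Type*}
    [∀ j, AddCommGroup (V j)] [∀ j, Module k (V j)] {p : ∀ j, P →ₗ[k] V j}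
    (hp : ∀ x ∈ N, (∀ j, p j x = 0) → x = 0) {z : K ⊗[k] P}
    (hz : z ∈ LinearMap.range (N.subtype.lTensor K)) (h : ∀ j, (p j).lTensor K z = 0) : z = 0 := by
  classical
  let B := Module.Basis.ofVectorSpace k K
  have hB : ∀ {V : Type _} [AddCommGroup V] [Module k V] (f : P →ₗ[k] V) (z : K ⊗[k] P) i,
      TensorProduct.equivFinsuppOfBasisLeft B (f.lTensor K z) i =
        f (TensorProduct.equivFinsuppOfBasisLeft B z i) := fun f z i => by
    induction z using TensorProduct.induction_on with
    | zero => simp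
    | tmul a x => simp
    | add x y hx hy => simp only [map_add, Finsupp.add_apply, hx, hy]
  have hN : ∀ i, TensorProduct.equivFinsuppOfBasisLeft B z i ∈ N := fun i => by
    clear h
    obtain ⟨w, rfl⟩ := hz
    induction w using TensorProduct.induction_on with
    | zero => simp
    | tmul a x =>
      rw [LinearMap.lTensor_tmul, TensorProduct.equivFinsuppOfBasisLeft_apply_tmul_apply]
      exact N.smul_mem _ x.2
    | add x y hx hy =>
      rw [map_add, map_add, Finsupp.add_apply]
      exact N.add_mem hx hy
  refine (TensorProduct.equivFinsuppOfBasisLeft B).injective (Finsupp.ext fun i => ?_)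
  rw [map_zero, Finsupp.zero_apply]
  exact hp _ (hN i) fun j => by rw [← hB, h, map_zero, Finsupp.zero_apply]

theorem range_lTensor_stable {τ : Representation k (GLinf k) P} {N : Submodule k P}
    (hN : ∀ g x, x ∈ N → τ g x ∈ N) (g : GLinf k) {z : K ⊗[k] P}
    (hz : z ∈ LinearMap.range (N.subtype.lTensor K)) :
    baseRep act τ g z ∈ LinearMap.range (N.subtype.lTensor K) := by
  obtain ⟨w, rfl⟩ := hz
  induction w using TensorProduct.induction_on with
  | zero => simp
  | tmul a x => exact ⟨act g a ⊗ₜ ⟨τ g x, hN g x x.2⟩, rfl⟩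
  | add x y hx hy => rw [map_add, map_add]; exact Submodule.add_mem _ hx hy

theorem exists_finset_mem_range (z : K ⊗[k] P) : ∃ F : Finset P, ∀ N : Submodule k P,
    (∀ x ∈ F, x ∈ N) → z ∈ LinearMap.range (N.subtype.lTensor K) := by
  classical
  induction z using TensorProduct.induction_on with
  | zero => exact ⟨∅, fun N _ => Submodule.zero_mem _⟩
  | tmul a x => exact ⟨{x}, fun N hN => ⟨a ⊗ₜ ⟨x, hN x (Finset.mem_singleton_self x)⟩, rfl⟩⟩
  | add x y hx hy =>
    obtain ⟨F, hF⟩ := hx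
    obtain ⟨F', hF'⟩ := hy
    exact ⟨F ∪ F', fun N hN => Submodule.add_mem _
      (hF N fun x hx => hN x (Finset.mem_union_left _ hx))
      (hF' N fun x hx => hN x (Finset.mem_union_right _ hx))⟩

variable {M : Type u} [AddCommGroup M] [Module K M] [Module k M] [IsScalarTower k K M]
  {ρ : Representation k (GLinf k) M}

/-- Each generator contributes one tensor with distinct entries, and the image of that tensor
involves finitely many vectors of P. This cuts the target down to a finitely generated piece of P,
on which finitely many Schur functors suffice. -/
theorem LowGen.exists_finset {τ : Representation k (GLinf k) P}
    {Ψ : M →ₗ[K] K ⊗[k] P} (hΨ : Equi ρ (baseRep act τ) (Ψ.restrictScalars k)) {d : ℕ}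
    {L : Submodule K M} (hL : LowGen K ρ d L) :
    ∃ F : Finset P, ∀ N : Submodule k P, (∀ g x, x ∈ N → τ g x ∈ N) → (∀ x ∈ F, x ∈ N) →
      ∀ x ∈ L, Ψ x ∈ LinearMap.range (N.subtype.lTensor K) := by
  classical
  induction hL with
  | bot => exact ⟨∅, fun N _ _ x hx => by
      rw [(Submodule.mem_bot K).1 hx, map_zero]; exact Submodule.zero_mem _⟩
  | @sup L hL κ _ f hcard hf ih =>
    obtain ⟨F, hF⟩ := ih
    obtain ⟨c, hc, -⟩ := exists_injective_lt κ
    obtain ⟨F', hF'⟩ := exists_finset_mem_range (Ψ (f (bten k c)))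
    refine ⟨F ∪ F', fun N hN hFN => ?_⟩
    have hS : ∀ v, Ψ (f v) ∈ LinearMap.range (N.subtype.baseChange K) := fun v => by
      have : (LinearMap.range (N.subtype.lTensor K)).comap (Ψ.restrictScalars k ∘ₗ f) = ⊤ :=
        eq_top_of_bten_mem (fun g x hx => by
          change Ψ.restrictScalars k (f (tensorRep k κ g x)) ∈
            LinearMap.range (N.subtype.lTensor K)
          rw [hf, hΨ]
          exact range_lTensor_stable hN g hx) hc
          (hF' N fun x hx => hFN x (Finset.mem_union_right _ hx))
      exact (this ▸ Submodule.mem_top : v ∈ _)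
    have hle : L ⊔ GLStruct.rspan K f ≤ (LinearMap.range (N.subtype.baseChange K)).comap Ψ :=
      sup_le (hF N hN fun x hx => hFN x (Finset.mem_union_left _ hx)) (rspan_le hS)
    exact fun x hx => hle hx

/-- A finitely generated module has a finite jointly injective family of maps to modules
`K ⊗ 𝐒_μ(𝐕)`. -/
theorem LowGen.exists_separating [CharZero k] (hA : FracSub act A)
    (hD : ∀ N, HasCoaction hA.stable N) (hρ : Semi act ρ) {d : ℕ}
    (hL : LowGen K ρ d (⊤ : Submodule K M)) :
    ∃ (ι : Type) (_ : Fintype ι) (μ : ι → YoungDiagram) (θ : ∀ j, M →ₗ[K] K ⊗[k] Schur k (μ j)),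
      (∀ j, Equi ρ (baseRep act (schurRep k (μ j))) ((θ j).restrictScalars k)) ∧
        ∀ x, (∀ j, θ j x = 0) → x = 0 := by
  obtain ⟨Q, _, _, τ, Ψ, hτ, hΨi, hΨ⟩ := hL.exists_embedding hA hD hρ
  obtain ⟨F, hF⟩ := hL.exists_finset hΨ
  obtain ⟨ι, _, μ, p, N, hp, hN, hFN, hpN⟩ := exists_schur_separating hτ F
  refine ⟨ι, inferInstance, μ, fun j => (p j).baseChange K ∘ₗ Ψ, fun j => ?_, fun x hx => ?_⟩
  · exact (hp j).lTensor.comp hΨ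
  · exact hΨi ((eq_zero_of_lTensor_eq_zero hpN (hF N hN hFN x Submodule.mem_top) hx).trans
      (map_zero Ψ).symm)

theorem exists_lowGen_mem {x : M} (hx : x ∈ polyPart ρ) :
    ∃ d, ∃ L : Submodule K M, LowGen K ρ d L ∧ x ∈ L := by
  induction hx using Submodule.span_induction with
  | mem x hx =>
    obtain ⟨κ, _, f, hf, -, y, rfl⟩ := hx
    exact ⟨_, _, LowGen.rspan (Nat.lt_succ_self _) hf, mem_rspan f y⟩
  | zero => exact ⟨0, ⊥, LowGen.bot, Submodule.zero_mem _⟩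
  | add x y _ _ hx hy =>
    obtain ⟨d, L, hL, hxL⟩ := hx
    obtain ⟨d', L', hL', hyL⟩ := hy
    exact ⟨max d d', L ⊔ L', (hL.mono (le_max_left _ _)).sup_low (hL'.mono (le_max_right _ _)),
      Submodule.add_mem _ (Submodule.mem_sup_left hxL) (Submodule.mem_sup_right hyL)⟩
  | smul a x _ hx =>
    obtain ⟨d, L, hL, hxL⟩ := hx
    refine ⟨d, L, hL, ?_⟩
    rw [← algebraMap_smul K]
    exact L.smul_mem _ hxL

theorem exists_lowGen_finset (S : Finset M)
    (hS : ∀ x ∈ S, ∃ (a : K) (y : M), y ∈ polyPart ρ ∧ x = a • y) :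
    ∃ d, ∃ L : Submodule K M, LowGen K ρ d L ∧ ∀ x ∈ S, x ∈ L := by
  classical
  induction S using Finset.induction_on with
  | empty => exact ⟨0, ⊥, LowGen.bot, by simp⟩
  | insert x S _ ih =>
    obtain ⟨d, L, hL, hxL⟩ := ih fun x hx => hS x (Finset.mem_insert_of_mem hx)
    obtain ⟨a, y, hy, rfl⟩ := hS x (Finset.mem_insert_self x S)
    obtain ⟨d', L', hL', hyL⟩ := exists_lowGen_mem (K := K) hy
    refine ⟨max d d', L ⊔ L', (hL.mono (le_max_left _ _)).sup_low (hL'.mono (le_max_right _ _)),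
      fun z hz => ?_⟩
    rcases Finset.mem_insert.1 hz with rfl | hz
    · exact Submodule.mem_sup_right (L'.smul_mem a hyL)
    · exact Submodule.mem_sup_left (hxL z hz)

end Separation

/-! ### Functoriality of Schur functors for arbitrary linear maps of 𝐕. -/

section FunctorialMaps

variable {k : Type u} [Field k] {r : ℕ} (σ : Fin r → YoungDiagram)

/-- The map on a Schur functor induced by a linear map. -/
def schurMap (φ : Std k →ₗ[k] Std k) (μ : YoungDiagram) : Schur k μ →ₗ[k] Schur k μ :=
  (tmap μ.cells φ).restrict (by
    rintro _ ⟨y, rfl⟩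
    exact ⟨tmap _ φ y, by rw [youngSymmetrizer_eq, permEnd_tmap]⟩)

/-- The map on a sum of Schur functors induced by a linear map. -/
def sumMap (φ : Std k →ₗ[k] Std k) : SchurSum k σ →ₗ[k] SchurSum k σ :=
  DirectSum.lmap fun i => schurMap φ (σ i)

theorem schurMap_schurMap (φ ψ : Std k →ₗ[k] Std k) (μ : YoungDiagram) (x : Schur k μ) :
    schurMap φ μ (schurMap ψ μ x) = schurMap (φ ∘ₗ ψ) μ x := Subtype.ext (tmap_tmap φ ψ x.1)

theorem sumMap_lof (φ : Std k →ₗ[k] Std k) (i : Fin r) (x : Schur k (σ i)) :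
    sumMap σ φ (DirectSum.lof k (Fin r) (fun i => Schur k (σ i)) i x) =
      DirectSum.lof k (Fin r) (fun i => Schur k (σ i)) i (schurMap φ (σ i) x) := by
  rw [sumMap, DirectSum.lmap_lof]

theorem sum_ext {W : Type*} [AddCommGroup W] [Module k W] {f g : SchurSum k σ →ₗ[k] W}
    (h : ∀ i x, f (DirectSum.lof k (Fin r) (fun i => Schur k (σ i)) i x) =
      g (DirectSum.lof k (Fin r) (fun i => Schur k (σ i)) i x)) : f = g :=
  DirectSum.linearMap_ext k fun i => LinearMap.ext (h i)

theorem sumMap_sumMap (φ ψ : Std k →ₗ[k] Std k) (x : SchurSum k σ) :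
    sumMap σ φ (sumMap σ ψ x) = sumMap σ (φ ∘ₗ ψ) x := by
  refine LinearMap.congr_fun (f := sumMap σ φ ∘ₗ sumMap σ ψ) (g := sumMap σ (φ ∘ₗ ψ))
    (sum_ext σ fun i x => ?_) x
  rw [LinearMap.comp_apply, sumMap_lof, sumMap_lof, sumMap_lof, schurMap_schurMap]

theorem sumMap_id (x : SchurSum k σ) : sumMap σ LinearMap.id x = x := by
  refine LinearMap.congr_fun (f := sumMap σ LinearMap.id) (g := LinearMap.id)
    (sum_ext σ fun i x => ?_) x
  rw [sumMap_lof]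
  exact congrArg _ (Subtype.ext (tmap_id x.1))

theorem schurSumRep_apply (g : GLinf k) (x : SchurSum k σ) :
    schurSumRep k σ g x = sumMap σ (g.1 : Std k →ₗ[k] Std k) x := by
  refine LinearMap.congr_fun (f := schurSumRep k σ g) (g := sumMap σ (g.1 : Std k →ₗ[k] Std k))
    (sum_ext σ fun i x => ?_) x
  rw [sumMap_lof, schurSumRep, Representation.directSum_apply, DirectSum.lmap_lof]
  exact congrArg _ (Subtype.ext (tensorRep_eq_tmap g x.1))

theorem tmap_congr {κ : Type} [Fintype κ] (x : Ten k κ) : ∃ p, ∀ φ ψ : Std k →ₗ[k] Std k,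
    (∀ i < p, φ (bv k i) = ψ (bv k i)) → tmap κ φ x = tmap κ ψ x := by
  obtain ⟨p, hp⟩ := exists_mem_levelSub x
  refine ⟨p, fun φ ψ h => ?_⟩
  have hx := hp p le_rfl
  clear hp
  induction hx using Submodule.span_induction with
  | mem x hx =>
    obtain ⟨I, hI, rfl⟩ := hx
    rw [bten, tmap_tprod, tmap_tprod]
    congr 1
    ext s : 1
    exact h _ (hI s)
  | zero => rw [map_zero, map_zero]
  | add x y _ _ hx hy => rw [map_add, map_add, hx, hy]
  | smul a x _ hx => rw [map_smul, map_smul, hx]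

theorem sumMap_congr (x : SchurSum k σ) : ∃ p, ∀ φ ψ : Std k →ₗ[k] Std k,
    (∀ i < p, φ (bv k i) = ψ (bv k i)) → sumMap σ φ x = sumMap σ ψ x := by
  induction x using DirectSum.induction_on with
  | zero => exact ⟨0, fun φ ψ _ => by rw [map_zero, map_zero]⟩
  | of i x =>
    obtain ⟨p, hp⟩ := tmap_congr x.1
    refine ⟨p, fun φ ψ h => ?_⟩
    rw [← DirectSum.lof_eq_of k, sumMap_lof, sumMap_lof]
    exact congrArg _ (Subtype.ext (hp φ ψ h))
  | add x y hx hy =>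
    obtain ⟨p, hp⟩ := hx
    obtain ⟨q, hq⟩ := hy
    refine ⟨max p q, fun φ ψ h => ?_⟩
    rw [map_add, map_add, hp φ ψ fun i hi => h i (hi.trans_le (le_max_left p q)),
      hq φ ψ fun i hi => h i (hi.trans_le (le_max_right p q))]

end FunctorialMaps

/-! ### The splitting coaction on a symmetric algebra. -/

section ShiftPair

variable {k : Type u} [Field k] {W : Type u} [AddCommGroup W] [Module k W]

/-- A shift operator by `N` on a representation and an equivariant left inverse of it. -/
structure ShiftPair (ρ : Representation k (GLinf k) W) (N : ℕ) where
  T : W →ₗ[k] W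
  U : W →ₗ[k] W
  left_inv : ∀ x, U (T x) = x
  equi_T : Equi ρ (shiftRep ρ N) T
  equi_U : Equi (shiftRep ρ N) ρ U
  local_eq : ∀ x, ∃ p, ∀ g : GLinf k, (∀ i < p, g.1 (bv k i) = bv k (N + i)) → ρ g x = T x

/-- The shift operators on a sum of Schur functors. -/
def sumShiftPair {r : ℕ} (σ : Fin r → YoungDiagram) (N : ℕ) : ShiftPair (schurSumRep k σ) N where
  T := sumMap σ (tau k N)
  U := sumMap σ (untau k N)
  left_inv x := by
    rw [sumMap_sumMap, show untau k N ∘ₗ tau k N = LinearMap.id from LinearMap.ext (untau_tau N),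
      sumMap_id]
  equi_T g x := by
    rw [shiftRep_apply, schurSumRep_apply, schurSumRep_apply, sumMap_sumMap, sumMap_sumMap]
    congr 2
    exact LinearMap.ext fun v => (shiftHom_tau N g v).symm
  equi_U g x := by
    rw [shiftRep_apply, schurSumRep_apply, schurSumRep_apply, sumMap_sumMap, sumMap_sumMap]
    congr 2
    exact LinearMap.ext fun v => untau_shiftHom N g v
  local_eq x := by
    obtain ⟨p, hp⟩ := sumMap_congr σ x
    refine ⟨p, fun g hg => ?_⟩
    rw [schurSumRep_apply]
    exact hp _ _ fun i hi => (hg i hi).trans (tau_bv N i).symm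

variable {ρ : Representation k (GLinf k) W} {N : ℕ}

theorem symAct_ι (g : GLinf k) (x : W) :
    symAct ρ g (SymmetricAlgebra.ι k W x) = SymmetricAlgebra.ι k W (ρ g x) := by
  simp [symAct]

/-- The algebra map from `Sym W` to `Sym W ⊗ Sym W` that splits `x` into `U x` and `x - T (U x)`. -/
def symSplit (T U : W →ₗ[k] W) :
    SymmetricAlgebra k W →ₐ[k] SymmetricAlgebra k W ⊗[k] SymmetricAlgebra k W :=
  SymmetricAlgebra.lift
    (Algebra.TensorProduct.includeLeft.toLinearMap ∘ₗ SymmetricAlgebra.ι k W ∘ₗ U +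
      Algebra.TensorProduct.includeRight.toLinearMap ∘ₗ SymmetricAlgebra.ι k W ∘ₗ
        (LinearMap.id - T ∘ₗ U))

theorem symSplit_ι (T U : W →ₗ[k] W) (x : W) :
    symSplit T U (SymmetricAlgebra.ι k W x) = SymmetricAlgebra.ι k W (U x) ⊗ₜ 1 +
      1 ⊗ₜ SymmetricAlgebra.ι k W (x - T (U x)) := by
  rw [symSplit, SymmetricAlgebra.lift_ι_apply]
  rfl

/-- Applying T on the first factor and multiplying recovers x = T(Ux) + (x − T(Ux)). -/
theorem symSplit_injective (T U : W →ₗ[k] W) : Function.Injective (symSplit T U) := by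
  let m : SymmetricAlgebra k W ⊗[k] SymmetricAlgebra k W →ₐ[k] SymmetricAlgebra k W :=
    Algebra.TensorProduct.productMap
      (SymmetricAlgebra.lift (SymmetricAlgebra.ι k W ∘ₗ T)) (AlgHom.id k _)
  have : m.comp (symSplit T U) = AlgHom.id k _ :=
      SymmetricAlgebra.algHom_ext (LinearMap.ext fun x => by
    change m (symSplit T U (SymmetricAlgebra.ι k W x)) = SymmetricAlgebra.ι k W x
    rw [symSplit_ι, map_add, Algebra.TensorProduct.productMap_apply_tmul,
      Algebra.TensorProduct.productMap_apply_tmul, SymmetricAlgebra.lift_ι_apply, map_one, map_one,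
      mul_one, one_mul, AlgHom.id_apply, LinearMap.comp_apply, ← map_add, add_sub_cancel])
  exact Function.LeftInverse.injective fun x => AlgHom.congr_fun this x

/-- The coaction on the symmetric algebra. -/
def ShiftPair.coaction (s : ShiftPair ρ N) :
    SymmetricAlgebra k W →ₐ[k] SymmetricAlgebra k W ⊗[k] SymmetricAlgebra k W := symSplit s.T s.U

theorem ShiftPair.coaction_ι (s : ShiftPair ρ N) (x : W) :
    s.coaction (SymmetricAlgebra.ι k W x) = SymmetricAlgebra.ι k W (s.U x) ⊗ₜ 1 +
      1 ⊗ₜ SymmetricAlgebra.ι k W (x - s.T (s.U x)) := symSplit_ι s.T s.U x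

theorem ShiftPair.coaction_injective (s : ShiftPair ρ N) : Function.Injective s.coaction :=
  symSplit_injective s.T s.U

theorem ShiftPair.coaction_equi (s : ShiftPair ρ N) (g : GLinf k) (a : SymmetricAlgebra k W) :
    s.coaction (symAct ρ (shiftHom N g) a) =
      TensorProduct.map (symAct ρ g).toLinearMap (symAct ρ (shiftHom N g)).toLinearMap
        (s.coaction a) := by
  have : s.coaction.comp
      (symAct ρ (shiftHom N g) : SymmetricAlgebra k W →ₐ[k] SymmetricAlgebra k W) =
      (Algebra.TensorProduct.map (symAct ρ g : SymmetricAlgebra k W →ₐ[k] SymmetricAlgebra k W)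
        (symAct ρ (shiftHom N g) : SymmetricAlgebra k W →ₐ[k] SymmetricAlgebra k W)).comp
          s.coaction := SymmetricAlgebra.algHom_ext (LinearMap.ext fun x => by
    change s.coaction (symAct ρ (shiftHom N g) (SymmetricAlgebra.ι k W x)) =
      Algebra.TensorProduct.map _ _ (s.coaction (SymmetricAlgebra.ι k W x))
    have h1 := s.equi_U g x
    rw [shiftRep_apply] at h1
    rw [symAct_ι, s.coaction_ι, s.coaction_ι, map_add, Algebra.TensorProduct.map_tmul,
      Algebra.TensorProduct.map_tmul, map_one, map_one, AlgEquiv.coe_toAlgHom,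
      AlgEquiv.coe_toAlgHom, symAct_ι, symAct_ι, h1,
      s.equi_T, shiftRep_apply, ← map_sub (ρ (shiftHom N g))])
  exact AlgHom.congr_fun this a

/-- An element that shifts far enough acts on a generator as T, and U T = 1 leaves nothing in the
second factor. -/
theorem ShiftPair.coaction_local (s : ShiftPair ρ N) (a : SymmetricAlgebra k W) :
    ∃ p, ∀ g : GLinf k, (∀ i < p, g.1 (bv k i) = bv k (N + i)) →
      s.coaction (symAct ρ g a) = a ⊗ₜ 1 := by
  induction a using SymmetricAlgebra.induction with
  | algebraMap r =>
    refine ⟨0, fun g _ => ?_⟩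
    rw [AlgEquiv.commutes, AlgHom.commutes]
    rfl
  | ι x =>
    obtain ⟨p, hp⟩ := s.local_eq x
    refine ⟨p, fun g hg => ?_⟩
    rw [symAct_ι, s.coaction_ι, hp g hg, s.left_inv, sub_self, map_zero, TensorProduct.tmul_zero,
      add_zero]
  | mul a b ha hb =>
    obtain ⟨p, hp⟩ := ha
    obtain ⟨q, hq⟩ := hb
    refine ⟨max p q, fun g hg => ?_⟩
    rw [map_mul, map_mul, hp g fun i hi => hg i (hi.trans_le (le_max_left p q)),
      hq g fun i hi => hg i (hi.trans_le (le_max_right p q)),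
      Algebra.TensorProduct.tmul_mul_tmul, one_mul]
  | add a b ha hb =>
    obtain ⟨p, hp⟩ := ha
    obtain ⟨q, hq⟩ := hb
    refine ⟨max p q, fun g hg => ?_⟩
    rw [map_add, map_add, hp g fun i hi => hg i (hi.trans_le (le_max_left p q)),
      hq g fun i hi => hg i (hi.trans_le (le_max_right p q)), TensorProduct.add_tmul]

end ShiftPair

/-! ### The symmetric algebra inside its fraction field. -/

section Fractions

variable {k : Type u} [Field k] [CharZero k]

theorem one_mem_polyPart {K : Type u} [Field K] [Algebra k K] {act : GLinf k →* (K ≃ₐ[k] K)}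
    (r : k) : algebraMap k K r ∈ polyPart (actRep act) := by
  have h : Equi (actRep (1 : GLinf k →* (k ≃ₐ[k] k))) (actRep act) (Algebra.linearMap k K) :=
    fun g a => ((act g).commutes a).symm
  have h1 : r ∈ polyPart (actRep (1 : GLinf k →* (k ≃ₐ[k] k))) := by
    rw [polyPart_actRep_one]
    exact Submodule.mem_top
  exact map_mem_polyPart h h1

omit [CharZero k] in
theorem mul_mem_polyPart {K : Type u} [Field K] [Algebra k K] {act : GLinf k →* (K ≃ₐ[k] K)}
    {a b : K} (ha : a ∈ polyPart (actRep act)) (hb : b ∈ polyPart (actRep act)) :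
    a * b ∈ polyPart (actRep act) := by
  have h : Equi ((actRep act).tprod (actRep act)) (actRep act) (LinearMap.mul' k K) := fun g z => by
    induction z using TensorProduct.induction_on with
    | zero => simp
    | tmul a b => exact (map_mul (act g) a b).symm
    | add x y hx hy => simp only [map_add, hx, hy]
  exact map_mem_polyPart h (tmul_mem_polyPart ha hb)

omit [CharZero k] in
theorem HasCoaction.of_shiftPair {K : Type u} [Field K] [Algebra k K]
    {act : GLinf k →* (K ≃ₐ[k] K)} {A : Subalgebra k K} {hA : ∀ g, ∀ a ∈ A, act g a ∈ A}
    {W : Type u} [AddCommGroup W] [Module k W] {ρ : Representation k (GLinf k) W} {N : ℕ}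
    (s : ShiftPair ρ N) (e : SymmetricAlgebra k W ≃ₐ[k] A)
    (he' : ∀ g a, act g (e a) = e (symAct ρ g a)) : HasCoaction hA N := by
  have he : ∀ g a, algRep hA g (e a) = e (symAct ρ g a) := fun g a => Subtype.ext (he' g a)
  let D : A →ₐ[k] A ⊗[k] A :=
    (Algebra.TensorProduct.congr e e).toAlgHom.comp (s.coaction.comp e.symm.toAlgHom)
  have hDe : ∀ a, D (e a) = TensorProduct.map e.toLinearMap e.toLinearMap (s.coaction a) :=
    fun a => by
      change Algebra.TensorProduct.congr e e (s.coaction (e.symm (e a))) = _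
      rw [e.symm_apply_apply]
      rfl
  refine ⟨D, ?_, fun g a => ?_, fun a => ?_⟩
  · exact (Algebra.TensorProduct.congr e e).injective.comp
      (s.coaction_injective.comp e.symm.injective)
  · obtain ⟨a, rfl⟩ := e.surjective a
    rw [he, hDe, hDe, s.coaction_equi]
    generalize s.coaction a = z
    induction z using TensorProduct.induction_on with
    | zero => simp
    | tmul b c =>
      rw [TensorProduct.map_tmul, TensorProduct.map_tmul, TensorProduct.map_tmul,
        TensorProduct.map_tmul]
      exact congrArg₂ (· ⊗ₜ[k] ·) (he _ _).symm (he _ _).symm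
    | add x y hx hy => simp only [map_add, hx, hy]
  · obtain ⟨a, rfl⟩ := e.surjective a
    obtain ⟨p, hp⟩ := s.coaction_local a
    refine ⟨p, fun g hg => ?_⟩
    rw [he, hDe, hp g hg, TensorProduct.map_tmul]
    exact congrArg (e a ⊗ₜ[k] ·) (map_one e)

variable {r : ℕ} (σ : Fin r → YoungDiagram)

variable (k) in
/-- The symmetric algebra as a subalgebra of its field of fractions. -/
def symSub : Subalgebra k (RatField k σ) :=
  (IsScalarTower.toAlgHom k (SymmetricAlgebra k (SchurSum k σ)) (RatField k σ)).range

omit [CharZero k] in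
theorem ratAct_algebraMap (g : GLinf k) (a : SymmetricAlgebra k (SchurSum k σ)) :
    ratAct k σ g (algebraMap _ (RatField k σ) a) =
      algebraMap _ (RatField k σ) (symAct (schurSumRep k σ) g a) :=
  IsFractionRing.fieldEquivOfAlgEquiv_algebraMap _ _ _ _ _

variable (k) in
set_option maxHeartbeats 400000 in
theorem fracSub_symSub : FracSub (ratAct k σ) (symSub k σ) where
  stable := by
    rintro g _ ⟨a, rfl⟩
    exact ⟨symAct (schurSumRep k σ) g a, (ratAct_algebraMap σ g a).symm⟩
  poly := by
    rintro _ ⟨a, rfl⟩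
    change algebraMap (SymmetricAlgebra k (SchurSum k σ)) (RatField k σ) a ∈ _
    induction a using SymmetricAlgebra.induction with
    | algebraMap r =>
      rw [← IsScalarTower.algebraMap_apply]
      exact one_mem_polyPart r
    | ι x =>
      have h : Equi (schurSumRep k σ) (actRep (ratAct k σ))
          ((IsScalarTower.toAlgHom k (SymmetricAlgebra k (SchurSum k σ))
            (RatField k σ)).toLinearMap ∘ₗ SymmetricAlgebra.ι k (SchurSum k σ)) := fun g x => by
        change algebraMap (SymmetricAlgebra k (SchurSum k σ)) (RatField k σ) _ =
          ratAct k σ g (algebraMap (SymmetricAlgebra k (SchurSum k σ)) (RatField k σ) _)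
        rw [ratAct_algebraMap, symAct_ι]
      refine map_mem_polyPart h ?_
      rw [schurSumRep, polyPart_directSum fun i => polyPart_schurRep (σ i)]
      exact Submodule.mem_top
    | mul a b ha hb => rw [map_mul]; exact mul_mem_polyPart ha hb
    | add a b ha hb => rw [map_add]; exact Submodule.add_mem _ ha hb
  frac x := by
    obtain ⟨a, b, hb, rfl⟩ := IsFractionRing.div_surjective
      (A := SymmetricAlgebra k (SchurSum k σ)) x
    have hb0 : algebraMap (SymmetricAlgebra k (SchurSum k σ)) (RatField k σ) b ≠ 0 :=
      IsFractionRing.to_map_ne_zero_of_mem_nonZeroDivisors hb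
    exact ⟨_, ⟨a, rfl⟩, _, ⟨b, rfl⟩, hb0, mul_div_cancel₀ _ hb0⟩

variable (k) in
theorem hasCoaction_symSub (N : ℕ) : HasCoaction (fracSub_symSub k σ).stable N :=
  HasCoaction.of_shiftPair (sumShiftPair σ N)
    (AlgEquiv.ofInjective
      (IsScalarTower.toAlgHom k (SymmetricAlgebra k (SchurSum k σ)) (RatField k σ))
      (IsFractionRing.injective (SymmetricAlgebra k (SchurSum k σ)) (RatField k σ)))
    fun g a => ratAct_algebraMap σ g a

end Fractions

/-! ### Descending a fraction to fewer variables. -/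

section Slices

variable {k : Type u} [Field k]

/-- A linear functional on the second factor of a tensor product of algebras. -/
def sliceMap {B : Type*} [CommRing B] [Algebra k B] (c : B →ₗ[k] k) : B ⊗[k] B →ₗ[k] B :=
  (TensorProduct.rid k B).toLinearMap ∘ₗ c.lTensor B

theorem sliceMap_tmul {B : Type*} [CommRing B] [Algebra k B] (c : B →ₗ[k] k) (x y : B) :
    sliceMap c (x ⊗ₜ y) = c y • x := by
  rw [sliceMap, LinearMap.comp_apply, LinearMap.lTensor_tmul]
  exact TensorProduct.rid_tmul _ _

theorem sliceMap_mul {B : Type*} [CommRing B] [Algebra k B] (c : B →ₗ[k] k) (h : B) (z : B ⊗[k] B) :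
    sliceMap c ((h ⊗ₜ 1) * z) = h * sliceMap c z := by
  induction z using TensorProduct.induction_on with
  | zero => simp
  | tmul x y =>
    rw [Algebra.TensorProduct.tmul_mul_tmul, one_mul, sliceMap_tmul, sliceMap_tmul,
      mul_smul_comm]
  | add x y hx hy => rw [mul_add, map_add, hx, hy, map_add, mul_add]

theorem sliceMap_map {B : Type*} [CommRing B] [Algebra k B] (c : B →ₗ[k] k) (φ : B →ₐ[k] B)
    (z : B ⊗[k] B) : sliceMap c (Algebra.TensorProduct.map φ (AlgHom.id k B) z) =
      φ (sliceMap c z) := by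
  induction z using TensorProduct.induction_on with
  | zero => simp
  | tmul x y => rw [Algebra.TensorProduct.map_tmul, sliceMap_tmul, sliceMap_tmul, map_smul]; rfl
  | add x y hx hy => rw [map_add, map_add, hx, hy, map_add, map_add]

theorem exists_sliceMap_ne_zero {B : Type*} [CommRing B] [Algebra k B] {z : B ⊗[k] B} (hz : z ≠ 0) :
    ∃ c : B →ₗ[k] k, sliceMap c z ≠ 0 := by
  classical
  by_contra! h
  let β := Module.Basis.ofVectorSpace k B
  refine hz ((TensorProduct.equivFinsuppOfBasisRight (M := B) β).injective (Finsupp.ext fun i => ?_))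
  rw [TensorProduct.equivFinsuppOfBasisRight_apply, map_zero, Finsupp.zero_apply]
  exact h (β.coord i)

variable {W : Type u} [AddCommGroup W] [Module k W]

/-- The algebra map on the symmetric algebra induced by a linear map. -/
def symLift (f : W →ₗ[k] W) : SymmetricAlgebra k W →ₐ[k] SymmetricAlgebra k W :=
  SymmetricAlgebra.lift (SymmetricAlgebra.ι k W ∘ₗ f)

theorem symLift_ι (f : W →ₗ[k] W) (x : W) :
    symLift f (SymmetricAlgebra.ι k _ x) = SymmetricAlgebra.ι k _ (f x) := by
  rw [symLift, SymmetricAlgebra.lift_ι_apply, LinearMap.comp_apply]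

variable {e f g : W →ₗ[k] W}

theorem symSplit_idem (hf : ∀ x, f (f x) = f x) (a : SymmetricAlgebra k W) :
    symSplit LinearMap.id f (symLift f a) = symLift f a ⊗ₜ 1 := by
  refine AlgHom.congr_fun (φ₁ := (symSplit LinearMap.id f).comp (symLift f))
    (φ₂ := Algebra.TensorProduct.includeLeft.comp (symLift f))
    (SymmetricAlgebra.algHom_ext (LinearMap.ext fun x => ?_)) a
  change symSplit _ _ (symLift f (SymmetricAlgebra.ι k _ x)) =
    symLift f (SymmetricAlgebra.ι k _ x) ⊗ₜ 1
  rw [symLift_ι, symSplit_ι, hf, LinearMap.id_apply, sub_self, map_zero,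
    TensorProduct.tmul_zero, add_zero]

theorem map_symSplit (he : ∀ x, e (e x) = e x) (hfg : ∀ x, f (g (f x)) = e x)
    (a : SymmetricAlgebra k W) :
    Algebra.TensorProduct.map (symLift e) (AlgHom.id k (SymmetricAlgebra k W))
      (symSplit LinearMap.id f (symLift g (symLift f a))) =
      symSplit LinearMap.id f (symLift g (symLift f a)) := by
  let F := (symSplit LinearMap.id f).comp ((symLift g).comp (symLift f))
  refine AlgHom.congr_fun (φ₁ := (Algebra.TensorProduct.map (symLift e)
    (AlgHom.id k (SymmetricAlgebra k W))).comp F) (φ₂ := F)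
    (SymmetricAlgebra.algHom_ext (LinearMap.ext fun x => ?_)) a
  change Algebra.TensorProduct.map (symLift e) (AlgHom.id k (SymmetricAlgebra k W))
    (symSplit _ _ (symLift g (symLift f (SymmetricAlgebra.ι k _ x)))) =
      symSplit _ _ (symLift g (symLift f (SymmetricAlgebra.ι k _ x)))
  rw [symLift_ι, symLift_ι, symSplit_ι, map_add, Algebra.TensorProduct.map_tmul,
    Algebra.TensorProduct.map_tmul, symLift_ι, map_one, map_one, hfg, he]
  rfl

/-- Splitting along f puts the variables outside the image of f into the second factor. There u and
h stay in the first factor, while the transforms by g have first components in the image of e only.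
A functional on the second factor that does not kill the transform of h yields u' and h'. -/
theorem exists_slice (he : ∀ x, e (e x) = e x) (hf : ∀ x, f (f x) = f x)
    (hfg : ∀ x, f (g (f x)) = e x) {u h : SymmetricAlgebra k W} (hu : symLift f u = u)
    (hh : symLift f h = h) (h0 : symLift g h ≠ 0) (hrel : h * symLift g u = u * symLift g h) :
    ∃ u' h' : SymmetricAlgebra k W, h' ≠ 0 ∧ symLift e u' = u' ∧ symLift e h' = h' ∧
      h * u' = u * h' := by
  have hδu := symSplit_idem hf u
  have hδh := symSplit_idem hf h
  have hδGu := map_symSplit he hfg u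
  have hδGh := map_symSplit he hfg h
  rw [hu] at hδu hδGu
  rw [hh] at hδh hδGh
  obtain ⟨c, hc⟩ := exists_sliceMap_ne_zero (z := symSplit LinearMap.id f (symLift g h))
    (fun h1 => h0 ((map_eq_zero_iff _ (symSplit_injective _ _)).1 h1))
  refine ⟨sliceMap c (symSplit LinearMap.id f (symLift g u)),
    sliceMap c (symSplit LinearMap.id f (symLift g h)), hc, ?_, ?_, ?_⟩
  · rw [← sliceMap_map, hδGu]
  · rw [← sliceMap_map, hδGh]
  · have h1 := congrArg (fun z => sliceMap c (symSplit LinearMap.id f z)) hrel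
    simp only [map_mul, hδu, hδh, sliceMap_mul] at h1
    exact h1

end Slices

theorem mul_eq_mul_of_fractions {S F : Type*} [CommRing S] [Field F] {j : S →+* F}
    (hj : Function.Injective j) {a : F} {h u h' u' : S} (h1 : j h * a = j u)
    (h2 : j h' * a = j u') : h * u' = u * h' := by
  apply hj
  rw [map_mul, map_mul, ← h1, ← h2]
  ring

theorem fraction_eq_of_mul_eq {S F : Type*} [CommRing S] [Field F] {j : S →+* F} {a : F}
    {h u h' u' : S} (hh : j h ≠ 0) (h1 : j h * a = j u) (h2 : h * u' = u * h') :
    j h' * a = j u' := by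
  refine mul_left_cancel₀ hh ?_
  rw [mul_left_comm, h1, ← map_mul, ← map_mul, h2, mul_comm]

/-! ### Fractions that depend on finitely many basis vectors. -/

section Levels

variable {k : Type u} [Field k] {r : ℕ} (σ : Fin r → YoungDiagram)

/-- The algebra map on `Sym (k^{⊕σ})` induced by a linear map. -/
def symMap (φ : Std k →ₗ[k] Std k) :
    SymmetricAlgebra k (SchurSum k σ) →ₐ[k] SymmetricAlgebra k (SchurSum k σ) :=
  symLift (sumMap σ φ)

theorem symMap_ι (φ : Std k →ₗ[k] Std k) (x : SchurSum k σ) :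
    symMap σ φ (SymmetricAlgebra.ι k _ x) = SymmetricAlgebra.ι k _ (sumMap σ φ x) :=
  symLift_ι _ x

theorem symAct_eq_symMap (g : GLinf k) (a : SymmetricAlgebra k (SchurSum k σ)) :
    symAct (schurSumRep k σ) g a = symMap σ (g.1 : Std k →ₗ[k] Std k) a := by
  refine AlgHom.congr_fun (φ₁ := (symAct (schurSumRep k σ) g :
    SymmetricAlgebra k (SchurSum k σ) →ₐ[k] SymmetricAlgebra k (SchurSum k σ)))
    (φ₂ := symMap σ (g.1 : Std k →ₗ[k] Std k))
    (SymmetricAlgebra.algHom_ext (LinearMap.ext fun x => ?_)) a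
  change symAct (schurSumRep k σ) g (SymmetricAlgebra.ι k _ x) = symMap σ _ (SymmetricAlgebra.ι k _ x)
  rw [symAct_ι, symMap_ι, schurSumRep_apply]

theorem symMap_congr (a : SymmetricAlgebra k (SchurSum k σ)) : ∃ p, ∀ φ ψ : Std k →ₗ[k] Std k,
    (∀ i < p, φ (bv k i) = ψ (bv k i)) → symMap σ φ a = symMap σ ψ a := by
  induction a using SymmetricAlgebra.induction with
  | algebraMap r => exact ⟨0, fun φ ψ _ => by rw [AlgHom.commutes, AlgHom.commutes]⟩
  | ι x =>
    obtain ⟨p, hp⟩ := sumMap_congr σ x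
    exact ⟨p, fun φ ψ h => by rw [symMap_ι, symMap_ι, hp φ ψ h]⟩
  | mul a b ha hb =>
    obtain ⟨p, hp⟩ := ha
    obtain ⟨q, hq⟩ := hb
    refine ⟨max p q, fun φ ψ h => ?_⟩
    rw [map_mul, map_mul, hp φ ψ fun i hi => h i (hi.trans_le (le_max_left p q)),
      hq φ ψ fun i hi => h i (hi.trans_le (le_max_right p q))]
  | add a b ha hb =>
    obtain ⟨p, hp⟩ := ha
    obtain ⟨q, hq⟩ := hb
    refine ⟨max p q, fun φ ψ h => ?_⟩
    rw [map_add, map_add, hp φ ψ fun i hi => h i (hi.trans_le (le_max_left p q)),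
      hq φ ψ fun i hi => h i (hi.trans_le (le_max_right p q))]

theorem symMap_id (a : SymmetricAlgebra k (SchurSum k σ)) : symMap σ LinearMap.id a = a := by
  refine AlgHom.congr_fun (φ₂ := AlgHom.id k _)
    (SymmetricAlgebra.algHom_ext (LinearMap.ext fun x => ?_)) a
  change symMap σ LinearMap.id (SymmetricAlgebra.ι k _ x) = SymmetricAlgebra.ι k _ x
  rw [symMap_ι, sumMap_id]

theorem trunc_bv_of_lt {q i : ℕ} (h : i < q) : trunc k q (bv k i) = bv k i := by
  rw [trunc, lc_bv, if_pos h]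

theorem trunc_bv_of_le {q i : ℕ} (h : q ≤ i) : trunc k q (bv k i) = 0 := by
  rw [trunc, lc_bv, if_neg (by omega)]

theorem exists_gl_fix_shift (d p : ℕ) : ∃ g : GLinf k, (∀ i < d, g.1 (bv k i) = bv k i) ∧
    ∀ i, d ≤ i → i < p → g.1 (bv k i) = bv k (p + i) := by
  let s : Equiv.Perm ℕ :=
    { toFun := fun i => if d ≤ i ∧ i < p then p + i else if p + d ≤ i ∧ i < p + p then i - p else i
      invFun := fun i => if d ≤ i ∧ i < p then p + i else if p + d ≤ i ∧ i < p + p then i - p else i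
      left_inv := fun i => by dsimp only; split_ifs <;> omega
      right_inv := fun i => by dsimp only; split_ifs <;> omega }
  refine ⟨permGL s ⟨p + p, fun i hi => ?_⟩, fun i hi => ?_, fun i hi hip => ?_⟩
  · change (if d ≤ i ∧ i < p then p + i else if p + d ≤ i ∧ i < p + p then i - p else i) = i
    split_ifs <;> omega
  · rw [permGL_bv]
    congr 1
    change (if d ≤ i ∧ i < p then p + i else if p + d ≤ i ∧ i < p + p then i - p else i) = i
    split_ifs <;> omega
  · rw [permGL_bv]
    congr 1
    change (if d ≤ i ∧ i < p then p + i else if p + d ≤ i ∧ i < p + p then i - p else i) = p + i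
    split_ifs <;> omega

theorem trunc_comp_fix_shift {d p : ℕ} (hdp : d ≤ p) {g : GLinf k}
    (h1 : ∀ i < d, g.1 (bv k i) = bv k i) (h2 : ∀ i, d ≤ i → i < p → g.1 (bv k i) = bv k (p + i)) :
    trunc k p ∘ₗ (g.1 : Std k →ₗ[k] Std k) ∘ₗ trunc k p = trunc k d := std_ext fun i => by
  rw [LinearMap.comp_apply, LinearMap.comp_apply]
  change trunc k p (g.1 (trunc k p (bv k i))) = _
  rcases lt_or_ge i d with h | h
  · rw [trunc_bv_of_lt (h.trans_le hdp), h1 i h, trunc_bv_of_lt (h.trans_le hdp), trunc_bv_of_lt h]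
  · rw [trunc_bv_of_le h]
    rcases lt_or_ge i p with h' | h'
    · rw [trunc_bv_of_lt h', h2 i h h', trunc_bv_of_le (by omega)]
    · rw [trunc_bv_of_le h', map_zero, map_zero]

/-- `F` is the fraction field of `Sym (k^{⊕σ})`, compatibly with the actions of `GL`. -/
def IsSymFrac {F : Type u} [Field F] [Algebra k F] (act : GLinf k →* (F ≃ₐ[k] F))
    (j : SymmetricAlgebra k (SchurSum k σ) →ₐ[k] F) : Prop :=
  Function.Injective j ∧
  (∀ (g : GLinf k) (s), act g (j s) = j (symMap σ (g.1 : Std k →ₗ[k] Std k) s)) ∧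
  ∀ a : F, ∃ u h, j h ≠ 0 ∧ j h * a = j u

theorem isSymFrac_ratAct : IsSymFrac σ (ratAct k σ)
    (IsScalarTower.toAlgHom k (SymmetricAlgebra k (SchurSum k σ)) (RatField k σ)) := by
  refine ⟨IsFractionRing.injective (SymmetricAlgebra k (SchurSum k σ)) (RatField k σ),
    fun g s => (ratAct_algebraMap σ g s).trans (by rw [symAct_eq_symMap]; rfl), fun a => ?_⟩
  obtain ⟨u, h, hh, rfl⟩ := IsFractionRing.div_surjective
    (A := SymmetricAlgebra k (SchurSum k σ)) a
  have h0 : algebraMap (SymmetricAlgebra k (SchurSum k σ)) (RatField k σ) h ≠ 0 := fun h1 =>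
    nonZeroDivisors.ne_zero hh (IsFractionRing.injective (SymmetricAlgebra k (SchurSum k σ))
      (RatField k σ) (h1.trans (map_zero _).symm))
  exact ⟨u, h, h0, mul_div_cancel₀ _ h0⟩

variable {F : Type u} [Field F] [Algebra k F] {act : GLinf k →* (F ≃ₐ[k] F)}
  {j : SymmetricAlgebra k (SchurSum k σ) →ₐ[k] F}

variable {σ} in
theorem IsSymFrac.inj (h : IsSymFrac σ act j) : Function.Injective j := h.1

variable {σ} in
theorem IsSymFrac.act_apply (h : IsSymFrac σ act j) (g : GLinf k) (s) :
    act g (j s) = j (symMap σ (g.1 : Std k →ₗ[k] Std k) s) := h.2.1 g s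

variable {σ} in
theorem IsSymFrac.frac (h : IsSymFrac σ act j) (a : F) : ∃ u h, j h ≠ 0 ∧ j h * a = j u :=
  h.2.2 a

/-- An element of the fraction field that only depends on the first `d` basis vectors is a fraction
of such elements of the symmetric algebra. -/
theorem IsSymFrac.exists_level_fraction (hj : IsSymFrac σ act j) {d : ℕ} {a : F}
    (ha : FixedAt (actRep act) d a) :
    ∃ u h : SymmetricAlgebra k (SchurSum k σ), j h ≠ 0 ∧ symMap σ (trunc k d) u = u ∧
      symMap σ (trunc k d) h = h ∧ j h * a = j u := by
  obtain ⟨u, h, hh, hha⟩ := hj.frac a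
  obtain ⟨p₁, hp₁⟩ := symMap_congr σ u
  obtain ⟨p₂, hp₂⟩ := symMap_congr σ h
  let p := max d (max p₁ p₂)
  have hup : symMap σ (trunc k p) u = u := (hp₁ _ LinearMap.id fun i hi => trunc_bv_of_lt
    (hi.trans_le ((le_max_left _ _).trans (le_max_right _ _)))).trans (symMap_id σ u)
  have hhp : symMap σ (trunc k p) h = h := (hp₂ _ LinearMap.id fun i hi => trunc_bv_of_lt
    (hi.trans_le ((le_max_right _ _).trans (le_max_right _ _)))).trans (symMap_id σ h)
  -- This g fixes a and moves the vectors e_i with d ≤ i < p beyond p. So a acquires a second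
  -- presentation as a fraction, sharing only the first d vectors with the first one.
  obtain ⟨g, hg1, hg2⟩ := exists_gl_fix_shift (k := k) d p
  have hga : j (symMap σ (g.1 : Std k →ₗ[k] Std k) h) * a =
      j (symMap σ (g.1 : Std k →ₗ[k] Std k) u) := by
    have h1 := congrArg (act g) hha
    have h2 : act g a = a := ha g hg1
    rwa [map_mul, hj.act_apply, hj.act_apply, h2] at h1
  have hrel : h * symMap σ (g.1 : Std k →ₗ[k] Std k) u =
      u * symMap σ (g.1 : Std k →ₗ[k] Std k) h :=
    mul_eq_mul_of_fractions (j := (j : _ →+* F)) hj.inj hha hga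
  have hGh : symMap σ (g.1 : Std k →ₗ[k] Std k) h ≠ 0 := fun h0 => hh (by
    have h1 := hj.act_apply g h
    rw [h0, map_zero] at h1
    exact (map_eq_zero_iff _ (act g).injective).1 h1)
  obtain ⟨u', h', hh', hu'e, hh'e, hrel'⟩ := exists_slice
    (e := sumMap σ (trunc k d)) (f := sumMap σ (trunc k p))
    (g := sumMap σ (g.1 : Std k →ₗ[k] Std k))
    (fun x => by rw [sumMap_sumMap, show trunc k d ∘ₗ trunc k d = trunc k d from
      LinearMap.ext (trunc_trunc d)])
    (fun x => by rw [sumMap_sumMap, show trunc k p ∘ₗ trunc k p = trunc k p from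
      LinearMap.ext (trunc_trunc p)])
    (fun x => by rw [sumMap_sumMap, sumMap_sumMap,
      ← trunc_comp_fix_shift (le_max_left d (max p₁ p₂)) hg1 hg2]; rfl) hup hhp hGh hrel
  exact ⟨u', h', fun h0 => hh' (hj.inj (h0.trans (map_zero j).symm)), hu'e, hh'e,
    fraction_eq_of_mul_eq (j := (j : _ →+* F)) hh hha hrel'⟩

theorem IsSymFrac.exists_common_level_fraction (hj : IsSymFrac σ act j) {d : ℕ} {ι : Type*}
    (s : Finset ι) (a : ι → F) (ha : ∀ i ∈ s, FixedAt (actRep act) d (a i)) :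
    ∃ (h : SymmetricAlgebra k (SchurSum k σ)) (u : ι → SymmetricAlgebra k (SchurSum k σ)),
      j h ≠ 0 ∧ symMap σ (trunc k d) h = h ∧
        ∀ i ∈ s, symMap σ (trunc k d) (u i) = u i ∧ j h * a i = j (u i) := by
  classical
  induction s using Finset.induction_on with
  | empty => exact ⟨1, fun _ => 0, by simp, map_one _, fun i hi => absurd hi (by simp)⟩
  | insert i s hi ih =>
    obtain ⟨h, u, h0, h1, h2⟩ := ih fun i' hi' => ha i' (Finset.mem_insert_of_mem hi')
    obtain ⟨v, h', h0', hv, hh', hva⟩ :=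
      hj.exists_level_fraction σ (ha i (Finset.mem_insert_self i s))
    refine ⟨h * h', fun i' => if i' = i then h * v else u i' * h', ?_, ?_, fun i' hi' => ?_⟩
    · rw [map_mul]
      exact mul_ne_zero h0 h0'
    · rw [map_mul, h1, hh']
    · by_cases he : i' = i
      · subst he
        simp only [if_true]
        rw [map_mul, map_mul, map_mul, h1, hv, mul_assoc, hva]
        exact ⟨rfl, rfl⟩
      · obtain ⟨h3, h4⟩ := h2 i' (Finset.mem_of_mem_insert_of_ne hi' he)
        simp only [if_neg he]
        rw [map_mul, map_mul, map_mul, h3, hh', ← h4]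
        exact ⟨rfl, by ring⟩

end Levels

/-! ### A functional on multilinear coefficients that kills an ideal. -/

section Functional

open MvPolynomial

variable {κ : Type} [Fintype κ] [DecidableEq κ] {q : ℕ}

/-- The exponent of the monomial that takes one variable, or none, from each block. -/
def blockExp (o : κ → Option (Fin q)) : κ × Fin q →₀ ℕ :=
  Finsupp.equivFunOnFinite.symm fun x => if o x.1 = some x.2 then 1 else 0

theorem blockExp_apply (o : κ → Option (Fin q)) (x : κ × Fin q) :
    blockExp o x = if o x.1 = some x.2 then 1 else 0 := rfl

theorem blockExp_injective : Function.Injective (blockExp (κ := κ) (q := q)) := by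
  intro o o' h
  funext s
  refine Option.ext fun n => ?_
  have h1 := DFunLike.congr_fun h (s, n)
  rw [blockExp_apply, blockExp_apply] at h1
  dsimp only at h1
  split_ifs at h1 <;> simp_all

theorem exists_blockExp_eq {m : κ × Fin q →₀ ℕ} {i : κ → Fin q}
    (h : m ≤ blockExp fun s => some (i s)) : ∃ o, m = blockExp o := by
  refine ⟨fun s => if m (s, i s) = 0 then none else some (i s), Finsupp.ext fun x => ?_⟩
  obtain ⟨s, n⟩ := x
  have h1 := h (s, n)
  rw [blockExp_apply] at h1 ⊢
  dsimp only at h1 ⊢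
  by_cases hn : i s = n
  · subst hn
    rw [if_pos rfl] at h1
    split_ifs with h2 h3 h3
    · exact absurd h3 (by simp)
    · exact h2
    · omega
    · exact absurd rfl h3
  · rw [if_neg (fun h => hn (Option.some_injective _ h))] at h1
    split_ifs with h2 h3 h3
    · exact absurd h3 (by simp)
    · omega
    · exact absurd (Option.some_injective _ h3) hn
    · omega

theorem eq_of_blockExp_le {i i' : κ → Fin q}
    (h : blockExp (fun s => some (i s)) ≤ blockExp fun s => some (i' s)) : i = i' := by
  funext s
  have h1 := h (s, i s)
  rw [blockExp_apply, blockExp_apply, if_pos rfl] at h1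
  by_contra hne
  rw [if_neg (fun h => hne (Option.some_injective _ h).symm)] at h1
  omega

theorem degree_blockExp (i : κ → Fin q) :
    (blockExp fun s => some (i s)).degree = Fintype.card κ := by
  rw [Finsupp.degree_eq_sum, Fintype.sum_prod_type]
  simp [blockExp_apply]

theorem prod_block_eq_monomial {F : Type*} [CommRing F] (o : κ → Option (Fin q)) :
    ∏ s, (o s).elim (1 : MvPolynomial (κ × Fin q) F) (fun n => X (s, n)) =
      monomial (blockExp o) 1 := by
  rw [monomial_eq, C_1, one_mul, Finsupp.prod_fintype _ _ (fun _ => pow_zero _),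
    Fintype.prod_prod_type]
  refine Finset.prod_congr rfl fun s _ => ?_
  cases h : o s with
  | none => simp [blockExp_apply, h]
  | some n => simp [blockExp_apply, h]

/-- Bernoulli's inequality gives (q/(q+1))^d ≥ 1 − d/(q+1), and this exceeds N/(N+1) as soon as
d(N+1) < q+1, which explains the witness. The two sides will count linear conditions and unknowns.
-/
theorem exists_mul_pow_lt (N d : ℕ) : ∃ q : ℕ, N * ((q + 1) ^ d - q ^ d) < q ^ d := by
  refine ⟨d * (N + 1) + 1, ?_⟩
  set q := d * (N + 1) + 1 with hq
  have h1 : (q + 1 : ℝ) > 0 := by positivity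
  have h2 := one_add_mul_le_pow (a := -(1 / (q + 1 : ℝ))) (by
    have : 1 / (q + 1 : ℝ) ≤ 1 := by rw [div_le_one h1]; linarith [(Nat.cast_nonneg q : (0 : ℝ) ≤ q)]
    linarith) d
  have h3 : (1 + -(1 / (q + 1 : ℝ))) = q / (q + 1) := by field_simp; ring
  rw [h3, div_pow, le_div_iff₀ (by positivity)] at h2
  have h4 : (N : ℝ) < (N + 1) * (1 + d * -(1 / (q + 1 : ℝ))) := by
    have h5 : (d * (N + 1) : ℝ) / (q + 1) < 1 := by
      rw [div_lt_one h1, hq]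
      push_cast
      linarith
    have h6 : ((N : ℝ) + 1) * (1 + d * -(1 / (q + 1 : ℝ))) = N + 1 - (d * (N + 1) : ℝ) / (q + 1) := by
      field_simp
      ring
    linarith
  have h5 : (N : ℝ) * (q + 1) ^ d < (N + 1) * q ^ d := by
    calc (N : ℝ) * (q + 1) ^ d < (N + 1) * (1 + d * -(1 / (q + 1 : ℝ))) * (q + 1) ^ d :=
          mul_lt_mul_of_pos_right h4 (by positivity)
      _ = (N + 1) * ((1 + d * -(1 / (q + 1 : ℝ))) * (q + 1) ^ d) := by ring
      _ ≤ (N + 1) * q ^ d := mul_le_mul_of_nonneg_left h2 (by positivity)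
  have h6 : N * (q + 1) ^ d < (N + 1) * q ^ d := by exact_mod_cast h5
  have h7 : q ^ d ≤ (q + 1) ^ d := Nat.pow_le_pow_left (Nat.le_succ q) d
  obtain ⟨e, he⟩ := Nat.exists_eq_add_of_le h7
  rw [he, Nat.add_sub_cancel_left]
  rw [he] at h6
  nlinarith

variable {F : Type*} [Field F]

/-- The combination of the top multilinear coefficients of a polynomial with the weights `x`. -/
def blockFun (x : (κ → Fin q) → F) : MvPolynomial (κ × Fin q) F →ₗ[F] F :=
  ∑ i, x i • lcoeff F (blockExp fun s => some (i s))

theorem blockFun_apply (x : (κ → Fin q) → F) (p : MvPolynomial (κ × Fin q) F) :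
    blockFun x p = ∑ i, x i * coeff (blockExp fun s => some (i s)) p := by
  rw [blockFun, LinearMap.sum_apply]
  rfl

theorem blockFun_eq_zero_of_totalDegree_lt (x : (κ → Fin q) → F) {p : MvPolynomial (κ × Fin q) F}
    (h : p.totalDegree < Fintype.card κ) : blockFun x p = 0 := by
  rw [blockFun_apply]
  refine Finset.sum_eq_zero fun i _ => ?_
  rw [coeff_eq_zero_of_totalDegree_lt, mul_zero]
  have := degree_blockExp i
  rw [Finsupp.degree] at this
  rwa [← this] at h

theorem card_isNone_blocks : Fintype.card {o : κ → Option (Fin q) // ∃ s, o s = none} =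
    (q + 1) ^ Fintype.card κ - q ^ Fintype.card κ := by
  classical
  have h1 : Fintype.card {o : κ → Option (Fin q) // ¬ ∃ s, o s = none} = q ^ Fintype.card κ := by
    rw [← Fintype.card_fin q, ← Fintype.card_fun, Fintype.card_fin]
    symm
    refine Fintype.card_of_bijective (f := fun i : κ → Fin q =>
      (⟨fun s => some (i s), by simp⟩ : {o : κ → Option (Fin q) // ¬ ∃ s, o s = none}))
      ⟨fun i i' h => ?_, fun o => ?_⟩
    · funext s
      exact Option.some_injective _ (congrFun (congrArg Subtype.val h) s)
    · obtain ⟨o, ho⟩ := o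
      push Not at ho
      choose i hi using fun s => Option.ne_none_iff_exists'.1 (ho s)
      exact ⟨i, Subtype.ext (funext fun s => (hi s).symm)⟩
  have h2 := Fintype.card_subtype_compl (fun o : κ → Option (Fin q) => ∃ s, o s = none)
  have h3 := Fintype.card_subtype_le (fun o : κ → Option (Fin q) => ∃ s, o s = none)
  rw [h1, Fintype.card_fun, Fintype.card_option, Fintype.card_fin] at h2
  rw [Fintype.card_fun, Fintype.card_option, Fintype.card_fin] at h3
  omega

/-- There are q^|κ| unknown weights, and one linear condition for each generator and each monomial
that takes at most one variable from each block and none from some block. The full multilinear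
monomials impose nothing, because the generators have constant term zero. -/
theorem exists_blockFun {N : ℕ} (y : Fin N → MvPolynomial (κ × Fin q) F)
    (hy : ∀ l, constantCoeff (y l) = 0)
    (hN : N * ((q + 1) ^ Fintype.card κ - q ^ Fintype.card κ) < q ^ Fintype.card κ) :
    ∃ x : (κ → Fin q) → F, x ≠ 0 ∧ ∀ w ∈ Ideal.span (Set.range y), blockFun x w = 0 := by
  classical
  let Φ : ((κ → Fin q) → F) →ₗ[F]
      (Fin N × {o : κ → Option (Fin q) // ∃ s, o s = none} → F) :=
    LinearMap.pi fun lo => ∑ i, coeff (blockExp fun s => some (i s))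
      (monomial (blockExp lo.2.1) 1 * y lo.1) • LinearMap.proj i
  have hker : LinearMap.ker Φ ≠ ⊥ := LinearMap.ker_ne_bot_of_finrank_lt (by
    rw [Module.finrank_fintype_fun_eq_card, Module.finrank_fintype_fun_eq_card, Fintype.card_prod,
      Fintype.card_fin, card_isNone_blocks, Fintype.card_fun, Fintype.card_fin]
    exact hN)
  obtain ⟨x, hx, hx0⟩ := Submodule.exists_mem_ne_zero_of_ne_bot hker
  have hmon : ∀ (m : κ × Fin q →₀ ℕ) (a : F) (l : Fin N), blockFun x (monomial m a * y l) = 0 := by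
    intro m a l
    by_cases hm : ∃ i : κ → Fin q, m ≤ blockExp (fun s => some (i s)) ∧ m ≠ blockExp fun s => some (i s)
    · obtain ⟨i, hmi, hne⟩ := hm
      obtain ⟨o, rfl⟩ := exists_blockExp_eq hmi
      have ho : ∃ s, o s = none := by
        by_contra! ho
        choose i' hi' using fun s => Option.ne_none_iff_exists'.1 (ho s)
        obtain rfl : o = fun s => some (i' s) := funext hi'
        exact hne (by rw [eq_of_blockExp_le hmi])
      have h1 := congrFun (LinearMap.mem_ker.1 hx) (l, ⟨o, ho⟩)
      simp only [Φ, LinearMap.pi_apply, LinearMap.sum_apply, LinearMap.smul_apply,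
        LinearMap.proj_apply, smul_eq_mul, Pi.zero_apply] at h1
      have h2 : monomial (blockExp o) a = a • monomial (R := F) (blockExp o) 1 := by
        rw [smul_monomial, smul_eq_mul, mul_one]
      rw [h2, smul_mul_assoc, map_smul, blockFun_apply]
      rw [show ∑ i, x i * coeff (blockExp fun s => some (i s)) (monomial (blockExp o) 1 * y l) = 0
        from (Finset.sum_congr rfl fun i _ => mul_comm _ _).trans h1, smul_zero]
    · push Not at hm
      rw [blockFun_apply]
      refine Finset.sum_eq_zero fun i _ => ?_
      rw [coeff_monomial_mul']
      split_ifs with h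
      · rw [hm i h, tsub_self, ← constantCoeff_eq, hy, mul_zero, mul_zero]
      · rw [mul_zero]
  have key : ∀ w ∈ Ideal.span (Set.range y), ∀ p, blockFun x (p • w) = 0 := fun w hw => by
    induction hw using Submodule.span_induction with
    | mem w hw =>
      obtain ⟨l, rfl⟩ := hw
      intro p
      rw [smul_eq_mul]
      induction p using MvPolynomial.induction_on' with
      | monomial m a => exact hmon m a l
      | add p p' h h' => rw [add_mul, map_add, h, h', add_zero]
    | zero => intro p; rw [smul_zero, map_zero]
    | add w w' _ _ h h' => intro p; rw [smul_add, map_add, h, h', add_zero]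
    | smul p' w hw h => intro p; rw [smul_smul]; exact h _
  exact ⟨x, hx0, fun w hw => one_smul (MvPolynomial (κ × Fin q) F) w ▸ key w hw 1⟩

end Functional

/-! ### Polynomial dependence on unipotent parameters. -/

section UnipotentFamilies

open MvPolynomial

variable {k : Type u} [Field k] {κ : Type} [Fintype κ] [DecidableEq κ] {q : ℕ}

/-- The family of unipotent maps that add combinations of the vectors `e_{b (s, n)}` to `e_{c s}`. -/
def unipMap (c : κ → ℕ) (b : κ × Fin q → ℕ) (t : κ × Fin q → k) : Std k →ₗ[k] Std k :=
  LinearMap.id + ∑ x, t x • (Finsupp.lapply (c x.1)).smulRight (bv k (b x))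

theorem unipMap_apply (c : κ → ℕ) (b : κ × Fin q → ℕ) (t : κ × Fin q → k) (v : Std k) :
    unipMap c b t v = v + ∑ x, (t x * v (c x.1)) • bv k (b x) := by
  rw [unipMap, LinearMap.add_apply, LinearMap.sum_apply]
  congr 1
  refine Finset.sum_congr rfl fun x _ => ?_
  rw [LinearMap.smul_apply, LinearMap.smulRight_apply, smul_smul]
  rfl

theorem unipMap_zero (c : κ → ℕ) (b : κ × Fin q → ℕ) :
    unipMap c b (0 : κ × Fin q → k) = LinearMap.id := by
  refine LinearMap.ext fun v => ?_
  rw [unipMap_apply]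
  simp

theorem unipMap_bv {c : κ → ℕ} (hc : Function.Injective c) (b : κ × Fin q → ℕ)
    (t : κ × Fin q → k) (s : κ) :
    unipMap c b t (bv k (c s)) = bv k (c s) + ∑ n, t (s, n) • bv k (b (s, n)) := by
  rw [unipMap_apply, Fintype.sum_prod_type]
  congr 1
  rw [Finset.sum_eq_single s]
  · refine Finset.sum_congr rfl fun n _ => ?_
    simp [bv]
  · intro s' _ hs'
    refine Finset.sum_eq_zero fun n _ => ?_
    have : bv k (c s) (c s') = 0 := by
      rw [bv, Finsupp.single_apply, if_neg (fun h => hs' (hc h).symm)]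
    rw [this, mul_zero, zero_smul]
  · intro h; exact absurd (Finset.mem_univ s) h

theorem exists_gl_unipMap {c : κ → ℕ} (hc : Function.Injective c) {b : κ × Fin q → ℕ}
    (hb : ∀ x s, b x ≠ c s) (t : κ × Fin q → k) :
    ∃ g : GLinf k, (g.1 : Std k →ₗ[k] Std k) = unipMap c b t := by
  obtain ⟨g, hg1, hg2⟩ := exists_gl_unip (k := k) c hc (fun s => ∑ n, t (s, n) • bv k (b (s, n)))
    (fun s l => by
      rw [Finsupp.finsetSum_apply]
      refine Finset.sum_eq_zero fun n _ => ?_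
      rw [Finsupp.smul_apply, bv, Finsupp.single_apply, if_neg (hb _ _), smul_zero])
  refine ⟨g, std_ext fun i => ?_⟩
  change g.1 (bv k i) = _
  by_cases h : ∃ s, c s = i
  · obtain ⟨s, rfl⟩ := h
    rw [hg1, unipMap_bv hc]
  · push Not at h
    rw [hg2 i h, unipMap_apply]
    symm
    rw [add_eq_left]
    refine Finset.sum_eq_zero fun x _ => ?_
    rw [bv, Finsupp.single_apply, if_neg (fun h' => h x.1 h'.symm), mul_zero, zero_smul]

variable {F : Type u} [Field F] [Algebra k F]

theorem eval_algebraMap_map {τ : Type*} (t : τ → k) (p : MvPolynomial τ k) :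
    eval (fun x => algebraMap k F (t x)) (MvPolynomial.map (algebraMap k F) p) =
      algebraMap k F (eval t p) := by
  rw [eval_map, ← aeval_def]
  exact aeval_algebraMap_apply F t p

theorem multilinear_family {κ' : Type} [Fintype κ'] [DecidableEq κ'] {O τ : Type*} [Fintype O]
    (m : MultilinearMap k (fun _ : κ' => Std k) F) (P : κ' → O → MvPolynomial τ k)
    (w : κ' → O → Std k) (t : τ → k) :
    m (fun s => ∑ o, eval t (P s o) • w s o) = eval (fun x => algebraMap k F (t x))
      (∑ o : κ' → O, MvPolynomial.map (algebraMap k F) (∏ s, P s (o s)) *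
        C (m fun s => w s (o s))) := by
  classical
  rw [MultilinearMap.map_sum, map_sum]
  refine Finset.sum_congr rfl fun o _ => ?_
  rw [MultilinearMap.map_smul_univ, map_mul, eval_algebraMap_map, eval_C, map_prod, Algebra.smul_def]

theorem exists_multilinear_family {κ' : Type} [Fintype κ'] [DecidableEq κ'] {O τ : Type*}
    [Fintype O] (m : MultilinearMap k (fun _ : κ' => Std k) F) (P : κ' → O → MvPolynomial τ k)
    (w : κ' → O → Std k) : ∃ p : MvPolynomial τ F, ∀ t : τ → k,
      m (fun s => ∑ o, eval t (P s o) • w s o) = eval (fun x => algebraMap k F (t x)) p :=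
  ⟨_, multilinear_family m P w⟩

theorem exists_tensor_family {κ' : Type} [Fintype κ'] (c : κ → ℕ) (b : κ × Fin q → ℕ)
    (Λ : Ten k κ' →ₗ[k] F) (z : Ten k κ') : ∃ p : MvPolynomial (κ × Fin q) F, ∀ t,
      Λ (tmap κ' (unipMap c b t) z) = eval (fun x => algebraMap k F (t x)) p := by
  induction z using PiTensorProduct.induction_on with
  | smul_tprod r v =>
    classical
    obtain ⟨p, hp⟩ := exists_multilinear_family
      (Λ.compMultilinearMap (PiTensorProduct.tprod k)) (O := Option (κ × Fin q))
      (fun _ o => o.elim 1 X) (fun s o => o.elim (v s) fun x => v s (c x.1) • bv k (b x))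
    refine ⟨C (algebraMap k F r) * p, fun t => ?_⟩
    rw [map_smul, tmap_tprod, map_smul, map_mul, eval_C, Algebra.smul_def, ← hp,
      LinearMap.compMultilinearMap_apply]
    congr 3
    funext s
    rw [unipMap_apply, Fintype.sum_option]
    simp
  | add x y hx hy =>
    obtain ⟨p, hp⟩ := hx
    obtain ⟨p', hp'⟩ := hy
    exact ⟨p + p', fun t => by rw [map_add, map_add, map_add, hp, hp']⟩

variable {r : ℕ} (σ : Fin r → YoungDiagram)

theorem schurMap_toSchur (φ : Std k →ₗ[k] Std k) (μ : YoungDiagram) (z : Ten k μ.cells) :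
    schurMap φ μ (toSchur k μ z) = toSchur k μ (tmap μ.cells φ z) := Subtype.ext (by
  change tmap μ.cells φ (youngSymmetrizer k μ z) = youngSymmetrizer k μ (tmap μ.cells φ z)
  rw [youngSymmetrizer_eq, permEnd_tmap])

theorem exists_sum_family (c : κ → ℕ) (b : κ × Fin q → ℕ) (Λ : SchurSum k σ →ₗ[k] F)
    (x : SchurSum k σ) : ∃ p : MvPolynomial (κ × Fin q) F, ∀ t,
      Λ (sumMap σ (unipMap c b t) x) = eval (fun x => algebraMap k F (t x)) p := by
  induction x using DirectSum.induction_on with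
  | zero => exact ⟨0, fun t => by rw [map_zero, map_zero, map_zero]⟩
  | of i x =>
    obtain ⟨z, rfl⟩ := toSchur_surjective (k := k) (σ i) x
    obtain ⟨p, hp⟩ := exists_tensor_family c b
      (Λ ∘ₗ DirectSum.lof k (Fin r) (fun i => Schur k (σ i)) i ∘ₗ toSchur k (σ i)) z
    refine ⟨p, fun t => ?_⟩
    rw [← hp]
    have h := sumMap_lof σ (unipMap c b t) i (toSchur k (σ i) z)
    rw [schurMap_toSchur] at h
    exact congrArg Λ h
  | add x y hx hy =>
    obtain ⟨p, hp⟩ := hx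
    obtain ⟨p', hp'⟩ := hy
    exact ⟨p + p', fun t => by rw [map_add, map_add, map_add, hp, hp']⟩

theorem range_tmap_trunc_fg {κ' : Type} [Fintype κ'] (d : ℕ) :
    (LinearMap.range (tmap κ' (trunc k d))).FG := by
  have h1 : LinearMap.range (tmap κ' (trunc k d)) ≤
      Submodule.span k (Set.range fun I : κ' → Fin d => bten k fun s => (I s : ℕ)) := by
    rw [LinearMap.range_eq_map, ← (tenBasis k κ').span_eq, Submodule.map_span, Submodule.span_le]
    rintro _ ⟨_, ⟨I, rfl⟩, rfl⟩
    rw [tenBasis_apply, bten, tmap_tprod]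
    by_cases h : ∀ s, I s < d
    · refine Submodule.subset_span ⟨fun s => ⟨I s, h s⟩, ?_⟩
      exact congrArg (PiTensorProduct.tprod k) (funext fun s => (trunc_bv_of_lt (h s)).symm)
    · push Not at h
      obtain ⟨s, hs⟩ := h
      have : PiTensorProduct.tprod k (fun s => trunc k d (bv k (I s))) = 0 :=
        (PiTensorProduct.tprod k).map_coord_zero s (trunc_bv_of_le hs)
      rw [this]
      exact Submodule.zero_mem _
  have : FiniteDimensional k
      (Submodule.span k (Set.range fun I : κ' → Fin d => bten k fun s => (I s : ℕ))) :=
    FiniteDimensional.span_of_finite k (Set.finite_range _)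
  have h2 := Submodule.finiteDimensional_of_le h1
  exact Module.Finite.iff_fg.1 h2

/-- The number of variables of Sym supported on the first d vectors is finite and depends on d and σ
only. It is the N of the counting argument. -/
theorem exists_fg_sumMap_trunc_mem (d : ℕ) : ∃ W : Submodule k (SchurSum k σ), W.FG ∧
    ∀ x, sumMap σ (trunc k d) x ∈ W := by
  refine ⟨⨆ i, (LinearMap.range (tmap (σ i).cells (trunc k d))).map
    (DirectSum.lof k (Fin r) (fun i => Schur k (σ i)) i ∘ₗ toSchur k (σ i)),
    Submodule.fg_iSup _ fun i => (range_tmap_trunc_fg d).map _, fun x => ?_⟩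
  induction x using DirectSum.induction_on with
  | zero => rw [map_zero]; exact Submodule.zero_mem _
  | of i x =>
    obtain ⟨z, rfl⟩ := toSchur_surjective (k := k) (σ i) x
    have h := sumMap_lof σ (trunc k d) i (toSchur k (σ i) z)
    rw [schurMap_toSchur] at h
    refine Submodule.mem_iSup_of_mem i ⟨_, ⟨z, rfl⟩, h.symm⟩
  | add x y hx hy => rw [map_add]; exact Submodule.add_mem _ hx hy

end UnipotentFamilies

/-! ### Vectors killed by all maps to lower degree. -/

section NonzeroSocle

open MvPolynomial

variable {k : Type u} [Field k] {F : Type u} [Field F] [Algebra k F]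
  {act : GLinf k →* (F ≃ₐ[k] F)}

/-- An element that fixes the first d vectors and moves the next ones beyond the support fixes z,
yet it leaves no coordinate at an index with an entry ≥ d in the old range. -/
theorem entries_lt_of_fixedAt {κ : Type} [Fintype κ] {d : ℕ} {z : F ⊗[k] Ten k κ}
    (hz : FixedAt (baseRep act (tensorRep k κ)) d z) {I : κ → ℕ}
    (hI : (tenBasisK F κ).repr z I ≠ 0) (s : κ) : I s < d := by
  by_contra! hs
  obtain ⟨p, hp⟩ := exists_entry_bound ((tenBasisK F κ).repr z).support
  obtain ⟨g, hg1, hg2⟩ := exists_gl_fix_shift (k := k) d p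
  apply hI
  rw [← hz g hg1, tenBasisK_repr_baseRep]
  refine Finset.sum_eq_zero fun J hJ => ?_
  rw [Finset.prod_eq_zero (Finset.mem_univ s), zero_smul]
  have h1 := hp I (Finsupp.mem_support_iff.2 hI) s
  rcases lt_or_ge (J s) d with h | h
  · rw [hg1 _ h, bv, Finsupp.single_apply, if_neg (by omega)]
  · rw [hg2 _ h (hp J hJ s), bv, Finsupp.single_apply, if_neg (by omega)]

theorem coeff_fixedAt {κ : Type} [Fintype κ] {d : ℕ} {z : F ⊗[k] Ten k κ}
    (hz : FixedAt (baseRep act (tensorRep k κ)) d z) {I : κ → ℕ}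
    (hI : (tenBasisK F κ).repr z I ≠ 0) : FixedAt (actRep act) d ((tenBasisK F κ).repr z I) := by
  intro g hg
  conv_rhs => rw [← hz g hg, tenBasisK_repr_baseRep]
  rw [Finset.sum_eq_single I]
  · rw [Finset.prod_eq_one, one_smul, actRep_apply]
    intro s _
    rw [hg _ (entries_lt_of_fixedAt hz hI s), bv, Finsupp.single_apply, if_pos rfl]
  · intro J hJ hne
    obtain ⟨s, hs⟩ := Function.ne_iff.1 hne
    rw [Finset.prod_eq_zero (Finset.mem_univ s), zero_smul]
    rw [hg _ (entries_lt_of_fixedAt hz (Finsupp.mem_support_iff.1 hJ) s), bv, Finsupp.single_apply,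
      if_neg hs]
  · intro h
    exact absurd (Finsupp.mem_support_iff.2 hI) h

theorem bten_fixedAt {κ : Type} {d : ℕ} {c : κ → ℕ} (hc : ∀ s, c s < d) :
    FixedAt (tensorRep k κ) d (bten k c) := fun g hg => by
  rw [bten, tensorRep_tprod]
  exact congrArg _ (funext fun s => hg _ (hc s))

/-- Each matrix entry of `unipMap` has degree at most one in the parameters, and a tensor of degree
|κ'| multiplies |κ'| of them. -/
theorem exists_entry_family {κ κ' : Type} [Fintype κ] [DecidableEq κ] [Fintype κ'] {q : ℕ}
    (c : κ → ℕ) (b : κ × Fin q → ℕ) (I J : κ' → ℕ) : ∃ p : MvPolynomial (κ × Fin q) F,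
      p.totalDegree ≤ Fintype.card κ' ∧ ∀ t, eval (fun x => algebraMap k F (t x)) p =
        algebraMap k F (∏ s, unipMap c b t (bv k (I s)) (J s)) := by
  refine ⟨∏ s, (C (algebraMap k F (bv k (I s) (J s))) +
    ∑ x : κ × Fin q, C (algebraMap k F (bv k (I s) (c x.1) * bv k (b x) (J s))) * X x), ?_,
      fun t => ?_⟩
  · refine (totalDegree_finsetProd _ _).trans ((Finset.sum_le_card_nsmul _ _ 1 fun s _ => ?_).trans
      (by simp))
    refine (totalDegree_add _ _).trans (max_le (by rw [totalDegree_C]; omega) ?_)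
    refine totalDegree_finsetSum_le fun x _ => (totalDegree_mul _ _).trans ?_
    rw [totalDegree_C, totalDegree_X]
  · rw [map_prod, map_prod]
    refine Finset.prod_congr rfl fun s _ => ?_
    rw [unipMap_apply, Finsupp.add_apply, Finsupp.finsetSum_apply, map_add, map_add, map_sum,
      map_sum, eval_C]
    congr 1
    refine Finset.sum_congr rfl fun x _ => ?_
    rw [map_mul, eval_C, eval_X, Finsupp.smul_apply, smul_eq_mul, ← map_mul]
    congr 1
    ring

variable {r : ℕ} {σ : Fin r → YoungDiagram} {j : SymmetricAlgebra k (SchurSum k σ) →ₐ[k] F}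

set_option maxHeartbeats 1000000 in
/-- The elements of the symmetric algebra that only depend on the first vectors, moved by a
unipotent family: they agree with the constant family modulo an ideal. -/
theorem exists_sym_family {κ : Type} [Fintype κ] [DecidableEq κ] {q : ℕ} {c : κ → ℕ}
    {b : κ × Fin q → ℕ} {d N : ℕ} {e : Fin N → SchurSum k σ}
    (he : ∀ x, sumMap σ (trunc k d) x ∈ Submodule.span k (Set.range e))
    {P : Fin N → MvPolynomial (κ × Fin q) F}
    (hP : ∀ l t, j (SymmetricAlgebra.ι k _ (sumMap σ (unipMap c b t) (e l))) =
      eval (fun x => algebraMap k F (t x)) (P l)) (s : SymmetricAlgebra k (SchurSum k σ)) :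
    ∃ p : MvPolynomial (κ × Fin q) F,
      (∀ t, j (symMap σ (unipMap c b t) (symMap σ (trunc k d) s)) =
        eval (fun x => algebraMap k F (t x)) p) ∧
      p - C (j (symMap σ (trunc k d) s)) ∈
        Ideal.span (Set.range fun l => P l - C (j (SymmetricAlgebra.ι k _ (e l)))) := by
  induction s using SymmetricAlgebra.induction with
  | algebraMap a =>
    refine ⟨C (algebraMap k F a), fun t => ?_, ?_⟩
    · rw [AlgHom.commutes, AlgHom.commutes, AlgHom.commutes, eval_C]
    · rw [AlgHom.commutes, AlgHom.commutes, sub_self]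
      exact Ideal.zero_mem _
  | ι x =>
    rw [symMap_ι]
    have hx := he x
    have hΛ : ∀ a y, j (SymmetricAlgebra.ι k (SchurSum k σ) (a • y)) =
        algebraMap k F a * j (SymmetricAlgebra.ι k _ y) := fun a y =>
      (map_smul (j.toLinearMap ∘ₗ SymmetricAlgebra.ι k (SchurSum k σ)) a y).trans
        (Algebra.smul_def _ _)
    generalize sumMap σ (trunc k d) x = y at hx
    simp only [symMap_ι]
    induction hx using Submodule.span_induction with
    | mem y hy =>
      obtain ⟨l, rfl⟩ := hy
      exact ⟨P l, hP l, Ideal.subset_span ⟨l, rfl⟩⟩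
    | zero =>
      refine ⟨0, fun t => by simp, ?_⟩
      rw [map_zero, map_zero, C_0, sub_zero]
      exact Ideal.zero_mem _
    | add y y' _ _ h h' =>
      obtain ⟨p, hp, hpa⟩ := h
      obtain ⟨p', hp', hpa'⟩ := h'
      refine ⟨p + p', fun t => by rw [map_add, map_add, map_add, map_add, hp, hp'], ?_⟩
      rw [map_add, map_add, C_add, add_sub_add_comm]
      exact Ideal.add_mem _ hpa hpa'
    | smul a y _ h =>
      obtain ⟨p, hp, hpa⟩ := h
      refine ⟨C (algebraMap k F a) * p, fun t => ?_, ?_⟩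
      · rw [map_smul (sumMap σ _), hΛ, map_mul, eval_C, hp]
      · rw [hΛ, C_mul, ← mul_sub]
        exact Ideal.mul_mem_left _ _ hpa
  | mul s s' h h' =>
    obtain ⟨p, hp, hpa⟩ := h
    obtain ⟨p', hp', hpa'⟩ := h'
    have e1 : symMap σ (trunc k d) (s * s') = _ := map_mul (symMap σ (trunc k d)) s s'
    rw [e1]
    refine ⟨p * p', fun t => ?_, ?_⟩
    · rw [map_mul (symMap σ _), map_mul j, hp, hp', map_mul]
    rw [map_mul j, C_mul]
    have h1 := Ideal.add_mem _ (Ideal.mul_mem_right p' _ hpa)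
      (Ideal.mul_mem_left _ (C (j (symMap σ (trunc k d) s))) hpa')
    convert h1 using 1
    ring
  | add s s' h h' =>
    obtain ⟨p, hp, hpa⟩ := h
    obtain ⟨p', hp', hpa'⟩ := h'
    have e1 : symMap σ (trunc k d) (s + s') = _ := map_add (symMap σ (trunc k d)) s s'
    rw [e1]
    refine ⟨p + p', fun t => ?_, ?_⟩
    · rw [map_add (symMap σ (unipMap c b t)), map_add j, hp, hp', map_add]
    rw [map_add j, C_add, add_sub_add_comm]
    exact Ideal.add_mem _ hpa hpa'

theorem coeff_blockExp_sum {κ : Type} [Fintype κ] [DecidableEq κ] {q : ℕ}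
    (a : (κ → Option (Fin q)) → F) (i : κ → Fin q) :
    coeff (blockExp fun s => some (i s)) (∑ o : κ → Option (Fin q),
      MvPolynomial.map (algebraMap k F) (∏ s, (o s).elim 1 fun n => X (s, n)) * C (a o)) =
        a fun s => some (i s) := by
  rw [coeff_sum, Finset.sum_eq_single fun s => some (i s)]
  · rw [prod_block_eq_monomial, map_monomial, map_one, mul_comm, coeff_C_mul, coeff_monomial, if_pos rfl,
      mul_one]
  · intro o _ ho
    rw [prod_block_eq_monomial, map_monomial, map_one, mul_comm, coeff_C_mul, coeff_monomial,
      if_neg (fun h => ho (blockExp_injective h)), mul_zero]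
  · intro h; exact absurd (Finset.mem_univ _) h

variable [CharZero k]

set_option maxHeartbeats 1000000 in
-- Let g_t add Σ_n t_{s,n} e_{b(s,n)} to e_{c s}. A coordinate of f(g_t e_c) is a polynomial G whose
-- full multilinear coefficients come from the tensors e_{b(s,i_s)}. On the other side f(g_t e_c) =
-- g_t f(e_c); with the coordinates of f(e_c) written as u_I/h this gives H G = Σ U_I Q_I, where H
-- and the U_I are constant modulo an ideal with N generators and the Q_I have degree at most |κ'| <
-- |κ|. The functional of `exists_blockFun` kills the right side, hence G. Its weights x do not
-- depend on f.
theorem IsSymFrac.exists_killed (hj : IsSymFrac σ act j) {κ : Type} [Fintype κ] [DecidableEq κ]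
    {c : κ → ℕ} (hc : Function.Injective c) {d : ℕ} (hcd : ∀ s, c s < d) :
    ∃ (q : ℕ) (b : κ × Fin q → ℕ) (x : (κ → Fin q) → F), Function.Injective b ∧ x ≠ 0 ∧
      ∀ (κ' : Type) [Fintype κ'], Fintype.card κ' < Fintype.card κ →
        ∀ f : Ten k κ →ₗ[k] F ⊗[k] Ten k κ',
          Equi (tensorRep k κ) (baseRep act (tensorRep k κ')) f →
            ∑ i, x i • f (bten k fun s => b (s, i s)) = 0 := by
  classical
  obtain ⟨W, hWfg, hW⟩ := exists_fg_sumMap_trunc_mem (k := k) σ d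
  obtain ⟨N, e, he⟩ := Submodule.fg_iff_exists_fin_generating_family.1 hWfg
  -- N is determined by d and σ before q is chosen, so the number of parameters can be made as large
  -- as the counting requires.
  obtain ⟨q, hq⟩ := exists_mul_pow_lt N (Fintype.card κ)
  let b : κ × Fin q → ℕ := fun x => d + Fintype.equivFin (κ × Fin q) x
  have hb : Function.Injective b := fun x y h =>
    (Fintype.equivFin (κ × Fin q)).injective (Fin.ext (Nat.add_left_cancel h))
  have hbc : ∀ x s, b x ≠ c s := fun x s h => by
    have := hcd s
    have h1 : d ≤ b x := Nat.le_add_right _ _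
    omega
  choose P hP using fun l : Fin N => exists_sum_family σ c b
    (j.toLinearMap ∘ₗ SymmetricAlgebra.ι k (SchurSum k σ)) (e l)
  have hy : ∀ l, constantCoeff (P l - C (j (SymmetricAlgebra.ι k _ (e l)))) = 0 := fun l => by
    have h1 := hP l 0
    rw [unipMap_zero, sumMap_id] at h1
    have h2 : (fun x : κ × Fin q => algebraMap k F ((0 : κ × Fin q → k) x)) = 0 :=
      funext fun x => map_zero _
    rw [h2, eval_zero] at h1
    rw [map_sub, ← h1, constantCoeff_C]
    exact sub_self _
  obtain ⟨x, hx0, hx⟩ := exists_blockFun _ hy hq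
  refine ⟨q, b, x, hb, hx0, fun κ' _ hκ f hf => ?_⟩
  have hfam := exists_sym_family (σ := σ) (j := j) (c := c) (b := b) (d := d) (e := e)
    (fun y => he ▸ hW y) (P := P) hP
  set z := f (bten k c) with hz
  have hzd : FixedAt (baseRep act (tensorRep k κ')) d z := (bten_fixedAt hcd).map hf
  obtain ⟨h, u, hh0, hh, hu⟩ := hj.exists_common_level_fraction σ
    ((tenBasisK F κ').repr z).support (fun I => (tenBasisK F κ').repr z I)
    (fun I hI => coeff_fixedAt hzd (Finsupp.mem_support_iff.1 hI))
  obtain ⟨H, hH, hHa⟩ := hfam h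
  choose U hU hUa using fun I => hfam (u I)
  rw [hh] at hHa
  simp only [hh] at hH
  refine (tenBasisK F κ').repr.injective (Finsupp.ext fun J => ?_)
  choose Q hQd hQ using fun I => exists_entry_family (k := k) (F := F) (q := q) c b I J
  let m : MultilinearMap k (fun _ : κ => Std k) F :=
    ((((tenBasisK F κ').coord J).restrictScalars k) ∘ₗ f).compMultilinearMap
      (PiTensorProduct.tprod k)
  let w : κ → Option (Fin q) → Std k := fun s o => o.elim (bv k (c s)) fun n => bv k (b (s, n))
  let G : MvPolynomial (κ × Fin q) F := ∑ o : κ → Option (Fin q),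
    MvPolynomial.map (algebraMap k F) (∏ s, (o s).elim 1 fun n => X (s, n)) *
      C (m fun s => w s (o s))
  have hG : ∀ t, eval (fun x => algebraMap k F (t x)) G =
      (tenBasisK F κ').repr (f (tmap κ (unipMap c b t) (bten k c))) J := fun t => by
    rw [← multilinear_family m (fun s o => o.elim 1 fun n => X (s, n)) w t, bten, tmap_tprod]
    change _ = m _
    congr 1
    funext s
    rw [unipMap_bv hc, Fintype.sum_option]
    simp [w]
  -- Both sides agree at all parameter values in k, which form an infinite grid.
  have hid : H * G = ∑ I ∈ ((tenBasisK F κ').repr z).support, U I * Q I := by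
    refine funext_set (fun _ => Set.range (algebraMap k F))
      (fun _ => Set.infinite_range_of_injective (algebraMap k F).injective) fun v hv => ?_
    choose t ht using fun x => hv x (Set.mem_univ x)
    obtain rfl : (fun x => algebraMap k F (t x)) = v := funext ht
    obtain ⟨g, hg⟩ := exists_gl_unipMap hc hbc t
    have h1 : f (tmap κ (unipMap c b t) (bten k c)) = baseRep act (tensorRep k κ') g z := by
      rw [← hg, ← tensorRep_eq_tmap, hf]
    rw [map_mul, hG, h1, tenBasisK_repr_baseRep, ← hH, ← hg, map_sum, Finset.mul_sum]
    refine Finset.sum_congr rfl fun I hI => ?_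
    obtain ⟨hu1, hu2⟩ := hu I hI
    rw [map_mul, ← hU, hu1, hQ, ← hg, ← hj.act_apply, ← hj.act_apply, ← hu2, map_mul,
      Algebra.smul_def]
    simp only [LinearEquiv.coe_coe]
    ring
  have hCmul : ∀ (a : F) (p : MvPolynomial (κ × Fin q) F), blockFun x (C a * p) =
      a * blockFun x p := fun a p => by rw [C_mul', map_smul, smul_eq_mul]
  have hcong : ∀ (p : MvPolynomial (κ × Fin q) F) (a : F) (p' : MvPolynomial (κ × Fin q) F),
      p - C a ∈ Ideal.span (Set.range fun l => P l - C (j (SymmetricAlgebra.ι k _ (e l)))) →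
        blockFun x (p * p') = a * blockFun x p' := fun p a p' hp => by
    have h1 : p * p' = (p - C a) * p' + C a * p' := by ring
    rw [h1, map_add, hx _ (Ideal.mul_mem_right p' _ hp), zero_add, hCmul]
  -- Modulo the ideal, H and U I become the constants j h and j (u I), and the functional vanishes
  -- on degrees below |κ|. As j h ≠ 0, it vanishes on G.
  have hzero : blockFun x G = 0 := by
    have h1 := congrArg (blockFun x) hid
    have h2 : blockFun x (∑ I ∈ ((tenBasisK F κ').repr z).support, U I * Q I) = 0 := by
      rw [map_sum]
      refine Finset.sum_eq_zero fun I _ => ?_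
      rw [hcong _ _ _ (hUa I), blockFun_eq_zero_of_totalDegree_lt x ((hQd I).trans_lt hκ), mul_zero]
    rw [hcong H _ G hHa, h2] at h1
    exact (mul_eq_zero.1 h1).resolve_left hh0
  rw [blockFun_apply] at hzero
  rw [map_sum, Finsupp.finsetSum_apply, map_zero, Finsupp.zero_apply, ← hzero]
  refine Finset.sum_congr rfl fun i _ => ?_
  rw [coeff_blockExp_sum, map_smul, Finsupp.smul_apply, smul_eq_mul]
  rfl

end NonzeroSocle

/-! ### The modules L_μ are non-zero. -/

section NonzeroSocle

variable {k : Type u} [Field k]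

/-- The hypothesis forces equal values to sit in equal positions, so only the identity permutation
can carry I to J. -/
theorem tenBasis_repr_permEnd_bten {κ : Type} [Fintype κ] [DecidableEq κ]
    (z : MonoidAlgebra k (Equiv.Perm κ)) {I J : κ → ℕ}
    (h : ∀ s t, I s = J t → s = t) :
    (tenBasis k κ).repr (permEnd k κ z (bten k I)) J = if I = J then z.coeff 1 else 0 := by
  induction z using MonoidAlgebra.induction_on with
  | of p =>
    rw [permEnd_of, rx_bten, tenBasis_repr_bten, MonoidAlgebra.of_apply, MonoidAlgebra.coeff_single,
      Finsupp.single_apply]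
    have h1 : I ∘ p.symm = J ↔ I = J ∧ p = 1 := by
      refine ⟨fun h1 => ?_, fun ⟨h1, h2⟩ => by subst h2; exact h1⟩
      have hp : p = 1 := Equiv.ext fun s => by
        have h2 := congrFun h1 (p s)
        rw [Function.comp_apply, Equiv.symm_apply_apply] at h2
        exact (h _ _ h2).symm
      subst hp
      exact ⟨h1, rfl⟩
    simp only [h1]
    by_cases hIJ : I = J <;> by_cases hp : p = 1 <;> simp [hIJ, hp]
  | add y z hy hz =>
    rw [map_add, LinearMap.add_apply, map_add, Finsupp.add_apply, hy, hz, MonoidAlgebra.coeff_add,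
      Finsupp.add_apply]
    split_ifs <;> simp
  | smul r z hz =>
    rw [map_smul, LinearMap.smul_apply, map_smul, Finsupp.smul_apply, hz, MonoidAlgebra.coeff_smul,
      Finsupp.smul_apply]
    split_ifs <;> simp

variable [CharZero k] {F : Type u} [Field F] [Algebra k F] {act : GLinf k →* (F ≃ₐ[k] F)}
  {r : ℕ} {σ : Fin r → YoungDiagram} {j : SymmetricAlgebra k (SchurSum k σ) →ₐ[k] F}

/-- The killed vector of the tensor power is projected to 𝐒_μ; a map of Schur functors becomes a map
of tensor powers through `tenOfSchur`. The projection is non-zero because the indices b(s,n) are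
distinct and the Young symmetrizer has coefficient 1 at the identity. -/
theorem IsSymFrac.exists_schur_killed (hj : IsSymFrac σ act j) (μ : YoungDiagram) :
    ∃ y : F ⊗[k] Schur k μ, y ≠ 0 ∧ ∀ (ν : YoungDiagram)
      (f : F ⊗[k] Schur k μ →ₗ[F] F ⊗[k] Schur k ν), ν.card < μ.card →
        (∀ g x, f (baseRep act (schurRep k μ) g x) = baseRep act (schurRep k ν) g (f x)) →
          f y = 0 := by
  classical
  obtain ⟨q, b, x, hb, hx0, hx⟩ := hj.exists_killed
    (c := fun s : μ.cells => (Fintype.equivFin μ.cells s : ℕ))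
    (fun s t h => (Fintype.equivFin μ.cells).injective (Fin.ext h)) (fun s => Fin.is_lt _)
  let B : (μ.cells → Fin q) → μ.cells → ℕ := fun i s => b (s, i s)
  let y : F ⊗[k] Schur k μ := ∑ i, x i ⊗ₜ[k] toSchur k μ (bten k (B i))
  refine ⟨y, fun hy => ?_, fun ν f hν hf => ?_⟩
  rotate_left
  · show f y = 0
    let f₀ : Schur k μ →ₗ[k] F ⊗[k] Schur k ν :=
      (f.restrictScalars k : F ⊗[k] Schur k μ →ₗ[k] F ⊗[k] Schur k ν) ∘ₗ TensorProduct.mk k F _ 1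
    have hf₀ : Equi (schurRep k μ) (baseRep act (schurRep k ν)) f₀ := fun g v => by
      refine Eq.trans (congrArg f ?_) (hf g ((1 : F) ⊗ₜ[k] v))
      exact congrArg (fun a : F => a ⊗ₜ[k] schurRep k μ g v) (map_one (act g)).symm
    have h1 := hx ν.cells (by simpa using hν) (tenOfSchur f₀) (tenOfSchur_equi hf₀)
    have h2 : (ofSchur k ν).baseChange F (∑ i, x i • f₀ (toSchur k μ (bten k (B i)))) = 0 := by
      rw [map_sum, ← h1]
      exact Finset.sum_congr rfl fun i _ => map_smul _ _ _
    have h3 := lTensor_ofSchur_injective (h2.trans (map_zero ((ofSchur k ν).lTensor F)).symm)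
    rw [← h3]
    refine (map_sum f _ _).trans (Finset.sum_congr rfl fun i _ => ?_)
    refine Eq.trans (congrArg f ?_) (map_smul f (x i) ((1 : F) ⊗ₜ[k] toSchur k μ (bten k (B i))))
    rw [TensorProduct.smul_tmul', smul_eq_mul, mul_one]
  obtain ⟨i₀, hi₀⟩ := Function.ne_iff.1 hx0
  refine hi₀ ?_
  have hB : ∀ i s i' t, B i s = B i' t → s = t := fun i s i' t h => congrArg Prod.fst (hb h)
  have hBi : ∀ i, Function.Injective (B i) := fun i s t h => hB i s i t h
  have h1 := congrArg (fun z => (tenBasisK F μ.cells).repr ((ofSchur k μ).baseChange F z) (B i₀)) hy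
  simp only [y, map_sum, map_zero, Finsupp.zero_apply, Finsupp.finsetSum_apply,
    LinearMap.baseChange_tmul] at h1
  rw [Finset.sum_eq_single i₀] at h1
  · rw [tenBasisK, Module.Basis.baseChange_repr_tmul] at h1
    change (tenBasis k μ.cells).repr (youngSymmetrizer k μ (bten k (B i₀))) (B i₀) • x i₀ = 0 at h1
    rwa [youngSymmetrizer_eq, tenBasis_repr_permEnd_bten _ (fun s t h => hBi i₀ h),
      if_pos rfl, coeff_one_youngElt, one_smul] at h1
  · intro i _ hi
    rw [tenBasisK, Module.Basis.baseChange_repr_tmul]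
    change (tenBasis k μ.cells).repr (youngSymmetrizer k μ (bten k (B i))) (B i₀) • x i = 0
    rw [youngSymmetrizer_eq, tenBasis_repr_permEnd_bten _ (fun s t h => hB i s i₀ t h),
      if_neg, zero_smul]
    intro h
    exact hi (funext fun s => congrArg Prod.snd (hb (congrFun h s)))
  · intro h
    exact absurd (Finset.mem_univ i₀) h

theorem mem_simpleSub {μ : YoungDiagram} {y : (SemilinRep.free act μ).carrier} :
    y ∈ SemilinRep.simpleSub act μ ↔ ∀ (ν : YoungDiagram)
      (f : (SemilinRep.free act μ).carrier →ₗ[F] (SemilinRep.free act ν).carrier),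
        ν.card < μ.card → SemilinRep.IsEquivariant f → f y = 0 := by
  rw [SemilinRep.simpleSub, Submodule.mem_sInf]
  exact ⟨fun h ν f hν hf => h _ ⟨ν, f, hν, hf, rfl⟩,
    fun h => by rintro _ ⟨ν, f, hν, hf, rfl⟩; exact h ν f hν hf⟩

theorem IsSymFrac.simpleSub_ne_bot (hj : IsSymFrac σ act j) (μ : YoungDiagram) :
    SemilinRep.simpleSub act μ ≠ ⊥ := by
  obtain ⟨y, hy0, hy⟩ := hj.exists_schur_killed μ
  intro hbot
  exact hy0 ((Submodule.eq_bot_iff _).1 hbot y (mem_simpleSub.2 fun ν f hν hf => hy ν f hν hf))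

end NonzeroSocle

namespace SemilinRep

variable {k : Type u} [Field k] {K : Type u} [Field K] [Algebra k K]
  {act : GLinf k →* (K ≃ₐ[k] K)}

/-! ### Subobjects, quotients and finite products -/

section Constructions

theorem isEquivariant_comp {X Y Z : SemilinRep act} {f : Y.carrier →ₗ[K] Z.carrier}
    {g : X.carrier →ₗ[K] Y.carrier} (hf : IsEquivariant f) (hg : IsEquivariant g) :
    IsEquivariant (M := X) (N := Z) (f ∘ₗ g) := fun a x => by
  rw [LinearMap.comp_apply, hg, hf, LinearMap.comp_apply]

theorem IsEquivariant.equi {X Y : SemilinRep act} {f : X.carrier →ₗ[K] Y.carrier}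
    (hf : IsEquivariant f) : Equi X.ρ Y.ρ (f.restrictScalars k) := hf

theorem isStable_ker {X Y : SemilinRep act} {f : X.carrier →ₗ[K] Y.carrier}
    (hf : IsEquivariant f) : X.IsStable (LinearMap.ker f) := fun g x hx => by
  rw [LinearMap.mem_ker, hf, LinearMap.mem_ker.1 hx, map_zero]

theorem IsStable.map {X Y : SemilinRep act} {f : X.carrier →ₗ[K] Y.carrier}
    (hf : IsEquivariant f) {N : Submodule K X.carrier} (hN : X.IsStable N) :
    Y.IsStable (N.map f) := by
  rintro g _ ⟨x, hx, rfl⟩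
  exact ⟨X.ρ g x, hN g x hx, hf g x⟩

theorem IsStable.comap {X Y : SemilinRep act} {f : X.carrier →ₗ[K] Y.carrier}
    (hf : IsEquivariant f) {N : Submodule K Y.carrier} (hN : Y.IsStable N) :
    X.IsStable (N.comap f) := fun g x hx => by
  rw [Submodule.mem_comap, hf]
  exact hN g _ hx

theorem isStable_bot (X : SemilinRep act) : X.IsStable ⊥ := fun g x hx => by
  rw [(Submodule.mem_bot K).1 hx, map_zero]
  exact Submodule.zero_mem _

theorem isStable_top (X : SemilinRep act) : X.IsStable ⊤ := fun _ _ _ => Submodule.mem_top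

theorem IsStable.inf {X : SemilinRep act} {N P : Submodule K X.carrier} (hN : X.IsStable N)
    (hP : X.IsStable P) : X.IsStable (N ⊓ P) := fun g x hx => ⟨hN g x hx.1, hP g x hx.2⟩

variable {M : SemilinRep act} {N : Submodule K M.carrier} (hN : M.IsStable N)

/-- The inclusion of a subobject. -/
def subIncl : (M.sub N hN).carrier →ₗ[K] M.carrier := N.subtype

theorem subIncl_equivariant : IsEquivariant (M := M.sub N hN) (N := M) (subIncl hN) :=
  fun _ _ => rfl

theorem subIncl_injective : Function.Injective (subIncl hN) := Subtype.val_injective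

theorem subIncl_mem (x : (M.sub N hN).carrier) : subIncl hN x ∈ N := Subtype.property x

theorem exists_subIncl_eq {x : M.carrier} (hx : x ∈ N) : ∃ y, subIncl hN y = x := ⟨⟨x, hx⟩, rfl⟩

theorem range_subIncl : LinearMap.range (subIncl hN) = N := N.range_subtype

theorem isStable_map_subIncl {P : Submodule K (M.sub N hN).carrier} (hP : (M.sub N hN).IsStable P) :
    M.IsStable (P.map (subIncl hN)) := hP.map (subIncl_equivariant hN)

/-- A map with values in a subobject. -/
def subLift {X : SemilinRep act} (f : X.carrier →ₗ[K] M.carrier) (h : ∀ x, f x ∈ N) :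
    X.carrier →ₗ[K] (M.sub N hN).carrier := f.codRestrict N h

theorem subIncl_subLift {X : SemilinRep act} (f : X.carrier →ₗ[K] M.carrier) (h : ∀ x, f x ∈ N)
    (x : X.carrier) : subIncl hN (subLift hN f h x) = f x := rfl

theorem subLift_equivariant {X : SemilinRep act} {f : X.carrier →ₗ[K] M.carrier}
    (hf : IsEquivariant f) (h : ∀ x, f x ∈ N) :
    IsEquivariant (M := X) (N := M.sub N hN) (subLift hN f h) := fun g x =>
  subIncl_injective hN (hf g x)

/-- The projection to a quotient. -/
def quotMk : M.carrier →ₗ[K] (M.quot N hN).carrier := N.mkQ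

theorem quotMk_equivariant : IsEquivariant (M := M) (N := M.quot N hN) (quotMk hN) :=
  fun _ _ => rfl

theorem quotMk_surjective : Function.Surjective (quotMk hN) := N.mkQ_surjective

theorem quotMk_eq_zero {x : M.carrier} : quotMk hN x = 0 ↔ x ∈ N :=
  Submodule.Quotient.mk_eq_zero N

/-- The product of a family of semi-linear representations. -/
def pi {ι : Type} (X : ι → SemilinRep act) : SemilinRep act where
  carrier := ∀ i, (X i).carrier
  ρ :=
    { toFun := fun g => LinearMap.pi fun i => (X i).ρ g ∘ₗ LinearMap.proj i
      map_one' := by ext x i; simp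
      map_mul' := fun g h => by ext x i; simp }
  semilinear g a x := funext fun i => (X i).semilinear g a (x i)

/-- The projections of a product. -/
def piProj {ι : Type} (X : ι → SemilinRep act) (i : ι) :
    (pi X).carrier →ₗ[K] (X i).carrier := LinearMap.proj i

theorem piProj_equivariant {ι : Type} (X : ι → SemilinRep act) (i : ι) :
    IsEquivariant (M := pi X) (N := X i) (piProj X i) := fun _ _ => rfl

theorem pi_ext {ι : Type} {X : ι → SemilinRep act} {x y : (pi X).carrier}
    (h : ∀ i, piProj X i x = piProj X i y) : x = y := funext h

/-- The map to a product with given components. -/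
def piLift {ι : Type} {X : ι → SemilinRep act} {Y : SemilinRep act}
    (f : ∀ i, Y.carrier →ₗ[K] (X i).carrier) : Y.carrier →ₗ[K] (pi X).carrier := LinearMap.pi f

theorem piLift_equivariant {ι : Type} {X : ι → SemilinRep act} {Y : SemilinRep act}
    {f : ∀ i, Y.carrier →ₗ[K] (X i).carrier} (hf : ∀ i, IsEquivariant (f i)) :
    IsEquivariant (M := Y) (N := pi X) (piLift f) := fun g y => funext fun i => hf i g y

/-- The inclusions into a product. -/
def piSingle {ι : Type} [DecidableEq ι] (X : ι → SemilinRep act) (i : ι) :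
    (X i).carrier →ₗ[K] (pi X).carrier := LinearMap.single K (fun i => (X i).carrier) i

theorem piProj_piSingle_self {ι : Type} [DecidableEq ι] (X : ι → SemilinRep act) (i : ι)
    (x : (X i).carrier) : piProj X i (piSingle X i x) = x :=
  Pi.single_eq_same (M := fun i => (X i).carrier) i x

theorem piProj_piSingle_of_ne {ι : Type} [DecidableEq ι] (X : ι → SemilinRep act) {i j : ι}
    (h : j ≠ i) (x : (X i).carrier) : piProj X j (piSingle X i x) = 0 :=
  Pi.single_eq_of_ne (M := fun i => (X i).carrier) h x

theorem piSingle_equivariant {ι : Type} [DecidableEq ι] (X : ι → SemilinRep act) (i : ι) :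
    IsEquivariant (M := X i) (N := pi X) (piSingle X i) := fun g x => pi_ext fun j => by
  rw [piProj_equivariant]
  by_cases h : j = i
  · subst h
    rw [piProj_piSingle_self, piProj_piSingle_self]
  · rw [piProj_piSingle_of_ne X h, piProj_piSingle_of_ne X h, map_zero]

theorem sum_piSingle {ι : Type} [Fintype ι] [DecidableEq ι] (X : ι → SemilinRep act)
    (x : (pi X).carrier) : ∑ i, piSingle X i (piProj X i x) = x :=
  Finset.univ_sum_single (M := fun i => (X i).carrier) x

end Constructions

/-! ### Isomorphisms -/

theorem isEquivariant_symm {X Y : SemilinRep act} {e : X.carrier ≃ₗ[K] Y.carrier}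
    (he : IsEquivariant (M := X) (N := Y) e.toLinearMap) :
    IsEquivariant (M := Y) (N := X) e.symm.toLinearMap := fun g y => e.injective (by
  have h := he g (e.symm y)
  change e (X.ρ g (e.symm y)) = Y.ρ g (e (e.symm y)) at h
  change e (e.symm (Y.ρ g y)) = e (X.ρ g (e.symm y))
  rw [h, e.apply_symm_apply, e.apply_symm_apply])

theorem Iso.symm {X Y : SemilinRep act} (h : X.Iso Y) : Y.Iso X := by
  obtain ⟨e, he⟩ := h
  exact ⟨e.symm, isEquivariant_symm he⟩

theorem Iso.trans {X Y Z : SemilinRep act} (h : X.Iso Y) (h' : Y.Iso Z) : X.Iso Z := by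
  obtain ⟨e, he⟩ := h
  obtain ⟨e', he'⟩ := h'
  exact ⟨e.trans e', isEquivariant_comp (Y := Y) he' he⟩

theorem iso_of_bijective {X Y : SemilinRep act} {f : X.carrier →ₗ[K] Y.carrier}
    (hf : IsEquivariant f) (hb : Function.Bijective f) : X.Iso Y :=
  ⟨LinearEquiv.ofBijective f hb, hf⟩

/-- A map that induces an isomorphism from a subquotient to a subobject. -/
theorem iso_of_ker_eq_range {X Y Z W : SemilinRep act} {p : X.carrier →ₗ[K] Y.carrier}
    (hp : IsEquivariant p) (hps : Function.Surjective p) {i : Z.carrier →ₗ[K] W.carrier}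
    (hi : IsEquivariant i) (hii : Function.Injective i) {f : X.carrier →ₗ[K] W.carrier}
    (hf : IsEquivariant f) (hker : LinearMap.ker f = LinearMap.ker p)
    (hrange : LinearMap.range f = LinearMap.range i) : Y.Iso Z := by
  let e₁ := (p.quotKerEquivOfSurjective hps).symm
  let e₂ := Submodule.quotEquivOfEq _ _ hker.symm
  let e₃ := f.quotKerEquivRange
  let e₄ := LinearEquiv.ofEq _ _ hrange
  let e₅ := (LinearEquiv.ofInjective i hii).symm
  let e : Y.carrier ≃ₗ[K] Z.carrier := e₁ ≪≫ₗ e₂ ≪≫ₗ e₃ ≪≫ₗ e₄ ≪≫ₗ e₅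
  have key : ∀ x, i (e (p x)) = f x := fun x => by
    have h1 : e₁ (p x) = Submodule.Quotient.mk x := by
      rw [LinearEquiv.symm_apply_eq]
      rfl
    change i (e₅ (e₄ (e₃ (e₂ (e₁ (p x)))))) = f x
    rw [h1]
    exact congrArg Subtype.val ((LinearEquiv.ofInjective i hii).apply_symm_apply _)
  refine ⟨e, fun g y => hii ?_⟩
  obtain ⟨x, rfl⟩ := hps y
  change i (e (Y.ρ g (p x))) = i (Z.ρ g (e (p x)))
  rw [← hp, key, hf, hi, key]

end SemilinRep

namespace SemilinRep

variable {k : Type u} [Field k] {K : Type u} [Field K] [Algebra k K]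
  {act : GLinf k →* (K ≃ₐ[k] K)}

/-! ### Finitely generated subobjects -/

/-- A subobject generated by finitely many maps from tensor powers. -/
def FG (M : SemilinRep act) (N : Submodule K M.carrier) : Prop := ∃ d, LowGen K M.ρ d N

theorem FG.isStable {M : SemilinRep act} {N : Submodule K M.carrier} (h : M.FG N) : M.IsStable N :=
  h.elim fun _ h => h.stable (act := act) M.semilinear

theorem FG.sup {M : SemilinRep act} {N P : Submodule K M.carrier} (hN : M.FG N) (hP : M.FG P) :
    M.FG (N ⊔ P) := by
  obtain ⟨d, hd⟩ := hN
  obtain ⟨e, he⟩ := hP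
  exact ⟨max d e, (hd.mono (le_max_left d e)).sup_low (he.mono (le_max_right d e))⟩

theorem FG.bot (M : SemilinRep act) : M.FG ⊥ := ⟨0, LowGen.bot⟩

theorem FG.finset_sup {M : SemilinRep act} {ι : Type*} (s : Finset ι)
    {N : ι → Submodule K M.carrier} (h : ∀ i ∈ s, M.FG (N i)) : M.FG (s.sup N) := by
  classical
  induction s using Finset.induction_on with
  | empty => exact FG.bot M
  | insert i s _ ih =>
    rw [Finset.sup_insert]
    exact (h i (Finset.mem_insert_self i s)).sup (ih fun j hj => h j (Finset.mem_insert_of_mem hj))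

theorem map_rspan {X Y : SemilinRep act} (φ : X.carrier →ₗ[K] Y.carrier) {V : Type*}
    [AddCommGroup V] [Module k V] (f : V →ₗ[k] X.carrier) :
    (rspan K f).map φ = rspan K (φ.restrictScalars k ∘ₗ f) := by
  rw [rspan, rspan, Submodule.map_span, ← Set.range_comp]
  rfl

theorem FG.map {X Y : SemilinRep act} {φ : X.carrier →ₗ[K] Y.carrier} (hφ : IsEquivariant φ)
    {N : Submodule K X.carrier} (hN : X.FG N) : Y.FG (N.map φ) := by
  obtain ⟨d, hd⟩ := hN
  refine ⟨d, ?_⟩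
  induction hd with
  | bot => rw [Submodule.map_bot]; exact LowGen.bot
  | sup hN f hcard hf ih =>
    rw [Submodule.map_sup, map_rspan]
    exact LowGen.sup ih _ hcard (Equi.comp hφ.equi hf)

/-- Every generating map takes its values in the range of i, so it lifts along i, equivariantly by
injectivity. -/
theorem FG.of_map {X Y : SemilinRep act} {i : X.carrier →ₗ[K] Y.carrier} (hi : IsEquivariant i)
    (hii : Function.Injective i) {N : Submodule K X.carrier} (hN : Y.FG (N.map i)) : X.FG N := by
  obtain ⟨d, hd⟩ := hN
  refine ⟨d, ?_⟩
  suffices H : ∀ P : Submodule K Y.carrier, LowGen K Y.ρ d P → P ≤ LinearMap.range i →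
      ∃ Q : Submodule K X.carrier, LowGen K X.ρ d Q ∧ Q.map i = P by
    obtain ⟨Q, hQ, hQN⟩ := H _ hd (LinearMap.map_le_range)
    rwa [← Submodule.map_injective_of_injective hii hQN]
  intro P hP
  induction hP with
  | bot => exact fun _ => ⟨⊥, LowGen.bot, Submodule.map_bot _⟩
  | @sup P hP κ _ f hcard hf ih =>
    intro hle
    obtain ⟨Q, hQ, rfl⟩ := ih (le_sup_left.trans hle)
    have hfi : ∀ x, f x ∈ LinearMap.range i := fun x =>
      hle (Submodule.mem_sup_right (mem_rspan f x))
    let e := LinearEquiv.ofInjective i hii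
    let f' : Ten k κ →ₗ[k] X.carrier := (e.symm.toLinearMap.restrictScalars k) ∘ₗ
      f.codRestrict ((LinearMap.range i).restrictScalars k) hfi
    have hf' : ∀ x, i (f' x) = f x := fun x =>
      congrArg Subtype.val (e.apply_symm_apply ⟨f x, hfi x⟩)
    refine ⟨Q ⊔ rspan K f', LowGen.sup hQ f' hcard fun g x => hii ?_, ?_⟩
    · rw [hi, hf', hf', hf]
    · rw [Submodule.map_sup, map_rspan]
      congr 2
      exact LinearMap.ext hf'

theorem FG.sub_top {M : SemilinRep act} {N : Submodule K M.carrier} (hN : M.FG N) :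
    (M.sub N hN.isStable).FG ⊤ := by
  refine FG.of_map (subIncl_equivariant hN.isStable) (subIncl_injective hN.isStable) ?_
  rwa [← LinearMap.range_eq_map, range_subIncl]

theorem FG.of_surjective {X Y : SemilinRep act} {φ : X.carrier →ₗ[K] Y.carrier}
    (hφ : IsEquivariant φ) (hs : Function.Surjective φ) (hX : X.FG ⊤) : Y.FG ⊤ := by
  rw [← LinearMap.range_eq_top.2 hs, LinearMap.range_eq_map]
  exact hX.map hφ

theorem FG.pi_top {ι : Type} [Fintype ι] {X : ι → SemilinRep act} (hX : ∀ i, (X i).FG ⊤) :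
    (pi X).FG ⊤ := by
  classical
  have h : (⊤ : Submodule K (pi X).carrier) =
      Finset.univ.sup fun i => (⊤ : Submodule K (X i).carrier).map (piSingle X i) := by
    symm
    rw [eq_top_iff]
    intro x _
    rw [← sum_piSingle X x]
    exact Submodule.sum_mem _ fun i _ => (Finset.le_sup (f := fun i =>
      (⊤ : Submodule K (X i).carrier).map (piSingle X i)) (Finset.mem_univ i))
        ⟨_, Submodule.mem_top, rfl⟩
  rw [h]
  exact FG.finset_sup _ fun i _ => (hX i).map (piSingle_equivariant X i)

/-- The natural map from `𝐒_μ(𝐕)` to `K^{⊕μ}`. -/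
def freeMk (act : GLinf k →* (K ≃ₐ[k] K)) (μ : YoungDiagram) :
    Schur k μ →ₗ[k] (free act μ).carrier := TensorProduct.mk k K (Schur k μ) 1

theorem freeMk_equi (μ : YoungDiagram) :
    Equi (schurRep k μ) (free act μ).ρ (freeMk act μ) := fun g v =>
  congrArg (fun a : K => a ⊗ₜ[k] schurRep k μ g v) (map_one (act g)).symm

theorem free_span (μ : YoungDiagram) : rspan K (freeMk act μ) = ⊤ := by
  rw [eq_top_iff]
  intro x _
  refine TensorProduct.induction_on (motive := fun x : K ⊗[k] Schur k μ =>
    (show (free act μ).carrier from x) ∈ rspan K (freeMk act μ)) x ?_ ?_ ?_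
  · exact Submodule.zero_mem _
  · intro a v
    have h : a • freeMk act μ v = (show (free act μ).carrier from a ⊗ₜ[k] v) := by
      change a • ((1 : K) ⊗ₜ[k] v) = a ⊗ₜ[k] v
      rw [TensorProduct.smul_tmul', smul_eq_mul, mul_one]
    exact h ▸ Submodule.smul_mem _ a (mem_rspan _ v)
  · exact fun x y hx hy => Submodule.add_mem _ hx hy

theorem free_hom_ext {μ : YoungDiagram} {X : SemilinRep act}
    {f g : (free act μ).carrier →ₗ[K] X.carrier} (h : ∀ v, f (freeMk act μ v) = g (freeMk act μ v)) :
    f = g := by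
  refine LinearMap.ext_on (free_span μ) ?_
  rintro _ ⟨v, rfl⟩
  exact h v

variable [CharZero k]

theorem FG.free_top (μ : YoungDiagram) : (free act μ).FG ⊤ := by
  refine ⟨Fintype.card μ.cells + 1, ?_⟩
  have h : rspan K (freeMk act μ ∘ₗ toSchur k μ) = ⊤ := by
    rw [← free_span μ, rspan, rspan, LinearMap.coe_comp,
      (toSchur_surjective (k := k) μ).range_comp]
  rw [← h]
  exact LowGen.rspan (Nat.lt_succ_self _) (Equi.comp (freeMk_equi μ) (toSchur_equi μ))

/-! ### The category of `K`-modules -/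

/-- The properties of the action that determine the structure of the category of `K`-modules. -/
structure Admissible (act : GLinf k →* (K ≃ₐ[k] K)) : Prop where
  exists_subalgebra : ∃ (A : Subalgebra k K) (hA : FracSub act A), ∀ N, HasCoaction hA.stable N
  simpleSub_ne_bot : ∀ μ, simpleSub act μ ≠ ⊥

theorem smul_mem_polyPart {M : SemilinRep act} {a : K} {x : M.carrier}
    (ha : a ∈ polyPart (actRep act)) (hx : x ∈ polyPart M.ρ) : a • x ∈ polyPart M.ρ := by
  have h : Equi ((actRep act).tprod M.ρ) M.ρ
      (((LinearMap.id : M.carrier →ₗ[k] M.carrier).liftBaseChange K).restrictScalars k) :=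
    liftBaseChange_equi (act := act) M.semilinear (fun _ _ => rfl)
  have h1 := map_mem_polyPart h (tmul_mem_polyPart ha hx)
  rwa [LinearMap.restrictScalars_apply, LinearMap.liftBaseChange_tmul] at h1

/-- Denominators can be taken in A, whose elements are polynomial, and products of polynomial
elements are polynomial. A common denominator therefore turns a combination of polynomial vectors
into one polynomial vector. -/
theorem isKModule_iff (hact : Admissible act) {M : SemilinRep act} :
    M.IsKModule ↔ Submodule.span K (polyPart M.ρ : Set M.carrier) = ⊤ := by
  classical
  constructor
  · intro h
    rw [eq_top_iff]
    intro x _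
    obtain ⟨a, y, hy, rfl⟩ := h x
    exact Submodule.smul_mem _ _ (Submodule.subset_span (isPolynomialElement_iff.1 hy))
  · intro h x
    obtain ⟨A, hA, -⟩ := hact.exists_subalgebra
    have hx : x ∈ Submodule.span K (polyPart M.ρ : Set M.carrier) := h ▸ Submodule.mem_top
    suffices H : ∃ b ∈ A, b ≠ 0 ∧ b • x ∈ polyPart M.ρ by
      obtain ⟨b, -, hb0, hb⟩ := H
      exact ⟨b⁻¹, b • x, isPolynomialElement_iff.2 hb, (inv_smul_smul₀ hb0 x).symm⟩
    induction hx using Submodule.span_induction with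
    | mem x hx => exact ⟨1, A.one_mem, one_ne_zero, by rwa [one_smul]⟩
    | zero => exact ⟨1, A.one_mem, one_ne_zero, by rw [smul_zero]; exact Submodule.zero_mem _⟩
    | add x y _ _ hx hy =>
      obtain ⟨b, hbA, hb0, hb⟩ := hx
      obtain ⟨c, hcA, hc0, hc⟩ := hy
      refine ⟨b * c, A.mul_mem hbA hcA, mul_ne_zero hb0 hc0, ?_⟩
      rw [smul_add]
      refine Submodule.add_mem _ ?_ ?_
      · rw [mul_comm, mul_smul]
        exact smul_mem_polyPart (hA.poly c hcA) hb
      · rw [mul_smul]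
        exact smul_mem_polyPart (hA.poly b hbA) hc
    | smul a x _ hx =>
      obtain ⟨b, hbA, hb0, hb⟩ := hx
      obtain ⟨c, hcA, d, hdA, hd0, hdc⟩ := hA.frac a
      refine ⟨d * b, A.mul_mem hdA hbA, mul_ne_zero hd0 hb0, ?_⟩
      have : (d * b) • a • x = c • b • x := by
        rw [smul_smul, smul_smul, ← hdc]
        congr 1
        ring
      rw [this]
      exact smul_mem_polyPart (hA.poly c hcA) hb

theorem FG.isKModule (hact : Admissible act) {M : SemilinRep act} (h : M.FG ⊤) : M.IsKModule := by
  rw [isKModule_iff hact, eq_top_iff]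
  obtain ⟨d, hd⟩ := h
  generalize (⊤ : Submodule K M.carrier) = N at hd
  induction hd with
  | bot => exact bot_le
  | @sup N hN κ _ f hcard hf ih =>
    exact sup_le ih (rspan_le fun x => Submodule.subset_span
      (map_mem_polyPart hf (polyPart_tensorRep (k := k) κ ▸ Submodule.mem_top)))

theorem IsKModule.of_surjective {X Y : SemilinRep act} {f : X.carrier →ₗ[K] Y.carrier}
    (hf : IsEquivariant f) (hs : Function.Surjective f) (hX : X.IsKModule) : Y.IsKModule := by
  intro y
  obtain ⟨x, rfl⟩ := hs y
  obtain ⟨a, x, hx, rfl⟩ := hX x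
  exact ⟨a, f x, isPolynomialElement_iff.2 (map_mem_polyPart hf.equi (isPolynomialElement_iff.1 hx)),
    map_smul f a x⟩

/-- If i x = a y with a ≠ 0 and y polynomial, the representation generated by y lies in the range of
i and can be pulled back to X. -/
theorem IsKModule.of_injective {X Y : SemilinRep act} {i : X.carrier →ₗ[K] Y.carrier}
    (hi : IsEquivariant i) (hii : Function.Injective i) (hY : Y.IsKModule) : X.IsKModule := by
  intro x
  obtain ⟨a, y, hy, hxy⟩ := hY (i x)
  rcases eq_or_ne a 0 with rfl | ha
  · refine ⟨0, 0, isPolynomialElement_iff.2 (Submodule.zero_mem _), hii ?_⟩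
    rw [hxy, zero_smul, zero_smul, map_zero]
  have hyx : i (a⁻¹ • x) = y := by rw [map_smul, hxy, inv_smul_smul₀ ha]
  refine ⟨a, a⁻¹ • x, ?_, (smul_inv_smul₀ ha x).symm⟩
  have hle : (orbitSpan Y.ρ y).toSubmodule ≤ (LinearMap.range i).restrictScalars k :=
    Submodule.span_le.2 (by
      rintro _ ⟨g, rfl⟩
      exact ⟨X.ρ g (a⁻¹ • x), by rw [hi, hyx]⟩)
  let e := LinearEquiv.ofInjective i hii
  let f : (orbitSpan Y.ρ y).toSubmodule →ₗ[k] X.carrier :=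
    (e.symm.toLinearMap.restrictScalars k) ∘ₗ Submodule.inclusion hle
  have hf : ∀ z, i (f z) = z.1 := fun z =>
    congrArg Subtype.val (e.apply_symm_apply ⟨z.1, hle z.2⟩)
  have hfe : Equi (orbitSpan Y.ρ y).toRepresentation X.ρ f := fun g z => hii (by
    rw [hi, hf, hf]
    rfl)
  have hy' : y ∈ (orbitSpan Y.ρ y).toSubmodule := Submodule.subset_span ⟨1, by simp⟩
  have h1 : f ⟨y, hy'⟩ = a⁻¹ • x := hii (by rw [hf, hyx])
  rw [isPolynomialElement_iff, ← h1]
  have h2 := isPolynomial_iff.1 (show IsPolynomial (orbitSpan Y.ρ y).toRepresentation from hy)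
  exact map_mem_polyPart hfe (h2 ▸ Submodule.mem_top)

theorem IsKModule.sub {M : SemilinRep act} (hM : M.IsKModule) {N : Submodule K M.carrier}
    (hN : M.IsStable N) : (M.sub N hN).IsKModule :=
  IsKModule.of_injective (subIncl_equivariant hN) (subIncl_injective hN) hM

theorem IsKModule.quot {M : SemilinRep act} (hM : M.IsKModule) {N : Submodule K M.carrier}
    (hN : M.IsStable N) : (M.quot N hN).IsKModule :=
  IsKModule.of_surjective (quotMk_equivariant hN) (quotMk_surjective hN) hM

theorem IsKModule.exists_fg_mem {M : SemilinRep act} (hM : M.IsKModule) (x : M.carrier) :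
    ∃ N, M.FG N ∧ x ∈ N := by
  obtain ⟨a, y, hy, rfl⟩ := hM x
  obtain ⟨d, L, hL, hyL⟩ := exists_lowGen_mem (K := K) (isPolynomialElement_iff.1 hy)
  exact ⟨L, ⟨d, hL⟩, Submodule.smul_mem _ a hyL⟩

theorem IsFinGen.fg {M : SemilinRep act} (hM : M.IsKModule) (h : M.IsFinGen) : M.FG ⊤ := by
  obtain ⟨S, hS⟩ := h
  obtain ⟨d, L, hL, hSL⟩ := exists_lowGen_finset S fun x _ => by
    obtain ⟨a, y, hy, rfl⟩ := hM x
    exact ⟨a, y, isPolynomialElement_iff.1 hy, rfl⟩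
  have : L = ⊤ := by
    rw [eq_top_iff, ← hS, Submodule.span_le]
    rintro _ ⟨g, x, hx, rfl⟩
    exact FG.isStable ⟨d, hL⟩ g x (hSL x hx)
  exact ⟨d, this ▸ hL⟩

section Subquotients

variable {M : SemilinRep act} {N P : Submodule K M.carrier} (hN : M.IsStable N) (hP : M.IsStable P)

/-- The projection to a subquotient. -/
def subquotMk : (M.sub P hP).carrier →ₗ[K] (M.subquot N P hN hP).carrier :=
  quotMk (M.isStable_submoduleOf hN hP)

theorem subquotMk_equivariant :
    IsEquivariant (M := M.sub P hP) (N := M.subquot N P hN hP) (subquotMk hN hP) :=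
  quotMk_equivariant _

theorem subquotMk_surjective : Function.Surjective (subquotMk hN hP) := quotMk_surjective _

theorem subquotMk_eq_zero {x : (M.sub P hP).carrier} :
    subquotMk hN hP x = 0 ↔ subIncl hP x ∈ N := quotMk_eq_zero _

theorem subquot_simple_cases (h : (M.subquot N P hN hP).IsSimple) {Q : Submodule K M.carrier}
    (hQ : M.IsStable Q) (hQP : Q ≤ P) : Q ≤ N ∨ P ≤ N ⊔ Q := by
  have hst : (M.subquot N P hN hP).IsStable ((Q.comap (subIncl hP)).map (subquotMk hN hP)) :=
    (hQ.comap (subIncl_equivariant hP)).map (subquotMk_equivariant hN hP)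
  rcases h.2.2 _ hst with h0 | h1
  · left
    intro x hx
    obtain ⟨x, rfl⟩ := exists_subIncl_eq hP (hQP hx)
    refine (subquotMk_eq_zero hN hP).1 ((Submodule.mem_bot K).1 ?_)
    rw [← h0]
    exact ⟨x, hx, rfl⟩
  · right
    intro y hy
    obtain ⟨y, rfl⟩ := exists_subIncl_eq hP hy
    have hy' : subquotMk hN hP y ∈ (Q.comap (subIncl hP)).map (subquotMk hN hP) := by
      rw [h1]
      exact Submodule.mem_top
    obtain ⟨z, hz, hzy⟩ := hy'
    have h2 : subIncl hP (y - z) ∈ N := (subquotMk_eq_zero hN hP).1 (by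
      rw [map_sub, hzy, sub_self])
    have h3 : subIncl hP y = subIncl hP (y - z) + subIncl hP z := by rw [← map_add, sub_add_cancel]
    rw [h3]
    exact Submodule.add_mem_sup h2 hz

theorem not_le_of_subquot_nontrivial (h : Nontrivial (M.subquot N P hN hP).carrier) : ¬ P ≤ N := by
  intro hle
  obtain ⟨y, hy⟩ := exists_ne (0 : (M.subquot N P hN hP).carrier)
  obtain ⟨y, rfl⟩ := subquotMk_surjective hN hP y
  exact hy ((subquotMk_eq_zero hN hP).2 (hle (subIncl_mem hP y)))

end Subquotients

/-- Along a composition series, one vector of a term outside the preceding one suffices to generate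
it modulo that one. -/
theorem IsFiniteLength.fg {M : SemilinRep act} (hM : M.IsKModule) (h : M.IsFiniteLength) :
    M.FG ⊤ := by
  obtain ⟨s⟩ := h
  suffices H : ∀ i, ∃ L, M.FG L ∧ s.term i ≤ L by
    obtain ⟨L, hL, hle⟩ := H (Fin.last _)
    rw [s.last_eq, top_le_iff] at hle
    exact hle ▸ hL
  intro i
  induction i using Fin.induction with
  | zero => exact ⟨⊥, FG.bot M, s.first_eq.le⟩
  | succ i ih =>
    obtain ⟨L, hL, hle⟩ := ih
    obtain ⟨x, hx, hxi⟩ := Set.not_subset.1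
      (not_le_of_subquot_nontrivial (s.stable i.castSucc) (s.stable i.succ) (s.simple i).2.1)
    obtain ⟨L', hL', hxL'⟩ := hM.exists_fg_mem x
    refine ⟨L ⊔ L', hL.sup hL', ?_⟩
    rcases subquot_simple_cases _ _ (s.simple i) (hL'.isStable.inf (s.stable i.succ))
      inf_le_right with h | h
    · exact absurd (h ⟨hxL', hx⟩) hxi
    · exact h.trans (sup_le_sup hle inf_le_left)

end SemilinRep

namespace SemilinRep

variable {k : Type u} [Field k] [CharZero k] {K : Type u} [Field K] [Algebra k K]
  {act : GLinf k →* (K ≃ₐ[k] K)}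

/-! ### Maps between the modules `K^{⊕μ}` -/

/-- The map is determined by its restriction to 𝐒_μ. There, rigidity of Schur functors over K leaves
only an invariant scalar in equal degree, and a non-zero scalar of the field K is invertible. -/
theorem free_hom_cases (hact : Admissible act) {μ ν : YoungDiagram}
    {f : (free act μ).carrier →ₗ[K] (free act ν).carrier} (hf : IsEquivariant f) :
    f = 0 ∨ ν.card < μ.card ∨ (μ = ν ∧ Function.Bijective f) := by
  obtain ⟨A, hA, -⟩ := hact.exists_subalgebra
  have hsm : ∀ a : K, ∃ p, FixedAt (actRep act) p a := hA.smooth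
  let f₀ : Schur k μ →ₗ[k] K ⊗[k] Schur k ν := f.restrictScalars k ∘ₗ freeMk act μ
  have hf₀ : Equi (schurRep k μ) (baseRep act (schurRep k ν)) f₀ :=
    Equi.comp (ρ' := (free act μ).ρ) hf.equi (freeMk_equi μ)
  by_cases h0 : f₀ = 0
  · exact Or.inl (free_hom_ext fun v => LinearMap.congr_fun h0 v)
  refine Or.inr ((schur_card_le hf₀ h0).lt_or_eq.imp id fun hcard => ?_)
  obtain rfl : μ = ν := by
    by_contra hne
    exact h0 (schur_eq_zero_of_ne hsm hf₀ hcard hne)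
  refine ⟨rfl, ?_⟩
  obtain ⟨b, -, hb⟩ := schur_eq_tmul hsm hf₀
  have hb0 : b ≠ 0 := by
    rintro rfl
    exact h0 (LinearMap.ext fun v => by rw [hb, TensorProduct.zero_tmul]; rfl)
  have hfb : f = b • (LinearMap.id : (free act μ).carrier →ₗ[K] (free act μ).carrier) :=
    free_hom_ext fun v => (hb v).trans (by
      change b ⊗ₜ[k] v = b • ((1 : K) ⊗ₜ[k] v)
      rw [TensorProduct.smul_tmul', smul_eq_mul, mul_one])
  constructor
  · intro x y hxy
    rw [hfb] at hxy
    exact smul_right_injective _ hb0 hxy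
  · intro y
    exact ⟨b⁻¹ • y, by rw [hfb]; exact smul_inv_smul₀ hb0 y⟩

/-- A stable subspace of a finitely generated module is a finite intersection of kernels of maps to
the modules `K^{⊕μ}`. -/
theorem exists_separating (hact : Admissible act) {M : SemilinRep act} (hM : M.FG ⊤)
    {N : Submodule K M.carrier} (hN : M.IsStable N) :
    ∃ (ι : Type) (_ : Fintype ι) (μ : ι → YoungDiagram)
      (θ : ∀ j, M.carrier →ₗ[K] (free act (μ j)).carrier),
        (∀ j, IsEquivariant (θ j)) ∧ ∀ x, (∀ j, θ j x = 0) ↔ x ∈ N := by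
  obtain ⟨A, hA, hD⟩ := hact.exists_subalgebra
  obtain ⟨d, hd⟩ := FG.of_surjective (quotMk_equivariant hN) (quotMk_surjective hN) hM
  obtain ⟨ι, hι, μ, θ, hθ, hinj⟩ := hd.exists_separating hA hD (M.quot N hN).semilinear
  refine ⟨ι, hι, μ, fun j => (show (M.quot N hN).carrier →ₗ[K] (free act (μ j)).carrier from θ j) ∘ₗ
    quotMk hN, fun j => ?_, fun x => ⟨fun h => ?_, fun hx j => ?_⟩⟩
  · exact isEquivariant_comp (Y := M.quot N hN) (hθ j) (quotMk_equivariant hN)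
  · exact (quotMk_eq_zero hN).1 (hinj _ h)
  · rw [LinearMap.comp_apply, (quotMk_eq_zero hN).2 hx]
    exact map_zero _

/-! ### The simple modules -/

theorem simpleSub_le_ker {μ ν : YoungDiagram}
    {f : (free act μ).carrier →ₗ[K] (free act ν).carrier} (hf : IsEquivariant f)
    (hν : ν.card < μ.card) : simpleSub act μ ≤ LinearMap.ker f := fun _ hx =>
  mem_simpleSub.1 hx ν f hν hf

/-- Separate the points of the quotient by N. No separating map is bijective, since all of them kill
N ≠ 0, so each one vanishes or lowers the degree, and hence kills L_μ. -/
theorem simpleSub_le (hact : Admissible act) {μ : YoungDiagram}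
    {N : Submodule K (free act μ).carrier} (hN : (free act μ).IsStable N) (h0 : N ≠ ⊥) :
    simpleSub act μ ≤ N := by
  obtain ⟨ι, _, ν, θ, hθ, hker⟩ := exists_separating hact (FG.free_top μ) hN
  intro x hx
  refine (hker x).1 fun j => ?_
  rcases free_hom_cases hact (hθ j) with h | h | ⟨-, h⟩
  · rw [h, LinearMap.zero_apply]
  · exact simpleSub_le_ker (hθ j) h hx
  · refine absurd ((Submodule.eq_bot_iff _).2 fun y hy => ?_) h0
    exact h.1 (((hker y).2 hy j).trans (map_zero _).symm)

theorem free_isKModule (hact : Admissible act) (μ : YoungDiagram) : (free act μ).IsKModule :=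
  (FG.free_top μ).isKModule hact

theorem nontrivial_sub {M : SemilinRep act} {N : Submodule K M.carrier} (hN : M.IsStable N)
    (h0 : N ≠ ⊥) : Nontrivial (M.sub N hN).carrier := by
  obtain ⟨x, hx, hx0⟩ := Submodule.exists_mem_ne_zero_of_ne_bot h0
  obtain ⟨y, rfl⟩ := exists_subIncl_eq hN hx
  exact ⟨y, 0, fun h => hx0 (by rw [h, map_zero])⟩

theorem isSimple_sub {M : SemilinRep act} (hM : M.IsKModule) {N : Submodule K M.carrier}
    (hN : M.IsStable N) (h0 : N ≠ ⊥)
    (h : ∀ P : Submodule K M.carrier, M.IsStable P → P ≤ N → P ≠ ⊥ → N ≤ P) :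
    (M.sub N hN).IsSimple := by
  refine ⟨hM.sub hN, nontrivial_sub hN h0, fun P hP => ?_⟩
  by_cases hb : P.map (subIncl hN) = ⊥
  · left
    exact Submodule.map_injective_of_injective (subIncl_injective hN)
      (hb.trans (Submodule.map_bot _).symm)
  · right
    have hle : P.map (subIncl hN) ≤ N := by
      rintro _ ⟨x, -, rfl⟩
      exact subIncl_mem hN x
    refine eq_top_iff.2 fun x _ => ?_
    obtain ⟨y, hy, hyx⟩ := h _ (isStable_map_subIncl hN hP) hle hb (subIncl_mem hN x)
    exact subIncl_injective hN hyx ▸ hy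

theorem le_of_isSimple_sub {M : SemilinRep act} {N : Submodule K M.carrier} {hN : M.IsStable N}
    (h : (M.sub N hN).IsSimple) {P : Submodule K M.carrier} (hP : M.IsStable P)
    (h0 : P ⊓ N ≠ ⊥) : N ≤ P := by
  rcases h.2.2 _ (hP.comap (subIncl_equivariant hN)) with h1 | h1
  · refine absurd ((Submodule.eq_bot_iff _).2 fun x hx => ?_) h0
    obtain ⟨y, rfl⟩ := exists_subIncl_eq hN hx.2
    have : y ∈ P.comap (subIncl hN) := hx.1
    rw [h1, Submodule.mem_bot] at this
    rw [this, map_zero]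
  · intro x hx
    obtain ⟨y, rfl⟩ := exists_subIncl_eq hN hx
    have : y ∈ P.comap (subIncl hN) := by rw [h1]; exact Submodule.mem_top
    exact this

theorem ne_bot_of_isSimple_sub {M : SemilinRep act} {N : Submodule K M.carrier} {hN : M.IsStable N}
    (h : (M.sub N hN).IsSimple) : N ≠ ⊥ := by
  obtain ⟨-, ⟨x, y, hxy⟩, -⟩ := h
  rintro rfl
  refine hxy (subIncl_injective hN ?_)
  rw [(Submodule.mem_bot K).1 (subIncl_mem hN x), (Submodule.mem_bot K).1 (subIncl_mem hN y)]

theorem simpleObj_isSimple (hact : Admissible act) (μ : YoungDiagram) :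
    (simpleObj act μ).IsSimple :=
  isSimple_sub (free_isKModule hact μ) (isStable_simpleSub act μ) (hact.simpleSub_ne_bot μ)
    fun _ hP _ h0 => simpleSub_le hact hP h0

theorem eq_simpleSub_of_isSimple (hact : Admissible act) {μ : YoungDiagram}
    {N : Submodule K (free act μ).carrier} {hN : (free act μ).IsStable N}
    (h : ((free act μ).sub N hN).IsSimple) : N = simpleSub act μ := by
  have hle := simpleSub_le hact hN (ne_bot_of_isSimple_sub h)
  refine le_antisymm (le_of_isSimple_sub h (isStable_simpleSub act μ) ?_) hle
  rw [inf_eq_left.2 hle]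
  exact hact.simpleSub_ne_bot μ

theorem socle_free (hact : Admissible act) (μ : YoungDiagram) :
    (free act μ).socle = simpleSub act μ := by
  refine le_antisymm (sSup_le ?_) (le_sSup ⟨isStable_simpleSub act μ, simpleObj_isSimple hact μ⟩)
  rintro N ⟨hN, h⟩
  exact (eq_simpleSub_of_isSimple hact h).le

theorem IsSimple.fg {M : SemilinRep act} (hM : M.IsSimple) : M.FG ⊤ := by
  obtain ⟨hK, ⟨x, y, hxy⟩, h⟩ := hM
  obtain ⟨N, hN, hx⟩ := hK.exists_fg_mem (x - y)
  rcases h N hN.isStable with h0 | h0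
  · rw [h0, Submodule.mem_bot, sub_eq_zero] at hx
    exact absurd hx hxy
  · exact h0 ▸ hN

/-- Some separating map is non-zero, hence injective. Its image contains L_μ, and equals it by
simplicity. -/
theorem IsSimple.exists_embedding (hact : Admissible act) {M : SemilinRep act} (hM : M.IsSimple) :
    ∃ (μ : YoungDiagram) (f : M.carrier →ₗ[K] (free act μ).carrier), IsEquivariant f ∧
      Function.Injective f ∧ LinearMap.range f = simpleSub act μ := by
  obtain ⟨ι, _, μ, θ, hθ, hker⟩ := exists_separating hact hM.fg M.isStable_bot
  obtain ⟨x, hx⟩ := @exists_ne _ hM.2.1 (0 : M.carrier)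
  obtain ⟨j, hj⟩ : ∃ j, θ j x ≠ 0 := by
    by_contra! h
    exact hx ((Submodule.mem_bot K).1 ((hker x).1 h))
  have hinj : LinearMap.ker (θ j) = ⊥ := (hM.2.2 _ (isStable_ker (hθ j))).resolve_right fun h =>
    hj (LinearMap.mem_ker.1 (h ▸ Submodule.mem_top))
  refine ⟨μ j, θ j, hθ j, LinearMap.ker_eq_bot.1 hinj, ?_⟩
  have hle : simpleSub act (μ j) ≤ LinearMap.range (θ j) :=
    simpleSub_le hact (isStable_range (hθ j)) fun h => hj (by
      rw [LinearMap.range_eq_bot.1 h, LinearMap.zero_apply])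
  refine le_antisymm ?_ hle
  rcases hM.2.2 _ ((isStable_simpleSub act (μ j)).comap (hθ j)) with h | h
  · refine absurd ((Submodule.eq_bot_iff _).2 fun y hy => ?_) (hact.simpleSub_ne_bot (μ j))
    obtain ⟨z, rfl⟩ := hle hy
    have : z ∈ (simpleSub act (μ j)).comap (θ j) := hy
    rw [h, Submodule.mem_bot] at this
    rw [this, map_zero]
  · rintro _ ⟨z, rfl⟩
    have : z ∈ (simpleSub act (μ j)).comap (θ j) := by rw [h]; exact Submodule.mem_top
    exact this

theorem IsSimple.exists_iso (hact : Admissible act) {M : SemilinRep act} (hM : M.IsSimple) :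
    ∃ μ : YoungDiagram, M.Iso (simpleObj act μ) := by
  obtain ⟨μ, f, hf, hinj, hr⟩ := hM.exists_embedding hact
  have hmem : ∀ x, f x ∈ simpleSub act μ := fun x => hr ▸ LinearMap.mem_range_self f x
  refine ⟨μ, iso_of_bijective (f := subLift (isStable_simpleSub act μ) f hmem)
    (subLift_equivariant _ hf hmem) ⟨fun x y h => hinj ?_, fun y => ?_⟩⟩
  · exact congrArg (subIncl (isStable_simpleSub act μ)) h
  · obtain ⟨x, hx⟩ : subIncl (isStable_simpleSub act μ) y ∈ LinearMap.range f := by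
      rw [hr]
      exact subIncl_mem (isStable_simpleSub act μ) y
    exact ⟨x, subIncl_injective (isStable_simpleSub act μ) ((subIncl_subLift _ _ _ _).trans hx)⟩

/-! ### Injectivity -/

theorem injective_of_ne_zero_on_simpleSub (hact : Admissible act) {μ : YoungDiagram}
    {X : SemilinRep act} {f : (free act μ).carrier →ₗ[K] X.carrier} (hf : IsEquivariant f)
    (h : ∃ x ∈ simpleSub act μ, f x ≠ 0) : Function.Injective f := by
  rw [← LinearMap.ker_eq_bot]
  by_contra h0
  obtain ⟨x, hx, hfx⟩ := h
  exact hfx (simpleSub_le hact (isStable_ker hf) h0 hx)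

/-- Some separating map of M is non-zero on the image of L_μ. Its restriction to K^{⊕μ} is then
neither zero nor degree-lowering, so it is bijective, and inverting it gives the retraction. -/
theorem exists_retraction_of_fg (hact : Admissible act) {M : SemilinRep act} (hM : M.FG ⊤)
    {μ : YoungDiagram} {i : (free act μ).carrier →ₗ[K] M.carrier} (hi : IsEquivariant i)
    (hii : Function.Injective i) : ∃ r : M.carrier →ₗ[K] (free act μ).carrier,
      IsEquivariant r ∧ ∀ x, r (i x) = x := by
  obtain ⟨ι, _, ν, θ, hθ, hker⟩ := exists_separating hact hM M.isStable_bot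
  obtain ⟨x, hx, hx0⟩ := Submodule.exists_mem_ne_zero_of_ne_bot (hact.simpleSub_ne_bot μ)
  obtain ⟨j, hj⟩ : ∃ j, θ j (i x) ≠ 0 := by
    by_contra! h
    exact hx0 (hii (((Submodule.mem_bot K).1 ((hker (i x)).1 h)).trans (map_zero i).symm))
  have hg : IsEquivariant (M := free act μ) (N := free act (ν j)) (θ j ∘ₗ i) :=
    isEquivariant_comp (hθ j) hi
  have hb : Function.Bijective (θ j ∘ₗ i) := by
    rcases free_hom_cases hact hg with h | h | ⟨-, h⟩
    · exact absurd (LinearMap.congr_fun h x) hj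
    · exact absurd (LinearMap.mem_ker.1 (simpleSub_le_ker hg h hx)) hj
    · exact h
  let e := LinearEquiv.ofBijective (θ j ∘ₗ i) hb
  refine ⟨e.symm.toLinearMap ∘ₗ θ j, isEquivariant_comp (Y := free act (ν j))
    (isEquivariant_symm (e := e) hg) (hθ j), fun x => ?_⟩
  exact e.symm_apply_apply x

/-- A module that is an essential extension of `K^{⊕μ}` is equal to it. -/
theorem surjective_of_essential (hact : Admissible act) {M : SemilinRep act} (hM : M.IsKModule)
    {μ : YoungDiagram} {i : (free act μ).carrier →ₗ[K] M.carrier} (hi : IsEquivariant i)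
    (hii : Function.Injective i)
    (hess : ∀ N : Submodule K M.carrier, M.IsStable N → N ⊓ LinearMap.range i = ⊥ → N = ⊥) :
    Function.Surjective i := by
  intro x
  obtain ⟨L, hL, hx⟩ := hM.exists_fg_mem x
  have hQ : M.FG (L ⊔ LinearMap.range i) := by
    rw [LinearMap.range_eq_map]
    exact hL.sup ((FG.free_top μ).map hi)
  have hiQ : ∀ y, i y ∈ L ⊔ LinearMap.range i := fun y =>
    Submodule.mem_sup_right (LinearMap.mem_range_self i y)
  obtain ⟨r, hr, hri⟩ := exists_retraction_of_fg hact hQ.sub_top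
    (i := subLift hQ.isStable i hiQ) (subLift_equivariant _ hi hiQ) (fun y z h => hii (by
      have := congrArg (subIncl hQ.isStable) h
      rwa [subIncl_subLift, subIncl_subLift] at this))
  -- The kernel of the retraction meets the image of i trivially, so it vanishes by essentiality.
  have hN := hess ((LinearMap.ker r).map (subIncl hQ.isStable))
    (isStable_map_subIncl _ (isStable_ker hr)) (by
      rw [Submodule.eq_bot_iff]
      rintro _ ⟨⟨z, hz, rfl⟩, y, hy⟩
      have h1 : subLift hQ.isStable i hiQ y = z := subIncl_injective hQ.isStable hy
      have h2 := hri y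
      rw [h1, LinearMap.mem_ker.1 hz] at h2
      rw [← hy, ← h2, map_zero])
  obtain ⟨z, rfl⟩ := exists_subIncl_eq hQ.isStable (Submodule.mem_sup_left hx)
  refine ⟨r z, ?_⟩
  have h1 : z - subLift hQ.isStable i hiQ (r z) ∈ LinearMap.ker r := by
    rw [LinearMap.mem_ker, map_sub, hri, sub_self]
  have h2 : subIncl hQ.isStable (z - subLift hQ.isStable i hiQ (r z)) ∈
      (LinearMap.ker r).map (subIncl hQ.isStable) := ⟨_, h1, rfl⟩
  rw [hN, Submodule.mem_bot, map_sub, subIncl_subLift, sub_eq_zero] at h2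
  exact h2.symm

/-- Zorn's lemma gives a subobject C maximal among those meeting the image of i trivially. Modulo C
the extension is essential, hence an isomorphism. -/
theorem exists_retraction (hact : Admissible act) {M : SemilinRep act} (hM : M.IsKModule)
    {μ : YoungDiagram} {i : (free act μ).carrier →ₗ[K] M.carrier} (hi : IsEquivariant i)
    (hii : Function.Injective i) : ∃ r : M.carrier →ₗ[K] (free act μ).carrier,
      IsEquivariant r ∧ ∀ x, r (i x) = x := by
  obtain ⟨C, hC⟩ := zorn_le₀ {C : Submodule K M.carrier | M.IsStable C ∧
      C ⊓ LinearMap.range i = ⊥} (by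
    intro c hc hchain
    rcases c.eq_empty_or_nonempty with rfl | hne
    · exact ⟨⊥, ⟨M.isStable_bot, bot_inf_eq _⟩, by simp⟩
    have hmem : ∀ x, x ∈ sSup c ↔ ∃ C ∈ c, x ∈ C := fun x =>
      Submodule.mem_sSup_of_directed hne hchain.directedOn
    refine ⟨sSup c, ⟨fun g x hx => ?_, ?_⟩, fun C hCc => le_sSup hCc⟩
    · obtain ⟨C, hCc, hxC⟩ := (hmem x).1 hx
      exact (hmem _).2 ⟨C, hCc, (hc hCc).1 g x hxC⟩
    · rw [Submodule.eq_bot_iff]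
      rintro x ⟨hx, hxi⟩
      obtain ⟨C, hCc, hxC⟩ := (hmem x).1 hx
      have := (hc hCc).2
      rw [Submodule.eq_bot_iff] at this
      exact this x ⟨hxC, hxi⟩)
  obtain ⟨hCs, hCi⟩ := hC.prop
  have hdisj : ∀ y, i y ∈ C → y = 0 := fun y hy => by
    have h1 : i y ∈ C ⊓ LinearMap.range i := ⟨hy, LinearMap.mem_range_self i y⟩
    rw [hCi, Submodule.mem_bot] at h1
    exact hii (h1.trans (map_zero i).symm)
  let j : (free act μ).carrier →ₗ[K] (M.quot C hCs).carrier := quotMk hCs ∘ₗ i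
  have hj : IsEquivariant (M := free act μ) (N := M.quot C hCs) j :=
    isEquivariant_comp (quotMk_equivariant hCs) hi
  have hji : Function.Injective j := by
    rw [← LinearMap.ker_eq_bot, Submodule.eq_bot_iff]
    exact fun y hy => hdisj y ((quotMk_eq_zero hCs).1 hy)
  have hjs : Function.Surjective j := by
    refine surjective_of_essential hact (hM.quot hCs) hj hji fun N hN hNj => ?_
    have hle : C ≤ N.comap (quotMk hCs) := fun x hx => by
      rw [Submodule.mem_comap, (quotMk_eq_zero hCs).2 hx]
      exact Submodule.zero_mem _
    have h1 : N.comap (quotMk hCs) ≤ C := hC.le_of_ge ⟨hN.comap (quotMk_equivariant hCs), by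
      rw [Submodule.eq_bot_iff]
      rintro _ ⟨hx, y, rfl⟩
      have h2 : j y ∈ N ⊓ LinearMap.range j := ⟨hx, LinearMap.mem_range_self j y⟩
      rw [hNj, Submodule.mem_bot] at h2
      rw [hji (h2.trans (map_zero j).symm), map_zero]⟩ hle
    rw [Submodule.eq_bot_iff]
    intro x hx
    obtain ⟨x, rfl⟩ := quotMk_surjective hCs x
    exact (quotMk_eq_zero hCs).2 (h1 hx)
  let e := LinearEquiv.ofBijective j ⟨hji, hjs⟩
  refine ⟨e.symm.toLinearMap ∘ₗ quotMk hCs, isEquivariant_comp (Y := M.quot C hCs)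
    (isEquivariant_symm (e := e) hj) (quotMk_equivariant hCs), fun x => ?_⟩
  exact e.symm_apply_apply x

end SemilinRep

namespace SemilinRep

variable {k : Type u} [Field k] {K : Type u} [Field K] [Algebra k K]
  {act : GLinf k →* (K ≃ₐ[k] K)}

/-- The product of two semi-linear representations. -/
def prod (X Y : SemilinRep act) : SemilinRep act where
  carrier := X.carrier × Y.carrier
  ρ :=
    { toFun := fun g => (X.ρ g).prodMap (Y.ρ g)
      map_one' := by ext <;> simp
      map_mul' := fun g h => by ext <;> simp }
  semilinear g a x := Prod.ext (X.semilinear g a x.1) (Y.semilinear g a x.2)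

/-- The first inclusion into a product. -/
def prodInl (X Y : SemilinRep act) : X.carrier →ₗ[K] (prod X Y).carrier :=
  LinearMap.inl K X.carrier Y.carrier

/-- The second inclusion into a product. -/
def prodInr (X Y : SemilinRep act) : Y.carrier →ₗ[K] (prod X Y).carrier :=
  LinearMap.inr K X.carrier Y.carrier

theorem prodInl_equivariant (X Y : SemilinRep act) :
    IsEquivariant (M := X) (N := prod X Y) (prodInl X Y) := fun g x =>
  Prod.ext rfl (map_zero (Y.ρ g)).symm

theorem prodInr_equivariant (X Y : SemilinRep act) :
    IsEquivariant (M := Y) (N := prod X Y) (prodInr X Y) := fun g x =>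
  Prod.ext (map_zero (X.ρ g)).symm rfl

theorem exists_prod_eq {X Y : SemilinRep act} (z : (prod X Y).carrier) :
    ∃ x y, z = prodInl X Y x + prodInr X Y y :=
  ⟨z.1, z.2, Prod.ext (add_zero z.1).symm (zero_add z.2).symm⟩

theorem prod_eq_zero {X Y : SemilinRep act} {x : X.carrier} {y : Y.carrier}
    (h : prodInl X Y x + prodInr X Y y = 0) : x = 0 ∧ y = 0 :=
  ⟨(add_zero x).symm.trans (congrArg Prod.fst h), (zero_add y).symm.trans (congrArg Prod.snd h)⟩

variable [CharZero k]

theorem IsKModule.mem_span {X M : SemilinRep act} (hX : X.IsKModule)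
    {f : X.carrier →ₗ[K] M.carrier} (hf : IsEquivariant f) (x : X.carrier) :
    f x ∈ Submodule.span K (polyPart M.ρ : Set M.carrier) := by
  obtain ⟨a, y, hy, rfl⟩ := hX x
  rw [map_smul]
  exact Submodule.smul_mem _ _ (Submodule.subset_span
    (map_mem_polyPart hf.equi (isPolynomialElement_iff.1 hy)))

theorem IsKModule.prod (hact : Admissible act) {X Y : SemilinRep act} (hX : X.IsKModule)
    (hY : Y.IsKModule) : (X.prod Y).IsKModule := by
  rw [isKModule_iff hact, eq_top_iff]
  intro z _
  obtain ⟨x, y, rfl⟩ := exists_prod_eq z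
  exact Submodule.add_mem _ (hX.mem_span (prodInl_equivariant X Y) x)
    (hY.mem_span (prodInr_equivariant X Y) y)

theorem IsKModule.pi (hact : Admissible act) {ι : Type} [Fintype ι] {X : ι → SemilinRep act}
    (hX : ∀ i, (X i).IsKModule) : (pi X).IsKModule := by
  classical
  rw [isKModule_iff hact, eq_top_iff]
  intro x _
  rw [← sum_piSingle X x]
  exact Submodule.sum_mem _ fun i _ => (hX i).mem_span (piSingle_equivariant X i) _

/-! ### Injective objects -/

/-- The pushout of i and f contains a copy of K^{⊕μ}, and a retraction onto it extends f. -/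
theorem free_isInjective (hact : Admissible act) (μ : YoungDiagram) :
    (free act μ).IsInjective := by
  refine ⟨free_isKModule hact μ, fun X Y hX hY i f hi hf hii => ?_⟩
  let F := free act μ
  let δ : X.carrier →ₗ[K] (Y.prod F).carrier := prodInl Y F ∘ₗ i - prodInr Y F ∘ₗ f
  have hδ : ∀ x, δ x = prodInl Y F (i x) + prodInr Y F (-f x) := fun x => by
    rw [map_neg, ← sub_eq_add_neg]
    rfl
  have hδe : IsEquivariant (M := X) (N := Y.prod F) δ := fun g x => by
    rw [hδ, hδ, map_add, ← prodInl_equivariant, ← prodInr_equivariant, hi, hf, map_neg ((free act μ).ρ g)]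
  have hN := isStable_range (M := X) (N := Y.prod F) hδe
  have hj : IsEquivariant (M := F) (N := (Y.prod F).quot _ hN) (quotMk hN ∘ₗ prodInr Y F) :=
    isEquivariant_comp (Y := Y.prod F) (quotMk_equivariant hN) (prodInr_equivariant Y F)
  have hji : Function.Injective (quotMk hN ∘ₗ prodInr Y F) := by
    rw [← LinearMap.ker_eq_bot, Submodule.eq_bot_iff]
    intro v hv
    obtain ⟨x, hx⟩ := (quotMk_eq_zero hN).1 hv
    have h1 : prodInl Y F (i x) + prodInr Y F (-f x - v) = 0 := by
      rw [map_sub, ← add_sub_assoc, ← hδ, hx, sub_self]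
    obtain ⟨h2, h3⟩ := prod_eq_zero h1
    have h4 : x = 0 := hii (h2.trans (map_zero i).symm)
    rw [h4, map_zero, neg_zero, zero_sub, neg_eq_zero] at h3
    exact h3
  obtain ⟨r, hr, hrj⟩ := exists_retraction hact
    ((hY.prod hact (free_isKModule hact μ)).quot hN) hj hji
  refine ⟨r ∘ₗ quotMk hN ∘ₗ prodInl Y F, isEquivariant_comp (Y := (Y.prod F).quot _ hN) hr
    (isEquivariant_comp (Y := Y.prod F) (quotMk_equivariant hN) (prodInl_equivariant Y F)),
      LinearMap.ext fun x => ?_⟩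
  have h1 : quotMk hN (prodInl Y F (i x)) = quotMk hN (prodInr Y F (f x)) := by
    rw [← sub_eq_zero, ← map_sub, quotMk_eq_zero]
    exact ⟨x, rfl⟩
  change r (quotMk hN (prodInl Y F (i x))) = f x
  rw [h1]
  exact hrj (f x)

theorem IsInjective.pi (hact : Admissible act) {ι : Type} [Fintype ι] {X : ι → SemilinRep act}
    (hX : ∀ i, (X i).IsInjective) : (pi X).IsInjective := by
  refine ⟨IsKModule.pi hact fun i => (hX i).1, fun A B hA hB j f hj hf hji => ?_⟩
  choose h hh hhf using fun i => (hX i).2 A B hA hB j (piProj X i ∘ₗ f) hj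
    (isEquivariant_comp (piProj_equivariant X i) hf) hji
  refine ⟨piLift h, piLift_equivariant hh, LinearMap.ext fun a => pi_ext fun i => ?_⟩
  exact LinearMap.congr_fun (hhf i) a

theorem IsInjective.of_retract {I J : SemilinRep act} (hI : I.IsInjective)
    {s : J.carrier →ₗ[K] I.carrier} {r : I.carrier →ₗ[K] J.carrier} (hs : IsEquivariant s)
    (hr : IsEquivariant r) (hrs : ∀ x, r (s x) = x) : J.IsInjective := by
  refine ⟨IsKModule.of_surjective hr (fun x => ⟨s x, hrs x⟩) hI.1,
    fun A B hA hB j f hj hf hji => ?_⟩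
  obtain ⟨h, hh, hhf⟩ := hI.2 A B hA hB j (s ∘ₗ f) hj (isEquivariant_comp hs hf) hji
  refine ⟨r ∘ₗ h, isEquivariant_comp hr hh, LinearMap.ext fun a => ?_⟩
  have h1 := LinearMap.congr_fun hhf a
  change r (h (j a)) = f a
  rw [← hrs (f a)]
  exact congrArg r h1

/-! ### Finite length -/

/-- The subobjects contained in a given subspace. -/
def Below (M : SemilinRep act) (N : Submodule K M.carrier) : Type u :=
  {P : Submodule K M.carrier // M.IsStable P ∧ P ≤ N}

instance (M : SemilinRep act) (N : Submodule K M.carrier) : PartialOrder (Below M N) :=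
  inferInstanceAs (PartialOrder {P : Submodule K M.carrier // M.IsStable P ∧ P ≤ N})

/-- The subobjects contained in `N` satisfy both chain conditions. -/
def HasChainConditions (M : SemilinRep act) (N : Submodule K M.carrier) : Prop :=
  WellFoundedLT (Below M N) ∧ WellFoundedGT (Below M N)

theorem HasChainConditions.of_finite {M : SemilinRep act} {N : Submodule K M.carrier}
    (S : Set (Submodule K M.carrier)) (hS : S.Finite)
    (h : ∀ P, M.IsStable P → P ≤ N → P ∈ S) : M.HasChainConditions N := by
  have : Finite S := hS
  have : Finite (Below M N) := Finite.of_injective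
    (fun P : Below M N => (⟨P.1, h P.1 P.2.1 P.2.2⟩ : S))
    fun P Q hPQ => Subtype.ext (congrArg (fun x : S => x.1) hPQ)
  exact ⟨inferInstance, inferInstance⟩

/-- Comparable subobjects with the same intersection with ker θ and the same image under θ are
equal, so recording both is strictly monotone. -/
theorem HasChainConditions.of_map {M X : SemilinRep act} {θ : M.carrier →ₗ[K] X.carrier}
    (hθ : IsEquivariant θ) {N : Submodule K M.carrier} (hX : X.HasChainConditions ⊤)
    (h : M.HasChainConditions (N ⊓ LinearMap.ker θ)) : M.HasChainConditions N := by
  obtain ⟨h1, h2⟩ := hX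
  obtain ⟨h3, h4⟩ := h
  let φ : Below M N → Below M (N ⊓ LinearMap.ker θ) × Below X ⊤ := fun P =>
    (⟨P.1 ⊓ LinearMap.ker θ, P.2.1.inf (isStable_ker hθ), inf_le_inf_right _ P.2.2⟩,
      ⟨P.1.map θ, P.2.1.map hθ, le_top⟩)
  have hmono : Monotone φ := fun P Q hPQ =>
    ⟨inf_le_inf_right (LinearMap.ker θ) hPQ, Submodule.map_mono hPQ⟩
  have hφ : StrictMono φ := by
    intro P Q hPQ
    refine lt_of_le_not_ge (hmono hPQ.le) fun hle => hPQ.not_ge ?_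
    intro x hx
    obtain ⟨y, hy, hyx⟩ : θ x ∈ P.1.map θ := hle.2 ⟨x, hx, rfl⟩
    have hxy : x - y ∈ P.1 ⊓ LinearMap.ker θ := hle.1 ⟨Submodule.sub_mem _ hx (hPQ.le hy), by
      exact LinearMap.mem_ker.2 (by rw [map_sub, hyx, sub_self])⟩
    rw [← sub_add_cancel x y]
    exact Submodule.add_mem _ hxy.1 hy
  exact ⟨hφ.wellFoundedLT, hφ.wellFoundedGT⟩

theorem HasChainConditions.of_family {M : SemilinRep act} {ι : Type*} {X : ι → SemilinRep act}
    {θ : ∀ j, M.carrier →ₗ[K] (X j).carrier} (hθ : ∀ j, IsEquivariant (θ j))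
    (hX : ∀ j, (X j).HasChainConditions ⊤ ∨ θ j = 0) (s : Finset ι) {N : Submodule K M.carrier}
    (h : M.HasChainConditions (N ⊓ s.inf fun j => LinearMap.ker (θ j))) :
    M.HasChainConditions N := by
  classical
  induction s using Finset.induction_on generalizing N with
  | empty => rwa [Finset.inf_empty, inf_top_eq] at h
  | insert j s _ ih =>
    rw [Finset.inf_insert, ← inf_assoc] at h
    rcases hX j with hj | hj
    · exact HasChainConditions.of_map (hθ j) hj (ih h)
    · rw [hj, LinearMap.ker_zero, inf_top_eq] at h
      exact ih h

/-- The quotient by L_μ is separated by maps that are zero or land in K^{⊕ν} with |ν| < |μ|, where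
induction applies, and L_μ has only the two trivial subobjects. -/
theorem HasChainConditions.free (hact : Admissible act) (μ : YoungDiagram) :
    (free act μ).HasChainConditions ⊤ := by
  induction hn : μ.card using Nat.strong_induction_on generalizing μ with
  | _ n ih =>
    subst hn
    obtain ⟨ι, _, ν, θ, hθ, hker⟩ := exists_separating hact (FG.free_top μ)
      (isStable_simpleSub act μ)
    refine HasChainConditions.of_family (X := fun j => SemilinRep.free act (ν j)) hθ (fun j => ?_)
      Finset.univ ?_
    · rcases free_hom_cases hact (hθ j) with h | h | ⟨-, h⟩
      · exact Or.inr h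
      · exact Or.inl (ih _ h _ rfl)
      · refine absurd ((Submodule.eq_bot_iff _).2 fun y hy => ?_) (hact.simpleSub_ne_bot μ)
        exact h.1 (((hker y).2 hy j).trans (map_zero _).symm)
    · refine HasChainConditions.of_finite {⊥, simpleSub act μ} (Set.toFinite _) fun P hP hle => ?_
      rcases eq_or_ne P ⊥ with h0 | h0
      · exact Or.inl h0
      · refine Or.inr (le_antisymm (fun x hx => (hker x).1 fun j => ?_) (simpleSub_le hact hP h0))
        exact LinearMap.mem_ker.1 ((Finset.inf_le (f := fun j => LinearMap.ker (θ j))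
          (Finset.mem_univ j)) (hle hx).2)

theorem FG.hasChainConditions (hact : Admissible act) {M : SemilinRep act} (hM : M.FG ⊤) :
    M.HasChainConditions ⊤ := by
  obtain ⟨ι, _, ν, θ, hθ, hker⟩ := exists_separating hact hM M.isStable_bot
  refine HasChainConditions.of_family (X := fun j => SemilinRep.free act (ν j)) hθ
    (fun j => Or.inl (HasChainConditions.free hact _)) Finset.univ ?_
  refine HasChainConditions.of_finite {⊥} (Set.toFinite _) fun P hP hle => ?_
  refine (Submodule.eq_bot_iff _).2 fun x hx => (Submodule.mem_bot K).1 ((hker x).1 fun j => ?_)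
  exact LinearMap.mem_ker.1 ((Finset.inf_le (f := fun j => LinearMap.ker (θ j))
    (Finset.mem_univ j)) (hle hx).2)

theorem isSimple_subquot {M : SemilinRep act} (hM : M.IsKModule) {N P : Submodule K M.carrier}
    (hN : M.IsStable N) (hP : M.IsStable P) (hNP : N ≤ P) (hne : ¬ P ≤ N)
    (h : ∀ Q, M.IsStable Q → N ≤ Q → Q ≤ P → Q = N ∨ Q = P) : (M.subquot N P hN hP).IsSimple := by
  refine ⟨(hM.sub hP).quot _, ?_, fun Q hQ => ?_⟩
  · obtain ⟨x, hx, hxN⟩ := Set.not_subset.1 hne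
    obtain ⟨y, rfl⟩ := exists_subIncl_eq hP hx
    exact ⟨subquotMk hN hP y, 0, fun h0 => hxN ((subquotMk_eq_zero hN hP).1 h0)⟩
  · have hst := isStable_map_subIncl hP (hQ.comap (subquotMk_equivariant hN hP))
    have hle : (Q.comap (subquotMk hN hP)).map (subIncl hP) ≤ P := by
      rintro _ ⟨x, -, rfl⟩
      exact subIncl_mem hP x
    have hge : N ≤ (Q.comap (subquotMk hN hP)).map (subIncl hP) := fun x hx => by
      obtain ⟨y, rfl⟩ := exists_subIncl_eq hP (hNP hx)
      refine ⟨y, ?_, rfl⟩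
      change subquotMk hN hP y ∈ Q
      rw [(subquotMk_eq_zero hN hP).2 hx]
      exact Submodule.zero_mem _
    rcases h _ hst hge hle with h1 | h1
    · left
      rw [Submodule.eq_bot_iff]
      intro y hy
      obtain ⟨x, rfl⟩ := subquotMk_surjective hN hP y
      refine (subquotMk_eq_zero hN hP).2 ?_
      rw [← h1]
      exact ⟨x, hy, rfl⟩
    · right
      rw [eq_top_iff]
      intro y _
      obtain ⟨x, rfl⟩ := subquotMk_surjective hN hP y
      obtain ⟨z, hz, hzx⟩ := h1.ge (subIncl_mem hP x)
      exact subIncl_injective hP hzx ▸ hz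

theorem HasChainConditions.isFiniteLength {M : SemilinRep act} (hM : M.IsKModule)
    (h : M.HasChainConditions ⊤) : M.IsFiniteLength := by
  obtain ⟨h1, h2⟩ := h
  have : Nonempty (Below M ⊤) := ⟨⟨⊥, M.isStable_bot, le_top⟩⟩
  obtain ⟨a, h0, n, hn, hcov⟩ := exists_covBy_seq_of_wellFoundedLT_wellFoundedGT (Below M ⊤)
  refine ⟨⟨n, fun i => (a i).1, fun i => (a i).2.1, fun i => (hcov i i.2).le, ?_, ?_, fun i => ?_⟩⟩
  · exact le_bot_iff.1 (h0 (b := ⟨⊥, M.isStable_bot, le_top⟩) (bot_le (α := Submodule K M.carrier)))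
  · exact top_le_iff.1 (hn (b := ⟨⊤, M.isStable_top, le_top⟩) (le_top (α := Submodule K M.carrier)))
  · refine isSimple_subquot hM _ _ (hcov i i.2).le (fun hle => (hcov i i.2).lt.not_ge hle) fun Q hQ hNQ hQP => ?_
    have := (hcov i i.2).eq_or_eq (c := ⟨Q, hQ, le_top⟩) hNQ hQP
    exact this.imp (congrArg Subtype.val) (congrArg Subtype.val)

end SemilinRep

namespace SemilinRep

variable {k : Type u} [Field k] [CharZero k] {K : Type u} [Field K] [Algebra k K]
  {act : GLinf k →* (K ≃ₐ[k] K)}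

theorem IsFinGen.isFiniteLength (hact : Admissible act) {M : SemilinRep act} (hM : M.IsKModule)
    (h : M.IsFinGen) : M.IsFiniteLength :=
  ((h.fg hM).hasChainConditions hact).isFiniteLength hM

theorem free_isFiniteLength (hact : Admissible act) (μ : YoungDiagram) :
    (free act μ).IsFiniteLength :=
  (HasChainConditions.free hact μ).isFiniteLength (free_isKModule hact μ)

/-! ### Uniqueness of the label of a simple module -/

/-- By injectivity the isomorphism extends to a map K^{⊕μ} → K^{⊕ν} that is non-zero on L_μ. A map
lowering the degree would vanish there. -/
theorem eq_of_simpleObj_iso (hact : Admissible act) {μ ν : YoungDiagram}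
    (h : (simpleObj act μ).Iso (simpleObj act ν)) : μ = ν := by
  obtain ⟨e, he⟩ := h
  have hμ := isStable_simpleSub act μ
  have hν := isStable_simpleSub act ν
  obtain ⟨g, hg, hge⟩ := (free_isInjective hact ν).2 (simpleObj act μ) (free act μ)
    (simpleObj_isSimple hact μ).1 (free_isKModule hact μ) (subIncl hμ)
    (subIncl hν ∘ₗ e.toLinearMap) (subIncl_equivariant hμ)
    (isEquivariant_comp (Y := simpleObj act ν) (subIncl_equivariant hν) he) (subIncl_injective hμ)
  obtain ⟨x, hx0⟩ := @exists_ne _ (simpleObj_isSimple hact μ).2.1 (0 : (simpleObj act μ).carrier)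
  have hgx : g (subIncl hμ x) ≠ 0 := fun h0 => by
    have h1 : subIncl hν (e x) = 0 := (LinearMap.congr_fun hge x).symm.trans h0
    have h2 : e x = 0 := subIncl_injective hν (h1.trans (map_zero (subIncl hν)).symm)
    exact hx0 (e.injective (h2.trans (map_zero e).symm))
  rcases free_hom_cases hact hg with h | h | ⟨h, -⟩
  · exact absurd (LinearMap.congr_fun h _) hgx
  · exact absurd (LinearMap.mem_ker.1 (simpleSub_le_ker hg h (subIncl_mem hμ x))) hgx
  · exact h

theorem IsSimple.existsUnique_iso (hact : Admissible act) {M : SemilinRep act} (hM : M.IsSimple) :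
    ∃! μ : YoungDiagram, M.Iso (simpleObj act μ) := by
  obtain ⟨μ, hμ⟩ := hM.exists_iso hact
  exact ⟨μ, hμ, fun ν hν => eq_of_simpleObj_iso hact (hν.symm.trans hμ)⟩

/-! ### Indecomposable injective modules -/

theorem HasChainConditions.exists_simple {M : SemilinRep act} (hM : M.IsKModule)
    (h : M.HasChainConditions ⊤) (hnt : Nontrivial M.carrier) :
    ∃ (P : Submodule K M.carrier) (hP : M.IsStable P), (M.sub P hP).IsSimple := by
  obtain ⟨h1, -⟩ := h
  obtain ⟨P, hP0, hmin⟩ := h1.wf.has_min {P : Below M ⊤ | P.1 ≠ ⊥}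
    ⟨⟨⊤, M.isStable_top, le_top⟩, top_ne_bot⟩
  refine ⟨P.1, P.2.1, isSimple_sub hM P.2.1 hP0 fun Q hQ hle hQ0 => ?_⟩
  by_contra hcon
  exact hmin ⟨Q, hQ, le_top⟩ hQ0 (lt_of_le_not_ge hle hcon)

/-- A finitely generated non-zero subobject contains a simple one, isomorphic to some L_μ.
Injectivity of M extends its inclusion to K^{⊕μ} → M, which is injective since it is non-zero on the
socle, and K^{⊕μ} splits off. -/
theorem exists_iso_free_of_indecomposable (hact : Admissible act) {M : SemilinRep act}
    (hM : M.IsInjective) (hind : M.IsIndecomposable) : ∃ μ : YoungDiagram, M.Iso (free act μ) := by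
  obtain ⟨x, hx⟩ := @exists_ne _ hind.1 (0 : M.carrier)
  obtain ⟨L, hL, hxL⟩ := hM.1.exists_fg_mem x
  have hL0 : L ≠ ⊥ := fun h => hx ((Submodule.mem_bot K).1 (h ▸ hxL))
  obtain ⟨P, hP, hS⟩ := (hL.sub_top.hasChainConditions hact).exists_simple
    (hM.1.sub hL.isStable) (nontrivial_sub hL.isStable hL0)
  obtain ⟨μ, f, hf, hfi, hr⟩ := hS.exists_embedding hact
  have hιe : IsEquivariant (M := (M.sub L hL.isStable).sub P hP) (N := M)
      (subIncl hL.isStable ∘ₗ subIncl hP) :=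
    isEquivariant_comp (subIncl_equivariant hL.isStable) (subIncl_equivariant hP)
  obtain ⟨g, hg, hgf⟩ := hM.2 _ (free act μ) hS.1 (free_isKModule hact μ) f _ hf hιe hfi
  obtain ⟨z, hz⟩ := @exists_ne _ hS.2.1 (0 : ((M.sub L hL.isStable).sub P hP).carrier)
  have hfz : f z ∈ simpleSub act μ := hr ▸ LinearMap.mem_range_self f z
  have hgz : g (f z) ≠ 0 := fun h0 => hz (subIncl_injective hP (subIncl_injective hL.isStable
    (((LinearMap.congr_fun hgf z).symm.trans h0).trans (by rw [map_zero, map_zero]))))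
  have hgi := injective_of_ne_zero_on_simpleSub hact hg ⟨f z, hfz, hgz⟩
  obtain ⟨r, hr, hrg⟩ := exists_retraction hact hM.1 hg hgi
  refine ⟨μ, iso_of_bijective hr ⟨?_, fun y => ⟨g y, hrg y⟩⟩⟩
  have hcompl : IsCompl (LinearMap.range g) (LinearMap.ker r) := by
    refine IsCompl.of_le ?_ ?_
    · rintro _ ⟨⟨y, rfl⟩, hy⟩
      have h1 : r (g y) = 0 := hy
      rw [hrg] at h1
      rw [h1, map_zero]
      exact Submodule.zero_mem _
    · intro y _
      rw [← add_sub_cancel (g (r y)) y]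
      refine Submodule.add_mem_sup (LinearMap.mem_range_self g _) ?_
      rw [LinearMap.mem_ker, map_sub, hrg, sub_self]
  rcases hind.2 _ _ (isStable_range hg) (isStable_ker hr) hcompl with h | h
  · exact absurd (by rw [LinearMap.range_eq_bot.1 h, LinearMap.zero_apply]) hgz
  · exact LinearMap.ker_eq_bot.1 h

theorem isInjective_isIndecomposable_iff (hact : Admissible act) (M : SemilinRep act) :
    (M.IsInjective ∧ M.IsIndecomposable) ↔ ∃ μ : YoungDiagram, M.Iso (free act μ) := by
  refine ⟨fun h => exists_iso_free_of_indecomposable hact h.1 h.2, ?_⟩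
  rintro ⟨μ, e, he⟩
  obtain ⟨x, hx, hx0⟩ := Submodule.exists_mem_ne_zero_of_ne_bot (hact.simpleSub_ne_bot μ)
  refine ⟨(free_isInjective hact μ).of_retract he (isEquivariant_symm he) e.symm_apply_apply,
    ⟨e.symm x, 0, fun h => hx0 ?_⟩, fun N P hN hP hNP => ?_⟩
  · rwa [LinearEquiv.symm_apply_eq, map_zero] at h
  by_contra! hcon
  have key : ∀ Q : Submodule K M.carrier, M.IsStable Q → Q ≠ ⊥ → e.symm x ∈ Q := by
    intro Q hQ hQ0
    obtain ⟨y, hy, hyx⟩ := simpleSub_le hact (hQ.map he) (fun h => hQ0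
      (Submodule.map_injective_of_injective e.injective (h.trans (Submodule.map_bot _).symm))) hx
    rw [← hyx]
    change e.symm (e y) ∈ Q
    rwa [e.symm_apply_apply]
  have h1 := Submodule.disjoint_def.1 hNP.disjoint _ (key N hN hcon.1) (key P hP hcon.2)
  rw [LinearEquiv.symm_apply_eq, map_zero] at h1
  exact hx0 h1

/-! ### Composition factors of `K^{⊕μ}` -/

theorem iso_simpleObj_of_range_eq {M : SemilinRep act} {ν : YoungDiagram}
    {f : M.carrier →ₗ[K] (free act ν).carrier} (hf : IsEquivariant f) (hfi : Function.Injective f)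
    (hr : LinearMap.range f = simpleSub act ν) : M.Iso (simpleObj act ν) :=
  iso_of_ker_eq_range (X := M) (Y := M) (p := LinearMap.id) (fun _ _ => rfl)
    Function.surjective_id (subIncl_equivariant (isStable_simpleSub act ν))
    (subIncl_injective (isStable_simpleSub act ν)) hf
    (by rw [LinearMap.ker_id]; exact LinearMap.ker_eq_bot.2 hfi)
    (hr.trans (range_subIncl (isStable_simpleSub act ν)).symm)

theorem subquot_iso_simpleObj (hact : Admissible act) {μ : YoungDiagram}
    {N P : Submodule K (free act μ).carrier} (hN : (free act μ).IsStable N)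
    (hP : (free act μ).IsStable P) (h : ((free act μ).subquot N P hN hP).IsSimple) (h0 : N = ⊥) :
    P = simpleSub act μ ∧ ((free act μ).subquot N P hN hP).Iso (simpleObj act μ) := by
  have hPN := not_le_of_subquot_nontrivial hN hP h.2.1
  have hPL : P = simpleSub act μ := by
    have hle := simpleSub_le hact hP fun hb => hPN (hb ▸ bot_le)
    refine le_antisymm ?_ hle
    rcases subquot_simple_cases hN hP h (isStable_simpleSub act μ) hle with h1 | h1
    · exact absurd (le_bot_iff.1 (h0 ▸ h1)) (hact.simpleSub_ne_bot μ)
    · rwa [h0, bot_sup_eq] at h1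
  refine ⟨hPL, iso_of_ker_eq_range (subquotMk_equivariant hN hP) (subquotMk_surjective hN hP)
    (subIncl_equivariant (isStable_simpleSub act μ)) (subIncl_injective (isStable_simpleSub act μ))
    (subIncl_equivariant hP) ?_ ?_⟩
  · ext x
    rw [LinearMap.mem_ker, LinearMap.mem_ker, subquotMk_eq_zero, h0, Submodule.mem_bot]
  · rw [range_subIncl, hPL]
    exact (range_subIncl (isStable_simpleSub act μ)).symm

/-- An embedding of P/N into K^{⊕ν} extends by injectivity to K^{⊕μ} → K^{⊕ν}. This map is non-zero,
and it kills L_μ ⊆ N, so it is not bijective and must lower the degree. -/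
theorem subquot_iso_lower (hact : Admissible act) {μ : YoungDiagram}
    {N P : Submodule K (free act μ).carrier} (hN : (free act μ).IsStable N)
    (hP : (free act μ).IsStable P) (h : ((free act μ).subquot N P hN hP).IsSimple)
    (hL : simpleSub act μ ≤ N) (hNP : N ≤ P) :
    ∃ ν : YoungDiagram, ν.card < μ.card ∧
      ((free act μ).subquot N P hN hP).Iso (simpleObj act ν) := by
  obtain ⟨ν, φ, hφ, hφi, hr⟩ := h.exists_embedding hact
  refine ⟨ν, ?_, iso_simpleObj_of_range_eq hφ hφi hr⟩
  obtain ⟨g, hg, hgφ⟩ := (free_isInjective hact ν).2 ((free act μ).sub P hP) (free act μ)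
    ((free_isKModule hact μ).sub hP) (free_isKModule hact μ) (subIncl hP)
    (φ ∘ₗ subquotMk hN hP) (subIncl_equivariant hP)
    (isEquivariant_comp (Y := (free act μ).subquot N P hN hP) hφ (subquotMk_equivariant hN hP))
    (subIncl_injective hP)
  rcases free_hom_cases hact hg with h0 | h0 | ⟨-, h0⟩
  · obtain ⟨y, hy⟩ := @exists_ne _ h.2.1 (0 : ((free act μ).subquot N P hN hP).carrier)
    obtain ⟨y, rfl⟩ := subquotMk_surjective hN hP y
    refine absurd (hφi ?_) hy
    have h1 : g (subIncl hP y) = φ (subquotMk hN hP y) := LinearMap.congr_fun hgφ y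
    rw [← h1, h0, LinearMap.zero_apply, map_zero]
  · exact h0
  · obtain ⟨x, hx, hx0⟩ := Submodule.exists_mem_ne_zero_of_ne_bot (hact.simpleSub_ne_bot μ)
    obtain ⟨y, rfl⟩ := exists_subIncl_eq hP (hNP (hL hx))
    have h1 : g (subIncl hP y) = φ (subquotMk hN hP y) := LinearMap.congr_fun hgφ y
    rw [(subquotMk_eq_zero hN hP).2 (hL hx), map_zero] at h1
    exact absurd (h0.1 (h1.trans (map_zero g).symm)) hx0

/-- The first non-zero term of any composition series is the socle L_μ, so every later factor lies
above it. -/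
theorem compSeries_free (hact : Admissible act) (μ : YoungDiagram)
    (s : (free act μ).CompSeries) : ∃ i, (s.factor i).Iso (simpleObj act μ) ∧
      ∀ j, j ≠ i → ¬ (s.factor j).Iso (simpleObj act μ) ∧
        ∃ ν : YoungDiagram, ν.card < μ.card ∧ (s.factor j).Iso (simpleObj act ν) := by
  have hmono : Monotone s.term := Fin.monotone_iff_le_succ.2 s.le_succ
  have hpos : 0 < s.length := by
    by_contra h
    have h1 : (0 : Fin (s.length + 1)) = Fin.last s.length := Fin.ext (by
      change 0 = s.length
      omega)
    have h2 : (⊥ : Submodule K (free act μ).carrier) = ⊤ := by rw [← s.first_eq, h1, s.last_eq]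
    exact hact.simpleSub_ne_bot μ (le_bot_iff.1 (h2 ▸ le_top))
  let i : Fin s.length := ⟨0, hpos⟩
  obtain ⟨h1, h2⟩ := subquot_iso_simpleObj hact (s.stable i.castSucc) (s.stable i.succ) (s.simple i)
    s.first_eq
  refine ⟨i, h2, fun j hj => ?_⟩
  have hij : i.succ ≤ j.castSucc := by
    have : j.1 ≠ 0 := fun h => hj (Fin.ext h)
    change 0 + 1 ≤ j.1
    omega
  obtain ⟨ν, hν, hiso⟩ := subquot_iso_lower hact (s.stable j.castSucc) (s.stable j.succ)
    (s.simple j) (h1 ▸ hmono hij) (s.le_succ j)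
  refine ⟨fun h => ?_, ν, hν, hiso⟩
  have := eq_of_simpleObj_iso hact (hiso.symm.trans h)
  rw [this] at hν
  exact lt_irrefl _ hν

/-! ### Injective dimension -/

theorem isInjective_of_subsingleton {M : SemilinRep act} (hM : M.IsKModule)
    (h : Subsingleton M.carrier) : M.IsInjective :=
  ⟨hM, fun X Y _ _ i f hi hf _ => ⟨0, fun g y => by rw [LinearMap.zero_apply, LinearMap.zero_apply,
    map_zero], LinearMap.ext fun x => Subsingleton.elim _ _⟩⟩

theorem pi_hom_eq_zero {ι : Type} [Fintype ι] [DecidableEq ι] {X : ι → SemilinRep act}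
    {Y : SemilinRep act} {g : (pi X).carrier →ₗ[K] Y.carrier}
    (h : ∀ i, g ∘ₗ piSingle X i = 0) : g = 0 := by
  refine LinearMap.ext fun x => ?_
  rw [← sum_piSingle X x, map_sum, LinearMap.zero_apply]
  exact Finset.sum_eq_zero fun i _ => LinearMap.congr_fun (h i) _

/-- The cokernel of a minimal embedding into a finite sum of modules K^{⊕μ} has no maps to degree d
− 1 or more, so the bound drops by one; for d = 0 the module is zero. -/
theorem exists_injDimLE_of_vanishing (hact : Admissible act) (d : ℕ) {M : SemilinRep act}
    (hM : M.FG ⊤) (hd : ∀ (ν : YoungDiagram) (f : M.carrier →ₗ[K] (free act ν).carrier),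
      IsEquivariant f → d ≤ ν.card → f = 0) : ∃ n, InjDimLE n M := by
  classical
  induction d generalizing M with
  | zero =>
    refine ⟨0, isInjective_of_subsingleton (hM.isKModule hact) ⟨fun x y => sub_eq_zero.1 ?_⟩⟩
    obtain ⟨ι, _, μ, θ, hθ, hker⟩ := exists_separating hact hM M.isStable_bot
    refine (Submodule.mem_bot K).1 ((hker (x - y)).1 fun j => ?_)
    rw [hd _ (θ j) (hθ j) (Nat.zero_le _), LinearMap.zero_apply]
  | succ d ih =>
    obtain ⟨ι, _, μ, θ, hθ, hker⟩ := exists_separating hact hM M.isStable_bot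
    -- Minimality of the separating family means that the image of M meets every summand
    -- non-trivially.
    obtain ⟨s, hs, hmin⟩ := wellFounded_lt.has_min
      {s : Finset ι | ∀ x, (∀ j ∈ s, θ j x = 0) → x = 0}
      ⟨Finset.univ, fun x hx => (Submodule.mem_bot K).1 ((hker x).1 fun j => hx j
        (Finset.mem_univ j))⟩
    have hdep : ∀ j ∈ s, ∃ x, (∀ i ∈ s, i ≠ j → θ i x = 0) ∧ θ j x ≠ 0 := by
      intro j hj
      by_contra! hcon
      refine hmin (s.erase j) (fun x hx => hs x fun i hi => ?_) (Finset.erase_ssubset hj)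
      have h1 : ∀ i ∈ s, i ≠ j → θ i x = 0 := fun i hi hij => hx i (Finset.mem_erase.2 ⟨hij, hi⟩)
      by_cases hij : i = j
      · exact hij ▸ hcon x h1
      · exact h1 i hi hij
    let X : s → SemilinRep act := fun j => free act (μ j)
    let Θ : M.carrier →ₗ[K] (pi X).carrier := piLift fun j : s => θ j
    have hΘ : IsEquivariant (M := M) (N := pi X) Θ := piLift_equivariant fun j => hθ j
    have hΘi : Function.Injective Θ := by
      rw [← LinearMap.ker_eq_bot, Submodule.eq_bot_iff]
      intro x hx
      refine hs x fun j hj => ?_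
      have h1 : piProj X ⟨j, hj⟩ (Θ x) = 0 := by rw [LinearMap.mem_ker.1 hx, map_zero]
      exact h1
    have hN := isStable_range (M := M) (N := pi X) hΘ
    obtain ⟨n, hn⟩ := ih (M := (pi X).quot _ hN)
      (FG.of_surjective (quotMk_equivariant hN) (quotMk_surjective hN)
        (FG.pi_top fun j => FG.free_top _)) (by
      intro ν g hg hν
      have hg' : IsEquivariant (M := pi X) (N := free act ν) (g ∘ₗ quotMk hN) :=
        isEquivariant_comp (Y := (pi X).quot _ hN) hg (quotMk_equivariant hN)
      suffices H : g ∘ₗ quotMk hN = 0 by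
        refine LinearMap.ext fun y => ?_
        obtain ⟨x, rfl⟩ := quotMk_surjective hN y
        exact LinearMap.congr_fun H x
      refine pi_hom_eq_zero fun j => ?_
      have hgj : IsEquivariant (M := free act (μ j)) (N := free act ν)
          ((g ∘ₗ quotMk hN) ∘ₗ piSingle X j) :=
        isEquivariant_comp (Y := pi X) hg' (piSingle_equivariant X j)
      obtain ⟨x, hx, hxj⟩ := hdep j j.2
      -- A degree-lowering map is excluded, because `θ j` is non-zero and so |μ j| ≤ d ≤ |ν|. A
      -- bijective one is excluded, because g kills the image of M, which contains a non-zero vector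
      -- of the summand j.
      rcases free_hom_cases hact hgj with h | h | ⟨-, h⟩
      · exact h
      · have h1 : ¬ d + 1 ≤ (μ j).card := fun h1 => hxj (by
          rw [hd _ (θ j) (hθ j) h1, LinearMap.zero_apply])
        omega
      · exfalso
        have h1 : Θ x = piSingle X j (θ j x) := pi_ext fun i => by
          by_cases hij : i = j
          · subst hij
            rw [piProj_piSingle_self]
            rfl
          · rw [piProj_piSingle_of_ne X hij]
            exact hx i i.2 fun h => hij (Subtype.ext h)
        have h2 : g (quotMk hN (Θ x)) = 0 := by
          rw [(quotMk_eq_zero hN).2 (LinearMap.mem_range_self Θ x), map_zero]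
        rw [h1] at h2
        exact hxj (h.1 (h2.trans (map_zero _).symm)))
    exact ⟨n + 1, pi X, Θ, hΘ, IsInjective.pi hact fun j => free_isInjective hact _, hΘi, hn⟩

/-- M embeds in a finite sum of modules K^{⊕μ}, and maps to K^{⊕ν} extend to this sum, so they
vanish once |ν| exceeds all the degrees that occur. This supplies the bound d. -/
theorem FG.exists_injDimLE (hact : Admissible act) {M : SemilinRep act} (hM : M.FG ⊤) :
    ∃ n, InjDimLE n M := by
  classical
  obtain ⟨ι, _, μ, θ, hθ, hker⟩ := exists_separating hact hM M.isStable_bot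
  refine exists_injDimLE_of_vanishing hact (Finset.univ.sup (fun j => (μ j).card) + 1) hM
    fun ν f hf hν => ?_
  let X : ι → SemilinRep act := fun j => free act (μ j)
  let Θ : M.carrier →ₗ[K] (pi X).carrier := piLift θ
  have hΘ : IsEquivariant (M := M) (N := pi X) Θ := piLift_equivariant hθ
  have hΘi : Function.Injective Θ := by
    rw [← LinearMap.ker_eq_bot, Submodule.eq_bot_iff]
    intro x hx
    refine (Submodule.mem_bot K).1 ((hker x).1 fun j => ?_)
    have h1 : piProj X j (Θ x) = 0 := by rw [LinearMap.mem_ker.1 hx, map_zero]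
    exact h1
  obtain ⟨g, hg, hgf⟩ := (free_isInjective hact ν).2 M (pi X) (hM.isKModule hact)
    (IsKModule.pi hact fun j => free_isKModule hact _) Θ f hΘ hf hΘi
  have hg0 : g = 0 := pi_hom_eq_zero fun j => by
    have hgj : IsEquivariant (M := free act (μ j)) (N := free act ν) (g ∘ₗ piSingle X j) :=
      isEquivariant_comp (Y := pi X) hg (piSingle_equivariant X j)
    have hj : (μ j).card ≤ Finset.univ.sup fun j => (μ j).card :=
      Finset.le_sup (f := fun j => (μ j).card) (Finset.mem_univ j)
    rcases free_hom_cases hact hgj with h | h | ⟨h, -⟩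
    · exact h
    · omega
    · rw [h] at hj
      omega
  rw [← hgf, hg0, LinearMap.zero_comp]

theorem admissible_ratAct {r : ℕ} (σ : Fin r → YoungDiagram) : Admissible (ratAct k σ) where
  exists_subalgebra := ⟨symSub k σ, fracSub_symSub k σ, hasCoaction_symSub k σ⟩
  simpleSub_ne_bot := (isSymFrac_ratAct σ).simpleSub_ne_bot

end SemilinRep

end GLStruct

end

theorem mainTheorem3 {k : Type u} [Field k] [CharZero k] {r : ℕ} (σ : Fin r → YoungDiagram)
    (hσ : ∀ i, 0 < (σ i).card) : 
    -- every finitely generated module has finite length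
    (∀ M : GLStruct.SemilinRep (GLStruct.ratAct k σ), M.IsKModule → M.IsFinGen → M.IsFiniteLength) ∧
    -- the indecomposable injectives are exactly the `K^{⊕μ}`
    (∀ M : GLStruct.SemilinRep (GLStruct.ratAct k σ), (M.IsInjective ∧ M.IsIndecomposable) ↔
      ∃ μ : YoungDiagram, M.Iso (GLStruct.SemilinRep.free (GLStruct.ratAct k σ) μ)) ∧
    (∀ M : GLStruct.SemilinRep (GLStruct.ratAct k σ), M.IsKModule → M.IsFiniteLength → ∃ n, GLStruct.SemilinRep.InjDimLE n M) ∧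
    ((∀ μ : YoungDiagram, (GLStruct.SemilinRep.simpleObj (GLStruct.ratAct k σ) μ).IsSimple ∧
        (GLStruct.SemilinRep.free (GLStruct.ratAct k σ) μ).socle = GLStruct.SemilinRep.simpleSub (GLStruct.ratAct k σ) μ) ∧
      ∀ M : GLStruct.SemilinRep (GLStruct.ratAct k σ), M.IsSimple →
        ∃! μ : YoungDiagram, M.Iso (GLStruct.SemilinRep.simpleObj (GLStruct.ratAct k σ) μ)) ∧
    (∀ μ : YoungDiagram, (GLStruct.SemilinRep.free (GLStruct.ratAct k σ) μ).IsFiniteLength ∧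
      ∀ s : (GLStruct.SemilinRep.free (GLStruct.ratAct k σ) μ).CompSeries,
        ∃ i, (s.factor i).Iso (GLStruct.SemilinRep.simpleObj (GLStruct.ratAct k σ) μ) ∧
          ∀ j, j ≠ i → ¬ (s.factor j).Iso (GLStruct.SemilinRep.simpleObj (GLStruct.ratAct k σ) μ) ∧
            ∃ ν : YoungDiagram, ν.card < μ.card ∧
              (s.factor j).Iso (GLStruct.SemilinRep.simpleObj (GLStruct.ratAct k σ) ν)) := by
  have hact := GLStruct.SemilinRep.admissible_ratAct (k := k) σ
  exact ⟨fun M hM h => GLStruct.SemilinRep.IsFinGen.isFiniteLength hact hM h,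
    fun M => GLStruct.SemilinRep.isInjective_isIndecomposable_iff hact M,
    fun M hM h => GLStruct.SemilinRep.FG.exists_injDimLE hact
      (GLStruct.SemilinRep.IsFiniteLength.fg hM h),
    ⟨fun μ => ⟨GLStruct.SemilinRep.simpleObj_isSimple hact μ,
      GLStruct.SemilinRep.socle_free hact μ⟩,
      fun M hM => GLStruct.SemilinRep.IsSimple.existsUnique_iso hact hM⟩,
    fun μ => ⟨GLStruct.SemilinRep.free_isFiniteLength hact μ,
      fun s => GLStruct.SemilinRep.compSeries_free hact μ s⟩⟩
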